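/- **Conventions.** Let $k$ be a field of characteristic $0$. A *Feynman category* $\mathbb F$ is given by a coloured symmetric operad in sets: a set of vertices $v$, and sets $\mathrm{Hom}_{\mathbb F}(v_1\otimes\dots\otimes v_n,v)$ of generating morphisms ($n\ge 0$). Its objects are finite words $X=v_1\otimes\dots\otimes v_n$, and its morphisms $X\to Y$ are tensor products of generating morphisms, up to permutation of the letters of $X$. We assume that isomorphic vertices are equal and that each $\mathrm{Aut}(v)$ is finite. $\mathbb F$ is *cubical* if it carries a degree function with values in $\mathbb N$, additive for composition and for $\otimes$, such that a morphism has degree $0$ iff it is an isomorphism; each vertex is the target of finitely many degree $1$ morphisms; and for the set $C^n(X,Y)$ of chains of $n$ composable degree $1$ morphisms from $X$ to $Y$, modulo isomorphisms of the intermediate words, there are free $S_n$-actions, compatible with concatenation, such that composition induces a bijection $\coprod_n C^n(X,Y)_{S_n}\cong \mathrm{Hom}_{\mathbb F}(X,Y)$. For a sign $\pm$, $\mathbb F^{\pm}\text{-}\mathcal Ops$ is the category of symmetric monoidal functors $\mathcal P$ to differential graded $k$-vector spaces (cohomological grading) on the category of words with morphism sets $\coprod_n C^n$ that satisfy $\mathcal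 P(\sigma c)=(\pm1)^{|\sigma|}\mathcal P(c)$ for $\sigma\in S_n$. In the odd case ($-$), degree $1$ morphisms act by maps of degree $1$; signs follow the Koszul rule. A *morphism of cubical Feynman categories* $\phi\colon\mathbb F_1\to\mathbb F_2$ is a symmetric monoidal functor that sends vertices to vertices, preserves degrees, and has finite fibres on objects. It is *admissible* if it is faithful and satisfies: (1) if $\phi(g)=f\circ\phi(l)$, then $f$ is in the image of $\phi$, i.e. $f=\phi(f')$ with $f'$ from the target of $l$ to the target of $g$; (2) if $\phi(g)=f\circ h$, then $g=g_1\circ g_2$ with $f=\phi(g_1)\sigma^{-1}$ and $h=\sigma\phi(g_2)$ for an isomorphism $\sigma$. **The functors.** For $\phi$ admissible: * $R\colon\mathbb F_2^\pm\text{-}\mathcal Ops\to\mathbb F_1^\pm\text{-}\mathcal Ops$ is restriction along $\phi$. * $L^!\colon\mathbb F_1^\pm\text{-}\mathcal Ops\to\mathbb F_2^\pm\text{-}\mathcal Ops$ is given by $L^!(\mathcal P)(v)=\bigoplus_{\phi(w)=v}[\mathcal P(w)\otimes k[\mathrm{Aut}(v)]]_{\mathrm{Aut}(w)}$, where $[\mathcal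 P(\lambda)p\otimes\sigma]=[p\otimes\sigma\phi(\lambda)]$. A generating morphism $f\colon\phi(w_1)\otimes\dots\otimes\phi(w_n)\to v$ of degree at most $1$ acts by $\bigotimes_i[p_i\otimes 1]\mapsto[\mathcal P(g)(\bigotimes_i p_i)\otimes\sigma]$ if $f=\sigma\circ\phi(g)$ with $g\colon w_1\otimes\dots\otimes w_n\to w$ and $\sigma\in\mathrm{Aut}(v)$, and by $0$ if there is no such pair; this is extended by $\mathrm{Aut}$-equivariance. * $R^!$ is a left adjoint of $L^!$. * Call $\mathcal O\in\mathbb F^\pm\text{-}\mathcal Ops$ *dualizable* if for every degree $1$ morphism $f\colon v_1\otimes\dots\otimes v_n\to v$ the transpose of $\mathcal O(f)$ maps the graded dual $\mathcal O(v)^*$ into $\bigotimes_i\mathcal O(v_i)^*$ (for instance, if all $\mathcal O(v)$ are finite-dimensional). $R$ preserves dualizable objects. The *Feynman transform* $D$ is the contravariant functor that sends a dualizable $\mathcal O\in\mathbb F^{\pm}\text{-}\mathcal Ops$ to the free graded object $D(\mathcal O)\in\mathbb F^{\mp}\text{-}\mathcal Ops$ on the family of the $\mathrm{Aut}(v)$-modules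 $\mathcal O(v)^*$, with the differential that is given on a generator $\xi\in\mathcal O(v)^*$ of degree $n$ by $$d\xi=-(-1)^n\Big(\xi\circ d_{\mathcal O}+\sum_{[f]}\frac{1}{|\mathrm{Aut}(f)|}\,f\cdot(\xi\circ\mathcal O(f))\Big).$$ Here $[f]$ runs over the isomorphism classes of degree $1$ morphisms $f\colon X\to v$ (isomorphisms are taken over $v$), $\xi\circ\mathcal O(f)$ is read in $\bigotimes_i\mathcal O(v_i)^*$ with the Koszul signs, and $f\cdot(-)$ is the action of $f$ on the free object. On morphisms $D$ is given by transposition of generators. **Theorem.** Let $\phi\colon\mathbb F_1\to\mathbb F_2$ be an admissible morphism of cubical Feynman categories. For both parities: (a) The functor $L^!$ exists, i.e. the formulas above define objects of $\mathbb F_2^\pm\text{-}\mathcal Ops$, functorially; and it has a left adjoint $R^!$. (b) Suppose that in $\mathbb F_2$ no nontrivial automorphism $\theta$ of the middle word $Y$ of two composable degree $1$ morphisms $m\colon X\to Y$, $n\colon Y\to v$ satisfies $\theta m=m$ and $n\theta=n$. Then the Feynman transforms $D$ of $\mathbb F_1$ and of $\mathbb F_2$ exist (the differential squares to zero). (c)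 Whenever the Feynman transforms $D$ of $\mathbb F_1$ and $\mathbb F_2$ exist, in particular under the condition in (b), there is a natural isomorphism $$R^!D\;\cong\;DR$$ of contravariant functors from the dualizable objects of $\mathbb F_2^{\pm}\text{-}\mathcal Ops$ to $\mathbb F_1^{\mp}\text{-}\mathcal Ops$. -/

import Mathlib

universe u

open CategoryTheory

/-- A coloured symmetric operad in sets, with set of colours `V`, in its coordinate-free form:
`Hom x v` is the set of operations with inputs `x i`, for `i` in a finite set `I`, and output `v`;
`map` relabels inputs along bijections; `comp` is simultaneous composition in all inputs. -/
structure ColoredOperad where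
  V : Type u
  Hom : ∀ {I : Type} [Finite I], (I → V) → V → Type u
  map : ∀ {I J : Type} [Finite I] [Finite J] (e : I ≃ J) {x : J → V} {v : V},
    Hom x v → Hom (fun i => x (e i)) v
  one : ∀ v : V, Hom (fun _ : Unit => v) v
  comp : ∀ {J : Type} [Finite J] {I : J → Type} [∀ j, Finite (I j)] {y : J → V}
    {x : ∀ j, I j → V} {v : V}, Hom y v → (∀ j, Hom (x j) (y j)) →
    Hom (fun s : Σ j, I j => x s.1 s.2) v
  map_refl : ∀ {I : Type} [Finite I] {x : I → V} {v : V} (f : Hom x v),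
    map (Equiv.refl I) f = f
  map_map : ∀ {I J K : Type} [Finite I] [Finite J] [Finite K] (e : I ≃ J) (e' : J ≃ K)
    {x : K → V} {v : V} (f : Hom x v), map e (map e' f) = map (e.trans e') f
  comp_map_left : ∀ {J J' : Type} [Finite J] [Finite J'] (e : J' ≃ J) {I : J → Type}
    [∀ j, Finite (I j)] {y : J → V} {x : ∀ j, I j → V} {v : V} (f : Hom y v)
    (g : ∀ j, Hom (x j) (y j)),
    comp (I := fun j' => I (e j')) (x := fun j' => x (e j')) (map e f) (fun j' => g (e j')) =
      map (Equiv.sigmaCongrLeft (β := I) e) (comp f g)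
  comp_map_right : ∀ {J : Type} [Finite J] {I I' : J → Type} [∀ j, Finite (I j)]
    [∀ j, Finite (I' j)] (e : ∀ j, I' j ≃ I j) {y : J → V} {x : ∀ j, I j → V} {v : V}
    (f : Hom y v) (g : ∀ j, Hom (x j) (y j)),
    comp f (fun j => map (e j) (g j)) = map (Equiv.sigmaCongrRight e) (comp f g)
  one_comp : ∀ {I : Type} [Finite I] {x : I → V} {v : V} (f : Hom x v),
    comp (one v) (fun _ => f) = map (Equiv.uniqueSigma (fun _ : Unit => I)) f
  comp_one : ∀ {I : Type} [Finite I] {x : I → V} {v : V} (f : Hom x v),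
    comp f (fun i => one (x i)) = map (Equiv.sigmaUnique I (fun _ => Unit)) f
  comp_comp : ∀ {K : Type} [Finite K] {J : K → Type} [∀ k, Finite (J k)]
    {I : ∀ k, J k → Type} [∀ k j, Finite (I k j)] {z : K → V} {y : ∀ k, J k → V}
    {x : ∀ k j, I k j → V} {v : V} (f : Hom z v) (g : ∀ k, Hom (y k) (z k))
    (h : ∀ k j, Hom (x k j) (y k j)),
    comp (I := fun s : Σ k, J k => I s.1 s.2) (x := fun s => x s.1 s.2)
        (comp f g) (fun s => h s.1 s.2) =
      map (Equiv.sigmaAssoc I) (comp f (fun k => comp (g k) (h k)))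

namespace ColoredOperad

variable {C : ColoredOperad.{u}}

/-- The objects of the symmetric monoidal category of a coloured operad: finite lists
`x 0 ⊗ … ⊗ x (n - 1)` of colours. -/
structure Word (C : ColoredOperad.{u}) where
  n : ℕ
  x : Fin n → C.V

/-- A morphism of words: a map of index sets and, for each letter of the target, an operation
whose inputs are the letters in the fibre over it. So morphisms are tensor products of generating
morphisms, up to permutation of the source. -/
@[ext]
structure WordHom (X Y : C.Word) where
  π : Fin X.n → Fin Y.n
  g : ∀ j, C.Hom (fun i : {i // π i = j} => X.x i) (Y.x j)

/-- Composition of operations along a map `π` of index sets: `f` composed with operations `g j` on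
the fibres of `π`. -/
def subst {I J : Type} [Finite I] [Finite J] {x : I → C.V} {y : J → C.V} {v : C.V}
    (f : C.Hom y v) (π : I → J) (g : ∀ j, C.Hom (fun i : {i // π i = j} => x i) (y j)) :
    C.Hom x v :=
  C.map (Equiv.sigmaFiberEquiv π).symm (C.comp f g)

def fiberEquiv {I J K : Type} (π : I → J) (ρ : J → K) (k : K) (j : {j // ρ j = k}) :
    {i : {i // ρ (π i) = k} // (⟨π i, i.2⟩ : {j // ρ j = k}) = j} ≃ {i // π i = j.1} where
  toFun i := ⟨i.1.1, congrArg Subtype.val i.2⟩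
  invFun i := ⟨⟨i.1, by rw [i.2]; exact j.2⟩, Subtype.ext i.2⟩
  left_inv _ := rfl
  right_inv _ := rfl

def fiberId {I : Type} (i : I) : {i' // i' = i} ≃ Unit where
  toFun _ := ()
  invFun _ := ⟨i, rfl⟩
  left_inv := fun ⟨_, h⟩ => by subst h; rfl
  right_inv _ := rfl

/-- The identity operation of `v`, with its one input named by a one-element set. -/
def oneOf {I : Type} [Finite I] (e : I ≃ Unit) (x : I → C.V) (v : C.V) (h : ∀ i, x i = v) :
    C.Hom x v :=
  cast (by rw [show x = fun _ => v from funext h]) (C.map e (C.one v))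

def WordHom.id (X : C.Word) : WordHom X X where
  π i := i
  g j := oneOf (fiberId j) _ (X.x j) (fun i => congrArg X.x i.2)

def WordHom.comp {X Y Z : C.Word} (m : WordHom X Y) (n : WordHom Y Z) : WordHom X Z where
  π i := n.π (m.π i)
  g k := subst (n.g k) (fun i => ⟨m.π i, i.2⟩) (fun j => C.map (fiberEquiv m.π n.π k j) (m.g j))


theorem map_oneOf {I I' : Type} [Finite I] [Finite I'] (e : I ≃ Unit) (e' : I' ≃ I) (x : I → C.V)
    (v : C.V) (h : ∀ i, x i = v) :
    C.map e' (oneOf e x v h) = oneOf (e'.trans e) (fun i => x (e' i)) v (fun i => h (e' i)) := by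
  obtain rfl : x = fun _ => v := funext h
  exact C.map_map _ _ _

theorem map_heq {I J : Type} [Finite I] [Finite J] (e : I ≃ J) {x x' : J → C.V} {v : C.V}
    {f : C.Hom x v} {f' : C.Hom x' v} (hx : x = x') (hf : HEq f f') :
    HEq (C.map e f) (C.map e f') := by
  subst hx
  rw [eq_of_heq hf]

theorem map_congr {I J : Type} [Finite I] [Finite J] {e e' : I ≃ J} (h : ∀ i, e i = e' i)
    {x : J → C.V} {v : C.V} (f : C.Hom x v) : HEq (C.map e f) (C.map e' f) := by
  obtain rfl : e = e' := Equiv.ext h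
  rfl

theorem map_heq_self {I : Type} [Finite I] (e : I ≃ I) (he : ∀ i, e i = i) {x : I → C.V} {v : C.V}
    (f : C.Hom x v) : HEq (C.map e f) f := by
  obtain rfl : e = Equiv.refl I := Equiv.ext he
  exact heq_of_eq (C.map_refl f)

theorem comp_oneOf {J : Type} [Finite J] {I : J → Type} [∀ j, Finite (I j)] {y : J → C.V}
    {v : C.V} (f : C.Hom y v) (e : ∀ j, I j ≃ Unit) (x : ∀ j, I j → C.V)
    (h : ∀ j i, x j i = y j) (E : (Σ j, I j) ≃ J) (hE : ∀ s, E s = s.1) :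
    HEq (C.comp f (fun j => oneOf (e j) (x j) (y j) (h j))) (C.map E f) := by
  obtain rfl : x = fun j _ => y j := funext fun j => funext fun i => h j i
  obtain rfl : E = (Equiv.sigmaCongrRight e).trans (Equiv.sigmaUnique J (fun _ => Unit)) :=
    Equiv.ext hE
  refine heq_of_eq ((C.comp_map_right e f fun j => C.one (y j)).trans ?_)
  rw [C.comp_one]
  exact C.map_map _ _ _

theorem oneOf_comp {J : Type} [Finite J] {I : J → Type} [∀ j, Finite (I j)] (e : J ≃ Unit)
    {y : J → C.V} {v : C.V} (h : ∀ j, y j = v) {x : ∀ j, I j → C.V} (g : ∀ j, C.Hom (x j) (y j))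
    (j : J) (hj : y j = v)
    (E : (Σ j, I j) ≃ I j) (hE : ∀ i, E ⟨j, i⟩ = i) :
    HEq (C.comp (oneOf e y v h) g) (C.map E (g j)) := by
  obtain rfl : y = fun _ => v := funext h
  have hj0 : j = e.symm () := e.injective (Subsingleton.elim _ _)
  subst hj0
  have key := C.comp_map_left (I := I) e.symm (C.map e (C.one v)) g
  rw [C.map_map, show e.symm.trans e = Equiv.refl Unit from Equiv.ext fun _ => rfl] at key
  have h1 := C.one_comp (g (e.symm ()))
  set S := Equiv.sigmaCongrLeft (β := I) e.symm with hS
  have key2 : C.map S (C.comp (C.map e (C.one v)) g) =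
      C.map (Equiv.uniqueSigma (fun _ : Unit => I (e.symm ()))) (g (e.symm ())) := by
    rw [← h1, ← key]
    exact congrArg (fun o => C.comp o fun j' => g (e.symm j')) (C.map_refl (C.one v))
  have h3 : HEq (C.map S.symm (C.map S (C.comp (C.map e (C.one v)) g)))
      (C.comp (C.map e (C.one v)) g) := by
    rw [C.map_map]
    exact map_heq_self _ (fun i => by simp) _
  refine (HEq.symm h3).trans ?_
  rw [key2]
  obtain rfl : E = S.symm.trans (Equiv.uniqueSigma (fun _ : Unit => I (e.symm ()))) := by
    refine Equiv.ext fun s => ?_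
    obtain ⟨⟨⟨⟩, t⟩, rfl⟩ := S.surjective s
    exact (hE t).trans (congrArg (Equiv.uniqueSigma (fun _ : Unit => I (e.symm ())))
      (S.symm_apply_apply ⟨(), t⟩)).symm
  exact heq_of_eq (C.map_map S.symm (Equiv.uniqueSigma (fun _ : Unit => I (e.symm ())))
    (g (e.symm ())))

theorem subst_oneOf_right {J : Type} [Finite J] {K : Type} [Finite K] (π : K ≃ J) {x : K → C.V} {y : J → C.V} {v : C.V}
    (f : C.Hom y v) (h : ∀ i, x i = y (π i)) (e : ∀ j, {i // π i = j} ≃ Unit) :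
    HEq (subst f π (fun j => oneOf (e j) (fun i => x i) (y j) (fun i => by rw [h, i.2])))
     (C.map π f) := by
  refine HEq.trans (map_heq _ ?_ (comp_oneOf f e _ _ ((Equiv.sigmaFiberEquiv π).trans π) ?_)) ?_
  · funext s; rw [h, s.2.2]; simp [s.2.2]
  · intro s; exact s.2.2
  · rw [C.map_map]
    rfl


theorem WordHom.id_comp {X Y : C.Word} (m : WordHom X Y) : (WordHom.id X).comp m = m := by
  refine WordHom.ext rfl (heq_of_eq (funext fun k => eq_of_heq ?_))
  have := subst_oneOf_right (Equiv.refl {i // m.π i = k}) (x := fun i => X.x i) (y := fun i => X.x i)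
    (m.g k) (fun _ => rfl) (fun j => (fiberEquiv (fun i => i) m.π k j).trans (fiberId j.1))
  refine HEq.trans (heq_of_eq ?_)
    (this.trans (heq_of_eq (C.map_refl (I := {i // m.π i = k}) (m.g k))))
  refine congrArg (subst (I := {i // m.π i = k}) (x := fun i => X.x i.1) (m.g k)
    (Equiv.refl {i // m.π i = k})) (funext fun j => ?_)
  exact map_oneOf (fiberId j.1) (fiberEquiv (fun i => i) m.π k j) (fun i => X.x i.1) (X.x j.1)
    (fun i => congrArg X.x i.2)

theorem WordHom.comp_id {X Y : C.Word} (m : WordHom X Y) : m.comp (WordHom.id Y) = m := by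
  refine WordHom.ext rfl (heq_of_eq (funext fun k => eq_of_heq ?_))
  set J := {j // j = k}
  set g : ∀ j : J, C.Hom (fun i : {i : {i // m.π i = k} // (⟨m.π i, i.2⟩ : J) = j} => X.x i.1)
    (Y.x j.1) := fun j => C.map (fiberEquiv m.π (fun j => j) k j) (m.g j.1) with hg
  have h1 := oneOf_comp (fiberId k) (fun j : J => congrArg Y.x j.2) g ⟨k, rfl⟩ rfl
    ((Equiv.sigmaFiberEquiv (fun i : {i // m.π i = k} => (⟨m.π i, i.2⟩ : J))).trans
      (fiberEquiv m.π (fun j => j) k ⟨k, rfl⟩).symm) (fun i => Subtype.ext rfl)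
  have h2 := map_heq (Equiv.sigmaFiberEquiv (fun i : {i // m.π i = k} => (⟨m.π i, i.2⟩ : J))).symm
    ?_ h1
  · refine HEq.trans h2 ?_
    refine (heq_of_eq (C.map_map _ _ _)).trans ?_
    refine (heq_of_eq (C.map_map (K := {i // m.π i = k}) _ (fiberEquiv m.π (fun j => j) k ⟨k, rfl⟩)
      (m.g k))).trans ?_
    exact map_heq_self _ (fun i => rfl) _
  · rfl

theorem map_comp_map {K J : Type} [Finite K] [Finite J] {I I' : J → Type} [∀ j, Finite (I j)]
    [∀ j, Finite (I' j)] (A : K ≃ Σ j, I' j) {y : J → C.V} {v : C.V} (f : C.Hom y v)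
    (e : ∀ j, I' j ≃ I j) {x : ∀ j, I j → C.V} (g : ∀ j, C.Hom (x j) (y j)) :
    C.map A (C.comp f (fun j => C.map (e j) (g j))) =
      C.map (A.trans (Equiv.sigmaCongrRight e)) (C.comp f g) :=
  (congrArg (C.map A) (C.comp_map_right e f g)).trans (C.map_map _ _ _)

theorem WordHom.comp_assoc {X Y Z W : C.Word} (m : WordHom X Y) (n : WordHom Y Z)
    (p : WordHom Z W) : (m.comp n).comp p = m.comp (n.comp p) := by
  refine WordHom.ext rfl (heq_of_eq (funext fun l => ?_))
  have hL : ∀ k : {k // p.π k = l},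
      C.map (fiberEquiv (fun i => n.π (m.π i)) p.π l k) ((m.comp n).g k.1) =
      C.map (((fiberEquiv (fun i => n.π (m.π i)) p.π l k).trans (Equiv.sigmaFiberEquiv
        (fun i : {i // n.π (m.π i) = k.1} => (⟨m.π i, i.2⟩ : {j // n.π j = k.1}))).symm).trans
        (Equiv.sigmaCongrRight fun j => fiberEquiv m.π n.π k.1 j))
        (C.comp (n.g k.1) (fun j => m.g j.1)) := fun k =>
    (C.map_map (K := Σ j, {i : {i // n.π (m.π i) = k.1} // (⟨m.π i, i.2⟩ : {j // n.π j = k.1}) = j})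
      (x := fun s => X.x s.2.1.1) _ _ _).trans
      (map_comp_map (x := fun j i => X.x i.1) _ (n.g k.1) (fun j => fiberEquiv m.π n.π k.1 j)
        (fun j => m.g j.1))
  have hL2 := map_comp_map (I := fun k : {k // p.π k = l} => Σ j : {j // n.π j = k.1},
      {i // m.π i = j.1}) (x := fun k s => X.x s.2.1)
    (Equiv.sigmaFiberEquiv (fun i : {i // p.π (n.π (m.π i)) = l} =>
      (⟨n.π (m.π i), i.2⟩ : {k // p.π k = l}))).symm (p.g l)
    (fun k => ((fiberEquiv (fun i => n.π (m.π i)) p.π l k).trans (Equiv.sigmaFiberEquiv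
        (fun i : {i // n.π (m.π i) = k.1} => (⟨m.π i, i.2⟩ : {j // n.π j = k.1}))).symm).trans
        (Equiv.sigmaCongrRight fun j => fiberEquiv m.π n.π k.1 j))
    (fun k => C.comp (n.g k.1) (fun j : {j // n.π j = k.1} => m.g j.1))
  have hL3 : ((m.comp n).comp p).g l = _ :=
    (congrArg (subst (x := fun i : {i // p.π (n.π (m.π i)) = l} => X.x i.1) (p.g l)
      (fun i : {i // p.π (n.π (m.π i)) = l} => (⟨n.π (m.π i), i.2⟩ : {k // p.π k = l})))
      (funext hL)).trans hL2
  have hR :=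
    map_comp_map (x := fun k j => Y.x j.1) (Equiv.sigmaFiberEquiv
      (fun j : {j // p.π (n.π j) = l} => (⟨n.π j, j.2⟩ : {k // p.π k = l}))).symm (p.g l)
      (fiberEquiv n.π p.π l) (fun k => n.g k.1)
  have hR2 := C.comp_map_left (I := fun s : Σ k : {k // p.π k = l}, {j // n.π j = k.1} =>
      {i // m.π i = s.2.1}) ((Equiv.sigmaFiberEquiv
      (fun j : {j // p.π (n.π j) = l} => (⟨n.π j, j.2⟩ : {k // p.π k = l}))).symm.trans
      (Equiv.sigmaCongrRight (fiberEquiv n.π p.π l))) (C.comp (p.g l) fun k => n.g k.1)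
      (fun s => m.g s.2.1)
  have hA := C.comp_comp (p.g l) (fun k : {k // p.π k = l} => n.g k.1)
    (fun k (j : {j // n.π j = k.1}) => m.g j.1)
  have hR4 := (hR2.trans (congrArg (C.map (x := fun s : Σ s : Σ k : {k // p.π k = l},
    {j // n.π j = k.1}, {i // m.π i = s.2.1} => X.x s.2.1) (Equiv.sigmaCongrLeft _)) hA)).trans
    (C.map_map (x := fun s : Σ k : {k // p.π k = l}, Σ j : {j // n.π j = k.1},
      {i // m.π i = j.1} => X.x s.2.2.1) _ _ _)
  have hR3 : (m.comp (n.comp p)).g l = _ :=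
    (map_comp_map (x := fun j i => X.x i.1) _ ((n.comp p).g l)
      (fun j => fiberEquiv m.π (fun j => p.π (n.π j)) l j)
      (fun j : {j // p.π (n.π j) = l} => m.g j.1)).trans
    ((congrArg (C.map _) ((congrArg (fun o => C.comp o
      (fun j : {j // p.π (n.π j) = l} => m.g j.1)) hR).trans hR4)).trans (C.map_map (x := fun s : Σ k : {k // p.π k = l},
      Σ j : {j // n.π j = k.1}, {i // m.π i = j.1} => X.x s.2.2.1) _ _ _))
  refine eq_of_heq ((heq_of_eq hL3).trans (HEq.trans (map_congr ?_ _) (heq_of_eq hR3.symm)))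
  exact fun _ => rfl

instance : Category C.Word where
  Hom := WordHom
  id := WordHom.id
  comp := WordHom.comp
  id_comp := WordHom.id_comp
  comp_id := WordHom.comp_id
  assoc := WordHom.comp_assoc

/-- The one-letter word. -/
def single (v : C.V) : C.Word := ⟨1, fun _ => v⟩

end ColoredOperad

open ColoredOperad

/-- The standing conditions on a Feynman category: it is skeletal (isomorphic colours are equal),
and every colour has a finite automorphism group. -/
structure ColoredOperad.IsFeynman (C : ColoredOperad.{u}) : Prop where
  skeletal : ∀ v w : C.V, Nonempty (single v ≅ single w) → v = w
  finite_aut : ∀ v : C.V, Finite (Aut (single v))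

/-- A degree function, given on generating morphisms, additive for composition (and for tensor
products, through `DegreeFunction.degree`). -/
structure DegreeFunction (C : ColoredOperad.{u}) where
  deg : ∀ {I : Type} [Finite I] {x : I → C.V} {v : C.V}, C.Hom x v → ℕ
  deg_map : ∀ {I J : Type} [Finite I] [Finite J] (e : I ≃ J) {x : J → C.V} {v : C.V}
    (f : C.Hom x v), deg (C.map e f) = deg f
  deg_comp : ∀ {J : Type} [Fintype J] {I : J → Type} [∀ j, Finite (I j)] {y : J → C.V}
    {x : ∀ j, I j → C.V} {v : C.V} (f : C.Hom y v) (g : ∀ j, C.Hom (x j) (y j)),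
    deg (C.comp f g) = deg f + ∑ j, deg (g j)

namespace DegreeFunction

variable {C : ColoredOperad.{u}} (δ : DegreeFunction C)

/-- The degree of a morphism of words: the sum of the degrees of its components. -/
def degree {X Y : C.Word} (m : X ⟶ Y) : ℕ := ∑ j, δ.deg (WordHom.g m j)

/-- Sequences of `n` composable degree one morphisms from `X` to `Y`; a sequence of length `0`
is an isomorphism. -/
inductive Chain : C.Word → C.Word → ℕ → Type u
  | nil {X Y : C.Word} (e : X ≅ Y) : Chain X Y 0
  | cons {X Y Z : C.Word} {n : ℕ} (m : X ⟶ Y) (hm : δ.degree m = 1) (c : Chain Y Z n) :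
      Chain X Z (n + 1)

theorem degree_comp {X Y Z : C.Word} (m : X ⟶ Y) (n : Y ⟶ Z) :
    δ.degree (m ≫ n) = δ.degree m + δ.degree n := by
  have h : ∀ k, δ.deg (WordHom.g (m ≫ n) k) =
      δ.deg (WordHom.g n k) + ∑ j : {j // WordHom.π n j = k}, δ.deg (WordHom.g m j) := by
    intro k
    refine (δ.deg_map _ _).trans ((δ.deg_comp _ _).trans (congrArg _ ?_))
    exact Finset.sum_congr rfl fun j _ => δ.deg_map _ _
  unfold degree
  rw [Finset.sum_congr rfl fun k _ => h k, Finset.sum_add_distrib, add_comm]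
  congr 1
  rw [← Fintype.sum_sigma' (f := fun k (j : {j // WordHom.π n j = k}) => δ.deg (WordHom.g m j))]
  exact Fintype.sum_equiv (Equiv.sigmaFiberEquiv (WordHom.π n)) _ _ fun s => rfl

theorem deg_one (v : C.V) : δ.deg (C.one v) = 0 := by
  have h := δ.deg_comp (C.one v) (fun _ : Unit => C.one v)
  rw [C.one_comp, δ.deg_map] at h
  simpa using h

theorem deg_oneOf {I : Type} [Finite I] (e : I ≃ Unit) (x : I → C.V) (v : C.V)
    (h : ∀ i, x i = v) : δ.deg (oneOf e x v h) = 0 := by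
  obtain rfl : x = fun _ => v := funext h
  exact (δ.deg_map _ _).trans (δ.deg_one v)

theorem degree_id (X : C.Word) : δ.degree (𝟙 X) = 0 :=
  Finset.sum_eq_zero fun j _ => δ.deg_oneOf (fiberId j) (fun i => X.x i) (X.x j)
    (fun i => congrArg X.x i.2)

theorem degree_iso {X Y : C.Word} (e : X ≅ Y) : δ.degree e.hom = 0 := by
  have h := δ.degree_comp e.hom e.inv
  rw [e.hom_inv_id, δ.degree_id] at h
  omega

theorem deg_le_one {X Y : C.Word} {m : X ⟶ Y} (hm : δ.degree m ≤ 1) (j : Fin Y.n) :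
    δ.deg (WordHom.g m j) ≤ 1 :=
  (Finset.single_le_sum (f := fun j => δ.deg (WordHom.g m j)) (fun _ _ => Nat.zero_le _)
    (Finset.mem_univ j)).trans hm

variable {δ}

namespace Chain

/-- Precomposition of a chain with an isomorphism. -/
def pre {X' X Y : C.Word} {n : ℕ} (e : X' ≅ X) : δ.Chain X Y n → δ.Chain X' Y n
  | nil e' => nil (e ≪≫ e')
  | cons m hm c => cons (e.hom ≫ m) (by rw [degree_comp, degree_iso, hm]) c

/-- Concatenation of chains. -/
def append {X Y Z : C.Word} {n m : ℕ} : δ.Chain X Y n → δ.Chain Y Z m → δ.Chain X Z (m + n)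
  | nil e, d => d.pre e
  | cons f hf c, d => cons f hf (c.append d)

/-- The morphism obtained by composing a chain. -/
def composite {X Y : C.Word} {n : ℕ} : δ.Chain X Y n → (X ⟶ Y)
  | nil e => e.hom
  | cons m _ c => m ≫ c.composite

/-- Two chains agree modulo composition of isomorphisms if there are isomorphisms between their
intermediate words that are compatible with all steps. -/
def Rel {X Y : C.Word} {n : ℕ} : δ.Chain X Y n → δ.Chain X Y n → Prop
  | nil e, nil e' => e = e'
  | cons (Y := A) m _ c, cons (Y := B) m' _ c' =>
    ∃ θ : A ≅ B, m ≫ θ.hom = m' ∧ c.Rel (c'.pre θ)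

theorem pre_refl {X Y : C.Word} {n : ℕ} (c : δ.Chain X Y n) : c.pre (Iso.refl X) = c := by
  cases c <;> simp [pre]

theorem pre_pre {X'' X' X Y : C.Word} {n : ℕ} (e : X'' ≅ X') (e' : X' ≅ X) (c : δ.Chain X Y n) :
    (c.pre e').pre e = c.pre (e ≪≫ e') := by
  cases c <;> simp [pre]

theorem Rel.pre {X' X Y : C.Word} {n : ℕ} (e : X' ≅ X) {c c' : δ.Chain X Y n} (h : c.Rel c') :
    (c.pre e).Rel (c'.pre e) := by
  cases c with
  | nil => cases c'; simp only [Rel, Chain.pre] at h ⊢; rw [h]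
  | cons m hm c =>
    cases c' with
    | cons m' hm' c' =>
      obtain ⟨θ, h1, h2⟩ := h
      exact ⟨θ, by rw [Category.assoc, h1], h2⟩

theorem Rel.refl {X Y : C.Word} {n : ℕ} (c : δ.Chain X Y n) : c.Rel c := by
  induction c with
  | nil => exact rfl
  | cons m hm c ih => exact ⟨Iso.refl _, by simp, by rw [pre_refl]; exact ih⟩

theorem Rel.symm {X Y : C.Word} {n : ℕ} {c c' : δ.Chain X Y n} (h : c.Rel c') : c'.Rel c := by
  induction c with
  | nil => cases c'; exact Eq.symm h
  | cons m hm c ih =>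
    cases c' with
    | cons m' hm' c' =>
      obtain ⟨θ, h1, h2⟩ := h
      refine ⟨θ.symm, by simp [← h1], ?_⟩
      have := (ih h2).pre θ.symm
      rwa [pre_pre, Iso.symm_self_id, pre_refl] at this

theorem Rel.trans {X Y : C.Word} {n : ℕ} {c c' c'' : δ.Chain X Y n} (h : c.Rel c')
    (h' : c'.Rel c'') : c.Rel c'' := by
  induction c with
  | nil => cases c'; cases c''; exact Eq.trans h h'
  | cons m hm c ih =>
    cases c' with
    | cons m' hm' c' =>
      cases c'' with
      | cons m'' hm'' c'' =>
        obtain ⟨θ, h1, h2⟩ := h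
        obtain ⟨θ', h1', h2'⟩ := h'
        refine ⟨θ ≪≫ θ', by rw [← h1', ← h1]; simp, ih h2 ?_⟩
        have := h2'.pre θ
        rwa [pre_pre] at this

theorem composite_pre {X' X Y : C.Word} {n : ℕ} (e : X' ≅ X) (c : δ.Chain X Y n) :
    (c.pre e).composite = e.hom ≫ c.composite := by
  cases c <;> simp [pre, composite]

theorem Rel.composite_eq {X Y : C.Word} {n : ℕ} {c c' : δ.Chain X Y n} (h : c.Rel c') :
    c.composite = c'.composite := by
  induction c with
  | nil => cases c'; exact congrArg Iso.hom h
  | cons m hm c ih =>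
    cases c' with
    | cons m' hm' c' =>
      obtain ⟨θ, h1, h2⟩ := h
      simp only [composite, ih h2, composite_pre, ← h1, Category.assoc]

end Chain

variable (δ)

instance chainSetoid (X Y : C.Word) (n : ℕ) : Setoid (δ.Chain X Y n) where
  r := Chain.Rel
  iseqv := ⟨Chain.Rel.refl, Chain.Rel.symm, Chain.Rel.trans⟩

/-- The set of chains of length `n` from `X` to `Y` modulo isomorphism of intermediate words. -/
abbrev ChainClass (X Y : C.Word) (n : ℕ) : Type u := Quotient (δ.chainSetoid X Y n)

variable {δ}

def ChainClass.composite {X Y : C.Word} {n : ℕ} (c : δ.ChainClass X Y n) : X ⟶ Y :=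
  Quotient.lift Chain.composite (fun _ _ h => Chain.Rel.composite_eq h) c

end DegreeFunction

/-- A cubical Feynman category: a coloured operad with the standing conditions, a degree function
for which the degree zero morphisms are the isomorphisms, finitely many degree one morphisms into
each vertex, and free actions `perm` of the symmetric groups on the classes of chains such that
composition identifies `Hom(X, Y)` with the disjoint union over `n` of the orbit sets, compatibly
with concatenation. -/
structure CubicalFeynmanCategory where
  C : ColoredOperad.{u}
  isFeynman : C.IsFeynman
  δ : DegreeFunction C
  degree_eq_zero_iff : ∀ {X Y : C.Word} (m : X ⟶ Y), δ.degree m = 0 ↔ IsIso m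
  finite_degree_one : ∀ v : C.V, Finite (Σ X : C.Word, {f : X ⟶ single v // δ.degree f = 1})
  perm : ∀ {X Y : C.Word} {n : ℕ}, Equiv.Perm (Fin n) →* Equiv.Perm (δ.ChainClass X Y n)
  perm_free : ∀ {X Y : C.Word} {n : ℕ} (σ : Equiv.Perm (Fin n)) (c : δ.ChainClass X Y n),
    perm σ c = c → σ = 1
  composite_eq_iff : ∀ {X Y : C.Word} {n : ℕ} (c c' : δ.ChainClass X Y n),
    c.composite = c'.composite ↔ ∃ σ, perm σ c = c'
  exists_chain : ∀ {X Y : C.Word} (m : X ⟶ Y), ∃ c : δ.ChainClass X Y (δ.degree m),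
    c.composite = m
  perm_append : ∀ {X Y Z : C.Word} {m n : ℕ} (σ : Equiv.Perm (Fin m)) (τ : Equiv.Perm (Fin n))
    (c c' : δ.Chain X Y n) (d d' : δ.Chain Y Z m),
    perm τ ⟦c⟧ = ⟦c'⟧ → perm σ ⟦d⟧ = ⟦d'⟧ →
      perm (finSumFinEquiv.permCongr (Equiv.Perm.sumCongr σ τ)) ⟦c.append d⟧ = ⟦c'.append d'⟧

namespace CubicalFeynmanCategory

/-- No nontrivial automorphism of the middle word of a chain of two degree one morphisms fixes
both of them. -/
def Rigid (F : CubicalFeynmanCategory.{u}) : Prop :=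
  ∀ {X Y : F.C.Word} {v : F.C.V} (m : X ⟶ Y) (n : Y ⟶ single v), F.δ.degree m = 1 →
    F.δ.degree n = 1 → ∀ θ : Aut Y, m ≫ θ.hom = m → θ.hom ≫ n = n → θ = 1

end CubicalFeynmanCategory

/-- A morphism of cubical Feynman categories: a morphism of coloured operads (so a symmetric
monoidal functor that sends vertices to vertices), with finite fibres on objects, that preserves
the degree. -/
structure CubicalMorphism (F₁ F₂ : CubicalFeynmanCategory.{u}) where
  onV : F₁.C.V → F₂.C.V
  onHom : ∀ {I : Type} [Finite I] {x : I → F₁.C.V} {v : F₁.C.V}, F₁.C.Hom x v →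
    F₂.C.Hom (fun i => onV (x i)) (onV v)
  onHom_map : ∀ {I J : Type} [Finite I] [Finite J] (e : I ≃ J) {x : J → F₁.C.V} {v : F₁.C.V}
    (f : F₁.C.Hom x v), onHom (F₁.C.map e f) = F₂.C.map e (onHom f)
  onHom_one : ∀ v, onHom (F₁.C.one v) = F₂.C.one (onV v)
  onHom_comp : ∀ {J : Type} [Finite J] {I : J → Type} [∀ j, Finite (I j)] {y : J → F₁.C.V}
    {x : ∀ j, I j → F₁.C.V} {v : F₁.C.V} (f : F₁.C.Hom y v) (g : ∀ j, F₁.C.Hom (x j) (y j)),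
    onHom (F₁.C.comp f g) = F₂.C.comp (onHom f) (fun j => onHom (g j))
  finite_fiber : ∀ v : F₂.C.V, Finite {w : F₁.C.V // onV w = v}
  deg_onHom : ∀ {I : Type} [Finite I] {x : I → F₁.C.V} {v : F₁.C.V} (f : F₁.C.Hom x v),
    F₂.δ.deg (onHom f) = F₁.δ.deg f

namespace CubicalMorphism

variable {F₁ F₂ : CubicalFeynmanCategory.{u}} (φ : CubicalMorphism F₁ F₂)

theorem onHom_oneOf {I : Type} [Finite I] (e : I ≃ Unit) (x : I → F₁.C.V) (v : F₁.C.V)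
    (h : ∀ i, x i = v) :
    φ.onHom (oneOf e x v h) = oneOf e (fun i => φ.onV (x i)) (φ.onV v)
      (fun i => congrArg φ.onV (h i)) := by
  obtain rfl : x = fun _ => v := funext h
  exact (φ.onHom_map _ _).trans (congrArg _ (φ.onHom_one v))

theorem onHom_subst {I J : Type} [Finite I] [Finite J] {x : I → F₁.C.V} {y : J → F₁.C.V}
    {v : F₁.C.V} (f : F₁.C.Hom y v) (π : I → J)
    (g : ∀ j, F₁.C.Hom (fun i : {i // π i = j} => x i) (y j)) :
    φ.onHom (subst f π g) = subst (φ.onHom f) π (fun j => φ.onHom (g j)) :=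
  (φ.onHom_map _ _).trans (congrArg _ (φ.onHom_comp _ _))

def onWordHom {X Y : F₁.C.Word} (m : WordHom X Y) :
    WordHom (C := F₂.C) ⟨X.n, fun i => φ.onV (X.x i)⟩ ⟨Y.n, fun i => φ.onV (Y.x i)⟩ :=
  ⟨m.π, fun j => φ.onHom (m.g j)⟩

theorem onWordHom_comp {X Y Z : F₁.C.Word} (m : WordHom X Y) (n : WordHom Y Z) :
    φ.onWordHom (m.comp n) = (φ.onWordHom m).comp (φ.onWordHom n) := by
  refine WordHom.ext rfl (heq_of_eq (funext fun k => ?_))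
  refine (φ.onHom_subst (x := fun i : {i // n.π (m.π i) = k} => X.x i.1) (n.g k)
    (fun i => (⟨m.π i, i.2⟩ : {j // n.π j = k}))
    (fun j => F₁.C.map (fiberEquiv m.π n.π k j) (m.g j))).trans ?_
  refine congrArg (subst (x := fun i : {i // n.π (m.π i) = k} => φ.onV (X.x i.1))
    (φ.onHom (n.g k)) (fun i => (⟨m.π i, i.2⟩ : {j // n.π j = k}))) (funext fun j => ?_)
  exact φ.onHom_map (fiberEquiv m.π n.π k j) (m.g j)

/-- The functor on words given by a morphism. -/
def functor : F₁.C.Word ⥤ F₂.C.Word where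
  obj X := ⟨X.n, fun i => φ.onV (X.x i)⟩
  map m := φ.onWordHom m
  map_id X := WordHom.ext rfl (heq_of_eq (funext fun j =>
    φ.onHom_oneOf (fiberId j) (fun i => X.x i) (X.x j) (fun i => congrArg X.x i.2)))
  map_comp m n := φ.onWordHom_comp m n

/-- Admissibility: `φ` is faithful and satisfies the two factorization axioms. If
`φ(g) = f ∘ φ(l)`, then `f` is in the image of `φ`; and if `φ(g) = f ∘ h`, then `g = g₁ ∘ g₂`
with `f = φ(g₁) σ⁻¹` and `h = σ φ(g₂)` for an isomorphism `σ`. -/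
structure Admissible : Prop where
  faithful : φ.functor.Faithful
  cancel : ∀ {X Y Z : F₁.C.Word} (g : X ⟶ Z) (l : X ⟶ Y)
    (f : φ.functor.obj Y ⟶ φ.functor.obj Z), φ.functor.map g = φ.functor.map l ≫ f →
    ∃ f' : Y ⟶ Z, φ.functor.map f' = f
  factor : ∀ {X Z : F₁.C.Word} {Y : F₂.C.Word} (g : X ⟶ Z) (h : φ.functor.obj X ⟶ Y)
    (f : Y ⟶ φ.functor.obj Z), φ.functor.map g = h ≫ f →
    ∃ (Y' : F₁.C.Word) (g₂ : X ⟶ Y') (g₁ : Y' ⟶ Z) (σ : φ.functor.obj Y' ≅ Y),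
      g = g₂ ≫ g₁ ∧ h = φ.functor.map g₂ ≫ σ.hom ∧ f = σ.inv ≫ φ.functor.map g₁

theorem degree_map {X Y : F₁.C.Word} (m : X ⟶ Y) :
    F₂.δ.degree (φ.functor.map m) = F₁.δ.degree m :=
  Finset.sum_congr rfl fun _ _ => φ.deg_onHom _

end CubicalMorphism

/-- The two parities: `even` for invariant functors, `odd` for skew-invariant ones. -/
inductive Parity
  | even
  | odd

namespace Parity

def val : Parity → ℕ
  | even => 0
  | odd => 1

def flip : Parity → Parity
  | even => odd
  | odd => even

end Parity

/-- The sign for applying a tensor product of operations, `j` running through `J` in order and of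
degree `ε * δ j`, to a tensor product of elements of degrees `n i`, `i` running through `I` in
order, where element `i` is an input of operation `π i`: first the elements are sorted by the
operation, then the operations move past the elements that belong to earlier operations. -/
def koszulSign {I J : Type} [Fintype I] [LinearOrder I] [Fintype J] [LinearOrder J] (ε : Parity)
    (π : I → J) (δ : J → ℕ) (n : I → ℤ) : ℤˣ :=
  (∏ i, ∏ i', if i < i' ∧ π i' < π i then (-1) ^ (n i * n i') else 1) *
    ∏ i, ∏ j, if π i < j then (-1) ^ ((ε.val * δ j : ℤ) * n i) else 1

/-- A `ℤ`-graded vector space (an internal direct sum of its homogeneous parts `gr n`). -/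
structure GrVect (k : Type u) [Field k] where
  carrier : Type u
  [addCommGroup : AddCommGroup carrier]
  [module : Module k carrier]
  gr : ℤ → Submodule k carrier
  isInternal : DirectSum.IsInternal gr

namespace GrVect

variable {k : Type u} [Field k]

instance : CoeSort (GrVect k) (Type u) := ⟨carrier⟩

instance (M : GrVect k) : AddCommGroup M := M.addCommGroup

instance (M : GrVect k) : Module k M := M.module

/-- The degree `n` part of the graded linear dual: functionals that vanish on all homogeneous
parts but the one of degree `-n`. -/
def dual (M : GrVect k) (n : ℤ) : Submodule k (Module.Dual k M) where
  carrier := {ξ | ∀ m, m ≠ -n → ∀ x ∈ M.gr m, ξ x = 0}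
  add_mem' hξ hη m hm x hx := by simp [hξ m hm x hx, hη m hm x hx]
  zero_mem' _ _ _ _ := rfl
  smul_mem' r ξ hξ m hm x hx := by simp [hξ m hm x hx]

end GrVect

/-- Underlying data of a monoidal functor to graded vector spaces: a graded vector space for each
vertex, and multilinear maps for the generating morphisms of degree at most one. The linear order
on the inputs fixes the order of the tensor factors. -/
structure PreGradedOp (k : Type u) [Field k] (F : CubicalFeynmanCategory.{u}) where
  obj : F.C.V → GrVect k
  act : ∀ {I : Type} [Finite I] [LinearOrder I] {x : I → F.C.V} {v : F.C.V} (f : F.C.Hom x v),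
    F.δ.deg f ≤ 1 → MultilinearMap k (fun i => obj (x i)) (obj v)

namespace PreGradedOp

variable {k : Type u} [Field k] {F : CubicalFeynmanCategory.{u}} (P : PreGradedOp k F)

/-- A pure tensor of elements at the letters of a word, with recorded degrees and a sign. -/
structure Tensor (X : F.C.Word) where
  sign : ℤˣ
  deg : Fin X.n → ℤ
  val : ∀ i, P.obj (X.x i)

variable {P}

/-- The element given by a tensor over a one-letter word. -/
def Tensor.value {v : F.C.V} (t : P.Tensor (single v)) : P.obj v :=
  t.sign • t.val (0 : Fin 1)

/-- The image of a pure tensor under a morphism of words of degree at most one, with the Koszul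
sign; degree one operations have degree `ε.val`. -/
def push (ε : Parity) {X Y : F.C.Word} (m : X ⟶ Y) (hm : F.δ.degree m ≤ 1) (t : P.Tensor X) :
    P.Tensor Y where
  sign := t.sign * koszulSign ε (WordHom.π m) (fun j => F.δ.deg (WordHom.g m j)) t.deg
  deg j := ∑ i : {i // WordHom.π m i = j}, t.deg i + ε.val * F.δ.deg (WordHom.g m j)
  val j := P.act (WordHom.g m j) (F.δ.deg_le_one hm j) (fun i => t.val i)

/-- The image of a pure tensor under a chain. -/
def pushChain (ε : Parity) {X Y : F.C.Word} {n : ℕ} : F.δ.Chain X Y n → P.Tensor X → P.Tensor Y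
  | .nil e, t => push ε e.hom (by rw [F.δ.degree_iso]; exact Nat.zero_le 1) t
  | .cons m hm c, t => pushChain ε c (push ε m hm.le t)

variable (P)

/-- The value of a generating morphism of degree at most one on elements at its inputs. -/
def ev {X : F.C.Word} {v : F.C.V} (f : X ⟶ single v) (hf : F.δ.degree f ≤ 1)
    (p : ∀ i, P.obj (X.x i)) : P.obj v :=
  P.act (WordHom.g f (0 : Fin 1)) (F.δ.deg_le_one hf _) (fun i => p i)

/-- The linear map given by an isomorphism of vertices. -/
def evIso {v w : F.C.V} (σ : single v ≅ single w) : P.obj v →ₗ[k] P.obj w :=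
  haveI : Subsingleton {i // WordHom.π σ.hom i = (0 : Fin 1)} :=
    inferInstanceAs (Subsingleton {i : Fin 1 // WordHom.π σ.hom i = (0 : Fin 1)})
  (MultilinearMap.ofSubsingleton k (P.obj v) (P.obj w)
    (⟨(0 : Fin 1), Subsingleton.elim (α := Fin 1) _ _⟩ : {i // WordHom.π σ.hom i = (0 : Fin 1)})).symm
    (P.act (WordHom.g σ.hom (0 : Fin 1))
      (F.δ.deg_le_one (by rw [F.δ.degree_iso]; exact Nat.zero_le 1) _))

end PreGradedOp

/-- The graded objects of `𝔽⁺-Ops` (`ε = even`) and `𝔽⁻-Ops` (`ε = odd`): monoidal functors to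
graded vector spaces on the category of chains, so determined by the degree zero and degree one
generating morphisms, that are (skew) invariant under the symmetric groups. Degree one generators
act with degree `ε.val`. Invariance is required for transpositions of two consecutive steps; these
generate. -/
structure GradedOp (k : Type u) [Field k] (F : CubicalFeynmanCategory.{u}) (ε : Parity) extends
    PreGradedOp k F where
  act_mem : ∀ {I : Type} [Fintype I] [LinearOrder I] {x : I → F.C.V} {v : F.C.V}
    (f : F.C.Hom x v) (hf : F.δ.deg f ≤ 1) (n : I → ℤ) (p : ∀ i, obj (x i)),
    (∀ i, p i ∈ (obj (x i)).gr (n i)) →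
      act f hf p ∈ (obj v).gr (∑ i, n i + ε.val * F.δ.deg f)
  act_one : ∀ (v : F.C.V) (h : F.δ.deg (F.C.one v) ≤ 1) (p : obj v),
    act (F.C.one v) h (fun _ => p) = p
  act_map : ∀ {I J : Type} [Finite I] [LinearOrder I] [Finite J] [LinearOrder J] (e : I ≃o J)
    {x : J → F.C.V} {v : F.C.V} (f : F.C.Hom x v) (hf : F.δ.deg f ≤ 1)
    (hf' : F.δ.deg (F.C.map e.toEquiv f) ≤ 1) (p : ∀ j, obj (x j)),
    act (F.C.map e.toEquiv f) hf' (fun i => p (e i)) = act f hf p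
  act_subst : ∀ {I J : Type} [Fintype I] [LinearOrder I] [Fintype J] [LinearOrder J]
    {x : I → F.C.V} {y : J → F.C.V} {v : F.C.V} (f : F.C.Hom y v) (π : I → J)
    (g : ∀ j, F.C.Hom (fun i : {i // π i = j} => x i) (y j)) (hf : F.δ.deg f ≤ 1)
    (hg : ∀ j, F.δ.deg (g j) ≤ 1) (h : F.δ.deg (subst f π g) ≤ 1) (n : I → ℤ)
    (p : ∀ i, obj (x i)), (∀ i, p i ∈ (obj (x i)).gr (n i)) →
      act (subst f π g) h p = koszulSign ε π (fun j => F.δ.deg (g j)) n •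
        act f hf (fun j => act (g j) (hg j) (fun i => p i))
  act_swap : ∀ {X Y : F.C.Word} {v : F.C.V} {n : ℕ} (d d' : F.δ.Chain X Y 2)
    (c : F.δ.Chain Y (single v) n), F.perm (Equiv.swap 0 1) ⟦d⟧ = ⟦d'⟧ →
      ∀ t : toPreGradedOp.Tensor X, (∀ i, t.val i ∈ (obj (X.x i)).gr (t.deg i)) →
        (PreGradedOp.pushChain ε c (PreGradedOp.pushChain ε d' t)).value =
          (-1 : ℤˣ) ^ ε.val • (PreGradedOp.pushChain ε c (PreGradedOp.pushChain ε d t)).value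

/-- Morphisms of graded objects: natural transformations, of degree zero. -/
structure GradedOp.Hom {k : Type u} [Field k] {F : CubicalFeynmanCategory.{u}} {ε : Parity}
    (P Q : GradedOp k F ε) where
  app : ∀ v, P.obj v →ₗ[k] Q.obj v
  app_mem : ∀ v n, ∀ p ∈ (P.obj v).gr n, app v p ∈ (Q.obj v).gr n
  app_act : ∀ {I : Type} [Finite I] [LinearOrder I] {x : I → F.C.V} {v : F.C.V}
    (f : F.C.Hom x v) (hf : F.δ.deg f ≤ 1) (p : ∀ i, P.obj (x i)),
    app v (P.act f hf p) = Q.act f hf (fun i => app (x i) (p i))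

/-- The objects of `𝔽^±-Ops`, with values in differential graded vector spaces (cohomological
grading): the operations satisfy the graded Leibniz rule. -/
structure DGOp (k : Type u) [Field k] (F : CubicalFeynmanCategory.{u}) (ε : Parity) extends
    GradedOp k F ε where
  d : ∀ v, obj v →ₗ[k] obj v
  d_mem : ∀ v n, ∀ p ∈ (obj v).gr n, d v p ∈ (obj v).gr (n + 1)
  d_d : ∀ v p, d v (d v p) = 0
  d_act : ∀ {I : Type} [Fintype I] [LinearOrder I] {x : I → F.C.V} {v : F.C.V}
    (f : F.C.Hom x v) (hf : F.δ.deg f ≤ 1) (n : I → ℤ) (p : ∀ i, obj (x i)),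
    (∀ i, p i ∈ (obj (x i)).gr (n i)) →
      d v (act f hf p) = (-1 : ℤˣ) ^ (ε.val * F.δ.deg f) • ∑ i,
        (∏ i', if i' < i then (-1 : ℤˣ) ^ n i' else 1) •
          act f hf (Function.update p i (d (x i) (p i)))

namespace DGOp

variable {k : Type u} [Field k] {F F₁ F₂ : CubicalFeynmanCategory.{u}} {ε : Parity}

@[ext]
structure Hom (P Q : DGOp k F ε) where
  app : ∀ v, P.obj v →ₗ[k] Q.obj v
  app_mem : ∀ v n, ∀ p ∈ (P.obj v).gr n, app v p ∈ (Q.obj v).gr n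
  app_act : ∀ {I : Type} [Finite I] [LinearOrder I] {x : I → F.C.V} {v : F.C.V}
    (f : F.C.Hom x v) (hf : F.δ.deg f ≤ 1) (p : ∀ i, P.obj (x i)),
    app v (P.act f hf p) = Q.act f hf (fun i => app (x i) (p i))
  app_d : ∀ v p, app v (P.d v p) = Q.d v (app v p)

instance : Category (DGOp k F ε) where
  Hom := Hom
  id P := ⟨fun _ => LinearMap.id, fun _ _ _ h => h, fun _ _ _ => rfl, fun _ _ => rfl⟩
  comp a b := ⟨fun v => b.app v ∘ₗ a.app v, fun v n p h => b.app_mem v n _ (a.app_mem v n p h),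
    fun f hf p => by simp [a.app_act, b.app_act], fun v p => by simp [a.app_d, b.app_d]⟩

end DGOp

namespace CubicalMorphism

variable {k : Type u} [Field k] {F₁ F₂ : CubicalFeynmanCategory.{u}} {ε : Parity}
  (φ : CubicalMorphism F₁ F₂)

/-- Restriction along `φ`, on underlying data. -/
def pullbackPre (P : PreGradedOp k F₂) : PreGradedOp k F₁ where
  obj w := P.obj (φ.onV w)
  act f hf := P.act (φ.onHom f) ((φ.deg_onHom f).trans_le hf)

/-- The image of a chain under `φ`. -/
def mapChain {X Y : F₁.C.Word} {n : ℕ} : F₁.δ.Chain X Y n →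
    F₂.δ.Chain (φ.functor.obj X) (φ.functor.obj Y) n
  | .nil e => .nil (φ.functor.mapIso e)
  | .cons m hm c => .cons (φ.functor.map m) ((φ.degree_map m).trans hm) (mapChain c)

theorem mapChain_pre {X' X Y : F₁.C.Word} {n : ℕ} (e : X' ≅ X) (c : F₁.δ.Chain X Y n) :
    φ.mapChain (c.pre e) = (φ.mapChain c).pre (φ.functor.mapIso e) := by
  cases c with
  | nil e' => exact congrArg DegreeFunction.Chain.nil (φ.functor.mapIso_trans e e')
  | cons m hm c =>
    simp only [DegreeFunction.Chain.pre, mapChain, Functor.map_comp, Functor.mapIso_hom]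

theorem mapChain_rel {X Y : F₁.C.Word} {n : ℕ} {c c' : F₁.δ.Chain X Y n} (h : c.Rel c') :
    (φ.mapChain c).Rel (φ.mapChain c') := by
  induction c with
  | nil => cases c'; exact congrArg φ.functor.mapIso h
  | cons m hm c ih =>
    cases c' with
    | cons m' hm' c' =>
      obtain ⟨θ, h1, h2⟩ := h
      refine ⟨φ.functor.mapIso θ, ?_, ?_⟩
      · rw [← h1]; exact (φ.functor.map_comp m θ.hom).symm
      · have := ih h2
        rwa [mapChain_pre] at this

theorem composite_mapChain {X Y : F₁.C.Word} {n : ℕ} (c : F₁.δ.Chain X Y n) :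
    (φ.mapChain c).composite = φ.functor.map c.composite := by
  induction c with
  | nil => rfl
  | cons m hm c ih =>
    exact (congrArg _ ih).trans (φ.functor.map_comp _ _).symm

variable {φ}

theorem Admissible.rel_of_mapChain_rel (hφ : φ.Admissible) {X Y : F₁.C.Word} {n : ℕ}
    {c c' : F₁.δ.Chain X Y n} (h : (φ.mapChain c).Rel (φ.mapChain c')) : c.Rel c' := by
  have := hφ.faithful
  induction c with
  | nil e =>
    cases c' with
    | nil e' => exact Iso.ext (φ.functor.map_injective (congrArg Iso.hom h))
  | cons m hm c ih =>
    cases c' with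
    | cons m' hm' c' =>
      obtain ⟨θ, h1, h2⟩ := h
      obtain ⟨l, hl⟩ := hφ.cancel m' m θ.hom h1.symm
      have : IsIso l := (F₁.degree_eq_zero_iff l).1 (by
        rw [← φ.degree_map, hl]; exact F₂.δ.degree_iso θ)
      have hθ : φ.functor.mapIso (asIso l) = θ := Iso.ext hl
      refine ⟨asIso l, φ.functor.map_injective ?_, ih ?_⟩
      · rw [φ.functor.map_comp, ← h1, ← hl]; rfl
      · rw [mapChain_pre, hθ]; exact h2

theorem Admissible.perm_swap (hφ : φ.Admissible) {X Y : F₁.C.Word} (d d' : F₁.δ.Chain X Y 2)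
    (h : F₁.perm (Equiv.swap 0 1) ⟦d⟧ = ⟦d'⟧) :
    F₂.perm (Equiv.swap 0 1) ⟦φ.mapChain d⟧ = ⟦φ.mapChain d'⟧ := by
  have h1 : d.composite = d'.composite := (F₁.composite_eq_iff ⟦d⟧ ⟦d'⟧).2 ⟨_, h⟩
  obtain ⟨σ, hσ⟩ := (F₂.composite_eq_iff ⟦φ.mapChain d⟧ ⟦φ.mapChain d'⟧).1 (by
    change (φ.mapChain d).composite = (φ.mapChain d').composite
    rw [composite_mapChain, composite_mapChain, h1])
  have h2 := (by decide : ∀ τ : Equiv.Perm (Fin 2), τ = 1 ∨ τ = Equiv.swap 0 1) σ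
  rcases h2 with rfl | rfl
  · exfalso
    rw [map_one] at hσ
    have h3 : (⟦d⟧ : F₁.δ.ChainClass X Y 2) = ⟦d'⟧ :=
      Quotient.sound (hφ.rel_of_mapChain_rel (Quotient.exact hσ))
    rw [← h3] at h
    exact absurd (F₁.perm_free _ _ h) (by decide)
  · exact hσ

variable (φ)

def pullbackTensor (P : PreGradedOp k F₂) {X : F₁.C.Word} (t : (φ.pullbackPre P).Tensor X) :
    P.Tensor (φ.functor.obj X) :=
  ⟨t.sign, t.deg, t.val⟩

theorem pullbackTensor_push (P : PreGradedOp k F₂) {X Y : F₁.C.Word} (m : X ⟶ Y)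
    (hm : F₁.δ.degree m ≤ 1) (t : (φ.pullbackPre P).Tensor X) :
    φ.pullbackTensor P (PreGradedOp.push ε m hm t) =
      PreGradedOp.push ε (φ.functor.map m) ((φ.degree_map m).trans_le hm) (φ.pullbackTensor P t) := by
  have h : (fun j => F₁.δ.deg (WordHom.g m j)) =
      fun j => F₂.δ.deg (WordHom.g (φ.functor.map m) j) :=
    funext fun j => (φ.deg_onHom (WordHom.g m j)).symm
  have key : ∀ a b : Fin Y.n → ℕ, a = b →
      (⟨t.sign * koszulSign ε (WordHom.π m) a t.deg,
        fun j : Fin Y.n => ∑ i : {i : Fin X.n // WordHom.π m i = j}, t.deg i + ε.val * a j,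
        (PreGradedOp.push ε m hm t).val⟩ : P.Tensor (φ.functor.obj Y)) =
      ⟨t.sign * koszulSign ε (WordHom.π m) b t.deg,
        fun j : Fin Y.n => ∑ i : {i : Fin X.n // WordHom.π m i = j}, t.deg i + ε.val * b j,
        (PreGradedOp.push ε m hm t).val⟩ := by
    rintro a _ rfl
    rfl
  exact key _ _ h

theorem pullbackTensor_pushChain (P : PreGradedOp k F₂) {X Y : F₁.C.Word} {n : ℕ}
    (c : F₁.δ.Chain X Y n) (t : (φ.pullbackPre P).Tensor X) :
    φ.pullbackTensor P (PreGradedOp.pushChain ε c t) =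
      PreGradedOp.pushChain ε (φ.mapChain c) (φ.pullbackTensor P t) := by
  induction c with
  | nil e => exact φ.pullbackTensor_push P e.hom _ t
  | cons m hm c ih => exact (ih _).trans (congrArg _ (φ.pullbackTensor_push P m _ t))

variable {φ}

def Admissible.pullbackGraded (hφ : φ.Admissible) (P : GradedOp k F₂ ε) : GradedOp k F₁ ε where
  toPreGradedOp := φ.pullbackPre P.toPreGradedOp
  act_mem f hf n p hp := by
    have := P.act_mem (φ.onHom f) ((φ.deg_onHom f).trans_le hf) n p hp
    simp only [φ.deg_onHom] at this
    exact this
  act_one v h p := by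
    have h' : φ.onHom (F₁.C.one v) = F₂.C.one (φ.onV v) := φ.onHom_one v
    simp only [pullbackPre, h']
    exact P.act_one _ _ p
  act_map e x v f hf hf' p := by
    simp only [pullbackPre, φ.onHom_map]
    exact P.act_map e (φ.onHom f) _ _ p
  act_subst f π g hf hg h n p hp := by
    have h1 := P.act_subst (φ.onHom f) π (fun j => φ.onHom (g j))
      ((φ.deg_onHom f).trans_le hf) (fun j => (φ.deg_onHom _).trans_le (hg j))
      (by rw [← φ.onHom_subst]; exact (φ.deg_onHom _).trans_le h) n p hp
    simp only [φ.deg_onHom] at h1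
    simp only [pullbackPre, φ.onHom_subst]
    exact h1
  act_swap d d' c h t ht := by
    have h1 := P.act_swap (v := φ.onV _) (φ.mapChain d) (φ.mapChain d') (φ.mapChain c) (hφ.perm_swap d d' h)
      (φ.pullbackTensor _ t) ht
    rw [← φ.pullbackTensor_pushChain, ← φ.pullbackTensor_pushChain] at h1
    have e : ∀ s, (PreGradedOp.pushChain ε c s).value =
        PreGradedOp.Tensor.value (P := P.toPreGradedOp) (v := φ.onV _)
          (PreGradedOp.pushChain ε (φ.mapChain c) (φ.pullbackTensor P.toPreGradedOp s)) := fun s =>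
      congrArg (PreGradedOp.Tensor.value (P := P.toPreGradedOp) (v := φ.onV _))
        (φ.pullbackTensor_pushChain _ c s)
    exact (e _).trans (h1.trans (congrArg ((-1 : ℤˣ) ^ ε.val • ·) (e _).symm))

/-- The restriction functor `R = φ^*` from `𝔽₂^±-Ops` to `𝔽₁^±-Ops`. -/
def Admissible.pullback (hφ : φ.Admissible) : DGOp k F₂ ε ⥤ DGOp k F₁ ε where
  obj P :=
    { toGradedOp := hφ.pullbackGraded P.toGradedOp
      d w := P.d (φ.onV w)
      d_mem w := P.d_mem (φ.onV w)
      d_d w := P.d_d (φ.onV w)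
      d_act f hf n p hp := by
        have := P.d_act (φ.onHom f) ((φ.deg_onHom f).trans_le hf) n p hp
        simp only [φ.deg_onHom] at this
        exact this }
  map h := ⟨fun w => h.app (φ.onV w), fun w => h.app_mem _, fun f _ => h.app_act (φ.onHom f) _,
    fun w => h.app_d _⟩

end CubicalMorphism

variable {k : Type u} [Field k] {F : CubicalFeynmanCategory.{u}} {ε : Parity}

/-- A way of writing the transpose of the operation of a degree one morphism `f`, applied to a
functional `ξ`, as a finite sum of tensor products of homogeneous functionals on the inputs. -/
structure DGOp.Codecomposition (O : DGOp k F ε) {X : F.C.Word} {v : F.C.V} (f : X ⟶ single v)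
    (hf : F.δ.degree f = 1) (ξ : Module.Dual k (O.obj v)) where
  N : ℕ
  r : Fin N → k
  c : Fin N → Fin X.n → ℤ
  ζ : ∀ (a : Fin N) (i : Fin X.n), (O.obj (X.x i)).dual (c a i)
  sum_eq : ∀ p : ∀ i, O.obj (X.x i),
    ξ (O.ev f hf.le p) = ∑ a, r a * ∏ i, (ζ a i : Module.Dual k (O.obj (X.x i))) (p i)

/-- The objects whose linear dual carries the dual structure: the transpose of each degree one
operation takes values in the tensor product of the graded duals of the inputs. This holds for all
objects with finite-dimensional values. -/
def DGOp.Dualizable (O : DGOp k F ε) : Prop :=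
  ∀ {X : F.C.Word} {v : F.C.V} (f : X ⟶ single v) (hf : F.δ.degree f = 1) (n : ℤ),
    ∀ ξ ∈ (O.obj v).dual n, Nonempty (O.Codecomposition f hf ξ)

variable (k F ε) in
/-- The full subcategory of the dualizable objects. -/
abbrev DualizableOp : Type (u + 1) :=
  ObjectProperty.FullSubcategory (fun O : DGOp k F ε => O.Dualizable)

/-- The restriction functor `R` on dualizable objects. -/
def CubicalMorphism.Admissible.pullbackDualizable {F₁ F₂ : CubicalFeynmanCategory.{u}}
    {φ : CubicalMorphism F₁ F₂} (hφ : φ.Admissible) :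
    DualizableOp k F₂ ε ⥤ DualizableOp k F₁ ε :=
  ObjectProperty.lift _ (ObjectProperty.ι _ ⋙ hφ.pullback) fun O _ _ f hf n ξ hξ => by
    obtain ⟨c⟩ := O.property (φ.functor.map f) ((φ.degree_map f).trans hf) n ξ hξ
    exact ⟨⟨c.N, c.r, c.c, c.ζ, c.sum_eq⟩⟩

/-- Families of linear maps from the graded dual of `O` to `Q`. -/
def DGOp.DualMap (O : DGOp k F ε) {ε' : Parity} (Q : GradedOp k F ε') : Type u :=
  ∀ (v : F.C.V) (n : ℤ), (O.obj v).dual n →ₗ[k] Q.obj v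

/-- The family is a morphism from the linear dual of `O` to `Q` of modules over the groupoid of
vertices: it preserves degrees and is equivariant. -/
structure DGOp.IsDualMap (O : DGOp k F ε) {ε' : Parity} (Q : GradedOp k F ε')
    (γ : O.DualMap Q) : Prop where
  mem : ∀ v n ξ, γ v n ξ ∈ (Q.obj v).gr n
  equivariant : ∀ (v : F.C.V) (n : ℤ) (σ : Aut (single v)) (ξ η : (O.obj v).dual n),
    (∀ p, (η : Module.Dual k (O.obj v)) p = (ξ : Module.Dual k (O.obj v)) (O.evIso σ p)) →
      Q.evIso σ (γ v n η) = γ v n ξ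

/-- The degree one morphism `f` of the free object `D` applied to the transpose of `O(f)` at `ξ`.
The signs are those of the isomorphism between the tensor product of duals and the dual of the
tensor product, and of moving `f`, of degree `ε.flip.val`, past the functionals. -/
def DGOp.cobarTerm (O : DGOp k F ε) (D : GradedOp k F ε.flip) (gen : O.DualMap D) {X : F.C.Word}
    {v : F.C.V} (f : X ⟶ single v) (hf : F.δ.degree f = 1) {ξ : Module.Dual k (O.obj v)}
    (T : O.Codecomposition f hf ξ) : D.obj v :=
  ∑ a, T.r a • ((∏ i, ∏ j, if i < j then (-1 : ℤˣ) ^ (T.c a i * T.c a j) else 1) *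
    (-1 : ℤˣ) ^ (ε.flip.val * ∑ i, T.c a i)) •
      D.ev f hf.le (fun i => gen (X.x i) (T.c a i) (T.ζ a i))

/-- The number of automorphisms of a word times the number of words isomorphic to it. Hence
the sum over all words `X` and all `f : X ⟶ v` with the weights `1 / autWeight X` is the
sum over isomorphism classes of morphisms `f` to `v` with the weights `1 / |Aut f|`. -/
noncomputable def CubicalFeynmanCategory.autWeight (F : CubicalFeynmanCategory.{u}) (X : F.C.Word) : ℕ :=
  X.n.factorial * ∏ i, Nat.card (Aut (single (X.x i)))

/-- `D` is the Feynman transform of `O`: as a graded object it is the free object of the opposite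
parity on the linear dual of `O`, and on generators its differential is the linear dual of the
differential of `O` plus the sum, over isomorphism classes of degree one morphisms to the vertex, of
the transposes of the operations of `O`. -/
structure IsFeynmanTransform (O : DGOp k F ε) (D : DGOp k F ε.flip)
    (gen : O.DualMap D.toGradedOp) : Prop where
  isDualMap : O.IsDualMap D.toGradedOp gen
  free : ∀ (Q : GradedOp k F ε.flip) (γ : O.DualMap Q), O.IsDualMap Q γ →
    ∃! h : GradedOp.Hom D.toGradedOp Q, ∀ v n ξ, h.app v (gen v n ξ) = γ v n ξ
  d_gen : ∀ (v : F.C.V) (n : ℤ) (ξ : (O.obj v).dual n) (η : (O.obj v).dual (n + 1)),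
    (∀ p, (η : Module.Dual k (O.obj v)) p = (ξ : Module.Dual k (O.obj v)) (O.d v p)) →
    ∀ T : ∀ f : Σ X : F.C.Word, {f : X ⟶ single v // F.δ.degree f = 1},
      O.Codecomposition f.2.1 f.2.2 (ξ : Module.Dual k (O.obj v)),
    D.d v (gen v n ξ) = -((-1 : ℤˣ) ^ n • (gen v (n + 1) η +
      ∑ᶠ f : Σ X : F.C.Word, {f : X ⟶ single v // F.δ.degree f = 1},
        (F.autWeight f.1 : k)⁻¹ • O.cobarTerm D.toGradedOp gen f.2.1 f.2.2 (T f)))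

variable (k F ε) in
/-- The Feynman transform as a contravariant functor: `D⁺` for `ε = even`, `D⁻` for `ε = odd`. On
morphisms it is given by transposition of generators. -/
structure FeynmanTransform where
  functor : (DualizableOp k F ε)ᵒᵖ ⥤ DGOp k F ε.flip
  gen : ∀ O : DualizableOp k F ε, O.obj.DualMap (functor.obj (Opposite.op O)).toGradedOp
  isFeynmanTransform : ∀ O : DualizableOp k F ε,
    IsFeynmanTransform O.obj (functor.obj (Opposite.op O)) (gen O)
  map_gen : ∀ {O O' : DualizableOp k F ε} (h : O ⟶ O') (v : F.C.V) (n : ℤ)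
    (ξ : (O'.obj.obj v).dual n) (η : (O.obj.obj v).dual n),
    (∀ p, (η : Module.Dual k (O.obj.obj v)) p =
      (ξ : Module.Dual k (O'.obj.obj v)) (h.hom.app v p)) →
    (functor.map h.op).app v (gen O' v n ξ) = gen O v n η

namespace CubicalMorphism

variable {F₁ F₂ : CubicalFeynmanCategory.{u}} (φ : CubicalMorphism F₁ F₂)

/-- The functor on words, on morphisms to a vertex. -/
def mapSingle {X : F₁.C.Word} {w : F₁.C.V} (g : X ⟶ single w) :
    φ.functor.obj X ⟶ single (φ.onV w) :=
  φ.functor.map g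

/-- The group homomorphism from `Aut w` to `Aut (φ w)`. -/
def mapAut {w : F₁.C.V} (l : Aut (single w)) : Aut (single (φ.onV w)) :=
  φ.functor.mapIso l

/-- Pairs of a vertex `w` over `v` and an automorphism of `v` (as `φ(w) = v`, by skeletality). -/
def Lift (v : F₂.C.V) : Type u :=
  Σ w : F₁.C.V, (single (φ.onV w) ≅ single v)

open Classical in
/-- The relations `[P(l)(p) ⊗ σ] = [p ⊗ σ φ(l)]` in the direct sum of the `P(w) ⊗ k[Aut v]`. -/
def balancing (P : DGOp k F₁ ε) (v : F₂.C.V) :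
    Submodule k (DirectSum (φ.Lift v) fun t => P.obj t.1) :=
  Submodule.span k {x | ∃ (w : F₁.C.V) (σ : single (φ.onV w) ≅ single v) (l : Aut (single w))
    (p : P.obj w),
      x = DirectSum.of (fun t : φ.Lift v => P.obj t.1) ⟨w, σ⟩ (P.evIso l p) -
        DirectSum.of (fun t : φ.Lift v => P.obj t.1) ⟨w, φ.mapAut l ≪≫ σ⟩ p}

open Classical in
/-- The map from the direct sum of the `P(w) ⊗ k[Aut v]` over the vertices `w` over `v` that sends
`p ⊗ σ` to `Q(σ)(inc p)`. -/
noncomputable def summands (P : DGOp k F₁ ε) (Q : DGOp k F₂ ε)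
    (inc : ∀ w, P.obj w →ₗ[k] Q.obj (φ.onV w)) (v : F₂.C.V) :
    (DirectSum (φ.Lift v) fun t => P.obj t.1) →ₗ[k] Q.obj v :=
  DirectSum.toModule k (φ.Lift v) (Q.obj v) fun t => Q.evIso t.2 ∘ₗ inc t.1

end CubicalMorphism

variable (k ε) in
/-- The exceptional push-forward `L^!`. Its value at `v` is the direct sum, over the vertices `w`
over `v`, of the coinvariants of `P(w) ⊗ k[Aut v]` under `Aut w`; `inc p` is the class of
`p ⊗ 1`. A generating morphism `f` sends the tensor product of the `[pᵢ ⊗ 1]` to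
`[P(g)(⊗ pᵢ) ⊗ σ]` if `f = σ ∘ φ(g)` for some `g` and `σ`, and to zero otherwise. On all other
elements it is determined by equivariance. -/
structure ExceptionalPush {F₁ F₂ : CubicalFeynmanCategory.{u}} (φ : CubicalMorphism F₁ F₂) where
  functor : DGOp k F₁ ε ⥤ DGOp k F₂ ε
  inc : ∀ (P : DGOp k F₁ ε) (w : F₁.C.V), P.obj w →ₗ[k] (functor.obj P).obj (φ.onV w)
  inc_mem : ∀ P w n, ∀ p ∈ (P.obj w).gr n, inc P w p ∈ ((functor.obj P).obj (φ.onV w)).gr n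
  inc_d : ∀ P w p, inc P w (P.d w p) = (functor.obj P).d (φ.onV w) (inc P w p)
  map_inc : ∀ {P P' : DGOp k F₁ ε} (h : P ⟶ P') (w : F₁.C.V) (p : P.obj w),
    (functor.map h).app (φ.onV w) (inc P w p) = inc P' w (h.app w p)
  surjective : ∀ P v, Function.Surjective (φ.summands P (functor.obj P) (inc P) v)
  ker_eq : ∀ P v, LinearMap.ker (φ.summands P (functor.obj P) (inc P) v) = φ.balancing P v
  ev_lift : ∀ (P : DGOp k F₁ ε) {X : F₁.C.Word} {v : F₂.C.V} (f : φ.functor.obj X ⟶ single v)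
    (hf : F₂.δ.degree f ≤ 1) {w : F₁.C.V} (g : X ⟶ single w) (hg : F₁.δ.degree g ≤ 1)
    (σ : single (φ.onV w) ≅ single v), f = φ.mapSingle g ≫ σ.hom →
    ∀ p : ∀ i, P.obj (X.x i),
      (functor.obj P).ev f hf (fun i => inc P (X.x i) (p i)) =
        (functor.obj P).evIso σ (inc P w (P.ev g hg p))
  ev_eq_zero : ∀ (P : DGOp k F₁ ε) {X : F₁.C.Word} {v : F₂.C.V} (f : φ.functor.obj X ⟶ single v)
    (hf : F₂.δ.degree f ≤ 1),
    (¬∃ (w : F₁.C.V) (g : X ⟶ single w) (σ : single (φ.onV w) ≅ single v),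
      f = φ.mapSingle g ≫ σ.hom) →
    ∀ p : ∀ i, P.obj (X.x i), (functor.obj P).ev f hf (fun i => inc P (X.x i) (p i)) = 0

open Finset (sum_eq_zero sum_congr smul_sum mem_univ prod_congr sum_comm sum_add_distrib mul_sum sum_smul
  sum_neg_distrib sum_eq_single sum_ite_eq sum_eq_zero_iff add_sum_erase sum_filter)
open Function (update update_of_ne update_self Bijective)
open Fintype (ofFinite)
open Equiv (subtypeUnivEquiv sigmaFiberEquiv)
open Module (Dual)
open PreGradedOp (push pushChain)

/-- The morphisms of degree one to a vertex. -/
abbrev CubicalFeynmanCategory.DegOne (F : CubicalFeynmanCategory.{u}) (v : F.C.V) :=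
  Σ X : F.C.Word, {f : X ⟶ single v // F.δ.degree f = 1}

theorem DegreeFunction.degree_iso_le {C : ColoredOperad.{u}} (δ : DegreeFunction C) {X Y : C.Word}
    (e : X ≅ Y) : δ.degree e.hom ≤ 1 :=
  (δ.degree_iso e).trans_le (Nat.zero_le 1)

namespace ColoredOperad

variable {C : ColoredOperad.{u}}

/-! ### Relabelling and substitution -/

theorem map_bijective {I J : Type} [Finite I] [Finite J] (e : I ≃ J) {x : J → C.V} {v : C.V} :
    Bijective (fun f : C.Hom x v => C.map e f) := by
  constructor
  · intro f f' h
    have h1 : ∀ a : C.Hom x v, HEq (C.map e.symm (C.map e a)) a := fun a => by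
      rw [C.map_map]
      exact map_heq_self _ (fun j => by simp) a
    exact eq_of_heq ((h1 f).symm.trans ((heq_of_eq (congrArg (C.map e.symm) h)).trans (h1 f')))
  · intro f
    obtain ⟨x', rfl⟩ : ∃ x' : I → C.V, x = fun j => x' (e.symm j) := ⟨fun i => x (e i), by simp⟩
    have hx : (fun i => x' (e.symm (e i))) = x' := by simp
    refine ⟨C.map e.symm (cast (by rw [hx]) f), eq_of_heq ?_⟩
    change HEq (C.map e (C.map e.symm _)) f
    rw [C.map_map]
    exact (map_heq_self _ (fun j => by simp) _).trans (cast_heq _ _)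

theorem map_injective {I J : Type} [Finite I] [Finite J] (e : I ≃ J) {x : J → C.V} {v : C.V}
    {f f' : C.Hom x v} (h : C.map e f = C.map e f') : f = f' :=
  (map_bijective e).1 h

/-- The relabelling of the fibres of a map of index sets. -/
def fiberReindex {I I' J J' : Type} {π : I → J} {π' : I' → J'} (ρ : I' ≃ I) (e : J' ≃ J)
    (h : ∀ i', e (π' i') = π (ρ i')) (j' : J') : {i' // π' i' = j'} ≃ {i // π i = e j'} :=
  ρ.subtypeEquiv fun i' => by rw [← h, e.apply_eq_iff_eq]

theorem subst_reindex {I I' J J' : Type} [Finite I] [Finite I'] [Finite J] [Finite J']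
    {x : I → C.V} {y : J → C.V} {v : C.V} (f : C.Hom y v) (π : I → J)
    (g : ∀ j, C.Hom (fun i : {i // π i = j} => x i) (y j)) (ρ : I' ≃ I) (e : J' ≃ J) (π' : I' → J')
    (h : ∀ i', e (π' i') = π (ρ i')) :
    C.map ρ (subst f π g) =
      subst (x := fun i' => x (ρ i')) (C.map e f) π'
        (fun j' => C.map (fiberReindex ρ e h j') (g (e j'))) := by
  have h1 := map_comp_map (x := fun j' (i : {i // π i = e j'}) => x i)
    (sigmaFiberEquiv π').symm (C.map e f) (fiberReindex ρ e h) (fun j' => g (e j'))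
  have h2 := C.comp_map_left (x := fun j (i : {i // π i = j}) => x i) e f g
  have h3 : subst (x := fun i' => x (ρ i')) (C.map e f) π' (fun j' => C.map (fiberReindex ρ e h j') (g (e j'))) = _ :=
    h1.trans ((congrArg (C.map _) h2).trans
      (C.map_map (x := fun s : Σ j, {i // π i = j} => x s.2) _ _ _))
  have h4 : C.map ρ (subst f π g) = _ :=
    C.map_map (x := fun s : Σ j, {i // π i = j} => x s.2) ρ (sigmaFiberEquiv π).symm
      (C.comp f g)
  refine eq_of_heq ((heq_of_eq h4).trans (HEq.trans (map_congr ?_ _) (heq_of_eq h3.symm)))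
  intro i'
  refine Sigma.ext (h i').symm ?_
  refine (Subtype.heq_iff_coe_eq ?_).2 rfl
  intro s
  change π s = π (ρ i') ↔ π s = e (π' i')
  rw [h]

theorem subst_subst {I J K : Type} [Finite I] [Finite J] [Finite K] {x : I → C.V} {y : J → C.V}
    {z : K → C.V} {v : C.V} (f : C.Hom z v) (n : J → K)
    (h : ∀ k, C.Hom (fun j : {j // n j = k} => y j) (z k)) (m : I → J)
    (g : ∀ j, C.Hom (fun i : {i // m i = j} => x i) (y j)) :
    subst (subst f n h) m g = subst f (fun i => n (m i)) (fun k =>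
      subst (h k) (fun i : {i // n (m i) = k} => (⟨m i, i.2⟩ : {j // n j = k}))
        (fun j => C.map (fiberEquiv m n k j) (g j))) := by
  have hL : ∀ k, subst (x := fun i : {i // n (m i) = k} => x i) (h k)
      (fun i : {i // n (m i) = k} => (⟨m i, i.2⟩ : {j // n j = k}))
        (fun j => C.map (fiberEquiv m n k j) (g j)) =
      C.map ((sigmaFiberEquiv
        (fun i : {i // n (m i) = k} => (⟨m i, i.2⟩ : {j // n j = k}))).symm.trans
        (Equiv.sigmaCongrRight fun j => fiberEquiv m n k j))
        (C.comp (h k) (fun j => g j.1)) := fun k =>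
    map_comp_map (x := fun j i => x i.1) _ (h k) (fun j => fiberEquiv m n k j) (fun j => g j.1)
  have hL2 := map_comp_map (I := fun k : K => Σ j : {j // n j = k}, {i // m i = j.1})
    (x := fun k s => x s.2.1) (sigmaFiberEquiv (fun i => n (m i))).symm f
    (fun k => (sigmaFiberEquiv
        (fun i : {i // n (m i) = k} => (⟨m i, i.2⟩ : {j // n j = k}))).symm.trans
        (Equiv.sigmaCongrRight fun j => fiberEquiv m n k j))
    (fun k => C.comp (h k) (fun j : {j // n j = k} => g j.1))
  have hL3 := (congrArg (subst f (fun i => n (m i))) (funext hL)).trans hL2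
  have hR := C.comp_map_left (I := fun s : Σ k, {j // n j = k} => {i // m i = s.2.1})
    (x := fun s i => x i.1) (sigmaFiberEquiv n).symm (C.comp f h) (fun s => g s.2.1)
  have hA := C.comp_comp f h (fun k (j : {j // n j = k}) => g j.1)
  have hR4 := (congrArg (C.map (sigmaFiberEquiv m).symm) (hR.trans (congrArg (C.map (x := fun s : Σ s : Σ k : K,
    {j // n j = k}, {i // m i = s.2.1} => x s.2.1) (Equiv.sigmaCongrLeft _)) hA))).trans
    ((congrArg (C.map _) (C.map_map (x := fun s : Σ k : K, Σ j : {j // n j = k},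
      {i // m i = j.1} => x s.2.2.1) _ _ _)).trans (C.map_map (x := fun s : Σ k : K, Σ j : {j // n j = k},
      {i // m i = j.1} => x s.2.2.1) _ _ _))
  have hR5 : subst (subst f n h) m g = _ := hR4
  refine eq_of_heq ((heq_of_eq hR5).trans (HEq.trans (map_congr ?_ _) (heq_of_eq hL3.symm)))
  exact fun _ => rfl

/-! ### Unary operations -/

/-- A unary operation on the letter `x i`, with its input labelled by `{s // s = i}`. -/
noncomputable def unaryAt {I : Type} [Finite I] {x : I → C.V} {v : C.V} (i : I)
    (a : C.Hom (fun _ : Unit => x i) v) : C.Hom (fun s : {s // s = i} => x s) v :=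
  ((map_bijective (x := fun s : {s // s = i} => x s) (fiberId i).symm).2 a).choose

theorem map_unaryAt {I : Type} [Finite I] {x : I → C.V} {v : C.V} (i : I)
    (a : C.Hom (fun _ : Unit => x i) v) : C.map (fiberId i).symm (unaryAt (x := x) i a) = a :=
  ((map_bijective (x := fun s : {s // s = i} => x s) (fiberId i).symm).2 a).choose_spec

theorem eq_unaryAt_iff {I : Type} [Finite I] {x : I → C.V} {v : C.V} (i : I)
    (a : C.Hom (fun _ : Unit => x i) v) (b : C.Hom (fun s : {s // s = i} => x s) v) :
    b = unaryAt i a ↔ C.map (fiberId i).symm b = a := by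
  constructor
  · rintro rfl; exact map_unaryAt i a
  · intro h
    refine map_injective (x := fun s : {s // s = i} => x s) (fiberId i).symm ?_
    rw [h]; exact (map_unaryAt (x := x) i a).symm

/-- Precomposition of an operation with unary operations. -/
noncomputable def pre {I : Type} [Finite I] {x' x : I → C.V} {v : C.V}
    (a : ∀ i, C.Hom (fun _ : Unit => x' i) (x i)) (f : C.Hom x v) : C.Hom x' v :=
  subst f (fun i => i) (fun i => unaryAt i (a i))

/-- Postcomposition of an operation with a unary operation. -/
def post {I : Type} [Finite I] {x : I → C.V} {v w : C.V} (f : C.Hom x v)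
    (a : C.Hom (fun _ : Unit => v) w) : C.Hom x w :=
  subst a (fun _ => ()) (fun _ => C.map (subtypeUnivEquiv fun _ => rfl) f)

theorem post_subst {I J : Type} [Finite I] [Finite J] {x : I → C.V} {y : J → C.V} {v w : C.V}
    (f : C.Hom y v) (π : I → J) (g : ∀ j, C.Hom (fun i : {i // π i = j} => x i) (y j))
    (a : C.Hom (fun _ : Unit => v) w) : post (subst f π g) a = subst (post f a) π g := by
  refine Eq.trans ?_ (subst_subst a (fun _ => ()) _ π g).symm
  refine congrArg (subst (x := x) a fun _ => ()) (funext fun j => ?_)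
  exact subst_reindex (x := x) f π g (subtypeUnivEquiv fun _ => rfl)
    (subtypeUnivEquiv fun _ => rfl) _ (fun _ => rfl)

theorem map_post {I J : Type} [Finite I] [Finite J] (e : I ≃ J) {x : J → C.V} {v w : C.V}
    (f : C.Hom x v) (a : C.Hom (fun _ : Unit => v) w) :
    C.map e (post f a) = post (C.map e f) a := by
  refine (subst_reindex (x := x) a _ _ e (Equiv.refl Unit) (fun _ => ()) (fun _ => rfl)).trans ?_
  refine (congrArg (fun b => subst (x := fun i => x (e i)) b _ _) (C.map_refl a)).trans ?_
  refine congrArg (subst (x := fun i => x (e i)) a fun _ => ()) (funext fun j => ?_)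
  exact (C.map_map (x := x) _ _ _).trans (C.map_map (x := x) (subtypeUnivEquiv fun _ => rfl) e f).symm

theorem subst_pre {I J : Type} [Finite I] [Finite J] {x : I → C.V} {y y' : J → C.V} {v : C.V}
    (a : ∀ j, C.Hom (fun _ : Unit => y j) (y' j)) (f : C.Hom y' v) (π : I → J)
    (g : ∀ j, C.Hom (fun i : {i // π i = j} => x i) (y j)) :
    subst (pre a f) π g = subst f π (fun j => post (g j) (a j)) := by
  unfold pre
  rw [subst_subst]
  congr 1
  funext j
  have h := subst_reindex (I := {i // π i = j}) (x := fun i => x i.1) (unaryAt (x := y) j (a j))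
    (fun i : {i // π i = j} => (⟨π i, i.2⟩ : {s // s = j}))
    (fun s => C.map (fiberEquiv π (fun i => i) j s) (g s)) (Equiv.refl _)
    (fiberId j).symm (fun _ => ()) (fun i => Subtype.ext i.2.symm)
  rw [map_unaryAt] at h
  refine ((C.map_refl (I := {i // π i = j}) _).symm.trans h).trans ?_
  unfold post
  congr 1
  funext s
  exact C.map_map (K := {i // π i = j}) (x := fun i => x i.1) _ _ _

theorem map_fiberEquiv_unaryAt {I J : Type} [Finite I] [Finite J] {x : I → C.V} (π : I → J) (j : J)
    (i : {i // π i = j}) {v : C.V} (a : C.Hom (fun _ : Unit => x i) v) :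
    C.map (fiberEquiv (fun i => i) π j i) (unaryAt (x := x) i.1 a) =
      unaryAt (x := fun i : {i // π i = j} => x i) i a := by
  refine (eq_unaryAt_iff (x := fun i : {i // π i = j} => x i) i a _).2 ?_
  exact (C.map_map (x := fun s : {s // s = i.1} => x s.1) _ _ _).trans (map_unaryAt (x := x) i.1 a)

theorem pre_subst {I J : Type} [Finite I] [Finite J] {x' x : I → C.V} {y : J → C.V} {v : C.V}
    (a : ∀ i, C.Hom (fun _ : Unit => x' i) (x i)) (f : C.Hom y v) (π : I → J)
    (g : ∀ j, C.Hom (fun i : {i // π i = j} => x i) (y j)) :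
    pre a (subst f π g) = subst f π (fun j => pre (fun i => a i.1) (g j)) := by
  refine (subst_subst f π g (fun i => i) _).trans ?_
  congr 1
  funext j
  unfold pre
  congr 1
  funext i
  exact map_fiberEquiv_unaryAt (x := x') π j i (a i)

theorem pre_post {I : Type} [Finite I] {x' x : I → C.V} {v w : C.V}
    (a : ∀ i, C.Hom (fun _ : Unit => x' i) (x i)) (f : C.Hom x v)
    (b : C.Hom (fun _ : Unit => v) w) : pre a (post f b) = post (pre a f) b :=
  (post_subst f _ _ b).symm

theorem post_post {I : Type} [Finite I] {x : I → C.V} {v w z : C.V} (f : C.Hom x v)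
    (a : C.Hom (fun _ : Unit => v) w) (b : C.Hom (fun _ : Unit => w) z) :
    post (post f a) b = post f (post a b) :=
  post_subst a _ _ b

theorem post_unaryAt {I : Type} [Finite I] {x : I → C.V} {v w : C.V} (i : I)
    (a : C.Hom (fun _ : Unit => x i) v) (b : C.Hom (fun _ : Unit => v) w) :
    post (unaryAt (x := x) i a) b = unaryAt i (post a b) := by
  rw [eq_unaryAt_iff]
  exact (map_post (fiberId i).symm (unaryAt (x := x) i a) b).trans
    (congrArg (fun c => post c b) (map_unaryAt (x := x) i a))

theorem pre_pre {I : Type} [Finite I] {x'' x' x : I → C.V} {v : C.V}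
    (a : ∀ i, C.Hom (fun _ : Unit => x'' i) (x' i)) (b : ∀ i, C.Hom (fun _ : Unit => x' i) (x i))
    (f : C.Hom x v) : pre a (pre b f) = pre (fun i => post (a i) (b i)) f := by
  refine (subst_pre b f _ _).trans ?_
  unfold pre
  congr 1
  funext i
  exact post_unaryAt i (a i) (b i)

theorem map_pre {I J : Type} [Finite I] [Finite J] (e : I ≃ J) {x' x : J → C.V} {v : C.V}
    (a : ∀ j, C.Hom (fun _ : Unit => x' j) (x j)) (f : C.Hom x v) :
    C.map e (pre a f) = pre (fun i => a (e i)) (C.map e f) := by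
  refine (subst_reindex (x := x') f _ _ e e (fun i => i) (fun _ => rfl)).trans ?_
  refine congrArg (subst (x := fun i => x' (e i)) (C.map e f) fun i => i) (funext fun i => ?_)
  refine (eq_unaryAt_iff (x := fun i => x' (e i)) i _ _).2 ?_
  exact (C.map_map (x := fun s : {s // s = e i} => x' s.1) _ _ _).trans
    (map_unaryAt (x := x') (e i) (a (e i)))

theorem unaryAt_one {I : Type} [Finite I] {x : I → C.V} (i : I) : unaryAt (x := x) i (C.one (x i)) =
      oneOf (fiberId i) (fun s => x s.1) (x i) (fun s => congrArg x s.2) := by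
  refine ((eq_unaryAt_iff (x := x) i _ _).2 ?_).symm
  refine (map_oneOf _ _ _ _ _).trans ?_
  exact C.map_refl (C.one (x i))

theorem pre_one {I : Type} [Finite I] {x : I → C.V} {v : C.V} (f : C.Hom x v) :
    pre (fun i => C.one (x i)) f = f := by
  have h := subst_oneOf_right (Equiv.refl I) (x := x) (y := x) f (fun _ => rfl)
    (fun j => fiberId j)
  refine Eq.trans ?_ (eq_of_heq (h.trans (heq_of_eq (C.map_refl f))))
  unfold pre
  congr 1
  funext i
  exact unaryAt_one i

theorem post_one {I : Type} [Finite I] {x : I → C.V} {v : C.V} (f : C.Hom x v) :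
    post f (C.one v) = f := by
  have h := C.one_comp f
  have h1 := map_comp_map (x := fun (_ : Unit) i => x i)
    (sigmaFiberEquiv (fun _ : I => ())).symm (C.one v)
    (fun _ => subtypeUnivEquiv fun _ => rfl) (fun _ => f)
  have h2 : post f (C.one v) = _ := h1.trans ((congrArg (C.map _) h).trans
    (C.map_map (x := x) _ _ _))
  rw [h2]
  exact eq_of_heq (map_heq_self _ (fun _ => rfl) f)

theorem one_post {v w : C.V} (a : C.Hom (fun _ : Unit => v) w) : post (C.one v) a = a := by
  refine Eq.trans ?_ (pre_one a)
  refine congrArg (subst (x := fun _ : Unit => v) a fun _ => ()) (funext fun _ => ?_)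
  refine (eq_unaryAt_iff (x := fun _ : Unit => v) _ _ _).2 ?_
  refine (C.map_map (x := fun _ : Unit => v) _ _ _).trans ?_
  exact C.map_refl (C.one v)

/-! ### Morphisms of words to a vertex as operations -/

/-- The operation given by a morphism of words to a vertex. -/
def toOp {X : C.Word} {v : C.V} (f : X ⟶ single v) : C.Hom X.x v :=
  C.map (subtypeUnivEquiv fun _ => Subsingleton.elim (α := Fin 1) _ _).symm
    (WordHom.g f (0 : Fin 1))

/-- The morphism of words to a vertex given by an operation. -/
def ofOp {X : C.Word} {v : C.V} (f : C.Hom X.x v) : X ⟶ single v :=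
  WordHom.mk (fun _ => (0 : Fin 1)) (fun j : Fin 1 => C.map (J := Fin X.n)
    (subtypeUnivEquiv fun _ => Subsingleton.elim (α := Fin 1) _ _) f)

theorem toOp_ofOp {X : C.Word} {v : C.V} (f : C.Hom X.x v) : toOp (ofOp f) = f :=
  (C.map_map (x := X.x) _ _ _).trans (C.map_refl f)

theorem wordHom_single_ext {X : C.Word} {v : C.V} {f f' : X ⟶ single v}
    (h : toOp f = toOp f') : f = f' := by
  obtain ⟨π, g⟩ := f
  obtain ⟨π', g'⟩ := f'
  obtain rfl : π = π' := funext fun _ => Subsingleton.elim (α := Fin 1) _ _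
  congr 1
  funext j
  obtain rfl : j = (0 : Fin 1) := Subsingleton.elim (α := Fin 1) _ _
  exact map_injective _ h

theorem ofOp_toOp {X : C.Word} {v : C.V} (f : X ⟶ single v) : ofOp (toOp f) = f :=
  wordHom_single_ext (toOp_ofOp _)

theorem toOp_comp {X Y : C.Word} {v : C.V} (m : X ⟶ Y) (f : Y ⟶ single v) :
    toOp (m ≫ f) = subst (toOp f) (WordHom.π m) (WordHom.g m) := by
  unfold toOp
  refine (subst_reindex (x := fun i : {i // WordHom.π f (WordHom.π m i) = (0 : Fin 1)} => X.x i.1)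
    (WordHom.g f (0 : Fin 1)) _ _ _ (subtypeUnivEquiv fun _ =>
      Subsingleton.elim (α := Fin 1) _ _).symm (WordHom.π m) (fun _ => rfl)).trans ?_
  congr 1
  funext j
  refine (C.map_map (x := fun i : {i // WordHom.π m i = j} => X.x i.1) _ _ _).trans ?_
  exact C.map_refl (WordHom.g m j)

/-- The unary operation given by a morphism between vertices. -/
def uop {v w : C.V} (m : single v ⟶ single w) : C.Hom (fun _ : Unit => v) w :=
  C.map (J := Fin 1) (Equiv.ofUnique Unit (Fin 1)) (toOp m)

theorem toOp_comp_uop {X : C.Word} {v w : C.V} (f : X ⟶ single v) (m : single v ⟶ single w) :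
    toOp (f ≫ m) = post (toOp f) (uop m) := by
  refine (toOp_comp f m).trans ((C.map_refl (I := Fin X.n) _).symm.trans ((subst_reindex
    (I := Fin X.n) (J := Fin 1) (J' := Unit) (x := X.x) (y := fun _ => v) (toOp m) _ (WordHom.g f)
    (Equiv.refl (Fin X.n)) (Equiv.ofUnique Unit (Fin 1)) (fun _ => ())
    (fun _ => Subsingleton.elim (α := Fin 1) _ _)).trans ?_))
  refine congrArg (subst (x := X.x) (uop m) fun _ => ()) (funext fun j => ?_)
  exact (C.map_map (I := {i : Fin X.n // () = j}) (J := Fin X.n)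
    (x := fun i : {i // WordHom.π f i = (0 : Fin 1)} => X.x i.1)
    (subtypeUnivEquiv fun _ => rfl) (subtypeUnivEquiv fun _ =>
      Subsingleton.elim (α := Fin 1) _ _).symm (WordHom.g f (0 : Fin 1))).symm

theorem uop_comp {v w z : C.V} (m : single v ⟶ single w) (n : single w ⟶ single z) :
    uop (m ≫ n) = post (uop m) (uop n) := by
  unfold uop
  rw [toOp_comp_uop]
  exact map_post _ _ _

theorem uop_id (v : C.V) : uop (𝟙 (single v)) = C.one v := by
  have h : (WordHom.g (𝟙 (single v)) (0 : Fin 1)) =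
    oneOf (fiberId (0 : Fin 1)) (fun _ => v) v (fun _ => rfl) := rfl
  unfold uop toOp
  rw [h]
  refine (C.map_map (x := fun _ => v) _ _ _).trans ?_
  refine (map_oneOf _ _ _ _ _).trans ?_
  exact C.map_refl (C.one v)

theorem uop_injective {v w : C.V} {m n : single v ⟶ single w} (h : uop m = uop n) : m = n :=
  wordHom_single_ext (map_injective _ h)

theorem uop_surjective {v w : C.V} (a : C.Hom (fun _ : Unit => v) w) :
    ∃ m : single v ⟶ single w, uop m = a := by
  obtain ⟨b, hb⟩ := (map_bijective (x := fun _ : Fin 1 => v) (Equiv.ofUnique Unit (Fin 1))).2 a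
  refine ⟨ofOp (X := single v) b, ?_⟩
  exact (congrArg (C.map (J := Fin 1) (Equiv.ofUnique Unit (Fin 1)))
    (toOp_ofOp (X := single v) b)).trans hb

/-- The morphism of words of the same length given by unary operations on the letters. -/
noncomputable def letters {n : ℕ} {x' x : Fin n → C.V}
    (a : ∀ i, C.Hom (fun _ : Unit => x' i) (x i)) : (⟨n, x'⟩ : C.Word) ⟶ ⟨n, x⟩ :=
  WordHom.mk (fun i => i) (fun i => unaryAt i (a i))

theorem comp_letters_g {X : C.Word} {n : ℕ} {x' x : Fin n → C.V} (m : X ⟶ ⟨n, x'⟩)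
    (a : ∀ i, C.Hom (fun _ : Unit => x' i) (x i)) (j : Fin n) :
    WordHom.g (m ≫ letters a) j = post (I := {i // WordHom.π m i = j}) (v := x' j) (w := x j) (WordHom.g m j) (a j) := by
  change subst (x := fun i : {i // WordHom.π m i = j} => X.x i.1) (unaryAt (x := x') j (a j)) (fun i : {i // WordHom.π m i = j} => (⟨WordHom.π m i, i.2⟩ : {s // s = j}))
    (fun s => C.map (fiberEquiv (WordHom.π m) (fun i => i) j s) (WordHom.g m s)) = _
  have h := subst_reindex (I := {i // WordHom.π m i = j}) (x := fun i => X.x i.1)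
    (unaryAt (x := x') j (a j))
    (fun i : {i // WordHom.π m i = j} => (⟨WordHom.π m i, i.2⟩ : {s // s = j}))
    (fun s => C.map (fiberEquiv (WordHom.π m) (fun i => i) j s) (WordHom.g m s)) (Equiv.refl _)
    (fiberId j).symm (fun _ => ()) (fun i => Subtype.ext i.2.symm)
  rw [map_unaryAt] at h
  refine ((C.map_refl (I := {i // WordHom.π m i = j}) _).symm.trans h).trans ?_
  unfold post
  congr 1
  funext s
  exact C.map_map (K := {i // WordHom.π m i = j}) (x := fun i => X.x i.1) _ _ _

theorem comp_letters {X : C.Word} {n : ℕ} {x' x : Fin n → C.V} (m : X ⟶ ⟨n, x'⟩)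
    (a : ∀ i, C.Hom (fun _ : Unit => x' i) (x i)) :
    m ≫ letters a = WordHom.mk (X := X) (Y := ⟨n, x⟩) (WordHom.π (Y := ⟨n, x'⟩) m) (fun j : Fin n =>
      post (I := {i // WordHom.π (Y := ⟨n, x'⟩) m i = j}) (v := x' j) (w := x j)
        (WordHom.g (Y := ⟨n, x'⟩) m j) (a j)) :=
  WordHom.ext (X := X) (Y := ⟨n, x⟩) rfl
    (heq_of_eq (funext fun j : Fin n => comp_letters_g (x := x) m a j))

end ColoredOperad

/-! ### Graded vector spaces -/

theorem fiber_update {I J : Type*} {A : I → Type*} {B : J → Type*} [DecidableEq I] [DecidableEq J] (π : I → J)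
    (L : ∀ j, (∀ i : {i // π i = j}, A i) → B j) (p : ∀ i, A i) (i : I) (a : A i) :
    (fun j => L j (fun s : {s // π s = j} => update p i a s)) =
      update (fun j => L j (fun s : {s // π s = j} => p s)) (π i)
        (L (π i) (update (fun s : {s // π s = π i} => p s) ⟨i, rfl⟩ a)) := by
  funext j
  by_cases hj : j = π i
  · subst hj
    rw [update_self]
    congr 1
    funext s
    by_cases hs : s = ⟨i, rfl⟩
    · subst hs; simp
    · rw [update_of_ne hs, update_of_ne fun h => hs (Subtype.ext h)]
  · rw [update_of_ne hj]
    congr 1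
    funext s
    rw [update_of_ne]
    rintro rfl
    exact hj s.2.symm

section Multilinear

variable {R : Type*} [CommSemiring R] {I J : Type*} {A : I → Type*} {B : J → Type*} {N : Type*}
  [∀ i, AddCommMonoid (A i)] [∀ i, Module R (A i)] [∀ j, AddCommMonoid (B j)]
  [∀ j, Module R (B j)] [AddCommMonoid N] [Module R N]

/-- Composition of a multilinear map with multilinear maps on the fibres of a map of index sets. -/
def MultilinearMap.compFibers (M : MultilinearMap R B N) (π : I → J)
    (L : ∀ j, MultilinearMap R (fun i : {i // π i = j} => A i) (B j)) : MultilinearMap R A N where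
  toFun p := M fun j => L j fun i => p i
  map_update_add' p i a b := by
    classical
    have h := fiber_update π (fun j => L j) p i
    rename_i inst
    obtain rfl : inst = fun a b => Classical.propDecidable (a = b) := Subsingleton.elim _ _
    rw [h, h, h, (L _).map_update_add, M.map_update_add]
  map_update_smul' p i r b := by
    classical
    have h := fiber_update π (fun j => L j) p i
    rename_i inst
    obtain rfl : inst = fun a b => Classical.propDecidable (a = b) := Subsingleton.elim _ _
    rw [h, h, (L _).map_update_smul, M.map_update_smul]

end Multilinear

namespace GrVect

variable (M : GrVect k)

noncomputable def decomp : M ≃ₗ[k] DirectSum ℤ fun n => M.gr n :=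
  (LinearEquiv.ofBijective (DirectSum.coeLinearMap M.gr) M.isInternal).symm

/-- The projection to the homogeneous part of degree `n`. -/
noncomputable def proj (n : ℤ) : M →ₗ[k] M :=
  (M.gr n).subtype ∘ₗ DirectSum.component k ℤ (fun n => M.gr n) n ∘ₗ M.decomp.toLinearMap

variable {M}

theorem proj_mem (n : ℤ) (x : M) : M.proj n x ∈ M.gr n := Subtype.property _

theorem decomp_of_mem {n : ℤ} {x : M} (hx : x ∈ M.gr n) :
    M.decomp x = DirectSum.lof k ℤ (fun n => M.gr n) n ⟨x, hx⟩ := by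
  unfold decomp
  rw [LinearEquiv.symm_apply_eq]
  exact (DirectSum.coeLinearMap_lof M.gr n ⟨x, hx⟩).symm

theorem proj_of_mem {n : ℤ} {x : M} (hx : x ∈ M.gr n) : M.proj n x = x := by
  simp [proj, decomp_of_mem hx]

theorem proj_of_mem_ne {m n : ℤ} (h : m ≠ n) {x : M} (hx : x ∈ M.gr m) : M.proj n x = 0 := by
  simp [proj, decomp_of_mem hx, DirectSum.component.of, h]

theorem exists_sum_proj (x : M) : ∃ s : Finset ℤ, ∀ t, s ⊆ t → ∑ n ∈ t, M.proj n x = x := by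
  classical
  refine ⟨DFinsupp.support (M.decomp x), fun t ht => ?_⟩
  have h1 : x = DirectSum.coeLinearMap M.gr (M.decomp x) :=
    ((LinearEquiv.ofBijective (DirectSum.coeLinearMap M.gr) M.isInternal).apply_symm_apply x).symm
  have h2 : ∑ n ∈ t, M.proj n x = ∑ n ∈ DFinsupp.support (M.decomp x), M.proj n x := by
    refine (Finset.sum_subset ht fun n _ hn => ?_).symm
    have : M.decomp x n = 0 := by simpa using hn
    change ((M.decomp x n : M.gr n) : M) = 0
    rw [this]; rfl
  rw [h2]
  conv_rhs => rw [h1, DirectSum.coeLinearMap_eq_dfinsuppSum]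
  rfl

theorem mem_of_proj_eq {n : ℤ} {x : M} (h : M.proj n x = x) : x ∈ M.gr n := h ▸ proj_mem n x

theorem map_proj {M N : GrVect k} (f : M →ₗ[k] N) {s : ℤ}
    (hf : ∀ n, ∀ x ∈ M.gr n, f x ∈ N.gr (n + s)) (n : ℤ) (x : M) :
    f (M.proj n x) = N.proj (n + s) (f x) := by
  obtain ⟨t, ht⟩ := exists_sum_proj x
  conv_rhs => rw [← ht (insert n t) (Finset.subset_insert n t), map_sum, map_sum]
  rw [sum_eq_single n]
  · exact (proj_of_mem (hf n _ (proj_mem n x))).symm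
  · exact fun m _ hm => proj_of_mem_ne (fun h => hm (by omega)) (hf m _ (proj_mem m x))
  · exact fun h => absurd (Finset.mem_insert_self n t) h

theorem map_proj₀ {M N : GrVect k} (f : M →ₗ[k] N)
    (hf : ∀ n, ∀ x ∈ M.gr n, f x ∈ N.gr n) (n : ℤ) (x : M) :
    f (M.proj n x) = N.proj n (f x) := by
  simpa using map_proj (s := 0) f (by simpa using hf) n x

theorem hom_ext {N : Type*} [AddCommGroup N] [Module k N] {f g : M →ₗ[k] N}
    (h : ∀ n, ∀ x ∈ M.gr n, f x = g x) : f = g := by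
  refine LinearMap.ext fun x => ?_
  obtain ⟨s, hs⟩ := exists_sum_proj x
  rw [← hs s subset_rfl, map_sum, map_sum]
  exact sum_congr rfl fun n _ => h n _ (proj_mem n x)

theorem multilinear_ext {I : Type*} [Finite I] {A : I → GrVect k} {N : Type*} [AddCommGroup N]
    [Module k N] {f g : MultilinearMap k (fun i => A i) N}
    (h : ∀ (n : I → ℤ) (p : ∀ i, A i), (∀ i, p i ∈ (A i).gr (n i)) → f p = g p) : f = g := by
  classical
  have := ofFinite I
  refine MultilinearMap.ext fun p => ?_
  choose s hs using fun i => exists_sum_proj (p i)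
  have hp : p = fun i => ∑ n ∈ s i, (A i).proj n (p i) := funext fun i => (hs i _ subset_rfl).symm
  rw [hp, MultilinearMap.map_sum_finset, MultilinearMap.map_sum_finset]
  exact sum_congr rfl fun r _ => h r _ fun i => proj_mem _ _

theorem isInternal_of_proj {M : Type*} [AddCommGroup M] [Module k M] {gr : ℤ → Submodule k M}
    (pr : ℤ → M →ₗ[k] M) (h1 : ∀ n x, pr n x ∈ gr n) (h2 : ∀ n, ∀ x ∈ gr n, pr n x = x)
    (h3 : ∀ m n, m ≠ n → ∀ x ∈ gr m, pr n x = 0)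
    (h4 : ∀ x, ∃ s : Finset ℤ, ∑ n ∈ s, pr n x = x) : DirectSum.IsInternal gr := by
  classical
  constructor
  · rw [injective_iff_map_eq_zero]
    intro a ha
    have h : ∀ n, pr n ∘ₗ DirectSum.coeLinearMap gr =
        (gr n).subtype ∘ₗ DirectSum.component k ℤ (fun n => gr n) n := by
      intro n
      refine DirectSum.linearMap_ext k fun m => LinearMap.ext fun x => ?_
      by_cases hmn : m = n
      · subst hmn
        simp [h2 m x x.2]
      · simp [h3 m n hmn x x.2, DirectSum.component.of, hmn]
    refine DFinsupp.ext fun n => Subtype.ext ?_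
    have := LinearMap.congr_fun (h n) a
    change pr n (DirectSum.coeAddMonoidHom gr a) = (a n : M) at this
    rw [← this, ha, map_zero]
    rfl
  · intro x
    obtain ⟨s, hs⟩ := h4 x
    refine ⟨∑ n ∈ s, DirectSum.lof k ℤ (fun n => gr n) n ⟨pr n x, h1 n x⟩, ?_⟩
    rw [map_sum, ← hs]
    refine sum_congr rfl fun n _ => ?_
    rw [hs]
    exact DirectSum.coeLinearMap_lof gr n ⟨pr n x, h1 n x⟩

theorem isInternal_of_separating {M : Type*} [AddCommGroup M] [Module k M]
    {gr : ℤ → Submodule k M} {S : Type*} {N : S → GrVect k} (f : ∀ s, M →ₗ[k] N s)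
    (hf : ∀ x, (∀ s, f s x = 0) → x = 0) (hgr : ∀ s n, ∀ x ∈ gr n, f s x ∈ (N s).gr n)
    (htop : ∀ x, x ∈ ⨆ n, gr n) : DirectSum.IsInternal gr := by
  classical
  constructor
  · rw [injective_iff_map_eq_zero]
    intro a ha
    refine DFinsupp.ext fun n => Subtype.ext (hf _ fun s => ?_)
    have h : (N s).proj n ∘ₗ f s ∘ₗ DirectSum.coeLinearMap gr =
        f s ∘ₗ (gr n).subtype ∘ₗ DirectSum.component k ℤ (fun n => gr n) n := by
      refine DirectSum.linearMap_ext k fun m => LinearMap.ext fun x => ?_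
      by_cases hmn : m = n
      · subst hmn
        simp [proj_of_mem (hgr s m x x.2)]
      · simp [proj_of_mem_ne hmn (hgr s m x x.2), DirectSum.component.of, hmn]
    have := LinearMap.congr_fun h a
    change (N s).proj n (f s (DirectSum.coeAddMonoidHom gr a)) = f s (a n : M) at this
    rw [← this, ha, map_zero, map_zero]
  · intro x
    have h : ⨆ n, gr n = LinearMap.range (DirectSum.coeLinearMap gr) :=
      (DirectSum.range_coeLinearMap).symm
    have hx := htop x
    rw [h] at hx
    exact hx

end GrVect

/-! ### Koszul signs -/

/-- The sign of a parity. -/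
def sgn (z : ZMod 2) : ℤˣ := (-1) ^ z.val

theorem sgn_add (a b : ZMod 2) : sgn (a + b) = sgn a * sgn b := by
  revert a b; decide

theorem sgn_zero : sgn 0 = 1 := rfl

theorem sgn_one : sgn 1 = -1 := rfl

theorem sgn_intCast (n : ℤ) : sgn n = (-1) ^ n := by
  rcases Int.even_or_odd' n with ⟨c, rfl | rfl⟩
  · have : ((2 : ℤ) : ZMod 2) = 0 := rfl
    rw [Int.cast_mul, this, zero_mul, zpow_mul]
    simp [sgn_zero]
  · have : ((2 : ℤ) : ZMod 2) = 0 := rfl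
    rw [Int.cast_add, Int.cast_mul, this, zero_mul, zero_add, Int.cast_one, sgn_one, zpow_add,
      zpow_mul]
    simp

theorem sgn_natCast (n : ℕ) : sgn n = (-1) ^ n := by
  simpa using sgn_intCast n

theorem sgn_sum {I : Type*} (s : Finset I) (f : I → ZMod 2) :
    sgn (∑ i ∈ s, f i) = ∏ i ∈ s, sgn (f i) := by
  classical
  induction s using Finset.induction_on with
  | empty => rfl
  | insert a s ha ih => rw [Finset.sum_insert ha, Finset.prod_insert ha, sgn_add, ih]

variable {I J : Type} [Fintype I] [LinearOrder I] [Fintype J] [LinearOrder J]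

/-- The exponent of the Koszul sign. -/
def koszulExp (π : I → J) (d : J → ZMod 2) (a : I → ZMod 2) : ZMod 2 :=
  (∑ i, ∑ i', if i < i' ∧ π i' < π i then a i * a i' else 0) +
    ∑ i, ∑ j, if π i < j then d j * a i else 0

theorem koszulSign_eq (ε : Parity) (π : I → J) (δ : J → ℕ) (n : I → ℤ) :
    koszulSign ε π δ n = sgn (koszulExp π (fun j => ε.val * δ j) (fun i => n i)) := by
  unfold koszulSign koszulExp
  rw [sgn_add, sgn_sum, sgn_sum]
  congr 1
  · refine prod_congr rfl fun i _ => ?_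
    rw [sgn_sum]
    refine prod_congr rfl fun i' _ => ?_
    split_ifs
    · rw [← sgn_intCast]; push_cast; rfl
    · rfl
  · refine prod_congr rfl fun i _ => ?_
    rw [sgn_sum]
    refine prod_congr rfl fun i' _ => ?_
    split_ifs
    · rw [← sgn_intCast]; push_cast; rfl
    · rfl

theorem zmod_two_add_self (a : ZMod 2) : a + a = 0 := by
  revert a; decide

theorem sum_sum_eq_zero_of_pairing {I : Type*} [Fintype I] (t : I → I → ZMod 2)
    (h : ∀ i i', t i i' + t i' i = 0) (h0 : ∀ i, t i i = 0) : ∑ i, ∑ i', t i i' = 0 := by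
  classical
  rw [← Finset.sum_product']
  refine Finset.sum_involution (fun p _ => (p.2, p.1)) (fun p _ => h p.1 p.2) ?_ ?_ ?_
  · intro p _ hp hp'
    apply hp
    have : p.2 = p.1 := congrArg Prod.fst hp'
    rw [this]
    exact h0 _
  · intro p _; simp
  · intro p _; rfl

theorem sum_subtype_ite {I : Type*} [Fintype I] {A : Type*} [AddCommMonoid A] (p : I → Prop)
    [DecidablePred p] (f : I → A) : ∑ i : {i // p i}, f i = ∑ i, if p i then f i else 0 := by
  rw [← sum_filter]
  exact (Finset.sum_subtype (Finset.univ.filter p) (fun i => by simp) f).symm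

theorem sum_sum_ite {I J A : Type*} [Fintype I] [Fintype J] [DecidableEq J] [AddCommMonoid A]
    (m : I → J) (f : I → A) : ∑ j, ∑ i, (if m i = j then f i else 0) = ∑ i, f i := by
  rw [sum_comm]
  exact sum_congr rfl fun i _ => by simp

theorem tri_cases {I : Type*} [LinearOrder I] (i i' : I) :
    i = i' ∨ (i < i' ∧ ¬ i' < i ∧ i ≠ i' ∧ i' ≠ i) ∨ (i' < i ∧ ¬ i < i' ∧ i ≠ i' ∧ i' ≠ i) := by
  rcases lt_trichotomy i i' with h | h | h
  · exact Or.inr (Or.inl ⟨h, h.not_gt, h.ne, h.ne'⟩)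
  · exact Or.inl h
  · exact Or.inr (Or.inr ⟨h, h.not_gt, h.ne', h.ne⟩)

theorem inversions_comp {I J K : Type*} [LinearOrder I] [LinearOrder J] [LinearOrder K]
    (i i' : I) (p q : J) (r s : K) (c : ZMod 2) (h1 : i = i' → p = q) (h2 : p = q → r = s) :
    (if i < i' ∧ q < p then c else 0) + (if p < q ∧ s < r then c else 0) +
      ((if i < i' ∧ s < r then c else 0) + (if r = s ∧ i < i' ∧ q < p then c else 0)) +
    ((if i' < i ∧ p < q then c else 0) + (if q < p ∧ r < s then c else 0) +
      ((if i' < i ∧ r < s then c else 0) + (if s = r ∧ i' < i ∧ p < q then c else 0))) = 0 := by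
  have hc := zmod_two_add_self c
  rcases tri_cases p q with rfl | ⟨a1, a2, a3, a4⟩ | ⟨a1, a2, a3, a4⟩
  · obtain rfl := h2 rfl
    simp
  · have hi : i ≠ i' := fun h => a3 (h1 h)
    rcases tri_cases i i' with rfl | ⟨b1, b2, b3, b4⟩ | ⟨b1, b2, b3, b4⟩
    · exact absurd rfl hi
    all_goals
      rcases tri_cases r s with rfl | ⟨e1, e2, e3, e4⟩ | ⟨e1, e2, e3, e4⟩
      · simp [a1, a2, b1, b2, hc]
      · simp [a1, a2, b1, b2, e1, e2, e3, e4, hc]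
      · simp [a1, a2, b1, b2, e1, e2, e3, e4, hc]
  · have hi : i ≠ i' := fun h => a3 (h1 h)
    rcases tri_cases i i' with rfl | ⟨b1, b2, b3, b4⟩ | ⟨b1, b2, b3, b4⟩
    · exact absurd rfl hi
    all_goals
      rcases tri_cases r s with rfl | ⟨e1, e2, e3, e4⟩ | ⟨e1, e2, e3, e4⟩
      · simp [a1, a2, b1, b2, hc]
      · simp [a1, a2, b1, b2, e1, e2, e3, e4, hc]
      · simp [a1, a2, b1, b2, e1, e2, e3, e4, hc]

theorem inversions_op {J K : Type*} [LinearOrder J] [LinearOrder K]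
    (p q : J) (r s : K) (c : ZMod 2) (h2 : p = q → r = s) :
    (if p < q then c else 0) + ((if p < q ∧ s < r then c else 0) +
      (if q < p ∧ r < s then c else 0)) =
      (if r < s then c else 0) + (if r = s ∧ p < q then c else 0) := by
  have hc := zmod_two_add_self c
  rcases tri_cases p q with rfl | ⟨a1, a2, a3, a4⟩ | ⟨a1, a2, a3, a4⟩
  · obtain rfl := h2 rfl
    simp
  all_goals
    rcases tri_cases r s with rfl | ⟨e1, e2, e3, e4⟩ | ⟨e1, e2, e3, e4⟩
    · simp [a1, a2]
    · simp [a1, a2, e1, e2, e3]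
    · simp [a1, a2, e1, e2, e3, hc]

set_option maxHeartbeats 1000000 in
theorem koszulExp_comp {I J K : Type} [Fintype I] [LinearOrder I] [Fintype J] [LinearOrder J]
    [Fintype K] [LinearOrder K] (m : I → J) (n : J → K) (d : J → ZMod 2) (e : K → ZMod 2)
    (a : I → ZMod 2) (hd : ∀ j j', j ≠ j' → d j * d j' = 0) (he : ∀ j k, d j * e k = 0) :
    koszulExp m d a + koszulExp n e (fun j => (∑ i : {i // m i = j}, a i) + d j) =
      koszulExp (fun i => n (m i)) (fun k => e k + ∑ j : {j // n j = k}, d j) a +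
      ∑ k, koszulExp (fun i : {i // n (m i) = k} => (⟨m i, i.2⟩ : {j // n j = k}))
        (fun j => d j) (fun i => a i) := by
  have A1 : ∑ j, ∑ j', (if j < j' ∧ n j' < n j then
      ((∑ i : {i // m i = j}, a i) + d j) * ((∑ i : {i // m i = j'}, a i) + d j') else 0) =
      (∑ i, ∑ i', if m i < m i' ∧ n (m i') < n (m i) then a i * a i' else 0) +
      (∑ i, ∑ j, if m i < j ∧ n j < n (m i) then a i * d j else 0) +
      (∑ i, ∑ j, if j < m i ∧ n (m i) < n j then a i * d j else 0) := by
    have e1 : ∀ j j', (if j < j' ∧ n j' < n j then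
      ((∑ i : {i // m i = j}, a i) + d j) * ((∑ i : {i // m i = j'}, a i) + d j') else 0) =
      (∑ i, ∑ i', if m i = j then if m i' = j' then if m i < m i' ∧ n (m i') < n (m i) then a i * a i' else 0 else 0 else 0) +
      (∑ i, if m i = j then if m i < j' ∧ n j' < n (m i) then a i * d j' else 0 else 0) +
      (∑ i, if m i = j' then if j < m i ∧ n (m i) < n j then a i * d j else 0 else 0) := by
      intro j j'
      rw [sum_subtype_ite (fun i => m i = j), sum_subtype_ite (fun i => m i = j')]
      by_cases h : j < j' ∧ n j' < n j
      · have hjj : d j * d j' = 0 := hd j j' h.1.ne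
        rw [if_pos h, add_mul, mul_add, mul_add, hjj, add_zero, Finset.sum_mul_sum]
        congr 1
        · congr 1
          · refine sum_congr rfl fun i _ => sum_congr rfl fun i' _ => ?_
            split_ifs with h1 h2 h3 <;> simp_all
          · rw [Finset.sum_mul]
            refine sum_congr rfl fun i _ => ?_
            split_ifs with h1 h2 <;> simp_all
        · rw [mul_sum]
          refine sum_congr rfl fun i _ => ?_
          split_ifs with h1 h2 <;> simp_all [mul_comm]
      · rw [if_neg h]
        symm
        have z : ∀ {i i' : J} {x : ZMod 2}, (if i = j then if i' = j' then
            if i < i' ∧ n i' < n i then x else 0 else 0 else 0) = 0 := by grind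
        have z2 : ∀ {i : J} {x : ZMod 2}, (if i = j then if i < j' ∧ n j' < n i then x else 0
            else 0) = 0 := by grind
        have z3 : ∀ {i : J} {x : ZMod 2}, (if i = j' then if j < i ∧ n i < n j then x else 0
            else 0) = 0 := by grind
        simp only [z, z2, z3, Finset.sum_const_zero, add_zero]
    simp only [e1, sum_add_distrib]
    congr 1
    · congr 1
      · have : ∀ j : J, ∑ j' : J, ∑ i, ∑ i', (if m i = j then if m i' = j' then if m i < m i' ∧ n (m i') < n (m i) then a i * a i' else 0 else 0 else 0) =
          ∑ i, if m i = j then ∑ i', if m i < m i' ∧ n (m i') < n (m i) then a i * a i' else 0 else 0 := by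
          intro j
          rw [sum_comm]
          refine sum_congr rfl fun i _ => ?_
          rw [sum_comm]
          split_ifs
          · refine sum_congr rfl fun i' _ => ?_
            rw [sum_ite_eq Finset.univ (m i')]; simp
          · simp
        simp only [this]
        exact sum_sum_ite m _
      · have : ∀ j : J, ∑ j' : J, ∑ i, (if m i = j then if m i < j' ∧ n j' < n (m i) then a i * d j' else 0 else 0) =
          ∑ i, if m i = j then ∑ j', if m i < j' ∧ n j' < n (m i) then a i * d j' else 0 else 0 := by
          intro j
          rw [sum_comm]
          refine sum_congr rfl fun i _ => ?_
          split_ifs <;> simp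
        simp only [this]
        exact sum_sum_ite m _
    · rw [sum_congr rfl fun j _ => sum_comm, sum_comm]
      refine sum_congr rfl fun i _ => sum_congr rfl fun j _ => ?_
      rw [sum_ite_eq Finset.univ (m i)]; simp
  have A2 : ∑ j, ∑ k, (if n j < k then e k * ((∑ i : {i // m i = j}, a i) + d j) else 0) =
      ∑ i, ∑ k, if n (m i) < k then e k * a i else 0 := by
    rw [sum_comm, sum_comm (s := Finset.univ (α := I))]
    refine sum_congr rfl fun k _ => ?_
    have : ∀ j, (if n j < k then e k * ((∑ i : {i // m i = j}, a i) + d j) else 0) =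
        ∑ i, if m i = j then if n (m i) < k then e k * a i else 0 else 0 := by
      intro j
      rw [sum_subtype_ite (fun i => m i = j), mul_add, mul_comm (e k) (d j), he, add_zero, mul_sum]
      split_ifs with h
      · refine sum_congr rfl fun i _ => ?_
        split_ifs with h1 h2 <;> simp_all
      · exact (sum_eq_zero fun i _ => by grind).symm
    simp only [this]
    exact sum_sum_ite m _
  have A3 : ∑ i, ∑ k, (if n (m i) < k then (e k + ∑ j : {j // n j = k}, d j) * a i else 0) =
      (∑ i, ∑ k, if n (m i) < k then e k * a i else 0) +
        ∑ i, ∑ j, if n (m i) < n j then a i * d j else 0 := by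
    rw [← sum_add_distrib]
    refine sum_congr rfl fun i _ => ?_
    have : ∀ k, (if n (m i) < k then (e k + ∑ j : {j // n j = k}, d j) * a i else 0) =
        (if n (m i) < k then e k * a i else 0) +
        ∑ j, if n j = k then if n (m i) < n j then a i * d j else 0 else 0 := by
      intro k
      rw [sum_subtype_ite (fun j => n j = k)]
      split_ifs with h
      · rw [add_mul, Finset.sum_mul]
        congr 1
        refine sum_congr rfl fun j _ => ?_
        split_ifs with h1 h2 <;> simp_all [mul_comm]
      · exact (zero_add (0 : ZMod 2)).symm.trans
          (congrArg _ (sum_eq_zero fun j _ => by grind).symm)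
    simp only [this, sum_add_distrib]
    congr 1
    exact sum_sum_ite n _
  have A4 : ∑ k, koszulExp (fun i : {i // n (m i) = k} => (⟨m i, i.2⟩ : {j // n j = k}))
        (fun j => d j) (fun i => a i) =
      (∑ i, ∑ i', if n (m i) = n (m i') ∧ i < i' ∧ m i' < m i then a i * a i' else 0) +
        ∑ i, ∑ j, if n (m i) = n j ∧ m i < j then a i * d j else 0 := by
    have : ∀ k, koszulExp (fun i : {i // n (m i) = k} => (⟨m i, i.2⟩ : {j // n j = k}))
        (fun j => d j) (fun i => a i) =
        (∑ i, if n (m i) = k then ∑ i', if n (m i) = n (m i') ∧ i < i' ∧ m i' < m i then a i * a i' else 0 else 0) +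
        ∑ i, if n (m i) = k then ∑ j, if n (m i) = n j ∧ m i < j then a i * d j else 0 else 0 := by
      intro k
      unfold koszulExp
      rw [← sum_subtype_ite (fun i => n (m i) = k), ← sum_subtype_ite (fun i => n (m i) = k)]
      congr 1
      · refine sum_congr rfl fun i _ => ?_
        simp only [Subtype.mk_lt_mk]
        refine (sum_subtype_ite (fun i => n (m i) = k)
          (fun i' => if i.1 < i' ∧ m i' < m i then a i * a i' else 0)).trans ?_
        refine sum_congr rfl fun i' _ => ?_
        have := i.2
        split_ifs <;> simp_all
      · refine sum_congr rfl fun i _ => ?_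
        refine (sum_subtype_ite (fun j => n j = k)
          (fun j => if m i < j then d j * a i else 0)).trans ?_
        refine sum_congr rfl fun j _ => ?_
        have := i.2
        split_ifs <;> simp_all [mul_comm]
    simp only [this, sum_add_distrib]
    congr 1 <;> exact sum_sum_ite (fun i => n (m i)) _
  rw [A4]
  unfold koszulExp
  rw [A1, A2, A3]
  have B1 : (∑ i, ∑ i', if i < i' ∧ m i' < m i then a i * a i' else 0) +
      (∑ i, ∑ i', if m i < m i' ∧ n (m i') < n (m i) then a i * a i' else 0) +
      ((∑ i, ∑ i', if i < i' ∧ n (m i') < n (m i) then a i * a i' else 0) +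
      (∑ i, ∑ i', if n (m i) = n (m i') ∧ i < i' ∧ m i' < m i then a i * a i' else 0)) = 0 := by
    simp only [← sum_add_distrib]
    refine sum_sum_eq_zero_of_pairing _ ?_ ?_
    · intro i i'
      have hc : a i' * a i = a i * a i' := mul_comm _ _
      rw [hc]
      exact inversions_comp i i' (m i) (m i') (n (m i)) (n (m i')) _ (congrArg m) (congrArg n)
    · intro i; simp
  have B2 : (∑ i, ∑ j, if m i < j then d j * a i else 0) +
      ((∑ i, ∑ j, if m i < j ∧ n j < n (m i) then a i * d j else 0) +
      (∑ i, ∑ j, if j < m i ∧ n (m i) < n j then a i * d j else 0)) =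
      (∑ i, ∑ j, if n (m i) < n j then a i * d j else 0) +
        ∑ i, ∑ j, if n (m i) = n j ∧ m i < j then a i * d j else 0 := by
    simp only [← sum_add_distrib]
    refine sum_congr rfl fun i _ => sum_congr rfl fun j _ => ?_
    rw [mul_comm (d j)]
    exact inversions_op (m i) j (n (m i)) (n j) _ (congrArg n)
  have h2 : (2 : ZMod 2) = 0 := rfl
  linear_combination B1 + B2 - ((∑ i, ∑ i', if i < i' ∧ n (m i') < n (m i) then a i * a i' else 0) +
      (∑ i, ∑ i', if n (m i) = n (m i') ∧ i < i' ∧ m i' < m i then a i * a i' else 0)) * h2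

/-! ### Operations of graded objects -/

theorem koszulSign_subsingleton [Subsingleton J] (ε : Parity) (π : I → J) (δ : J → ℕ) (n : I → ℤ) :
    koszulSign ε π δ n = 1 := by
  have h : ∀ a b : J, ¬ a < b := fun a b h => h.ne (Subsingleton.elim a b)
  simp [koszulSign, h]

theorem koszulSign_monotone (ε : Parity) {π : I → J} (hπ : Monotone π) {δ : J → ℕ} (hδ : ∀ j, δ j = 0)
    (n : I → ℤ) : koszulSign ε π δ n = 1 := by
  have h : ∀ i i', ¬ (i < i' ∧ π i' < π i) := fun i i' h => (hπ h.1.le).not_gt h.2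
  simp [koszulSign, h, hδ]

theorem MultilinearMap.map_units_smul {R : Type*} [CommRing R] {I : Type*} [Fintype I]
    {A : I → Type*} {N : Type*} [∀ i, AddCommGroup (A i)] [∀ i, Module R (A i)] [AddCommGroup N]
    [Module R N] (M : MultilinearMap R A N) (s : I → ℤˣ) (p : ∀ i, A i) :
    M (fun i => s i • p i) = (∏ i, s i) • M p := by
  classical
  have h : ∀ {B : Type _} [AddCommGroup B] [Module R B] (c : ℤˣ) (x : B),
      c • x = (((c : ℤˣ) : ℤ) : R) • x := by
    intro B _ _ c x
    rw [Int.cast_smul_eq_zsmul]; rfl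
  have h' : ∀ (c : ℤˣ) (x : N), c • x = (((c : ℤˣ) : ℤ) : R) • x := fun c x => by
    rw [Int.cast_smul_eq_zsmul]; rfl
  rw [h', show (fun i => s i • p i) = fun i => (((s i : ℤˣ) : ℤ) : R) • p i from
    funext fun i => h _ _, M.map_smul_univ]
  simp

theorem DegreeFunction.deg_uop {C : ColoredOperad.{u}} (δ : DegreeFunction C) {v w : C.V}
    (σ : single v ≅ single w) : δ.deg (uop σ.hom) = 0 := by
  have h := δ.degree_iso σ
  have h2 : δ.deg (uop σ.hom) = δ.deg (WordHom.g σ.hom (0 : Fin 1)) :=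
    (δ.deg_map (J := Fin 1) _ _).trans (δ.deg_map _ _)
  rw [h2]
  exact sum_eq_zero_iff.1 h _ (mem_univ (0 : Fin 1))

theorem DegreeFunction.deg_toOp {C : ColoredOperad.{u}} (δ : DegreeFunction C) {X : C.Word}
    {v : C.V} (f : X ⟶ single v) : δ.deg (toOp f) = δ.degree f :=
  (δ.deg_map _ _).trans (Fin.sum_univ_one (fun j => δ.deg (WordHom.g f j))).symm

theorem DegreeFunction.deg_subst {C : ColoredOperad.{u}} (δ : DegreeFunction C) {I J : Type}
    [Finite I] [Fintype J] {x : I → C.V} {y : J → C.V} {v : C.V} (f : C.Hom y v) (π : I → J)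
    (g : ∀ j, C.Hom (fun i : {i // π i = j} => x i) (y j)) :
    δ.deg (subst f π g) = δ.deg f + ∑ j, δ.deg (g j) :=
  (δ.deg_map _ _).trans (δ.deg_comp _ _)

theorem DegreeFunction.deg_unaryAt {C : ColoredOperad.{u}} (δ : DegreeFunction C) {I : Type}
    [Finite I] {x : I → C.V} {v : C.V} (i : I) (a : C.Hom (fun _ : Unit => x i) v) :
    δ.deg (unaryAt (x := x) i a) = δ.deg a := by
  conv_rhs => rw [← map_unaryAt (x := x) i a]
  exact (δ.deg_map _ _).symm

theorem DegreeFunction.deg_pre {C : ColoredOperad.{u}} (δ : DegreeFunction C) {I : Type}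
    [Fintype I] {x' x : I → C.V} {v : C.V} (a : ∀ i, C.Hom (fun _ : Unit => x' i) (x i))
    (f : C.Hom x v) : δ.deg (pre a f) = δ.deg f + ∑ i, δ.deg (a i) :=
  (δ.deg_subst f _ _).trans (congrArg _ (sum_congr rfl fun i _ => δ.deg_unaryAt i (a i)))

theorem DegreeFunction.deg_post {C : ColoredOperad.{u}} (δ : DegreeFunction C) {I : Type}
    [Finite I] {x : I → C.V} {v w : C.V} (f : C.Hom x v) (a : C.Hom (fun _ : Unit => v) w) :
    δ.deg (post f a) = δ.deg f + δ.deg a := by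
  refine (δ.deg_subst (J := Unit) a _ _).trans ?_
  rw [Finset.univ_unique, Finset.sum_singleton, add_comm]
  exact congrArg (· + _) (δ.deg_map _ _)

theorem DegreeFunction.deg_post_iso {C : ColoredOperad.{u}} (δ : DegreeFunction C) {I : Type}
    [Finite I] {x : I → C.V} {v w : C.V} (f : C.Hom x v) (σ : single v ≅ single w) :
    δ.deg (post f (uop σ.hom)) = δ.deg f := by
  rw [δ.deg_post, δ.deg_uop, add_zero]

theorem DegreeFunction.deg_pre_iso {C : ColoredOperad.{u}} (δ : DegreeFunction C) {I : Type}
    [Finite I] {x' x : I → C.V} {v : C.V} (τ : ∀ i, single (x' i) ≅ single (x i))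
    (f : C.Hom x v) : δ.deg (pre (fun i => uop (τ i).hom) f) = δ.deg f := by
  have := ofFinite I
  rw [δ.deg_pre]
  simp [δ.deg_uop]

namespace PreGradedOp

/-- The structural laws of a graded object, apart from (skew) invariance. -/
structure Laws (P : PreGradedOp k F) (ε : Parity) : Prop where
  act_mem : ∀ {I : Type} [Fintype I] [LinearOrder I] {x : I → F.C.V} {v : F.C.V}
    (f : F.C.Hom x v) (hf : F.δ.deg f ≤ 1) (n : I → ℤ) (p : ∀ i, P.obj (x i)),
    (∀ i, p i ∈ (P.obj (x i)).gr (n i)) → P.act f hf p ∈ (P.obj v).gr (∑ i, n i + ε.val * F.δ.deg f)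
  act_one : ∀ (v : F.C.V) (h : F.δ.deg (F.C.one v) ≤ 1) (p : P.obj v),
    P.act (F.C.one v) h (fun _ => p) = p
  act_map : ∀ {I J : Type} [Finite I] [LinearOrder I] [Finite J] [LinearOrder J] (e : I ≃o J)
    {x : J → F.C.V} {v : F.C.V} (f : F.C.Hom x v) (hf : F.δ.deg f ≤ 1)
    (hf' : F.δ.deg (F.C.map e.toEquiv f) ≤ 1) (p : ∀ j, P.obj (x j)),
    P.act (F.C.map e.toEquiv f) hf' (fun i => p (e i)) = P.act f hf p
  act_subst : ∀ {I J : Type} [Fintype I] [LinearOrder I] [Fintype J] [LinearOrder J]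
    {x : I → F.C.V} {y : J → F.C.V} {v : F.C.V} (f : F.C.Hom y v) (π : I → J)
    (g : ∀ j, F.C.Hom (fun i : {i // π i = j} => x i) (y j)) (hf : F.δ.deg f ≤ 1)
    (hg : ∀ j, F.δ.deg (g j) ≤ 1) (h : F.δ.deg (subst f π g) ≤ 1) (n : I → ℤ)
    (p : ∀ i, P.obj (x i)), (∀ i, p i ∈ (P.obj (x i)).gr (n i)) →
      P.act (subst f π g) h p = koszulSign ε π (fun j => F.δ.deg (g j)) n •
        P.act f hf (fun j => P.act (g j) (hg j) (fun i => p i))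

end PreGradedOp

theorem GradedOp.laws (P : GradedOp k F ε) : P.toPreGradedOp.Laws ε :=
  ⟨P.act_mem, P.act_one, P.act_map, P.act_subst⟩

namespace PreGradedOp

variable {I : Type} [Finite I] [LinearOrder I] {x : I → F.C.V} {v : F.C.V}

variable {P : PreGradedOp k F}

theorem act_congr {f f' : F.C.Hom x v} (h : f = f') (hf : F.δ.deg f ≤ 1) (hf' : F.δ.deg f' ≤ 1)
    (p : ∀ i, P.obj (x i)) : P.act f hf p = P.act f' hf' p := by
  subst h; rfl

theorem deg_uop_le {v w : F.C.V} (σ : single v ≅ single w) : F.δ.deg (uop σ.hom) ≤ 1 := by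
  rw [F.δ.deg_uop]; exact Nat.zero_le 1

namespace Laws

variable (hP : P.Laws ε)

include hP

theorem act_map' {I J : Type} [Finite I] [LinearOrder I] [Finite J] [LinearOrder J] (e : I ≃ J)
    (he : ∀ {a b}, e a ≤ e b ↔ a ≤ b)
    {x : J → F.C.V} {v : F.C.V} (f : F.C.Hom x v) (hf : F.δ.deg f ≤ 1)
    (hf' : F.δ.deg (F.C.map e f) ≤ 1) (p : ∀ j, P.obj (x j)) :
    P.act (F.C.map e f) hf' (fun i => p (e i)) = P.act f hf p :=
  hP.act_map ⟨e, he⟩ f hf hf' p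

theorem ev_eq {X : F.C.Word} {v : F.C.V} (f : X ⟶ single v) (hf : F.δ.degree f ≤ 1)
    (p : ∀ i, P.obj (X.x i)) :
    P.ev f hf p = P.act (toOp f) ((F.δ.deg_toOp f).trans_le hf) p :=
  (hP.act_map' (subtypeUnivEquiv fun _ => Subsingleton.elim (α := Fin 1) _ _).symm Iff.rfl
    (WordHom.g f (0 : Fin 1)) (F.δ.deg_le_one hf _) _ (fun i => p i)).symm

theorem evIso_eq {v w : F.C.V} (σ : single v ≅ single w) (p : P.obj v) :
    P.evIso σ p = P.act (uop σ.hom) (deg_uop_le σ) (fun _ => p) := by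
  have h1 := hP.ev_eq (X := single v) σ.hom (F.δ.degree_iso_le _) (fun _ => p)
  exact h1.trans (hP.act_map' (J := Fin 1) (Equiv.ofUnique Unit (Fin 1)) (by intro a b; simp)
    (toOp σ.hom) ((F.δ.deg_toOp σ.hom).trans_le (F.δ.degree_iso_le _)) (deg_uop_le σ) (fun _ => p)).symm

theorem evIso_refl {v : F.C.V} (p : P.obj v) : P.evIso (Iso.refl (single v)) p = p := by
  rw [hP.evIso_eq]
  refine (act_congr (uop_id v) _ (by rw [F.δ.deg_one]; exact Nat.zero_le 1) _).trans ?_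
  exact hP.act_one v _ p

theorem evIso_mem {v w : F.C.V} (σ : single v ≅ single w) {n : ℤ} {p : P.obj v}
    (hp : p ∈ (P.obj v).gr n) : P.evIso σ p ∈ (P.obj w).gr n := by
  rw [hP.evIso_eq]
  have := hP.act_mem (uop σ.hom) (deg_uop_le σ) (fun _ => n) (fun _ => p) (fun _ => hp)
  simpa [F.δ.deg_uop] using this

theorem evIso_proj {v w : F.C.V} (σ : single v ≅ single w) (n : ℤ) (p : P.obj v) :
    P.evIso σ ((P.obj v).proj n p) = (P.obj w).proj n (P.evIso σ p) :=
  GrVect.map_proj₀ _ (fun _ _ => hP.evIso_mem σ) n p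

theorem act_post {I : Type} [Finite I] [LinearOrder I] {x : I → F.C.V} {v w : F.C.V}
    (f : F.C.Hom x v) (hf : F.δ.deg f ≤ 1) (σ : single v ≅ single w)
    (h : F.δ.deg (post f (uop σ.hom)) ≤ 1) (p : ∀ i, P.obj (x i)) :
    P.act (post f (uop σ.hom)) h p = P.evIso σ (P.act f hf p) := by
  have := ofFinite I
  suffices P.act (post f (uop σ.hom)) h = (P.evIso σ).compMultilinearMap (P.act f hf) by
    rw [this]; rfl
  refine GrVect.multilinear_ext fun n p hp => ?_
  have hm : ∀ j : Unit, F.δ.deg (F.C.map (I := {i : I // () = j}) (subtypeUnivEquiv fun _ => rfl) f) ≤ 1 :=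
    fun j => (F.δ.deg_map _ _).trans_le hf
  refine (hP.act_subst (uop σ.hom) (fun _ => ()) _ (deg_uop_le σ) hm h n p hp).trans ?_
  rw [koszulSign_subsingleton, one_smul]
  refine Eq.trans ?_ (hP.evIso_eq σ _).symm
  congr 1
  funext j
  exact hP.act_map' (subtypeUnivEquiv fun _ => rfl) Iff.rfl f hf _ p

theorem act_unaryAt (i : I)
    (σ : single (x i) ≅ single v) (h : F.δ.deg (unaryAt (x := x) i (uop σ.hom)) ≤ 1)
    (p : ∀ i, P.obj (x i)) :
    P.act (unaryAt (x := x) i (uop σ.hom)) h (fun s => p s) = P.evIso σ (p i) := by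
  rw [hP.evIso_eq]
  have h1 := hP.act_map' (fiberId i).symm (by intro a b; simp [Subsingleton.elim a b])
    (unaryAt (x := x) i (uop σ.hom)) h
    (by rw [map_unaryAt]; exact deg_uop_le σ) (fun s => p s)
  rw [← h1]
  exact act_congr (map_unaryAt (x := x) i (uop σ.hom)) _ _ _

theorem act_pre {I : Type} [Finite I] [LinearOrder I] {x' x : I → F.C.V} {v : F.C.V}
    (τ : ∀ i, single (x' i) ≅ single (x i)) (f : F.C.Hom x v) (hf : F.δ.deg f ≤ 1)
    (h : F.δ.deg (pre (fun i => uop (τ i).hom) f) ≤ 1) (p : ∀ i, P.obj (x' i)) :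
    P.act (pre (fun i => uop (τ i).hom) f) h p = P.act f hf (fun i => P.evIso (τ i) (p i)) := by
  have := ofFinite I
  suffices P.act (pre (fun i => uop (τ i).hom) f) h =
      (P.act f hf).compLinearMap (fun i => P.evIso (τ i)) by
    rw [this]; rfl
  refine GrVect.multilinear_ext fun n p hp => ?_
  have hm : ∀ i, F.δ.deg (unaryAt (x := x') i (uop (τ i).hom)) ≤ 1 := fun i => by
    rw [F.δ.deg_unaryAt]; exact deg_uop_le _
  refine (hP.act_subst f (fun i => i) _ hf hm h n p hp).trans ?_
  rw [koszulSign_monotone ε (π := fun i => i) (fun _ _ h => h) (fun i => by rw [F.δ.deg_unaryAt, F.δ.deg_uop]), one_smul]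
  change P.act f hf _ = P.act f hf _
  congr 1
  funext i
  exact hP.act_unaryAt i (τ i) (hm i) p

theorem evIso_trans {v w z : F.C.V} (σ : single v ≅ single w) (τ : single w ≅ single z)
    (p : P.obj v) : P.evIso (σ ≪≫ τ) p = P.evIso τ (P.evIso σ p) := by
  rw [hP.evIso_eq, hP.evIso_eq σ]
  refine (act_congr (uop_comp σ.hom τ.hom) _ ?_ _).trans (hP.act_post _ (deg_uop_le σ) τ _ _)
  rw [F.δ.deg_post_iso]; exact deg_uop_le σ

theorem evIso_evIso_symm {v w : F.C.V} (σ : single v ≅ single w) (p : P.obj w) :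
    P.evIso σ (P.evIso σ.symm p) = p := by
  rw [← hP.evIso_trans, Iso.symm_self_id, hP.evIso_refl]

end Laws

/-! ### Tensors over words -/

/-- Two tensors with recorded degrees agree if all multilinear maps agree on them. -/
def Tensor.Equiv {X : F.C.Word} (t t' : P.Tensor X) : Prop :=
  t.deg = t'.deg ∧ ∀ (N : Type u) [AddCommGroup N] [Module k N]
    (M : MultilinearMap k (fun i => P.obj (X.x i)) N), t.sign • M t.val = t'.sign • M t'.val

/-- The components of a tensor have the recorded degrees. -/
def Tensor.Homogeneous {X : F.C.Word} (t : P.Tensor X) : Prop :=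
  ∀ i, t.val i ∈ (P.obj (X.x i)).gr (t.deg i)

theorem Tensor.Equiv.refl {X : F.C.Word} (t : P.Tensor X) : t.Equiv t := ⟨rfl, fun _ _ _ _ => rfl⟩

theorem Tensor.Equiv.symm {X : F.C.Word} {t t' : P.Tensor X} (h : t.Equiv t') : t'.Equiv t :=
  ⟨h.1.symm, fun N _ _ M => (h.2 N M).symm⟩

theorem Tensor.Equiv.trans {X : F.C.Word} {t t' t'' : P.Tensor X} (h : t.Equiv t')
    (h' : t'.Equiv t'') : t.Equiv t'' :=
  ⟨h.1.trans h'.1, fun N _ _ M => (h.2 N M).trans (h'.2 N M)⟩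

theorem Tensor.Equiv.value_eq {v : F.C.V} {t t' : P.Tensor (single v)} (h : t.Equiv t') :
    t.value = t'.value :=
  h.2 _ (MultilinearMap.ofSubsingleton k (P.obj v) (P.obj v) (0 : Fin 1) LinearMap.id)

/-- The multilinear map on the letters of the source given by a morphism of words. -/
noncomputable def wordMap (P : PreGradedOp k F) {X Y : F.C.Word} (m : X ⟶ Y) (hm : F.δ.degree m ≤ 1) {N : Type*}
    [AddCommGroup N] [Module k N] (M : MultilinearMap k (fun j => P.obj (Y.x j)) N) :
    MultilinearMap k (fun i => P.obj (X.x i)) N :=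
  M.compFibers (WordHom.π m) fun j => P.act (WordHom.g m j) (F.δ.deg_le_one hm j)

theorem Tensor.Equiv.push {X Y : F.C.Word} (m : X ⟶ Y) (hm : F.δ.degree m ≤ 1)
    {t t' : P.Tensor X} (h : t.Equiv t') :
    (push ε m hm t).Equiv (push ε m hm t') := by
  refine ⟨by simp only [PreGradedOp.push, h.1], fun N _ _ M => ?_⟩
  have := h.2 N (P.wordMap m hm M)
  simp only [PreGradedOp.push, h.1]
  rw [mul_comm, mul_smul, mul_comm, mul_smul]
  exact congrArg _ this

theorem Tensor.Equiv.pushChain {X Y : F.C.Word} {n : ℕ} (c : F.δ.Chain X Y n)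
    {t t' : P.Tensor X} (h : t.Equiv t') :
    (pushChain ε c t).Equiv (pushChain ε c t') := by
  induction c with
  | nil e => exact h.push e.hom _
  | cons m hm c ih => exact ih (h.push m hm.le)

theorem degree_wordHom_comp {X Y Z : F.C.Word} (m : X ⟶ Y) (n : Y ⟶ Z) (l : Fin Z.n) :
    F.δ.deg (WordHom.g (m ≫ n) l) = F.δ.deg (WordHom.g n l) +
      ∑ j : {j // WordHom.π n j = l}, F.δ.deg (WordHom.g m j) := by
  refine (F.δ.deg_map _ _).trans ((F.δ.deg_comp _ _).trans (congrArg _ ?_))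
  exact sum_congr rfl fun j _ => F.δ.deg_map _ _

theorem degree_mul_degree {X Y : F.C.Word} {m : X ⟶ Y} (hm : F.δ.degree m ≤ 1) {j j' : Fin Y.n}
    (h : j ≠ j') : F.δ.deg (WordHom.g m j) * F.δ.deg (WordHom.g m j') = 0 := by
  have h1 : F.δ.deg (WordHom.g m j) + F.δ.deg (WordHom.g m j') ≤ F.δ.degree m := by
    have := Finset.sum_le_sum_of_subset (f := fun j => F.δ.deg (WordHom.g m j))
      (Finset.subset_univ {j, j'})
    rwa [Finset.sum_pair h] at this
  rcases Nat.eq_zero_or_pos (F.δ.deg (WordHom.g m j)) with h2 | h2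
  · rw [h2, zero_mul]
  · rw [show F.δ.deg (WordHom.g m j') = 0 by omega, mul_zero]

namespace Laws

variable (hP : P.Laws ε)

include hP

theorem homogeneous_push {X Y : F.C.Word} (m : X ⟶ Y) (hm : F.δ.degree m ≤ 1) {t : P.Tensor X}
    (ht : t.Homogeneous) : (push ε m hm t).Homogeneous := fun j =>
  hP.act_mem (WordHom.g m j) (F.δ.deg_le_one hm j) (fun i => t.deg i) (fun i => t.val i)
    (fun i => ht i)

theorem homogeneous_pushChain {X Y : F.C.Word} {n : ℕ} (c : F.δ.Chain X Y n) {t : P.Tensor X}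
    (ht : t.Homogeneous) : (pushChain ε c t).Homogeneous := by
  induction c with
  | nil e => exact hP.homogeneous_push e.hom _ ht
  | cons m hm c ih => exact ih (hP.homogeneous_push m hm.le ht)

theorem push_comp {X Y Z : F.C.Word} (m : X ⟶ Y) (n : Y ⟶ Z) (hm : F.δ.degree m ≤ 1)
    (hn : F.δ.degree n ≤ 1) (h : F.δ.degree (m ≫ n) ≤ 1) {t : P.Tensor X} (ht : t.Homogeneous) :
    (push ε (m ≫ n) h t).Equiv (push ε n hn (push ε m hm t)) := by
  have hd := F.δ.degree_comp m n
  constructor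
  · funext l
    change ∑ i : {i // WordHom.π n (WordHom.π m i) = l}, t.deg i +
      ε.val * (F.δ.deg (WordHom.g (m ≫ n) l) : ℤ) = ∑ j : {j // WordHom.π n j = l},
      (∑ i : {i // WordHom.π m i = j.1}, t.deg i + ε.val * (F.δ.deg (WordHom.g m j) : ℤ)) +
        ε.val * (F.δ.deg (WordHom.g n l) : ℤ)
    rw [degree_wordHom_comp, sum_add_distrib]
    have : ∑ i : {i // WordHom.π n (WordHom.π m i) = l}, t.deg i =
        ∑ j : {j // WordHom.π n j = l}, ∑ i : {i // WordHom.π m i = j.1}, t.deg i := by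
      rw [← Fintype.sum_sigma']
      refine Fintype.sum_equiv ⟨fun i => ⟨⟨WordHom.π m i, i.2⟩, ⟨i.1, rfl⟩⟩,
        fun s => ⟨s.2.1, by rw [s.2.2]; exact s.1.2⟩, fun _ => rfl, ?_⟩ _ _ (fun _ => rfl)
      rintro ⟨⟨j, hj⟩, i, hi⟩
      change WordHom.π m i = j at hi
      subst hi
      rfl
    rw [this]
    push_cast
    rw [mul_add, mul_sum]
    ring
  · intro N _ _ M
    have hv : ∀ l, (push ε (m ≫ n) h t).val l =
        koszulSign ε (fun i : {i // WordHom.π n (WordHom.π m i) = l} =>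
          (⟨WordHom.π m i, i.2⟩ : {j // WordHom.π n j = l}))
          (fun j => F.δ.deg (WordHom.g m j)) (fun i => t.deg i) •
          (push ε n hn (push ε m hm t)).val l := by
      intro l
      have hg : ∀ j : {j // WordHom.π n j = l},
          F.δ.deg (F.C.map (fiberEquiv (WordHom.π m) (WordHom.π n) l j) (WordHom.g m j)) ≤ 1 :=
        fun j => (F.δ.deg_map _ _).trans_le (F.δ.deg_le_one hm j)
      refine (hP.act_subst (x := fun i : {i // WordHom.π n (WordHom.π m i) = l} => X.x i)
        (WordHom.g n l) _ _ (F.δ.deg_le_one hn l) hg (F.δ.deg_le_one h l) (fun i => t.deg i)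
        (fun i => t.val i) (fun i => ht i)).trans ?_
      congr 1
      · congr 1
        exact funext fun j => F.δ.deg_map _ _
      · change _ = P.act _ _ _
        congr 1
        funext j
        exact hP.act_map' (fiberEquiv (WordHom.π m) (WordHom.π n) l j) Iff.rfl (WordHom.g m j) _ _
          (fun i => t.val i)
    rw [show (push ε (m ≫ n) h t).val = _ from funext hv, MultilinearMap.map_units_smul, smul_smul]
    congr 1
    change t.sign * koszulSign ε (fun i => WordHom.π n (WordHom.π m i)) _ t.deg * _ =
      t.sign * koszulSign ε (WordHom.π m) _ t.deg * koszulSign ε (WordHom.π n) _ _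
    rw [mul_assoc, mul_assoc]
    congr 1
    simp only [koszulSign_eq, degree_wordHom_comp]
    rw [← sgn_sum, ← sgn_add, ← sgn_add]
    congr 1
    have key := koszulExp_comp (WordHom.π m) (WordHom.π n)
      (fun j => (ε.val * F.δ.deg (WordHom.g m j) : ZMod 2))
      (fun l => (ε.val * F.δ.deg (WordHom.g n l) : ZMod 2)) (fun i => (t.deg i : ZMod 2)) ?_ ?_
    · have e1 : ∀ l, ((ε.val : ZMod 2) * ((F.δ.deg (WordHom.g n l) +
          ∑ j : {j // WordHom.π n j = l}, F.δ.deg (WordHom.g m j) : ℕ) : ZMod 2)) =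
          ε.val * F.δ.deg (WordHom.g n l) +
          ∑ j : {j // WordHom.π n j = l}, (ε.val * F.δ.deg (WordHom.g m j) : ZMod 2) := by
        intro l
        push_cast
        rw [mul_add, mul_sum]
      simp only [e1]
      rw [← key]
      congr 2
      funext j
      simp only [push]
      push_cast
      rfl
    · intro j j' hj
      have := degree_mul_degree hm hj
      rw [mul_mul_mul_comm, ← Nat.cast_mul (F.δ.deg _), this]
      simp
    · intro j l
      have h1 : F.δ.deg (WordHom.g m j) = 0 ∨ F.δ.deg (WordHom.g n l) = 0 := by
        rcases Nat.eq_zero_or_pos (F.δ.degree m) with h0 | h0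
        · exact Or.inl (sum_eq_zero_iff.1 h0 j (mem_univ j))
        · have : F.δ.degree n = 0 := by omega
          exact Or.inr (sum_eq_zero_iff.1 this l (mem_univ l))
      rcases h1 with h1 | h1 <;> rw [h1] <;> simp

theorem push_id {X : F.C.Word} (h : F.δ.degree (𝟙 X) ≤ 1) (t : P.Tensor X) :
    (push ε (𝟙 X) h t).Equiv t := by
  have hd : ∀ j, F.δ.deg (WordHom.g (𝟙 X) j) = 0 := fun j =>
    sum_eq_zero_iff.1 (F.δ.degree_id X) j (mem_univ j)
  have hv : (push ε (𝟙 X) h t).val = t.val := by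
    funext j
    have e : WordHom.g (𝟙 X) j = unaryAt (x := X.x) j (uop (𝟙 (single (X.x j)))) := by
      rw [uop_id]
      exact (unaryAt_one (x := X.x) j).symm
    refine (act_congr e (F.δ.deg_le_one h j) (by rw [← e]; exact F.δ.deg_le_one h j)
      (fun i => t.val i)).trans ?_
    exact (hP.act_unaryAt j (Iso.refl _) _ t.val).trans (hP.evIso_refl _)
  constructor
  · funext j
    change ∑ i : {i // WordHom.π (𝟙 X) i = j}, t.deg i +
      ε.val * (F.δ.deg (WordHom.g (𝟙 X) j) : ℤ) = t.deg j
    have hs : ∑ i : {i // WordHom.π (𝟙 X) i = j}, t.deg i = t.deg j :=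
      Fintype.sum_eq_single (⟨j, rfl⟩ : {i // WordHom.π (𝟙 X) i = j})
        fun i hi => absurd (Subtype.ext i.2) hi
    rw [hd, hs]
    simp
  · intro N _ _ M
    rw [hv]
    congr 1
    change t.sign * koszulSign ε (fun i => i) _ t.deg = _
    rw [koszulSign_monotone ε (π := fun i => i) (fun _ _ h => h) hd, mul_one]

theorem pushChain_pre {X' X Y : F.C.Word} {n : ℕ} (e : X' ≅ X) (c : F.δ.Chain X Y n)
    {t : P.Tensor X'} (ht : t.Homogeneous) :
    (pushChain ε (c.pre e) t).Equiv (pushChain ε c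
      (push ε e.hom (F.δ.degree_iso_le _) t)) := by
  cases c with
  | nil e' => exact hP.push_comp e.hom e'.hom _ _ _ ht
  | cons m hm c => exact (hP.push_comp e.hom m _ _ _ ht).pushChain c

theorem pushChain_append {X Y Z : F.C.Word} {n m : ℕ} (c : F.δ.Chain X Y n) (d : F.δ.Chain Y Z m)
    {t : P.Tensor X} (ht : t.Homogeneous) :
    (pushChain ε (c.append d) t).Equiv (pushChain ε d (pushChain ε c t)) := by
  induction c with
  | nil e => exact hP.pushChain_pre e d ht
  | cons f hf c ih => exact ih d (hP.homogeneous_push f hf.le ht)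

end Laws

/-- The degrees of the components of a tensor after application of a morphism of words. -/
def pushDeg (ε : Parity) {X Y : F.C.Word} (m : X ⟶ Y) (n : Fin X.n → ℤ) (j : Fin Y.n) : ℤ :=
  ∑ i : {i // WordHom.π m i = j}, n i + ε.val * F.δ.deg (WordHom.g m j)

/-- The multilinear map on the letters of the source given by a chain, with the Koszul signs for
arguments of degrees `n`. -/
noncomputable def chainMap (P : PreGradedOp k F) (ε : Parity) {X Y : F.C.Word} {r : ℕ} {N : Type*}
    [AddCommGroup N] [Module k N] :
    ∀ (_ : F.δ.Chain X Y r) (_ : Fin X.n → ℤ) (_ : MultilinearMap k (fun j => P.obj (Y.x j)) N),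
      MultilinearMap k (fun i => P.obj (X.x i)) N
  | .nil e, n, M => koszulSign ε (WordHom.π e.hom) (fun j => F.δ.deg (WordHom.g e.hom j)) n •
      P.wordMap e.hom (F.δ.degree_iso_le _) M
  | .cons m hm c, n, M => koszulSign ε (WordHom.π m) (fun j => F.δ.deg (WordHom.g m j)) n •
      P.wordMap m hm.le (chainMap P ε c (pushDeg ε m n) M)

theorem pushChain_eq_chainMap {X Y : F.C.Word} {r : ℕ} (c : F.δ.Chain X Y r) (t : P.Tensor X)
    {N : Type*} [AddCommGroup N] [Module k N]
    (M : MultilinearMap k (fun j => P.obj (Y.x j)) N) :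
    (pushChain ε c t).sign • M (pushChain ε c t).val = t.sign • P.chainMap ε c t.deg M t.val := by
  induction c with
  | nil e => exact mul_smul _ _ _
  | cons m hm c ih => exact (ih _ _).trans (mul_smul _ _ _)

theorem value_pushChain {X : F.C.Word} {v : F.C.V} {r : ℕ} (c : F.δ.Chain X (single v) r)
    (t : P.Tensor X) : (pushChain ε c t).value = t.sign • P.chainMap ε c t.deg
      (MultilinearMap.ofSubsingleton k (P.obj v) (P.obj v) (0 : Fin 1) LinearMap.id) t.val :=
  pushChain_eq_chainMap c t
    (MultilinearMap.ofSubsingleton k (P.obj v) (P.obj v) (0 : Fin 1) LinearMap.id)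

end PreGradedOp

/-! ### Admissible morphisms on operations -/

namespace ColoredOperad

variable {C : ColoredOperad.{u}}

theorem pre_unit {v w z : C.V} (a : C.Hom (fun _ : Unit => v) w) (b : C.Hom (fun _ : Unit => w) z) :
    pre (fun _ => a) b = post a b := by
  refine congrArg (subst (x := fun _ : Unit => v) b fun _ => ()) (funext fun j => ?_)
  refine ((eq_unaryAt_iff (x := fun _ : Unit => v) j _ _).2 ?_).symm
  refine (C.map_map (x := fun _ : Unit => v) _ _ _).trans ?_
  exact C.map_refl a

theorem post_iso_symm {I : Type} [Finite I] {x : I → C.V} {v w : C.V} (f : C.Hom x v)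
    (σ : single v ≅ single w) : post (post f (uop σ.hom)) (uop σ.inv) = f := by
  rw [post_post, ← uop_comp, σ.hom_inv_id, uop_id, post_one]

theorem post_symm_iso {I : Type} [Finite I] {x : I → C.V} {v w : C.V} (f : C.Hom x w)
    (σ : single v ≅ single w) : post (post f (uop σ.inv)) (uop σ.hom) = f := by
  rw [post_post, ← uop_comp, σ.inv_hom_id, uop_id, post_one]

theorem post_iso_injective {I : Type} [Finite I] {x : I → C.V} {v w : C.V} {f f' : C.Hom x v}
    {σ : single v ≅ single w} (h : post f (uop σ.hom) = post f' (uop σ.hom)) : f = f' := by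
  rw [← post_iso_symm f σ, h, post_iso_symm]

theorem pre_iso_symm {I : Type} [Finite I] {x' x : I → C.V} {v : C.V}
    (τ : ∀ i, single (x' i) ≅ single (x i)) (f : C.Hom x v) :
    pre (fun i => uop (τ i).inv) (pre (fun i => uop (τ i).hom) f) = f := by
  rw [pre_pre]
  refine Eq.trans (congrArg (fun a => pre a f) (funext fun i => ?_)) (pre_one f)
  rw [← uop_comp, (τ i).inv_hom_id, uop_id]

end ColoredOperad

namespace CubicalFeynmanCategory

theorem exists_iso_of_deg {v w : F.C.V} (a : F.C.Hom (fun _ : Unit => v) w)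
    (h : F.δ.deg a = 0) : ∃ σ : single v ≅ single w, uop σ.hom = a := by
  obtain ⟨m, rfl⟩ := uop_surjective a
  have hm : F.δ.degree m = 0 := by
    rw [← F.δ.deg_toOp]
    exact (F.δ.deg_map (J := Fin 1) _ _).symm.trans h
  have := (F.degree_eq_zero_iff m).1 hm
  exact ⟨asIso m, rfl⟩

theorem finite_iso (v w : F.C.V) : Finite (single v ≅ single w) := by
  rcases isEmpty_or_nonempty (single v ≅ single w) with h | ⟨⟨σ⟩⟩
  · infer_instance
  · obtain rfl := F.isFeynman.skeletal v w ⟨σ⟩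
    exact F.isFeynman.finite_aut v

theorem card_aut_pos (v : F.C.V) : 0 < Nat.card (Aut (single v)) := by
  have := F.isFeynman.finite_aut v
  exact Nat.card_pos

theorem letters_isIso {n : ℕ} {x' x : Fin n → F.C.V} (τ : ∀ i, single (x' i) ≅ single (x i)) :
    IsIso (letters (fun i => uop (τ i).hom)) := by
  rw [← F.degree_eq_zero_iff]
  refine sum_eq_zero fun i _ => ?_
  exact (F.δ.deg_unaryAt (x := x') i _).trans (F.δ.deg_uop (τ i))

/-- The isomorphism of words of the same length given by isomorphisms of the letters. -/
noncomputable def lettersIso {n : ℕ} {x' x : Fin n → F.C.V}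
    (τ : ∀ i, single (x' i) ≅ single (x i)) : (⟨n, x'⟩ : F.C.Word) ≅ ⟨n, x⟩ :=
  @asIso _ _ _ _ (letters (fun i => uop (τ i).hom)) (letters_isIso τ)

theorem iso_bijective {X Y : F.C.Word} (σ : X ≅ Y) : Bijective (WordHom.π σ.hom) := by
  refine ⟨Function.LeftInverse.injective (g := WordHom.π σ.inv) fun i => ?_,
    Function.RightInverse.surjective (g := WordHom.π σ.inv) fun i => ?_⟩
  · exact congrFun (congrArg WordHom.π σ.hom_inv_id) i
  · exact congrFun (congrArg WordHom.π σ.inv_hom_id) i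

end CubicalFeynmanCategory

namespace CubicalMorphism

variable {F₁ F₂ : CubicalFeynmanCategory.{u}} (φ : CubicalMorphism F₁ F₂)

/-- The action of a morphism on isomorphisms of vertices. -/
def mapV {w w' : F₁.C.V} (l : single w ≅ single w') : single (φ.onV w) ≅ single (φ.onV w') :=
  φ.functor.mapIso l

theorem mapV_trans {w w' w'' : F₁.C.V} (l : single w ≅ single w') (l' : single w' ≅ single w'') :
    φ.mapV (l ≪≫ l') = φ.mapV l ≪≫ φ.mapV l' :=
  φ.functor.mapIso_trans _ _

theorem mapV_symm {w w' : F₁.C.V} (l : single w ≅ single w') :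
    φ.mapV l.symm = (φ.mapV l).symm := rfl

theorem onHom_toOp {X : F₁.C.Word} {w : F₁.C.V} (f : X ⟶ single w) :
    φ.onHom (toOp f) = toOp (φ.mapSingle f) :=
  φ.onHom_map _ _

theorem onHom_uop {w w' : F₁.C.V} (l : single w ≅ single w') :
    φ.onHom (uop l.hom) = uop (φ.mapV l).hom :=
  (φ.onHom_map (J := Fin 1) _ _).trans (congrArg (F₂.C.map (J := Fin 1) _) (φ.onHom_toOp l.hom))

theorem onHom_post {I : Type} [Finite I] {x : I → F₁.C.V} {v w : F₁.C.V} (f : F₁.C.Hom x v)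
    (a : F₁.C.Hom (fun _ : Unit => v) w) :
    φ.onHom (post f a) = post (φ.onHom f) (φ.onHom a) := by
  refine (φ.onHom_subst _ _ _).trans ?_
  refine congrArg (subst (x := fun i => φ.onV (x i)) (φ.onHom a) fun _ => ()) (funext fun j => ?_)
  exact φ.onHom_map _ _

theorem onHom_pre {I : Type} [Finite I] {x' x : I → F₁.C.V} {v : F₁.C.V}
    (a : ∀ i, F₁.C.Hom (fun _ : Unit => x' i) (x i)) (f : F₁.C.Hom x v) :
    φ.onHom (pre a f) = pre (x' := fun i => φ.onV (x' i)) (x := fun i => φ.onV (x i))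
      (fun i => φ.onHom (a i)) (φ.onHom f) := by
  refine (φ.onHom_subst _ _ _).trans ?_
  refine congrArg (subst (x := fun i => φ.onV (x' i)) (φ.onHom f) fun i => i) (funext fun i => ?_)
  refine (eq_unaryAt_iff (x := fun i => φ.onV (x' i)) i _ _).2 ?_
  exact (φ.onHom_map _ _).symm.trans (congrArg φ.onHom (map_unaryAt (x := x') i (a i)))

theorem map_ofOp {X : F₁.C.Word} {w : F₁.C.V} (f : F₁.C.Hom X.x w) :
    φ.mapSingle (ofOp f) = ofOp (X := φ.functor.obj X) (φ.onHom f) := by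
  refine wordHom_single_ext ?_
  rw [← φ.onHom_toOp, toOp_ofOp]
  exact (toOp_ofOp (X := φ.functor.obj X) (φ.onHom f)).symm

variable {φ}

namespace Admissible

theorem onHom_injective (hφ : φ.Admissible) {I : Type} [Finite I] {x : I → F₁.C.V} {w : F₁.C.V}
    {g g' : F₁.C.Hom x w} (h : φ.onHom g = φ.onHom g') : g = g' := by
  have := hφ.faithful
  obtain ⟨n, ⟨e⟩⟩ := Finite.exists_equiv_fin I
  refine map_injective e.symm ?_
  have h1 : φ.mapSingle (ofOp (X := ⟨n, fun i => x (e.symm i)⟩) (F₁.C.map e.symm g)) =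
      φ.mapSingle (ofOp (X := ⟨n, fun i => x (e.symm i)⟩) (F₁.C.map e.symm g')) := by
    rw [φ.map_ofOp, φ.map_ofOp]
    congr 1
    exact (φ.onHom_map _ _).trans ((congrArg _ h).trans (φ.onHom_map _ _).symm)
  have h2 := congrArg toOp (φ.functor.map_injective h1)
  rwa [toOp_ofOp, toOp_ofOp] at h2

theorem mapV_injective (hφ : φ.Admissible) {w w' : F₁.C.V} {l l' : single w ≅ single w'}
    (h : φ.mapV l = φ.mapV l') : l = l' := by
  have := hφ.faithful
  exact φ.functor.mapIso_injective h

/-- Cancellation for isomorphisms of vertices. -/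
theorem cancel_op (hφ : φ.Admissible) {I : Type} [Finite I] {x : I → F₁.C.V} {w w' : F₁.C.V}
    (b : F₁.C.Hom x w) (b' : F₁.C.Hom x w') (ρ : single (φ.onV w) ≅ single (φ.onV w'))
    (h : φ.onHom b' = post (φ.onHom b) (uop ρ.hom)) : ∃ l : single w ≅ single w', φ.mapV l = ρ := by
  obtain ⟨n, ⟨e⟩⟩ := Finite.exists_equiv_fin I
  have h1 : φ.mapSingle (ofOp (X := ⟨n, fun i => x (e.symm i)⟩) (F₁.C.map e.symm b')) =
      φ.mapSingle (ofOp (X := ⟨n, fun i => x (e.symm i)⟩) (F₁.C.map e.symm b)) ≫ ρ.hom := by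
    refine wordHom_single_ext ?_
    rw [toOp_comp_uop, φ.map_ofOp, φ.map_ofOp]
    refine (toOp_ofOp _).trans (Eq.trans ?_ (congrArg (fun a => post a (uop ρ.hom)) (toOp_ofOp _).symm))
    refine (φ.onHom_map _ _).trans ((congrArg _ h).trans ((map_post _ _ _).trans ?_))
    exact congrArg (fun a => post a (uop ρ.hom)) (φ.onHom_map _ _).symm
  obtain ⟨l, hl⟩ := hφ.cancel _ _ _ h1
  have : IsIso l := (F₁.degree_eq_zero_iff l).1 (by
    rw [← φ.degree_map, hl]; exact F₂.δ.degree_iso ρ)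
  exact ⟨asIso l, Iso.ext hl⟩

/-- The factorization axiom, with the isomorphism of words reduced to isomorphisms of letters. -/
theorem factor_word (hφ : φ.Admissible) {X : F₁.C.Word} {w : F₁.C.V} {Y : F₂.C.Word}
    (c : F₁.C.Hom X.x w) (h : φ.functor.obj X ⟶ Y) (f : F₂.C.Hom Y.x (φ.onV w))
    (hc : φ.onHom c = subst f (WordHom.π h) (WordHom.g h)) :
    ∃ (z : Fin Y.n → F₁.C.V) (τ : ∀ j, single (φ.onV (z j)) ≅ single (Y.x j))
      (b : ∀ j, F₁.C.Hom (fun i : {i : Fin X.n // WordHom.π h i = j} => X.x i.1) (z j))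
      (a : F₁.C.Hom z w),
      (∀ j, WordHom.g h j = post (φ.onHom (b j)) (uop (τ j).hom)) ∧
        φ.onHom a = pre (fun j => uop (τ j).hom) f := by
  have h1 : φ.mapSingle (ofOp c) = h ≫ ofOp f := by
    refine wordHom_single_ext ?_
    rw [toOp_comp, toOp_ofOp, φ.map_ofOp]
    exact (toOp_ofOp _).trans hc
  obtain ⟨Y', g₂, g₁, σ, -, h2, h3⟩ := hφ.factor (Z := single w) (ofOp c) h (ofOp f) h1
  have h4 : σ.hom ≫ ofOp f = φ.mapSingle g₁ :=
    (congrArg (σ.hom ≫ ·) h3).trans (Iso.hom_inv_id_assoc σ _)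
  subst h2
  let e : Fin Y.n ≃ Fin Y'.n := (Equiv.ofBijective _ (F₂.iso_bijective σ)).symm
  have he : ∀ j, WordHom.π σ.hom (e j) = j :=
    (Equiv.ofBijective _ (F₂.iso_bijective σ)).apply_symm_apply
  have he' : ∀ s, e (WordHom.π σ.hom s) = s :=
    (Equiv.ofBijective _ (F₂.iso_bijective σ)).symm_apply_apply
  have hτ : ∀ j, ∃ τ : single (φ.onV (Y'.x (e j))) ≅ single (Y.x j), uop τ.hom =
      F₂.C.map (x := fun s : {s : Fin Y'.n // WordHom.π σ.hom s = j} => φ.onV (Y'.x s.1))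
        (⟨fun _ => ⟨e j, he j⟩, fun _ => (), fun _ => rfl, fun s => Subtype.ext (by
      rw [← he' s.1, s.2])⟩ : Unit ≃ {s // WordHom.π σ.hom s = j}) (WordHom.g σ.hom j) := by
    intro j
    refine F₂.exists_iso_of_deg (v := φ.onV (Y'.x (e j))) _ ((F₂.δ.deg_map _ _).trans ?_)
    exact sum_eq_zero_iff.1 (F₂.δ.degree_iso σ) j (mem_univ j)
  choose τ hτ using hτ
  have hfib : ∀ (j : Fin Y.n) (i : Fin X.n), WordHom.π (φ.functor.map g₂ ≫ σ.hom) i = j ↔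
      WordHom.π (X := X) (Y := Y') g₂ i = e j := by
    intro j i
    change WordHom.π σ.hom (WordHom.π (X := X) (Y := Y') g₂ i) = j ↔ _
    refine e.apply_eq_iff_eq.symm.trans ?_
    exact Eq.congr (he' _) rfl
  refine ⟨fun j => Y'.x (e j), τ, fun j => F₁.C.map (Equiv.subtypeEquivRight (hfib j))
    (WordHom.g g₂ (e j)), F₁.C.map e (toOp g₁), fun j => ?_, ?_⟩
  · rw [hτ]
    let A := {i : Fin X.n // WordHom.π (φ.functor.map g₂ ≫ σ.hom) i = j}
    have h5 := subst_reindex (I := A) (J := {s : Fin Y'.n // WordHom.π σ.hom s = j})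
      (x := fun i : A => φ.onV (X.x i.1)) (WordHom.g σ.hom j)
      (fun i : A => (⟨WordHom.π (X := X) (Y := Y') g₂ i.1, i.2⟩ : {s : Fin Y'.n // WordHom.π σ.hom s = j}))
      (fun s => F₂.C.map (fiberEquiv (WordHom.π (X := X) (Y := Y') g₂) (WordHom.π (X := φ.functor.obj Y') (Y := Y) σ.hom) j s)
        (WordHom.g (φ.functor.map g₂) s.1)) (Equiv.refl _)
      (⟨fun _ => ⟨e j, he j⟩, fun _ => (), fun _ => rfl, fun s => Subtype.ext (by
      rw [← he' s.1, s.2])⟩ : Unit ≃ {s : Fin Y'.n // WordHom.π σ.hom s = j}) (fun _ => ())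
      (fun i => Subtype.ext ((hfib j i.1).1 i.2).symm)
    refine ((F₂.C.map_refl (I := A) _).symm.trans h5).trans ?_
    refine congrArg (subst (x := fun i : A => φ.onV (X.x i.1)) _ fun _ => ()) (funext fun s => ?_)
    refine (F₂.C.map_map (x := fun i : {i : Fin X.n // WordHom.π (X := X) (Y := Y') g₂ i = e j} => φ.onV (X.x i.1)) _ _ _).trans ?_
    refine Eq.trans ?_ (congrArg (F₂.C.map (I := {i : A // () = s}) (J := A)
      (x := fun i : A => φ.onV (X.x i.1)) (subtypeUnivEquiv fun _ => rfl))
      (φ.onHom_map (Equiv.subtypeEquivRight (hfib j)) (WordHom.g g₂ (e j))).symm)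
    exact (F₂.C.map_map (I := {i : A // () = s}) (J := A)
      (x := fun i : {i : Fin X.n // WordHom.π (X := X) (Y := Y') g₂ i = e j} => φ.onV (X.x i.1))
      (subtypeUnivEquiv fun _ => rfl) (Equiv.subtypeEquivRight (hfib j))
      (φ.onHom (WordHom.g g₂ (e j)))).symm
  · have h6 := congrArg toOp h4
    rw [toOp_comp, toOp_ofOp, ← φ.onHom_toOp] at h6
    refine (φ.onHom_map (I := Fin Y.n) (J := Fin Y'.n) (x := Y'.x) e (toOp g₁)).trans
      ((congrArg (F₂.C.map (I := Fin Y.n) (J := Fin Y'.n) (x := fun s : Fin Y'.n => φ.onV (Y'.x s)) e)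
      h6.symm).trans ?_)
    refine (subst_reindex (I := Fin Y'.n) (x := fun s : Fin Y'.n => φ.onV (Y'.x s)) f (WordHom.π (X := φ.functor.obj Y') (Y := Y) σ.hom) (WordHom.g σ.hom) (e : Fin Y.n ≃ Fin Y'.n)
      (Equiv.refl (Fin Y.n)) (fun j => j) (fun j => (he j).symm)).trans ?_
    refine (congrArg (fun a => subst (x := fun j => φ.onV (Y'.x (e j))) a (fun j => j) _)
      (F₂.C.map_refl f)).trans ?_
    refine congrArg (subst (x := fun j => φ.onV (Y'.x (e j))) f fun j => j) (funext fun j => ?_)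
    refine (eq_unaryAt_iff (x := fun j => φ.onV (Y'.x (e j))) j _ _).2 ?_
    refine Eq.trans ?_ (hτ j).symm
    exact F₂.C.map_map (x := fun s : {s : Fin Y'.n // WordHom.π σ.hom s = j} => φ.onV (Y'.x s.1)) _ _ _

end Admissible

/-! ### Lifts of vertices -/

instance finite_lift (φ : CubicalMorphism F₁ F₂) (v : F₂.C.V) : Finite (φ.Lift v) := by
  have := φ.finite_fiber v
  have h : ∀ w : {w // φ.onV w = v}, Finite (single (φ.onV w.1) ≅ single v) := fun w =>
    F₂.finite_iso _ _
  refine Finite.of_injective (β := Σ w : {w // φ.onV w = v}, (single (φ.onV w.1) ≅ single v))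
    (fun t => ⟨⟨t.1, F₂.isFeynman.skeletal _ _ ⟨t.2⟩⟩, t.2⟩) ?_
  rintro ⟨w, σ⟩ ⟨w', σ'⟩ h
  simp only [Sigma.mk.injEq, Subtype.mk.injEq] at h
  obtain ⟨rfl, h⟩ := h
  exact congrArg (Sigma.mk w) (by simpa using h)

noncomputable instance fintypeLift (φ : CubicalMorphism F₁ F₂) (v : F₂.C.V) :
    Fintype (φ.Lift v) := ofFinite _

variable (φ)

/-- Two lifts of a vertex are related by an isomorphism of vertices. -/
def Conn {v : F₂.C.V} (t t' : φ.Lift v) : Prop :=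
  ∃ l : single t.1 ≅ single t'.1, φ.mapV l ≪≫ t'.2 = t.2

variable {φ}

theorem Conn.symm {v : F₂.C.V} {t t' : φ.Lift v} (h : φ.Conn t t') : φ.Conn t' t := by
  obtain ⟨l, hl⟩ := h
  refine ⟨l.symm, ?_⟩
  rw [← hl, mapV_symm, Iso.symm_self_id_assoc]

variable (k φ) in
/-- The weight of a lift of a vertex. -/
noncomputable def liftWeight {v : F₂.C.V} (t : φ.Lift v) : k := (Nat.card (Aut (single t.1)) : k)⁻¹

open Classical in
theorem sum_conn [CharZero k] (hφ : φ.Admissible) {v : F₂.C.V} (t : φ.Lift v) :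
    ∑ t' : φ.Lift v, (if φ.Conn t t' then liftWeight k φ t' else 0) = 1 := by
  have := F₁.isFeynman.finite_aut t.1
  have := ofFinite (Aut (single t.1))
  let e : Aut (single t.1) → φ.Lift v := fun l => ⟨t.1, (φ.mapV l).symm ≪≫ t.2⟩
  have he : Function.Injective e := by
    intro l l' h
    have h1 : (φ.mapV l).symm ≪≫ t.2 = (φ.mapV l').symm ≪≫ t.2 := eq_of_heq (Sigma.mk.inj h).2
    have h2 : (φ.mapV l).symm = (φ.mapV l').symm := by
      have := congrArg (· ≪≫ t.2.symm) h1
      simpa using this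
    exact hφ.mapV_injective (Iso.symm_eq_iff.1 h2)
  have hs : (Finset.univ.filter fun t' => φ.Conn t t') = Finset.univ.map ⟨e, he⟩ := by
    ext t'
    simp only [Finset.mem_filter, mem_univ, true_and, Finset.mem_map, Function.Embedding.coeFn_mk]
    constructor
    · rintro ⟨l, hl⟩
      obtain ⟨w', σ'⟩ := t'
      obtain rfl := F₁.isFeynman.skeletal _ _ ⟨l⟩
      refine ⟨l, ?_⟩
      simp only [e]
      rw [← hl, Iso.symm_self_id_assoc]
    · rintro ⟨l, rfl⟩
      exact ⟨l, by simp [e]⟩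
  rw [← sum_filter, hs, Finset.sum_map]
  have hc : ∀ l, liftWeight k φ (e l) = (Nat.card (Aut (single t.1)) : k)⁻¹ := fun _ => rfl
  simp only [Function.Embedding.coeFn_mk, hc, Finset.sum_const, Finset.card_univ,
    ← Nat.card_eq_fintype_card, nsmul_eq_mul]
  exact mul_inv_cancel₀ (Nat.cast_ne_zero.2 (F₁.card_aut_pos t.1).ne')

open Classical in
theorem sum_pi_conn [CharZero k] (hφ : φ.Admissible) {I : Type} [Fintype I] {x : I → F₂.C.V}
    (τ : ∀ i, φ.Lift (x i)) :
    ∑ τ' : ∀ i, φ.Lift (x i), (if ∀ i, φ.Conn (τ i) (τ' i) then ∏ i, liftWeight k φ (τ' i) else 0) =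
      1 := by
  have h := Finset.prod_univ_sum (fun i => (Finset.univ : Finset (φ.Lift (x i))))
    (fun i t' => if φ.Conn (τ i) t' then liftWeight k φ t' else 0)
  rw [prod_congr rfl fun i _ => sum_conn hφ (τ i), Finset.prod_const_one] at h
  rw [h, Fintype.piFinset_univ]
  refine sum_congr rfl fun τ' _ => ?_
  split_ifs with h1
  · exact prod_congr rfl fun i _ => (if_pos (h1 i)).symm
  · push Not at h1
    obtain ⟨i, hi⟩ := h1
    exact (Finset.prod_eq_zero (mem_univ i) (if_neg hi)).symm

end CubicalMorphism

/-! ### Lifts of operations -/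

namespace CubicalMorphism

variable {F₁ F₂ : CubicalFeynmanCategory.{u}} (φ : CubicalMorphism F₁ F₂)

/-- The operation `g` lifts `f`, for given lifts of its inputs and output. -/
def IsLift {I : Type} [Finite I] {x : I → F₂.C.V} {v : F₂.C.V} (f : F₂.C.Hom x v)
    (s : ∀ i, φ.Lift (x i)) (t : φ.Lift v) (g : F₁.C.Hom (fun i => (s i).1) t.1) : Prop :=
  post (φ.onHom g) (uop t.2.hom) = pre (x' := fun i => φ.onV (s i).1) (fun i => uop (s i).2.hom) f

variable {φ}

section Lift

variable {I : Type} [Finite I] {x : I → F₂.C.V} {v : F₂.C.V} {f : F₂.C.Hom x v}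
  {s : ∀ i, φ.Lift (x i)} {t : φ.Lift v} {g : F₁.C.Hom (fun i => (s i).1) t.1}

theorem IsLift.deg_eq (h : φ.IsLift f s t g) : F₁.δ.deg g = F₂.δ.deg f := by
  have h1 := congrArg (fun a => F₂.δ.deg a) h
  simp only [F₂.δ.deg_post_iso, φ.deg_onHom] at h1
  exact h1.trans (F₂.δ.deg_pre_iso (fun i => (s i).2) f)

theorem IsLift.unique (hφ : φ.Admissible) {g' : F₁.C.Hom (fun i => (s i).1) t.1}
    (h : φ.IsLift f s t g) (h' : φ.IsLift f s t g') : g = g' :=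
  hφ.onHom_injective (post_iso_injective (σ := t.2) (Eq.trans h (Eq.symm h')))

theorem IsLift.post {t' : φ.Lift v} (h : φ.IsLift f s t g) (l : single t.1 ≅ single t'.1)
    (hl : φ.mapV l ≪≫ t'.2 = t.2) : φ.IsLift f s t' (post g (uop l.hom)) := by
  unfold IsLift at h ⊢
  rw [φ.onHom_post, φ.onHom_uop, post_post, ← uop_comp]
  exact (congrArg (fun a : single _ ≅ single _ => ColoredOperad.post (φ.onHom g) (uop a.hom)) hl).trans h

theorem IsLift.pre {s' : ∀ i, φ.Lift (x i)} (h : φ.IsLift f s t g)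
    (l : ∀ i, single (s' i).1 ≅ single (s i).1) (hl : ∀ i, φ.mapV (l i) ≪≫ (s i).2 = (s' i).2) :
    φ.IsLift f s' t (pre (x' := fun i => (s' i).1) (fun i => uop (l i).hom) g) := by
  unfold IsLift at h ⊢
  rw [φ.onHom_pre, ← pre_post, h]
  refine (pre_pre _ _ _).trans ?_
  refine congrArg (fun a => ColoredOperad.pre a f) (funext fun i => ?_)
  rw [φ.onHom_uop, ← uop_comp]
  exact congrArg (fun a : single _ ≅ single _ => uop a.hom) (hl i)

theorem IsLift.conn (hφ : φ.Admissible) {t' : φ.Lift v} {g' : F₁.C.Hom (fun i => (s i).1) t'.1}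
    (h : φ.IsLift f s t g) (h' : φ.IsLift f s t' g') : φ.Conn t t' := by
  obtain ⟨l, hl⟩ := hφ.cancel_op g g' (t.2 ≪≫ t'.2.symm) (by
    have h1 := h.trans h'.symm
    rw [← post_iso_symm (φ.onHom g') t'.2, ← h1, post_post, ← uop_comp]
    rfl)
  exact ⟨l, by rw [hl]; simp⟩

theorem IsLift.map {I' : Type} [Finite I'] (e : I' ≃ I) (h : φ.IsLift f s t g) :
    φ.IsLift (F₂.C.map e f) (fun i => s (e i)) t (F₁.C.map e g) := by
  unfold IsLift at h ⊢
  rw [φ.onHom_map]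
  refine (map_post e (φ.onHom g) _).symm.trans ((congrArg (F₂.C.map e) h).trans ?_)
  exact map_pre (x' := fun i => φ.onV (s i).1) e _ f

theorem isLift_map_iff {I' : Type} [Finite I'] (e : I' ≃ I) {g : F₁.C.Hom (fun i => (s i).1) t.1} :
    φ.IsLift (F₂.C.map e f) (fun i => s (e i)) t (F₁.C.map e g) ↔ φ.IsLift f s t g := by
  refine ⟨fun h => ?_, IsLift.map e⟩
  unfold IsLift at h ⊢
  refine map_injective (x := fun i => φ.onV (s i).1) e ?_
  refine (map_post e (φ.onHom g) _).trans (Eq.trans ?_ (map_pre (x' := fun i => φ.onV (s i).1) e _ f).symm)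
  rw [← h, φ.onHom_map]

end Lift

theorem IsLift.subst {I J : Type} [Finite I] [Finite J] {x : I → F₂.C.V} {y : J → F₂.C.V}
    {v : F₂.C.V} {f : F₂.C.Hom y v} {π : I → J}
    {g : ∀ j, F₂.C.Hom (fun i : {i // π i = j} => x i) (y j)} {s : ∀ i, φ.Lift (x i)}
    {r : ∀ j, φ.Lift (y j)} {t : φ.Lift v} {a : F₁.C.Hom (fun j => (r j).1) t.1}
    {b : ∀ j, F₁.C.Hom (fun i : {i // π i = j} => (s i).1) (r j).1} (ha : φ.IsLift f r t a)
    (hb : ∀ j, φ.IsLift (g j) (fun i : {i // π i = j} => s i) (r j) (b j)) :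
    φ.IsLift (subst f π g) s t (subst (x := fun i => (s i).1) a π b) := by
  unfold IsLift at ha ⊢
  rw [φ.onHom_subst, post_subst, ha]
  refine (subst_pre (x := fun i => φ.onV (s i).1) _ f π _).trans
    (Eq.trans ?_ (pre_subst (x' := fun i => φ.onV (s i).1) _ f π g).symm)
  exact congrArg (ColoredOperad.subst (x := fun i => φ.onV (s i).1) f π) (funext fun j => hb j)

theorem IsLift.factor (hφ : φ.Admissible) {n m : ℕ} {x : Fin n → F₂.C.V} {y : Fin m → F₂.C.V}
    {v : F₂.C.V} {f : F₂.C.Hom y v} {π : Fin n → Fin m}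
    {g : ∀ j, F₂.C.Hom (fun i : {i // π i = j} => x i) (y j)} {s : ∀ i, φ.Lift (x i)}
    {t : φ.Lift v} {c : F₁.C.Hom (fun i => (s i).1) t.1} (h : φ.IsLift (ColoredOperad.subst f π g) s t c) :
    ∃ (r : ∀ j, φ.Lift (y j)) (a : F₁.C.Hom (fun j => (r j).1) t.1)
      (b : ∀ j, F₁.C.Hom (fun i : {i // π i = j} => (s i).1) (r j).1), φ.IsLift f r t a ∧
        ∀ j, φ.IsLift (g j) (fun i : {i // π i = j} => s i) (r j) (b j) := by
  obtain ⟨z, τ, b, a, hb, ha⟩ := hφ.factor_word (X := ⟨n, fun i => (s i).1⟩) (Y := ⟨m, y⟩) c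
    (WordHom.mk π fun j => ColoredOperad.pre (x' := fun i : {i // π i = j} => φ.onV (s i.1).1)
      (fun i => uop (s i.1).2.hom) (g j)) (ColoredOperad.post f (uop t.2.inv)) (by
      rw [← post_iso_symm (φ.onHom c) t.2, h]
      refine (congrArg (fun a : F₂.C.Hom (fun i => φ.onV (s i).1) v =>
        ColoredOperad.post a (uop t.2.inv)) (pre_subst (I := Fin n) (x' := fun i => φ.onV (s i).1)
          (fun i => uop (s i).2.hom) f π g)).trans ?_
      exact post_subst (I := Fin n) (J := Fin m) (x := fun i => φ.onV (s i).1) f π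
        (fun j => ColoredOperad.pre (x' := fun i : {i // π i = j} => φ.onV (s i.1).1)
          (fun i => uop (s i.1).2.hom) (g j)) (uop t.2.inv))
  refine ⟨fun j => ⟨z j, τ j⟩, a, b, ?_, fun j => (hb j).symm⟩
  unfold IsLift
  rw [ha, ← pre_post]
  exact congrArg (ColoredOperad.pre (x' := fun j => φ.onV (z j)) fun j => uop (τ j).hom)
    (post_symm_iso f t.2)

/-! ### The action on families over the lifts -/

variable (φ)

open Classical in
/-- The value on lifted inputs of the lift of an operation, and zero if there is no lift. -/
noncomputable def liftAct (P : PreGradedOp k F₁) {I : Type} [Finite I] [LinearOrder I] {x : I → F₂.C.V}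
    {v : F₂.C.V} (f : F₂.C.Hom x v) (hf : F₂.δ.deg f ≤ 1) (s : ∀ i, φ.Lift (x i))
    (t : φ.Lift v) : MultilinearMap k (fun i => P.obj (s i).1) (P.obj t.1) :=
  if h : ∃ g, φ.IsLift f s t g then P.act h.choose (h.choose_spec.deg_eq.trans_le hf) else 0

variable {φ} {P : PreGradedOp k F₁}

section LiftAct

variable {I : Type} [Finite I] [LinearOrder I] {x : I → F₂.C.V} {v : F₂.C.V} {f : F₂.C.Hom x v}
  {s : ∀ i, φ.Lift (x i)} {t : φ.Lift v} {g : F₁.C.Hom (fun i => (s i).1) t.1}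

theorem IsLift.liftAct_eq (hφ : φ.Admissible) (h : φ.IsLift f s t g) (hf : F₂.δ.deg f ≤ 1) :
    φ.liftAct P f hf s t = P.act g (h.deg_eq.trans_le hf) := by
  have h' : ∃ g, φ.IsLift f s t g := ⟨g, h⟩
  unfold liftAct
  rw [dif_pos h']
  exact MultilinearMap.ext fun p => PreGradedOp.act_congr (h'.choose_spec.unique hφ h) _ _ p

theorem liftAct_eq_zero (h : ¬∃ g, φ.IsLift f s t g) (hf : F₂.δ.deg f ≤ 1) :
    φ.liftAct P f hf s t = 0 := dif_neg h

variable (hP : P.Laws ε)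
include hP

theorem evIso_liftAct (hφ : φ.Admissible) (hf : F₂.δ.deg f ≤ 1) {t' : φ.Lift v}
    (l : single t.1 ≅ single t'.1) (hl : φ.mapV l ≪≫ t'.2 = t.2) (p : ∀ i, P.obj (s i).1) :
    P.evIso l (φ.liftAct P f hf s t p) = φ.liftAct P f hf s t' p := by
  by_cases h : ∃ g, φ.IsLift f s t g
  · obtain ⟨g, hg⟩ := h
    rw [hg.liftAct_eq hφ, (hg.post l hl).liftAct_eq hφ]
    exact (hP.act_post (x := fun i => (s i).1) g _ l _ p).symm
  · rw [liftAct_eq_zero h, liftAct_eq_zero (t := t')]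
    · exact map_zero _
    · rintro ⟨g, hg⟩
      exact h ⟨_, hg.post l.symm (by rw [← hl, mapV_symm, Iso.symm_self_id_assoc])⟩

theorem liftAct_evIso (hφ : φ.Admissible) (hf : F₂.δ.deg f ≤ 1) {s' : ∀ i, φ.Lift (x i)}
    (l : ∀ i, single (s' i).1 ≅ single (s i).1) (hl : ∀ i, φ.mapV (l i) ≪≫ (s i).2 = (s' i).2)
    (p : ∀ i, P.obj (s' i).1) :
    φ.liftAct P f hf s t (fun i => P.evIso (l i) (p i)) = φ.liftAct P f hf s' t p := by
  by_cases h : ∃ g, φ.IsLift f s t g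
  · obtain ⟨g, hg⟩ := h
    rw [hg.liftAct_eq hφ, (hg.pre l hl).liftAct_eq hφ]
    exact (hP.act_pre (x' := fun i => (s' i).1) l g _ _ p).symm
  · rw [liftAct_eq_zero h, liftAct_eq_zero (s := s')]
    · rfl
    · rintro ⟨g, hg⟩
      exact h ⟨_, hg.pre (fun i => (l i).symm) fun i => by
        rw [← hl, mapV_symm, Iso.symm_self_id_assoc]⟩

theorem liftAct_mem [Fintype I] (hf : F₂.δ.deg f ≤ 1) (n : I → ℤ) (p : ∀ i, P.obj (s i).1)
    (hp : ∀ i, p i ∈ (P.obj (s i).1).gr (n i)) :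
    φ.liftAct P f hf s t p ∈ (P.obj t.1).gr (∑ i, n i + ε.val * F₂.δ.deg f) := by
  unfold liftAct
  split_ifs with h
  · have := hP.act_mem h.choose (h.choose_spec.deg_eq.trans_le hf) n p hp
    have h1 : (F₁.δ.deg h.choose : ℤ) = F₂.δ.deg f := congrArg Nat.cast h.choose_spec.deg_eq
    rwa [h1] at this
  · exact Submodule.zero_mem _

theorem liftAct_map (hφ : φ.Admissible) {I' : Type} [Finite I'] [LinearOrder I'] (e : I' ≃o I)
    (hf : F₂.δ.deg f ≤ 1) (hf' : F₂.δ.deg (F₂.C.map e.toEquiv f) ≤ 1) (p : ∀ i, P.obj (s i).1) :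
    φ.liftAct P (F₂.C.map e.toEquiv f) hf' (fun i => s (e i)) t (fun i => p (e i)) =
      φ.liftAct P f hf s t p := by
  by_cases h : ∃ g, φ.IsLift f s t g
  · obtain ⟨g, hg⟩ := h
    rw [hg.liftAct_eq hφ]
    refine (congrArg (fun M : MultilinearMap k (fun i => P.obj (s (e i)).1) (P.obj t.1) =>
      M fun i => p (e i)) ((hg.map e.toEquiv).liftAct_eq hφ hf')).trans ?_
    exact hP.act_map (x := fun i => (s i).1) e g _ _ p
  · rw [liftAct_eq_zero h]
    refine (congrArg (fun M : MultilinearMap k (fun i => P.obj (s (e i)).1) (P.obj t.1) =>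
      M fun i => p (e i)) (liftAct_eq_zero ?_ hf')).trans rfl
    rintro ⟨g, hg⟩
    obtain ⟨g, rfl⟩ := (map_bijective (x := fun i => (s i).1) e.toEquiv).2 g
    exact h ⟨g, (isLift_map_iff e.toEquiv).1 hg⟩

end LiftAct

theorem liftAct_subst [CharZero k] (hP : P.Laws ε) (hφ : φ.Admissible) {m n : ℕ} {x : Fin m → F₂.C.V}
    {y : Fin n → F₂.C.V} {v : F₂.C.V} (f : F₂.C.Hom y v) (π : Fin m → Fin n)
    (g : ∀ j, F₂.C.Hom (fun i : {i // π i = j} => x i) (y j)) (hf : F₂.δ.deg f ≤ 1)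
    (hg : ∀ j, F₂.δ.deg (g j) ≤ 1) (h : F₂.δ.deg (subst f π g) ≤ 1) (s : ∀ i, φ.Lift (x i))
    (t : φ.Lift v) (d : Fin m → ℤ) (p : ∀ i, P.obj (s i).1)
    (hp : ∀ i, p i ∈ (P.obj (s i).1).gr (d i)) :
    φ.liftAct P (subst f π g) h s t p = koszulSign ε π (fun j => F₂.δ.deg (g j)) d •
      ∑ r : ∀ j, φ.Lift (y j), (∏ j, liftWeight k φ (r j)) • φ.liftAct P f hf r t (fun j =>
        φ.liftAct P (g j) (hg j) (fun i : {i // π i = j} => s i) (r j) (fun i => p i)) := by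
  classical
  by_cases hc : ∃ c, φ.IsLift (subst f π g) s t c
  · obtain ⟨c, hc⟩ := hc
    obtain ⟨r, a, b, ha, hb⟩ := hc.factor hφ
    have hsub := ha.subst (x := x) (s := s) hb
    have hcs := hc.unique hφ hsub
    have hterm : ∀ r' : ∀ j, φ.Lift (y j), (∏ j, liftWeight k φ (r' j)) • φ.liftAct P f hf r' t (fun j =>
        φ.liftAct P (g j) (hg j) (fun i : {i // π i = j} => s i) (r' j) (fun i => p i)) =
        (if ∀ j, φ.Conn (r j) (r' j) then ∏ j, liftWeight k φ (r' j) else 0) •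
          φ.liftAct P f hf r t (fun j =>
            φ.liftAct P (g j) (hg j) (fun i : {i // π i = j} => s i) (r j) (fun i => p i)) := by
      intro r'
      split_ifs with hr
      · congr 1
        choose l hl using hr
        rw [← liftAct_evIso hP hφ hf l hl]
        congr 1
        funext j
        exact (evIso_liftAct hP hφ (hg j) (l j) (hl j) _).symm
      · push Not at hr
        obtain ⟨j, hj⟩ := hr
        have : ¬∃ b', φ.IsLift (g j) (fun i : {i // π i = j} => s i) (r' j) b' := fun ⟨b', hb'⟩ =>
          hj ((hb j).conn hφ hb')
        rw [(φ.liftAct P f hf r' t).map_coord_zero j, smul_zero, zero_smul]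
        rw [liftAct_eq_zero this]
        rfl
    have hone : (∑ r' : ∀ j, φ.Lift (y j), if ∀ j, φ.Conn (r j) (r' j) then
        ∏ j, liftWeight k φ (r' j) else 0) = 1 := by
      convert sum_pi_conn (k := k) hφ r
    rw [sum_congr rfl fun r' _ => hterm r', ← sum_smul]
    refine Eq.trans ?_ (congrArg (fun c : k => koszulSign ε π (fun j => F₂.δ.deg (g j)) d • c •
      φ.liftAct P f hf r t fun j => φ.liftAct P (g j) (hg j) (fun i : {i // π i = j} => s i) (r j)
        fun i => p i) hone.symm)
    rw [one_smul, hc.liftAct_eq hφ, ha.liftAct_eq hφ]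
    refine (PreGradedOp.act_congr hcs _ (hsub.deg_eq.trans_le h) p).trans ?_
    refine (hP.act_subst (x := fun i => (s i).1) a π b (ha.deg_eq.trans_le hf)
      (fun j => (hb j).deg_eq.trans_le (hg j)) _ d p hp).trans ?_
    congr 1
    · congr 1
      exact funext fun j => (hb j).deg_eq
    · congr 1
      funext j
      rw [(hb j).liftAct_eq hφ]
  · rw [liftAct_eq_zero hc, sum_eq_zero, smul_zero]
    · rfl
    intro r _
    by_cases h1 : ∃ a, φ.IsLift f r t a
    · obtain ⟨a, ha⟩ := h1
      have h2 : ∃ j, ¬∃ b, φ.IsLift (g j) (fun i : {i // π i = j} => s i) (r j) b := by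
        by_contra! h2
        choose b hb using h2
        exact hc ⟨_, ha.subst (x := x) (s := s) hb⟩
      obtain ⟨j, hj⟩ := h2
      rw [(φ.liftAct P f hf r t).map_coord_zero j, smul_zero]
      rw [liftAct_eq_zero hj]
      rfl
    · rw [liftAct_eq_zero h1]
      exact smul_zero _

end CubicalMorphism

/-! ### The exceptional push-forward of graded objects -/

theorem koszulSign_orderIso {I J I' J' : Type} [Fintype I] [LinearOrder I] [Fintype J]
    [LinearOrder J] [Fintype I'] [LinearOrder I'] [Fintype J'] [LinearOrder J'] (ε : Parity)
    (e : I' ≃o I) (e' : J' ≃o J) (π : I → J) (δ : J → ℕ) (n : I → ℤ) :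
    koszulSign ε (fun i => e'.symm (π (e i))) (fun j => δ (e' j)) (fun i => n (e i)) =
      koszulSign ε π δ n := by
  unfold koszulSign
  congr 1
  · rw [← Equiv.prod_comp e.toEquiv]
    refine prod_congr rfl fun i _ => ?_
    rw [← Equiv.prod_comp e.toEquiv]
    refine prod_congr rfl fun i' _ => ?_
    simp
  · rw [← Equiv.prod_comp e.toEquiv]
    refine prod_congr rfl fun i _ => ?_
    rw [← Equiv.prod_comp e'.toEquiv]
    refine prod_congr rfl fun i' _ => ?_
    simp [OrderIso.symm_apply_lt]

namespace CubicalMorphism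

variable {F₁ F₂ : CubicalFeynmanCategory.{u}} (φ : CubicalMorphism F₁ F₂)

/-- Compatible families of elements over the lifts of a vertex. -/
def pushModule (P : PreGradedOp k F₁) (v : F₂.C.V) : Submodule k (∀ t : φ.Lift v, P.obj t.1) where
  carrier := {x | ∀ (t t' : φ.Lift v) (l : single t.1 ≅ single t'.1), φ.mapV l ≪≫ t'.2 = t.2 →
    P.evIso l (x t) = x t'}
  add_mem' hx hy t t' l hl := by
    simp only [Pi.add_apply, map_add, hx t t' l hl, hy t t' l hl]
  zero_mem' t t' l hl := map_zero _
  smul_mem' r x hx t t' l hl := by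
    simp only [Pi.smul_apply, map_smul, hx t t' l hl]

/-- The homogeneous families. -/
def pushGr (P : PreGradedOp k F₁) (v : F₂.C.V) (n : ℤ) : Submodule k (φ.pushModule P v) where
  carrier := {x | ∀ t, x.1 t ∈ (P.obj t.1).gr n}
  add_mem' hx hy t := Submodule.add_mem _ (hx t) (hy t)
  zero_mem' _ := Submodule.zero_mem _
  smul_mem' _ _ hx t := Submodule.smul_mem _ _ (hx t)

/-- Linear maps on the values that commute with isomorphisms act on compatible families. -/
def pushMap {P Q : PreGradedOp k F₁} (h : ∀ w, P.obj w →ₗ[k] Q.obj w)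
    (hh : ∀ {w w' : F₁.C.V} (l : single w ≅ single w') (p : P.obj w),
      Q.evIso l (h w p) = h w' (P.evIso l p)) (v : F₂.C.V) :
    φ.pushModule P v →ₗ[k] φ.pushModule Q v where
  toFun x := ⟨fun t => h t.1 (x.1 t), fun t t' l hl => by rw [hh, x.2 t t' l hl]⟩
  map_add' x y := Subtype.ext (funext fun t => map_add _ _ _)
  map_smul' r x := Subtype.ext (funext fun t => map_smul _ _ _)

/-- The value of the exceptional push-forward at a vertex. -/
noncomputable def pushObj {P : PreGradedOp k F₁} (hP : P.Laws ε) (v : F₂.C.V) : GrVect k where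
  carrier := φ.pushModule P v
  gr := φ.pushGr P v
  isInternal := by
    classical
    refine GrVect.isInternal_of_proj
      (fun n => φ.pushMap (fun w => (P.obj w).proj n) (fun l p => hP.evIso_proj l n p) v)
      (fun n x t => GrVect.proj_mem n _)
      (fun n x hx => Subtype.ext (funext fun t => GrVect.proj_of_mem (hx t)))
      (fun m n h x hx => Subtype.ext (funext fun t => GrVect.proj_of_mem_ne h (hx t))) ?_
    intro x
    choose s hs using fun t => GrVect.exists_sum_proj (x.1 t)
    refine ⟨Finset.univ.biUnion s, Subtype.ext (funext fun t => ?_)⟩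
    refine Eq.trans ?_ (hs t _ (Finset.subset_biUnion_of_mem s (mem_univ t)))
    rw [AddSubmonoidClass.coe_finsetSum, Finset.sum_apply]
    rfl

variable {φ} {P : PreGradedOp k F₁} (hP : P.Laws ε)

/-- The component of a family at a lift. -/
noncomputable def component {v : F₂.C.V} (t : φ.Lift v) : φ.pushObj hP v →ₗ[k] P.obj t.1 :=
  LinearMap.proj t ∘ₗ (φ.pushModule P v).subtype

theorem push_ext {v : F₂.C.V} {x y : φ.pushObj hP v} (h : ∀ t, component hP t x = component hP t y) :
    x = y := Subtype.ext (funext h)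

theorem evIso_component {v : F₂.C.V} {t t' : φ.Lift v} (l : single t.1 ≅ single t'.1)
    (hl : φ.mapV l ≪≫ t'.2 = t.2) (x : φ.pushObj hP v) :
    P.evIso l (component hP t x) = component hP t' x := x.2 t t' l hl

variable {I : Type} [Finite I] [LinearOrder I] {x : I → F₂.C.V} {v : F₂.C.V}

open Classical in
/-- The component at a lift of the action of an operation on families. -/
noncomputable def pushActAt (f : F₂.C.Hom x v) (hf : F₂.δ.deg f ≤ 1) (t : φ.Lift v) :
    MultilinearMap k (fun i => φ.pushObj hP (x i)) (P.obj t.1) :=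
  letI := ofFinite (∀ i, φ.Lift (x i))
  ∑ s : ∀ i, φ.Lift (x i), (∏ᶠ i, liftWeight k φ (s i)) •
    (φ.liftAct P f hf s t).compLinearMap fun i => component hP (s i)

theorem pushActAt_apply {I : Type} [Fintype I] [LinearOrder I] {x : I → F₂.C.V} {v : F₂.C.V}
    (f : F₂.C.Hom x v) (hf : F₂.δ.deg f ≤ 1) (t : φ.Lift v) (p : ∀ i, φ.pushObj hP (x i)) :
    pushActAt hP f hf t p = ∑ s : ∀ i, φ.Lift (x i), (∏ i, liftWeight k φ (s i)) •
      φ.liftAct P f hf s t (fun i => component hP (s i) (p i)) := by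
  unfold pushActAt
  rw [sum_apply]
  refine sum_congr (by ext; simp) fun s _ => ?_
  rw [finprod_eq_prod_of_fintype]
  rfl

variable (hφ : φ.Admissible)

/-- The action of an operation on families. -/
noncomputable def pushAct (f : F₂.C.Hom x v) (hf : F₂.δ.deg f ≤ 1) :
    MultilinearMap k (fun i => φ.pushObj hP (x i)) (φ.pushObj hP v) where
  toFun p := ⟨fun t => pushActAt hP f hf t p, fun t t' l hl => by
    have := ofFinite I
    simp only [pushActAt_apply, map_sum, map_smul]
    refine sum_congr rfl fun s _ => ?_
    rw [evIso_liftAct hP hφ hf l hl]⟩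
  map_update_add' p i a b := Subtype.ext (funext fun t => (pushActAt hP f hf t).map_update_add p i a b)
  map_update_smul' p i r a := Subtype.ext (funext fun t => (pushActAt hP f hf t).map_update_smul p i r a)

/-- The exceptional push-forward on underlying data. -/
noncomputable def pushPre : PreGradedOp k F₂ where
  obj := φ.pushObj hP
  act f hf := pushAct hP hφ f hf

theorem component_act {I : Type} [Fintype I] [LinearOrder I] {x : I → F₂.C.V} {v : F₂.C.V}
    (f : F₂.C.Hom x v) (hf : F₂.δ.deg f ≤ 1) (t : φ.Lift v) (p : ∀ i, φ.pushObj hP (x i)) :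
    component hP t ((pushPre hP hφ).act f hf p) = ∑ s : ∀ i, φ.Lift (x i),
      (∏ i, liftWeight k φ (s i)) • φ.liftAct P f hf s t (fun i => component hP (s i) (p i)) :=
  pushActAt_apply hP f hf t p

include hφ in
theorem conn_unique {v : F₂.C.V} {s t : φ.Lift v} {l l' : single s.1 ≅ single t.1}
    (h : φ.mapV l ≪≫ t.2 = s.2) (h' : φ.mapV l' ≪≫ t.2 = s.2) : l = l' := by
  apply hφ.mapV_injective
  have h3 := congrArg (· ≪≫ t.2.symm) (h.trans h'.symm)
  simpa using h3

open Classical in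
/-- The component at `t` of the class of an element over the lift `s`. -/
noncomputable def classComponent (P : PreGradedOp k F₁) {v : F₂.C.V} (s t : φ.Lift v) :
    P.obj s.1 →ₗ[k] P.obj t.1 :=
  if h : φ.Conn s t then P.evIso h.choose else 0

include hφ in
theorem classComponent_eq {v : F₂.C.V} {s t : φ.Lift v} (l : single s.1 ≅ single t.1)
    (hl : φ.mapV l ≪≫ t.2 = s.2) : classComponent P s t = P.evIso l := by
  have h : φ.Conn s t := ⟨l, hl⟩
  refine (dif_pos h).trans ?_
  exact congrArg P.evIso (conn_unique hφ (s := s) (t := t) h.choose_spec hl)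

theorem classComponent_eq_zero {v : F₂.C.V} {s t : φ.Lift v} (h : ¬φ.Conn s t) :
    classComponent P s t = 0 := dif_neg h

include hP hφ in
theorem evIso_classComponent {v : F₂.C.V} (s t t' : φ.Lift v) (l : single t.1 ≅ single t'.1)
    (hl : φ.mapV l ≪≫ t'.2 = t.2) (p : P.obj s.1) :
    P.evIso l (classComponent P s t p) = classComponent P s t' p := by
  by_cases h : φ.Conn s t
  · obtain ⟨l', hl'⟩ := h
    rw [classComponent_eq hφ l' hl', classComponent_eq hφ (l' ≪≫ l)
      (by rw [mapV_trans, Iso.trans_assoc, hl, hl']), hP.evIso_trans]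
  · have h' : ¬φ.Conn s t' := fun ⟨l', hl'⟩ => h ⟨l' ≪≫ l.symm, by
      rw [mapV_trans, Iso.trans_assoc, ← hl, mapV_symm, Iso.symm_self_id_assoc, hl']⟩
    rw [classComponent_eq_zero h, classComponent_eq_zero h']
    exact map_zero _

/-- The class of an element over a lift. -/
noncomputable def classAt {v : F₂.C.V} (s : φ.Lift v) : P.obj s.1 →ₗ[k] φ.pushObj hP v where
  toFun p := ⟨fun t => classComponent P s t p, fun t t' l hl =>
    evIso_classComponent hP hφ s t t' l hl p⟩
  map_add' _ _ := Subtype.ext (funext fun _ => map_add _ _ _)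
  map_smul' _ _ := Subtype.ext (funext fun _ => map_smul _ _ _)

theorem component_classAt {v : F₂.C.V} {s t : φ.Lift v} (l : single s.1 ≅ single t.1)
    (hl : φ.mapV l ≪≫ t.2 = s.2) (p : P.obj s.1) :
    component hP t (classAt hP hφ s p) = P.evIso l p := by
  exact congrArg (fun h : P.obj s.1 →ₗ[k] P.obj t.1 => h p) (classComponent_eq hφ l hl)

theorem component_classAt_zero {v : F₂.C.V} {s t : φ.Lift v} (h : ¬φ.Conn s t) (p : P.obj s.1) :
    component hP t (classAt hP hφ s p) = 0 :=
  congrArg (fun h : P.obj s.1 →ₗ[k] P.obj t.1 => h p) (classComponent_eq_zero h)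

theorem classAt_mem {v : F₂.C.V} (s : φ.Lift v) {n : ℤ} {p : P.obj s.1}
    (hp : p ∈ (P.obj s.1).gr n) : classAt hP hφ s p ∈ (φ.pushObj hP v).gr n := fun t => by
  by_cases h : φ.Conn s t
  · obtain ⟨l, hl⟩ := h
    have := component_classAt hP hφ l hl p
    refine (congrArg (· ∈ (P.obj t.1).gr n) this).mpr (hP.evIso_mem l hp)
  · have := component_classAt_zero hP hφ h p
    exact (congrArg (· ∈ (P.obj t.1).gr n) this).mpr (Submodule.zero_mem _)

theorem classAt_evIso {v : F₂.C.V} {s t : φ.Lift v} (l : single s.1 ≅ single t.1)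
    (hl : φ.mapV l ≪≫ t.2 = s.2) (p : P.obj s.1) :
    classAt hP hφ t (P.evIso l p) = classAt hP hφ s p := by
  refine push_ext hP fun r => ?_
  by_cases h : φ.Conn t r
  · obtain ⟨l', hl'⟩ := h
    rw [component_classAt hP hφ l' hl', component_classAt hP hφ (l ≪≫ l')
      (by rw [mapV_trans, Iso.trans_assoc, hl', hl]), hP.evIso_trans]
  · rw [component_classAt_zero hP hφ h, component_classAt_zero hP hφ]
    rintro ⟨l', hl'⟩
    exact h ⟨l.symm ≪≫ l', by rw [mapV_trans, Iso.trans_assoc, hl', ← hl, mapV_symm,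
      Iso.symm_self_id_assoc]⟩

theorem sum_classAt [CharZero k] {v : F₂.C.V} (x : φ.pushObj hP v) :
    ∑ t : φ.Lift v, liftWeight k φ t • classAt hP hφ t (component hP t x) = x := by
  classical
  refine push_ext hP fun t => ?_
  rw [map_sum]
  have h : ∀ s : φ.Lift v, component hP t (liftWeight k φ s • classAt hP hφ s (component hP s x)) =
      (if φ.Conn t s then liftWeight k φ s else 0) • component hP t x := by
    intro s
    rw [map_smul]
    split_ifs with hs
    · obtain ⟨l, hl⟩ := hs.symm
      rw [component_classAt hP hφ l hl, evIso_component hP l hl]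
    · rw [component_classAt_zero hP hφ (fun h => hs h.symm), smul_zero, zero_smul]
  rw [sum_congr rfl fun s _ => h s, ← sum_smul]
  have h1 := sum_conn (k := k) hφ t
  refine Eq.trans (congrArg (· • component hP t x) (Eq.trans ?_ h1)) (one_smul _ _)
  exact sum_congr rfl fun s _ => by congr

section ActClass

variable {I : Type} [Finite I] [LinearOrder I] {x : I → F₂.C.V} {v : F₂.C.V} (f : F₂.C.Hom x v)
  (hf : F₂.δ.deg f ≤ 1) (s : ∀ i, φ.Lift (x i)) (p : ∀ i, P.obj (s i).1)

theorem component_act_classAt [CharZero k] (t : φ.Lift v) :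
    component hP t ((pushPre hP hφ).act f hf fun i => classAt hP hφ (s i) (p i)) =
      φ.liftAct P f hf s t p := by
  classical
  have := ofFinite I
  rw [component_act]
  have h : ∀ s' : ∀ i, φ.Lift (x i), (∏ i, liftWeight k φ (s' i)) •
      φ.liftAct P f hf s' t (fun i => component hP (s' i) (classAt hP hφ (s i) (p i))) =
      (if ∀ i, φ.Conn (s i) (s' i) then ∏ i, liftWeight k φ (s' i) else 0) •
        φ.liftAct P f hf s t p := by
    intro s'
    split_ifs with h
    · choose l hl using h
      rw [← liftAct_evIso hP hφ hf l hl]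
      congr 2
      exact funext fun i => component_classAt hP hφ (l i) (hl i) (p i)
    · push Not at h
      obtain ⟨i, hi⟩ := h
      rw [(φ.liftAct P f hf s' t).map_coord_zero i (component_classAt_zero hP hφ hi (p i)),
        smul_zero, zero_smul]
  rw [sum_congr rfl fun s' _ => h s', ← sum_smul]
  refine Eq.trans (congrArg (· • φ.liftAct P f hf s t p) ?_) (one_smul k _)
  convert sum_pi_conn (k := k) hφ s

theorem IsLift.act_classAt [CharZero k] {t : φ.Lift v} {g : F₁.C.Hom (fun i => (s i).1) t.1}
    (h : φ.IsLift f s t g) :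
    (pushPre hP hφ).act f hf (fun i => classAt hP hφ (s i) (p i)) =
      classAt hP hφ t (P.act g (h.deg_eq.trans_le hf) p) := by
  refine push_ext hP fun t' => ?_
  refine (component_act_classAt hP hφ f hf s p t').trans ?_
  by_cases hc : φ.Conn t t'
  · obtain ⟨l, hl⟩ := hc
    rw [component_classAt hP hφ l hl, ← h.liftAct_eq hφ hf, evIso_liftAct hP hφ hf l hl]
  · rw [component_classAt_zero hP hφ hc, liftAct_eq_zero]
    · rfl
    · rintro ⟨g', hg'⟩
      exact hc (h.conn hφ hg')

theorem act_classAt_eq_zero [CharZero k] (h : ¬∃ (t : φ.Lift v) (g : _), φ.IsLift f s t g) :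
    (pushPre hP hφ).act f hf (fun i => classAt hP hφ (s i) (p i)) = 0 := by
  refine push_ext hP fun t => ?_
  refine (component_act_classAt hP hφ f hf s p t).trans ?_
  rw [liftAct_eq_zero fun h' => h ⟨t, h'⟩]
  rfl

end ActClass

theorem act_uop_classAt [CharZero k] {v v' : F₂.C.V} (σ : single v ≅ single v') (s : φ.Lift v)
    (p : P.obj s.1) :
    (pushPre hP hφ).act (uop σ.hom) (PreGradedOp.deg_uop_le σ) (fun _ => classAt hP hφ s p) =
      classAt hP hφ ⟨s.1, s.2 ≪≫ σ⟩ p := by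
  have h : φ.IsLift (I := Unit) (uop σ.hom) (fun _ => s) ⟨s.1, s.2 ≪≫ σ⟩ (F₁.C.one s.1) := by
    unfold IsLift
    rw [φ.onHom_one, pre_unit, one_post, ← uop_comp]
    rfl
  refine (h.act_classAt hP hφ (uop σ.hom) (PreGradedOp.deg_uop_le σ) (fun _ => s) fun _ => p).trans ?_
  exact congrArg _ (hP.act_one _ _ _)

theorem pushPre_act_one [CharZero k] (v : F₂.C.V) (h : F₂.δ.deg (F₂.C.one v) ≤ 1)
    (x : φ.pushObj hP v) : (pushPre hP hφ).act (F₂.C.one v) h (fun _ => x) = x := by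
  have h1 : ∀ y : φ.pushObj hP v, (MultilinearMap.ofSubsingleton k (φ.pushObj hP v)
      (φ.pushObj hP v) ()).symm ((pushPre hP hφ).act (F₂.C.one v) h) y =
      (pushPre hP hφ).act (F₂.C.one v) h (fun _ => y) := fun y => rfl
  rw [← h1]
  conv_lhs => rw [← sum_classAt hP hφ x]
  conv_rhs => rw [← sum_classAt hP hφ x]
  rw [map_sum]
  refine sum_congr rfl fun t _ => ?_
  rw [map_smul, h1]
  congr 1
  refine (PreGradedOp.act_congr (uop_id v).symm _ (PreGradedOp.deg_uop_le (Iso.refl _)) _).trans ?_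
  refine (act_uop_classAt hP hφ (Iso.refl _) t _).trans ?_
  rw [Iso.trans_refl]
  rfl

theorem pushPre_act_map {I J : Type} [Finite I] [LinearOrder I] [Finite J] [LinearOrder J]
    (e : I ≃o J) {x : J → F₂.C.V} {v : F₂.C.V} (f : F₂.C.Hom x v) (hf : F₂.δ.deg f ≤ 1)
    (hf' : F₂.δ.deg (F₂.C.map e.toEquiv f) ≤ 1) (p : ∀ j, φ.pushObj hP (x j)) :
    (pushPre hP hφ).act (F₂.C.map e.toEquiv f) hf' (fun i => p (e i)) =
      (pushPre hP hφ).act f hf p := by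
  have := ofFinite I
  have := ofFinite J
  refine push_ext hP fun t => ?_
  refine (component_act hP hφ (F₂.C.map e.toEquiv f) hf' t fun i => p (e i)).trans
    (Eq.trans ?_ (component_act hP hφ f hf t p).symm)
  refine (Fintype.sum_equiv (Equiv.piCongrLeft (fun j => φ.Lift (x j)) e.toEquiv).symm _ _
    fun s => ?_).symm
  have hs : (Equiv.piCongrLeft (fun j => φ.Lift (x j)) e.toEquiv).symm s = fun i => s (e i) := rfl
  rw [hs]
  congr 1
  · exact (Fintype.prod_equiv e.toEquiv _ _ fun i => rfl).symm
  · exact (liftAct_map hP hφ e hf hf' fun i => component hP (s i) (p i)).symm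

/-- Families over an index set are families of families over the fibres of a map. -/
def piFiberEquiv {I J : Type*} (A : I → Type*) (π : I → J) :
    (∀ i, A i) ≃ ∀ j, ∀ i : {i // π i = j}, A i.1 where
  toFun s j i := s i.1
  invFun s i := s (π i) ⟨i, rfl⟩
  left_inv _ := rfl
  right_inv s := by
    funext j ⟨i, h⟩
    subst h
    rfl

theorem pushPre_act_subst_fin [CharZero k] {m n : ℕ} {x : Fin m → F₂.C.V} {y : Fin n → F₂.C.V}
    {v : F₂.C.V} (f : F₂.C.Hom y v) (π : Fin m → Fin n)
    (g : ∀ j, F₂.C.Hom (fun i : {i // π i = j} => x i) (y j)) (hf : F₂.δ.deg f ≤ 1)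
    (hg : ∀ j, F₂.δ.deg (g j) ≤ 1) (h : F₂.δ.deg (subst f π g) ≤ 1) (d : Fin m → ℤ)
    (p : ∀ i, φ.pushObj hP (x i)) (hp : ∀ i, p i ∈ (φ.pushObj hP (x i)).gr (d i)) :
    (pushPre hP hφ).act (subst f π g) h p = koszulSign ε π (fun j => F₂.δ.deg (g j)) d •
      (pushPre hP hφ).act f hf (fun j => (pushPre hP hφ).act (g j) (hg j) (fun i => p i)) := by
  refine push_ext hP fun t => ?_
  have hc : ∀ (u : ℤˣ) (z : φ.pushObj hP v), component hP t (u • z) = u • component hP t z :=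
    fun u z => map_zsmul (component hP t) (u : ℤ) z
  rw [component_act]
  refine Eq.trans ?_ ((congrArg (koszulSign ε π (fun j => F₂.δ.deg (g j)) d • ·)
    (component_act hP hφ f hf t _)).symm.trans (hc _ _).symm)
  rw [sum_congr rfl fun s _ => congrArg (fun z => (∏ i, liftWeight k φ (s i)) • z)
    (liftAct_subst hP hφ f π g hf hg h s t d (fun i => component hP (s i) (p i))
      fun i => hp i (s i))]
  have hsm : ∀ (r : k) (u : ℤˣ) (z : P.obj t.1), r • u • z = u • r • z := fun r u z =>
    smul_comm r (u : ℤ) z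
  rw [sum_congr rfl fun s _ => hsm _ _ _, ← smul_sum]
  refine congrArg (koszulSign ε π (fun j => F₂.δ.deg (g j)) d • ·) ?_
  rw [sum_congr rfl fun s _ => smul_sum, sum_comm]
  refine sum_congr rfl fun r _ => ?_
  rw [sum_congr rfl fun s _ => smul_comm _ _ _, ← smul_sum]
  refine congrArg ((∏ j, liftWeight k φ (r j)) • ·) ?_
  have hexp : (fun j => component hP (r j) ((pushPre hP hφ).act (g j) (hg j) (fun i => p i))) =
      fun j => ∑ s : ∀ i : {i // π i = j}, φ.Lift (x i), (∏ i, liftWeight k φ (s i)) •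
        φ.liftAct P (g j) (hg j) s (r j) (fun i => component hP (s i) (p i)) :=
    funext fun j => component_act hP hφ (g j) (hg j) (r j) fun i => p i
  refine Eq.trans ?_ (congrArg (φ.liftAct P f hf r t) hexp).symm
  rw [MultilinearMap.map_sum]
  refine Fintype.sum_equiv (piFiberEquiv (fun i => φ.Lift (x i)) π) _ _ fun s => ?_
  rw [MultilinearMap.map_smul_univ]
  congr 1
  refine Eq.trans ?_ (Fintype.prod_fiberwise π fun i => liftWeight k φ (s i)).symm |>.symm |>.symm
  rfl

end CubicalMorphism

namespace DegreeFunction.Chain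

theorem composite_append {C : ColoredOperad.{u}} {δ : DegreeFunction C} {X Y Z : C.Word} {n m : ℕ}
    (c : δ.Chain X Y n) (d : δ.Chain Y Z m) :
    (c.append d).composite = c.composite ≫ d.composite := by
  induction c with
  | nil e => exact composite_pre e d
  | cons f hf c ih => exact (congrArg (f ≫ ·) (ih d)).trans (Category.assoc _ _ _).symm

end DegreeFunction.Chain

namespace PreGradedOp

variable {P : PreGradedOp k F}

theorem Tensor.mk_congr {X : F.C.Word} {s s' : ℤˣ} {d d' : Fin X.n → ℤ}
    {v v' : ∀ i, P.obj (X.x i)} (hs : s = s') (hd : d = d') (hv : v = v') :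
    (⟨s, d, v⟩ : P.Tensor X) = ⟨s', d', v'⟩ := by
  subst hs hd hv
  rfl

theorem push_congr {X Y : F.C.Word} {m m' : X ⟶ Y} (h : m = m') (hm : F.δ.degree m ≤ 1)
    (hm' : F.δ.degree m' ≤ 1) (t : P.Tensor X) : push ε m hm t = push ε m' hm' t := by
  subst h
  rfl

/-- All multilinear maps vanish on the tensor. -/
def Tensor.IsZero {X : F.C.Word} (t : P.Tensor X) : Prop :=
  ∀ (N : Type u) [AddCommGroup N] [Module k N]
    (M : MultilinearMap k (fun i => P.obj (X.x i)) N), M t.val = 0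

theorem Tensor.IsZero.of_coord {X : F.C.Word} {t : P.Tensor X} (i : Fin X.n) (h : t.val i = 0) :
    t.IsZero := fun _ _ _ M => M.map_coord_zero i h

theorem Tensor.IsZero.of_equiv {X : F.C.Word} {t t' : P.Tensor X} (h : t.Equiv t')
    (ht' : t'.IsZero) : t.IsZero := fun N _ _ M => by
  have h1 := h.2 N M
  rwa [ht' N M, smul_zero, smul_eq_zero_iff_eq] at h1

theorem Tensor.IsZero.pushChain {X Y : F.C.Word} {n : ℕ} (c : F.δ.Chain X Y n) {t : P.Tensor X}
    (ht : t.IsZero) : (pushChain ε c t).IsZero := fun N _ _ M => by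
  have h := pushChain_eq_chainMap (ε := ε) c t M
  rwa [ht N, smul_zero, smul_eq_zero_iff_eq] at h

theorem Tensor.IsZero.value_eq {v : F.C.V} {t : P.Tensor (single v)} (ht : t.IsZero) :
    t.value = 0 := by
  have h := ht _ (MultilinearMap.ofSubsingleton k (P.obj v) (P.obj v) (0 : Fin 1) LinearMap.id)
  exact (congrArg (t.sign • ·) h).trans (smul_zero _)

theorem Laws.push_letters (hP : P.Laws ε) {n : ℕ} {x' x : Fin n → F.C.V}
    (τ : ∀ i, single (x' i) ≅ single (x i))
    (h : F.δ.degree (letters fun i => uop (τ i).hom) ≤ 1) (t : P.Tensor ⟨n, x'⟩) :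
    (push ε (letters fun i => uop (τ i).hom) h t).Equiv
      ⟨t.sign, t.deg, fun i => P.evIso (τ i) (t.val i)⟩ := by
  have hd : ∀ j : Fin n, F.δ.deg (WordHom.g (letters fun i => uop (τ i).hom) j) = 0 := fun j =>
    (F.δ.deg_unaryAt (x := x') j _).trans (F.δ.deg_uop (τ j))
  have hv : (push ε (letters fun i => uop (τ i).hom) h t).val = fun i => P.evIso (τ i) (t.val i) :=
    funext fun j => hP.act_unaryAt (x := x') j (τ j) (F.δ.deg_le_one h j) t.val
  constructor
  · funext j
    change ∑ i : {i : Fin n // WordHom.π (letters fun i => uop (τ i).hom) i = j}, t.deg i +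
      ε.val * (F.δ.deg (WordHom.g (letters fun i => uop (τ i).hom) j) : ℤ) = t.deg j
    have hs : ∑ i : {i : Fin n // WordHom.π (letters fun i => uop (τ i).hom) i = j}, t.deg i =
        t.deg j :=
      Fintype.sum_eq_single
        (⟨j, rfl⟩ : {i : Fin n // WordHom.π (letters fun i => uop (τ i).hom) i = j})
        fun i hi => absurd (Subtype.ext i.2) hi
    rw [hd, hs]
    simp
  · intro N _ _ M
    rw [hv]
    congr 1
    change t.sign * koszulSign ε (fun i => i) _ t.deg = _
    rw [koszulSign_monotone ε (π := fun i => i) (fun _ _ h => h) hd, mul_one]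

end PreGradedOp

namespace CubicalMorphism

variable {F₁ F₂ : CubicalFeynmanCategory.{u}} {φ : CubicalMorphism F₁ F₂} {P : PreGradedOp k F₁}
  (hP : P.Laws ε) (hφ : φ.Admissible)

theorem pushPre_act_subst [CharZero k] {x : I → F₂.C.V} {y : J → F₂.C.V}
    {v : F₂.C.V} (f : F₂.C.Hom y v) (π : I → J)
    (g : ∀ j, F₂.C.Hom (fun i : {i // π i = j} => x i) (y j)) (hf : F₂.δ.deg f ≤ 1)
    (hg : ∀ j, F₂.δ.deg (g j) ≤ 1) (h : F₂.δ.deg (subst f π g) ≤ 1) (d : I → ℤ)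
    (p : ∀ i, φ.pushObj hP (x i)) (hp : ∀ i, p i ∈ (φ.pushObj hP (x i)).gr (d i)) :
    (pushPre hP hφ).act (subst f π g) h p = koszulSign ε π (fun j => F₂.δ.deg (g j)) d •
      (pushPre hP hφ).act f hf (fun j => (pushPre hP hφ).act (g j) (hg j) (fun i => p i)) := by
  let eI : Fin (Fintype.card I) ≃o I := Fintype.orderIsoFinOfCardEq I rfl
  let eJ : Fin (Fintype.card J) ≃o J := Fintype.orderIsoFinOfCardEq J rfl
  have he : ∀ i, eJ.toEquiv (eJ.symm (π (eI i))) = π (eI.toEquiv i) := fun i => eJ.apply_symm_apply _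
  have sr := subst_reindex f π g eI.toEquiv eJ.toEquiv (fun i => eJ.symm (π (eI i))) he
  have hd : ∀ j, F₂.δ.deg (F₂.C.map (fiberReindex eI.toEquiv eJ.toEquiv he j) (g (eJ j))) =
      F₂.δ.deg (g (eJ j)) := fun j => F₂.δ.deg_map _ _
  have hs : F₂.δ.deg (F₂.C.map eI.toEquiv (subst f π g)) ≤ 1 := (F₂.δ.deg_map _ _).trans_le h
  refine (pushPre_act_map hP hφ eI (subst f π g) h hs p).symm.trans ?_
  refine (PreGradedOp.act_congr sr hs (by rw [← sr]; exact hs) _).trans ?_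
  refine (pushPre_act_subst_fin hP hφ (x := fun i => x (eI i)) (F₂.C.map eJ.toEquiv f) _ _
    ((F₂.δ.deg_map _ _).trans_le hf) (fun j => (hd j).trans_le (hg _)) _ (fun i => d (eI i))
    (fun i => p (eI i)) fun i => hp _).trans ?_
  refine congrArg₂ (fun (u : ℤˣ) (z : φ.pushObj hP v) => u • z) ?_ ?_
  · exact (congrArg (fun δ => koszulSign ε _ δ _) (funext hd)).trans
      (koszulSign_orderIso ε eI eJ π (fun j => F₂.δ.deg (g j)) d)
  · refine Eq.trans ?_ (pushPre_act_map hP hφ eJ f hf ((F₂.δ.deg_map _ _).trans_le hf) _)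
    refine congrArg _ (funext fun j => ?_)
    exact pushPre_act_map hP hφ ⟨fiberReindex eI.toEquiv eJ.toEquiv he j, eI.le_iff_le⟩
      (x := fun i : {i // π i = eJ j} => x i.1) (g (eJ j)) (hg _) _ fun i => p i.1

theorem pushPre_laws [CharZero k] : (pushPre hP hφ).Laws ε where
  act_mem f hf n p hp t := by
    have h := component_act hP hφ f hf t p
    refine (congrArg (· ∈ (P.obj t.1).gr _) h).mpr ?_
    exact Submodule.sum_mem _ fun s _ => Submodule.smul_mem _ _
      (liftAct_mem hP hf n _ fun i => hp i (s i))
  act_one := pushPre_act_one hP hφ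
  act_map := pushPre_act_map hP hφ
  act_subst := pushPre_act_subst hP hφ

variable (φ) in
/-- The vertex itself as a lift of its image. -/
def baseLift (w : F₁.C.V) : φ.Lift (φ.onV w) := ⟨w, Iso.refl _⟩

theorem isLift_base {I : Type} [Finite I] {x : I → F₁.C.V} {w : F₁.C.V} (g : F₁.C.Hom x w) :
    φ.IsLift (φ.onHom g) (fun i => φ.baseLift (x i)) (φ.baseLift w) g := by
  have h1 : post (φ.onHom g) (uop (Iso.refl (single (φ.onV w))).hom) = φ.onHom g :=
    (congrArg (post (φ.onHom g)) (uop_id (φ.onV w))).trans (post_one _)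
  have h2 : pre (fun i => uop (Iso.refl (single (φ.onV (x i)))).hom) (φ.onHom g) = φ.onHom g :=
    (congrArg (fun a => pre a (φ.onHom g)) (funext fun i => uop_id (φ.onV (x i)))).trans (pre_one _)
  exact h1.trans h2.symm

theorem evIso_classAt [CharZero k] {v v' : F₂.C.V} (σ : single v ≅ single v') (s : φ.Lift v)
    (p : P.obj s.1) :
    (pushPre hP hφ).evIso σ (classAt hP hφ s p) = classAt hP hφ ⟨s.1, s.2 ≪≫ σ⟩ p :=
  ((pushPre_laws hP hφ).evIso_eq σ _).trans (act_uop_classAt hP hφ σ s p)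

/-- The tensor of classes of elements at the letters of a word. -/
noncomputable def baseTensor {A : F₁.C.Word} (t : P.Tensor A) :
    (pushPre hP hφ).Tensor (φ.functor.obj A) :=
  ⟨t.sign, t.deg, fun i => classAt hP hφ (φ.baseLift (A.x i)) (t.val i)⟩

theorem homogeneous_baseTensor {A : F₁.C.Word} {t : P.Tensor A} (ht : t.Homogeneous) :
    (baseTensor hP hφ t).Homogeneous := fun i =>
  classAt_mem hP hφ (φ.baseLift (A.x i)) (ht i)

theorem push_baseTensor [CharZero k] {A B : F₁.C.Word} (b : A ⟶ B) (hb : F₁.δ.degree b ≤ 1)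
    (t : P.Tensor A) :
    push ε (φ.functor.map b) ((φ.degree_map b).trans_le hb) (baseTensor hP hφ t) =
      baseTensor hP hφ (push ε b hb t) := by
  have h : ∀ j, F₂.δ.deg (WordHom.g (φ.functor.map b) j) = F₁.δ.deg (WordHom.g b j) :=
    fun j => φ.deg_onHom _
  refine PreGradedOp.Tensor.mk_congr ?_ (funext fun j : Fin B.n => ?_)
    (funext fun j : Fin B.n => ?_)
  · exact congrArg (fun a => t.sign * koszulSign ε (WordHom.π b) a t.deg) (funext h)
  · exact congrArg (fun a : ℕ => ∑ i : {i : Fin A.n // WordHom.π b i = j}, t.deg i.1 + ε.val * (a : ℤ)) (h j)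
  · exact IsLift.act_classAt hP hφ (φ.onHom (WordHom.g b j)) _
      (fun i : {i : Fin A.n // WordHom.π b i = j} => φ.baseLift (A.x i.1)) (fun i => t.val i.1)
      (isLift_base (WordHom.g b j))

theorem exists_val_eq_zero [CharZero k] {A : F₁.C.Word} {Y : F₂.C.Word} (m : φ.functor.obj A ⟶ Y)
    (hm : F₂.δ.degree m ≤ 1)
    (h : ¬∃ (B : F₁.C.Word) (b : A ⟶ B) (σ : φ.functor.obj B ≅ Y), φ.functor.map b ≫ σ.hom = m)
    (t : P.Tensor A) : ∃ j, (push ε m hm (baseTensor hP hφ t)).val j = 0 := by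
  by_contra! hj
  have h1 : ∀ j, ∃ (r : φ.Lift (Y.x j)) (b : F₁.C.Hom (fun i : {i : Fin A.n // WordHom.π m i = j} =>
      A.x i.1) r.1), φ.IsLift (x := fun i : {i : Fin A.n // WordHom.π m i = j} => φ.onV (A.x i.1))
        (WordHom.g m j) (fun i => φ.baseLift (A.x i.1)) r b := by
    intro j
    by_contra hc
    exact hj j (act_classAt_eq_zero hP hφ (WordHom.g m j) _
      (fun i : {i : Fin A.n // WordHom.π m i = j} => φ.baseLift (A.x i.1)) (fun i => t.val i.1) hc)
  choose r b hb using h1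
  let B : F₁.C.Word := ⟨Y.n, fun j => (r j).1⟩
  let b' : A ⟶ B := WordHom.mk (X := A) (Y := B) (WordHom.π (X := φ.functor.obj A) (Y := Y) m) b
  refine h ⟨B, b', F₂.lettersIso fun j => (r j).2, ?_⟩
  refine (comp_letters (X := φ.functor.obj A) (φ.functor.map b') _).trans ?_
  refine WordHom.ext rfl (heq_of_eq (funext fun j => ?_))
  refine (hb j).trans ?_
  refine (congrArg (fun a => pre a (WordHom.g m j)) (funext fun i => uop_id _)).trans ?_
  exact pre_one (WordHom.g m j)

/-- A lift of a chain of degree one morphisms, for given lifts of source and target. -/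
def ChainLift (φ : CubicalMorphism F₁ F₂) : ∀ {A B : F₁.C.Word} {X Y : F₂.C.Word} {n : ℕ}, F₁.δ.Chain A B n → F₂.δ.Chain X Y n →
    (φ.functor.obj A ≅ X) → (φ.functor.obj B ≅ Y) → Prop
  | _, _, _, _, _, .nil l, .nil e, σ, σ' => φ.functor.map l.hom ≫ σ'.hom = σ.hom ≫ e.hom
  | _, _, _, _, _, .cons (Y := A) b _ C, .cons (Y := X) m _ c, σ, σ' =>
    ∃ σ₁ : φ.functor.obj A ≅ X, φ.functor.map b ≫ σ₁.hom = σ.hom ≫ m ∧ ChainLift φ C c σ₁ σ'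

include hφ in
theorem exists_chainLift {A B : F₁.C.Word} {X Y : F₂.C.Word} {n : ℕ} (c : F₂.δ.Chain X Y n)
    (G : A ⟶ B) (σ : φ.functor.obj A ≅ X) (σ' : φ.functor.obj B ≅ Y)
    (h : φ.functor.map G ≫ σ'.hom = σ.hom ≫ c.composite) :
    ∃ C : F₁.δ.Chain A B n, C.composite = G ∧ φ.ChainLift C c σ σ' := by
  have := hφ.faithful
  induction c generalizing A with
  | nil e =>
    have hG : F₁.δ.degree G = 0 := by
      have h1 := congrArg (fun m => F₂.δ.degree m) h
      simp only [DegreeFunction.Chain.composite, F₂.δ.degree_comp, F₂.δ.degree_iso,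
        φ.degree_map] at h1
      exact h1
    have := (F₁.degree_eq_zero_iff G).1 hG
    exact ⟨.nil (asIso G), rfl, h⟩
  | cons m hm c ih =>
    obtain ⟨A₁, g₂, g₁, σ₁, rfl, h2, h3⟩ := hφ.factor G (σ.hom ≫ m) (c.composite ≫ σ'.inv) (by
      rw [Category.assoc, ← Category.assoc m]
      exact (Iso.eq_comp_inv σ').2 h |>.trans (Category.assoc _ _ _))
    obtain ⟨C, hC, hCl⟩ := ih g₁ σ₁ σ' (by
      rw [← Iso.inv_comp_eq, ← Category.assoc, ← h3, Category.assoc, Iso.inv_hom_id,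
        Category.comp_id])
    have hg : F₁.δ.degree g₂ = 1 := by
      have h1 := congrArg (fun m => F₂.δ.degree m) h2
      simp only [F₂.δ.degree_comp, F₂.δ.degree_iso, φ.degree_map, hm] at h1
      omega
    exact ⟨.cons g₂ hg C, congrArg (g₂ ≫ ·) hC, σ₁, h2.symm, hCl⟩

theorem ChainLift.pre {A' A B : F₁.C.Word} {X' X Y : F₂.C.Word} {n : ℕ} {C : F₁.δ.Chain A B n}
    {c : F₂.δ.Chain X Y n} {σ : φ.functor.obj A ≅ X} {σ' : φ.functor.obj B ≅ Y}
    (h : φ.ChainLift C c σ σ') (θ : A' ≅ A) (Θ : X' ≅ X) (ρ : φ.functor.obj A' ≅ X')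
    (hθ : φ.functor.map θ.hom ≫ σ.hom = ρ.hom ≫ Θ.hom) :
    φ.ChainLift (C.pre θ) (c.pre Θ) ρ σ' := by
  cases c with
  | nil e =>
    cases C with
    | nil l =>
      simp only [ChainLift, DegreeFunction.Chain.pre, Iso.trans_hom, Functor.map_comp,
        Category.assoc] at h ⊢
      rw [h, ← Category.assoc, hθ, Category.assoc]
  | cons m hm c =>
    cases C with
    | cons b hb C =>
      obtain ⟨σ₁, h1, h2⟩ := h
      refine ⟨σ₁, ?_, h2⟩
      rw [Functor.map_comp, Category.assoc, h1, ← Category.assoc, hθ, Category.assoc]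

theorem ChainLift.rel {A B : F₁.C.Word} {X Y : F₂.C.Word} {n : ℕ} {C C' : F₁.δ.Chain A B n}
    {c c' : F₂.δ.Chain X Y n} {σ : φ.functor.obj A ≅ X} {σ' : φ.functor.obj B ≅ Y}
    (h : φ.ChainLift C c σ σ') (h' : φ.ChainLift C' c' σ σ') (hC : C.Rel C') : c.Rel c' := by
  induction c generalizing A with
  | nil e =>
    cases C with
    | nil l =>
      cases c' with
      | nil e' =>
        cases C' with
        | nil l' =>
          have hl : l = l' := hC
          subst hl
          have h1 : σ.hom ≫ e.hom = σ.hom ≫ e'.hom := Eq.trans (Eq.symm h) h'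
          exact Iso.ext ((cancel_epi σ.hom).1 h1)
  | cons m hm c ih =>
    cases C with
    | cons b hb C =>
      cases c' with
      | cons m' hm' c' =>
        cases C' with
        | cons b' hb' C' =>
          obtain ⟨σ₁, h1, h2⟩ := h
          obtain ⟨σ₁', h1', h2'⟩ := h'
          obtain ⟨θ, hθ, hCC⟩ := hC
          refine ⟨σ₁.symm ≪≫ φ.functor.mapIso θ ≪≫ σ₁', ?_, ?_⟩
          · rw [← cancel_epi σ.hom, ← h1', ← hθ, ← Category.assoc, ← h1]
            simp
          · exact ih h2 (h2'.pre θ _ σ₁ (by simp)) hCC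

section Swap

variable [CharZero k]

theorem push_push_baseTensor {A B : F₁.C.Word} {X Y : F₂.C.Word} {b : A ⟶ B} {m : X ⟶ Y}
    (hb : F₁.δ.degree b ≤ 1) (hm : F₂.δ.degree m ≤ 1) {σ : φ.functor.obj A ≅ X}
    {σ' : φ.functor.obj B ≅ Y} (h : φ.functor.map b ≫ σ'.hom = σ.hom ≫ m) {t : P.Tensor A}
    (ht : t.Homogeneous) :
    (push ε m hm (push ε σ.hom
      (F₂.δ.degree_iso_le _) (baseTensor hP hφ t))).Equiv
    (push ε σ'.hom (F₂.δ.degree_iso_le _)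
      (baseTensor hP hφ (push ε b hb t))) := by
  have hL := pushPre_laws hP hφ
  have ht' := homogeneous_baseTensor hP hφ ht
  have h1 : F₂.δ.degree (σ.hom ≫ m) ≤ 1 := by
    rw [F₂.δ.degree_comp, F₂.δ.degree_iso, zero_add]; exact hm
  rw [← push_baseTensor hP hφ b hb t]
  refine (hL.push_comp σ.hom m _ hm h1 ht').symm.trans ?_
  rw [PreGradedOp.push_congr h.symm h1 (h ▸ h1)]
  exact hL.push_comp (φ.functor.map b) σ'.hom _ _ _ ht'

theorem ChainLift.pushChain {A B : F₁.C.Word} {X Y : F₂.C.Word} {n : ℕ} {C : F₁.δ.Chain A B n}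
    {c : F₂.δ.Chain X Y n} {σ : φ.functor.obj A ≅ X} {σ' : φ.functor.obj B ≅ Y}
    (h : φ.ChainLift C c σ σ') {t : P.Tensor A} (ht : t.Homogeneous) :
    (pushChain ε c (push ε σ.hom
      (F₂.δ.degree_iso_le _) (baseTensor hP hφ t))).Equiv
    (push ε σ'.hom (F₂.δ.degree_iso_le _)
      (baseTensor hP hφ (pushChain ε C t))) := by
  induction c generalizing A with
  | nil e =>
    cases C with
    | nil l => exact push_push_baseTensor hP hφ _ _ h ht
  | cons m hm c ih =>
    cases C with
    | cons b hb C =>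
      obtain ⟨σ₁, h1, h2⟩ := h
      exact ((push_push_baseTensor hP hφ hb.le hm.le h1 ht).pushChain c).trans
        (ih h2 (hP.homogeneous_push b hb.le ht))

theorem pushChain_isZero {A : F₁.C.Word} {X Y : F₂.C.Word} {n : ℕ} (c : F₂.δ.Chain X Y n)
    (σ : φ.functor.obj A ≅ X)
    (h : ¬∃ (B : F₁.C.Word) (G : A ⟶ B) (σ' : φ.functor.obj B ≅ Y),
      φ.functor.map G ≫ σ'.hom = σ.hom ≫ c.composite) {t : P.Tensor A} (ht : t.Homogeneous) :
    (pushChain ε c (push ε σ.hom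
      (F₂.δ.degree_iso_le _) (baseTensor hP hφ t))).IsZero := by
  have hL := pushPre_laws hP hφ
  induction c generalizing A with
  | nil e =>
    exact absurd ⟨A, 𝟙 A, σ ≪≫ e, by
      rw [CategoryTheory.Functor.map_id, Category.id_comp]; rfl⟩ h
  | cons m hm c ih =>
    by_cases h1 : ∃ (B : F₁.C.Word) (b : A ⟶ B) (σ₁ : φ.functor.obj B ≅ _),
      φ.functor.map b ≫ σ₁.hom = σ.hom ≫ m
    · obtain ⟨B, b, σ₁, hb⟩ := h1
      have hb1 : F₁.δ.degree b ≤ 1 := by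
        have h1 := congrArg (fun m => F₂.δ.degree m) hb
        simp only [F₂.δ.degree_comp, F₂.δ.degree_iso, φ.degree_map, hm] at h1
        omega
      refine PreGradedOp.Tensor.IsZero.of_equiv ((push_push_baseTensor hP hφ hb1 hm.le hb ht).pushChain c) ?_
      refine ih σ₁ ?_ (hP.homogeneous_push b hb1 ht)
      rintro ⟨B', G, σ', hG⟩
      refine h ⟨B', b ≫ G, σ', ?_⟩
      rw [Functor.map_comp, Category.assoc, hG, ← Category.assoc, hb, Category.assoc]
      rfl
    · have h2 : F₂.δ.degree (σ.hom ≫ m) ≤ 1 := by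
        rw [F₂.δ.degree_comp, F₂.δ.degree_iso, zero_add]; exact hm.le
      obtain ⟨j, hj⟩ := exists_val_eq_zero hP hφ (σ.hom ≫ m) h2 h1 t
      refine PreGradedOp.Tensor.IsZero.pushChain c (PreGradedOp.Tensor.IsZero.of_equiv
        (hL.push_comp σ.hom m _ hm.le h2 (homogeneous_baseTensor hP hφ ht)).symm ?_)
      exact PreGradedOp.Tensor.IsZero.of_coord j hj

omit [CharZero k] in
theorem value_push_baseTensor {w : F₁.C.V} {v : F₂.C.V}
    (σ : φ.functor.obj (single w) ≅ single v) (t : P.Tensor (single w)) :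
    (push ε σ.hom (F₂.δ.degree_iso_le _)
      (baseTensor hP hφ t)).value =
        (pushPre hP hφ).evIso (v := φ.onV w) σ (classAt hP hφ (φ.baseLift w) t.value) := by
  have hk := koszulSign_subsingleton (J := Fin 1) ε (WordHom.π σ.hom)
    (fun j => F₂.δ.deg (WordHom.g σ.hom j)) t.deg
  have h1 : ∀ (s : ℤˣ) (z : P.obj w), (pushPre hP hφ).evIso (v := φ.onV w) σ
      (classAt hP hφ (φ.baseLift w) (s • z)) = s • (pushPre hP hφ).evIso (v := φ.onV w) σ
      (classAt hP hφ (φ.baseLift w) z) := fun s z =>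
    map_zsmul ((pushPre hP hφ).evIso (v := φ.onV w) (w := v) σ ∘ₗ classAt hP hφ (φ.baseLift w))
      (s : ℤ) z
  refine Eq.trans ?_ (h1 t.sign (t.val (0 : Fin 1))).symm
  refine congrArg₂ (fun (s : ℤˣ) (z : φ.pushObj hP v) => s • z) ?_ ?_
  · exact (congrArg (t.sign * ·) hk).trans (mul_one _)
  · refine congrArg ((pushPre hP hφ).act (WordHom.g σ.hom (0 : Fin 1)) _) (funext fun i => ?_)
    have hi : i.1 = (0 : Fin 1) := Subsingleton.elim (α := Fin 1) _ _
    exact congrArg (fun j : Fin 1 => classAt hP hφ (φ.baseLift w) (t.val j)) hi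

end Swap

end CubicalMorphism

theorem GradedOp.Hom.app_evIso {P Q : GradedOp k F ε} (h : GradedOp.Hom P Q) {v w : F.C.V}
    (σ : single v ≅ single w) (p : P.obj v) : h.app w (P.evIso σ p) = Q.evIso σ (h.app v p) := by
  rw [P.laws.evIso_eq, Q.laws.evIso_eq]
  exact h.app_act _ _ _

/-- The underlying morphism of graded objects. -/
def DGOp.Hom.toGraded {P Q : DGOp k F ε} (h : P ⟶ Q) : GradedOp.Hom P.toGradedOp Q.toGradedOp :=
  ⟨h.app, h.app_mem, h.app_act⟩

theorem DGOp.Hom.app_evIso {P Q : DGOp k F ε} (h : P ⟶ Q) {v w : F.C.V}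
    (σ : single v ≅ single w) (p : P.obj v) : h.app w (P.evIso σ p) = Q.evIso σ (h.app v p) :=
  GradedOp.Hom.app_evIso (DGOp.Hom.toGraded h) σ p

theorem DGOp.d_evIso (P : DGOp k F ε) {v w : F.C.V} (σ : single v ≅ single w) (p : P.obj v) :
    P.d w (P.evIso σ p) = P.evIso σ (P.d v p) := by
  suffices h : P.d w ∘ₗ P.evIso σ = P.evIso σ ∘ₗ P.d v from LinearMap.congr_fun h p
  refine GrVect.hom_ext fun n x hx => ?_
  simp only [LinearMap.comp_apply]
  rw [P.laws.evIso_eq, P.laws.evIso_eq]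
  refine (P.d_act (uop σ.hom) _ (fun _ => n) (fun _ => x) fun _ => hx).trans ?_
  simp only [F.δ.deg_uop, mul_zero, pow_zero, one_smul, Finset.univ_unique, Finset.sum_singleton,
    Finset.prod_singleton, lt_self_iff_false, if_false]
  congr 1

/-- The identity of parities needed for the Leibniz rule of a multilinear map. -/
theorem MultilinearMap.sum_update_congr {R : Type*} [CommRing R] {I : Type*} [Fintype I] [DecidableEq I]
    {A B : I → Type*} {N : Type*} [∀ i, AddCommGroup (A i)] [∀ i, Module R (A i)]
    [AddCommGroup N] [Module R N] (M : MultilinearMap R A N) (c : ∀ i, B i → A i)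
    (p : ∀ i, B i) (d : ∀ i, B i → B i) (d' : ∀ i, A i → A i) (h : ∀ i x, c i (d i x) = d' i (c i x))
    (i : I) : M (fun i' => c i' (update p i (d i (p i)) i')) =
      M (update (fun i' => c i' (p i')) i (d' i (c i (p i)))) := by
  congr 1
  funext i'
  by_cases hi : i' = i
  · subst hi
    simp [h]
  · simp [update_of_ne hi]

namespace CubicalMorphism

variable {F₁ F₂ : CubicalFeynmanCategory.{u}} {φ : CubicalMorphism F₁ F₂}

theorem liftAct_d (P : DGOp k F₁ ε) {x : I → F₂.C.V}
    {v : F₂.C.V} (f : F₂.C.Hom x v) (hf : F₂.δ.deg f ≤ 1) (s : ∀ i, φ.Lift (x i)) (t : φ.Lift v)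
    (n : I → ℤ) (p : ∀ i, P.obj (s i).1) (hp : ∀ i, p i ∈ (P.obj (s i).1).gr (n i)) :
    P.d t.1 (φ.liftAct P.toPreGradedOp f hf s t p) = (-1 : ℤˣ) ^ (ε.val * F₂.δ.deg f) • ∑ i,
      (∏ i', if i' < i then (-1 : ℤˣ) ^ n i' else 1) •
        φ.liftAct P.toPreGradedOp f hf s t (update p i (P.d (s i).1 (p i))) := by
  unfold liftAct
  split_ifs with h
  · refine (P.d_act h.choose (h.choose_spec.deg_eq.trans_le hf) n p hp).trans ?_
    exact congrArg (fun m : ℕ => (-1 : ℤˣ) ^ (ε.val * m) • ∑ i,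
      (∏ i', if i' < i then (-1 : ℤˣ) ^ n i' else 1) •
        P.act h.choose (h.choose_spec.deg_eq.trans_le hf) (update p i (P.d (s i).1 (p i))))
      h.choose_spec.deg_eq
  · simp

variable (hφ : φ.Admissible)

theorem pushPre_swap_classAt [CharZero k] (P : GradedOp k F₁ ε) {X Y : F₂.C.Word} {v : F₂.C.V}
    {n : ℕ} (d d' : F₂.δ.Chain X Y 2) (c : F₂.δ.Chain Y (single v) n)
    (h : F₂.perm (Equiv.swap 0 1) ⟦d⟧ = ⟦d'⟧) {A : F₁.C.Word} (σ : φ.functor.obj A ≅ X)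
    (t : P.Tensor A) (ht : t.Homogeneous) :
    (pushChain ε c (pushChain ε d' (push ε σ.hom
      (F₂.δ.degree_iso_le _) (baseTensor P.laws hφ t)))).value =
    (-1 : ℤˣ) ^ ε.val • (pushChain ε c (pushChain ε d
      (push ε σ.hom (F₂.δ.degree_iso_le _)
        (baseTensor P.laws hφ t)))).value := by
  have hL := pushPre_laws P.laws hφ
  have hdd : d.composite = d'.composite := (F₂.composite_eq_iff ⟦d⟧ ⟦d'⟧).2 ⟨_, h⟩
  by_cases hl : ∃ (B : F₁.C.Word) (G : A ⟶ B) (σ' : φ.functor.obj B ≅ single v),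
      φ.functor.map G ≫ σ'.hom = σ.hom ≫ (d.append c).composite
  · obtain ⟨B, G, σ₂, hG⟩ := hl
    obtain ⟨w, rfl⟩ : ∃ w, B = single w := by
      have h1 := Fintype.card_congr (Equiv.ofBijective _ (F₂.iso_bijective σ₂))
      obtain ⟨m, z⟩ := B
      have h1' : Fintype.card (Fin m) = Fintype.card (Fin 1) := h1
      have h2 : m = 1 := by simpa using h1'
      subst h2
      exact ⟨z 0, congrArg (Word.mk 1) (funext fun i => congrArg z (Subsingleton.elim i 0))⟩
    rw [DegreeFunction.Chain.composite_append] at hG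
    obtain ⟨A₁, g₂, g₁, σ₁, rfl, h2, h3⟩ := hφ.factor G (σ.hom ≫ d.composite)
      (c.composite ≫ σ₂.inv) (by
        rw [Category.assoc, ← Category.assoc d.composite]
        exact ((Iso.eq_comp_inv σ₂).2 hG).trans (Category.assoc _ _ _))
    obtain ⟨D, hD, hDl⟩ := exists_chainLift hφ d g₂ σ σ₁ h2.symm
    obtain ⟨D', hD', hDl'⟩ := exists_chainLift hφ d' g₂ σ σ₁ (hdd ▸ h2.symm)
    obtain ⟨C, hC, hCl⟩ := exists_chainLift hφ c g₁ σ₁ σ₂ (by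
      rw [← Iso.inv_comp_eq, ← Category.assoc, ← h3, Category.assoc, Iso.inv_hom_id,
        Category.comp_id])
    have hswap : F₁.perm (Equiv.swap 0 1) ⟦D⟧ = ⟦D'⟧ := by
      obtain ⟨τ, hτ⟩ := (F₁.composite_eq_iff ⟦D⟧ ⟦D'⟧).1 (hD.trans hD'.symm)
      rcases (by decide : ∀ τ : Equiv.Perm (Fin 2), τ = 1 ∨ τ = Equiv.swap 0 1) τ with rfl | rfl
      · exfalso
        rw [map_one] at hτ
        have h4 : (⟦d⟧ : F₂.δ.ChainClass X Y 2) = ⟦d'⟧ :=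
          Quotient.sound (hDl.rel hDl' (Quotient.exact hτ))
        rw [← h4] at h
        exact absurd (F₂.perm_free _ _ h) (by decide)
      · exact hτ
    have key : ∀ (E : F₁.δ.Chain A A₁ 2) (e : F₂.δ.Chain X Y 2), φ.ChainLift E e σ σ₁ →
        (pushChain ε c (pushChain ε e (push ε σ.hom
          (F₂.δ.degree_iso_le _) (baseTensor P.laws hφ t)))).value =
        (pushPre P.laws hφ).evIso (v := φ.onV w) σ₂ (classAt P.laws hφ (φ.baseLift w)
          (pushChain ε C (pushChain ε E t)).value) := by
      intro E e hE
      have h5 := ((hE.pushChain P.laws hφ ht).pushChain c).trans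
        (hCl.pushChain P.laws hφ (P.laws.homogeneous_pushChain E ht))
      exact h5.value_eq.trans (value_push_baseTensor P.laws hφ σ₂ _)
    rw [key D' d' hDl', key D d hDl, P.act_swap D D' C hswap t ht]
    exact map_zsmul ((pushPre P.laws hφ).evIso (v := φ.onV w) (w := v) σ₂ ∘ₗ
      classAt P.laws hφ (φ.baseLift w)) (((-1 : ℤˣ) ^ ε.val : ℤˣ) : ℤ) _
  · have hz : ∀ e : F₂.δ.Chain X Y 2, d.composite = e.composite →
        (pushChain ε c (pushChain ε e (push ε σ.hom
          (F₂.δ.degree_iso_le _) (baseTensor P.laws hφ t)))).value = 0 := by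
      intro e he
      have h1 := hL.pushChain_append e c (hL.homogeneous_push σ.hom
        (F₂.δ.degree_iso_le _) (homogeneous_baseTensor P.laws hφ ht))
      rw [← h1.value_eq]
      refine (pushChain_isZero P.laws hφ (e.append c) σ ?_ ht).value_eq
      rwa [DegreeFunction.Chain.composite_append, ← he, ← DegreeFunction.Chain.composite_append]
    rw [hz d' hdd, hz d rfl, smul_zero]

theorem pushPre_swap [CharZero k] (P : GradedOp k F₁ ε) {X Y : F₂.C.Word} {v : F₂.C.V}
    {n : ℕ} (d d' : F₂.δ.Chain X Y 2) (c : F₂.δ.Chain Y (single v) n)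
    (h : F₂.perm (Equiv.swap 0 1) ⟦d⟧ = ⟦d'⟧) (t : (pushPre P.laws hφ).Tensor X)
    (ht : t.Homogeneous) :
    (pushChain ε c (pushChain ε d' t)).value =
      (-1 : ℤˣ) ^ ε.val • (pushChain ε c (pushChain ε d t)).value := by
  have hL := pushPre_laws P.laws hφ
  let M : F₂.δ.Chain X Y 2 → MultilinearMap k (fun i => φ.pushObj P.laws (X.x i))
      (φ.pushObj P.laws v) := fun e =>
    (pushPre P.laws hφ).chainMap ε (e.append c) t.deg (MultilinearMap.ofSubsingleton k
      (φ.pushObj P.laws v) (φ.pushObj P.laws v) (0 : Fin 1) LinearMap.id)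
  have hval : ∀ (e : F₂.δ.Chain X Y 2) (t' : (pushPre P.laws hφ).Tensor X), t'.Homogeneous →
      t'.deg = t.deg →
      (pushChain ε c (pushChain ε e t')).value = t'.sign • M e t'.val := by
    intro e t' ht' hd
    rw [← (hL.pushChain_append e c ht').value_eq, PreGradedOp.value_pushChain, hd]
    rfl
  have hclass : ∀ (s : ∀ i, φ.Lift (X.x i)) (p : ∀ i, P.obj (s i).1),
      (∀ i, p i ∈ (P.obj (s i).1).gr (t.deg i)) →
      M d' (fun i => classAt P.laws hφ (s i) (p i)) =
        (-1 : ℤˣ) ^ ε.val • M d (fun i => classAt P.laws hφ (s i) (p i)) := by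
    intro s p hp
    let A : F₁.C.Word := ⟨X.n, fun i => (s i).1⟩
    let σ : φ.functor.obj A ≅ X := F₂.lettersIso fun i => (s i).2
    let τ : P.Tensor A := ⟨1, t.deg, p⟩
    let t' : (pushPre P.laws hφ).Tensor X := ⟨1, t.deg, fun i => classAt P.laws hφ (s i) (p i)⟩
    have ht' : t'.Homogeneous := fun i => classAt_mem P.laws hφ (s i) (hp i)
    have heq : (push ε σ.hom (F₂.δ.degree_iso_le _)
        (baseTensor P.laws hφ τ)).Equiv t' := by
      refine (hL.push_letters (fun i => (s i).2) _ (baseTensor P.laws hφ τ)).trans ?_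
      have : (⟨1, t.deg, fun i => (pushPre P.laws hφ).evIso (s i).2
          (classAt P.laws hφ (φ.baseLift (s i).1) (p i))⟩ : (pushPre P.laws hφ).Tensor X) = t' := by
        refine PreGradedOp.Tensor.mk_congr rfl rfl (funext fun i => ?_)
        refine (evIso_classAt P.laws hφ (s i).2 (φ.baseLift (s i).1) (p i)).trans ?_
        have h1 : (⟨(s i).1, (Iso.refl _) ≪≫ (s i).2⟩ : φ.Lift (X.x i)) = s i := by
          rw [Iso.refl_trans]; rfl
        have h2 : ∀ (r : φ.Lift (X.x i)), r = s i → ∀ hr : r.1 = (s i).1,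
            classAt P.laws hφ r (hr ▸ p i) = classAt P.laws hφ (s i) (p i) := by
          rintro r rfl hr
          rfl
        exact h2 _ h1 rfl
      rw [← this]
      exact PreGradedOp.Tensor.Equiv.refl _
    have h1 := pushPre_swap_classAt hφ P d d' c h σ τ hp
    have h2 : ∀ e, (pushChain ε c (pushChain ε e
        (push ε σ.hom (F₂.δ.degree_iso_le _)
          (baseTensor P.laws hφ τ)))).value = M e t'.val := fun e =>
      (((heq.pushChain e).pushChain c).value_eq.trans (hval e t' ht' rfl)).trans (one_smul _ _)
    rw [h2, h2] at h1
    exact h1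
  rw [hval d' t ht rfl, hval d t ht rfl]
  suffices hM : M d' t.val = (-1 : ℤˣ) ^ ε.val • M d t.val from
    (congrArg (t.sign • ·) hM).trans (smul_comm (t.sign : ℤ) (((-1 : ℤˣ) ^ ε.val : ℤˣ) : ℤ) _)
  have hsum : t.val = fun i => ∑ s : φ.Lift (X.x i), liftWeight k φ s •
      classAt P.laws hφ s (component P.laws s (t.val i)) :=
    funext fun i => (sum_classAt P.laws hφ (t.val i)).symm
  rw [hsum, (M d').map_sum, (M d).map_sum, smul_sum]
  refine sum_congr rfl fun s _ => ?_
  rw [(M d').map_smul_univ, (M d).map_smul_univ]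
  refine (congrArg ((∏ i, liftWeight k φ (s i)) • ·) (hclass s
    (fun i => component P.laws (s i) (t.val i)) fun i => ht i (s i))).trans ?_
  exact smul_comm _ (((-1 : ℤˣ) ^ ε.val : ℤˣ) : ℤ) _

/-- The exceptional push-forward of a graded object. -/
noncomputable def pushGraded [CharZero k] (P : GradedOp k F₁ ε) : GradedOp k F₂ ε where
  toPreGradedOp := pushPre P.laws hφ
  act_mem := (pushPre_laws P.laws hφ).act_mem
  act_one := (pushPre_laws P.laws hφ).act_one
  act_map := (pushPre_laws P.laws hφ).act_map
  act_subst := (pushPre_laws P.laws hφ).act_subst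
  act_swap := fun d d' c h t ht => pushPre_swap hφ P d d' c h t ht

theorem pushPre_d_act [CharZero k] (P : DGOp k F₁ ε) {x : I → F₂.C.V} {v : F₂.C.V} (f : F₂.C.Hom x v) (hf : F₂.δ.deg f ≤ 1) (n : I → ℤ)
    (p : ∀ i, φ.pushObj P.laws (x i)) (hp : ∀ i, p i ∈ (φ.pushObj P.laws (x i)).gr (n i)) :
    φ.pushMap P.d (fun l p => (P.d_evIso l p).symm) v ((pushPre P.laws hφ).act f hf p) =
      (-1 : ℤˣ) ^ (ε.val * F₂.δ.deg f) • ∑ i,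
        (∏ i', if i' < i then (-1 : ℤˣ) ^ n i' else 1) • (pushPre P.laws hφ).act f hf
          (update p i (φ.pushMap P.d (fun l p => (P.d_evIso l p).symm) (x i) (p i))) := by
  refine push_ext P.laws fun t => ?_
  have hc : ∀ (u : ℤˣ) (z : φ.pushObj P.laws v),
      component P.laws t (u • z) = u • component P.laws t z :=
    fun u z => map_zsmul (component P.laws t) (u : ℤ) z
  refine Eq.trans ?_ ((hc _ _).trans (congrArg ((-1 : ℤˣ) ^ (ε.val * F₂.δ.deg f) • ·)
    (map_sum (component P.laws t) _ _))).symm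
  refine (congrArg (P.d t.1) (component_act P.laws hφ f hf t p)).trans ?_
  rw [map_sum]
  have hsm : ∀ (r : k) (u : ℤˣ) (z : P.obj t.1), r • u • z = u • r • z := fun r u z =>
    smul_comm r (u : ℤ) z
  rw [sum_congr rfl fun s _ => (map_smul (P.d t.1) _ _).trans (congrArg (_ • ·)
    (liftAct_d P f hf s t n (fun i => component P.laws (s i) (p i)) fun i => hp i (s i)))]
  rw [sum_congr rfl fun s _ => hsm _ _ _, ← smul_sum]
  congr 1
  rw [sum_congr rfl fun s _ => smul_sum, sum_comm]
  refine sum_congr rfl fun i _ => ?_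
  rw [sum_congr rfl fun s _ => hsm _ _ _, ← smul_sum]
  refine Eq.trans ?_ (hc _ _).symm
  congr 1
  refine Eq.trans ?_ (component_act P.laws hφ f hf t _).symm
  refine sum_congr rfl fun s _ => ?_
  congr 1
  exact (MultilinearMap.sum_update_congr (φ.liftAct P.toPreGradedOp f hf s t)
    (fun i => component P.laws (s i)) p
    (fun i => φ.pushMap P.d (fun l p => (P.d_evIso l p).symm) (x i)) (fun i => P.d (s i).1)
    (fun _ _ => rfl) i).symm

/-- The exceptional push-forward of an object with differential. -/
noncomputable def pushDG [CharZero k] (P : DGOp k F₁ ε) : DGOp k F₂ ε where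
  toGradedOp := pushGraded hφ P.toGradedOp
  d v := φ.pushMap P.d (fun l p => (P.d_evIso l p).symm) v
  d_mem _ n _ hx t := P.d_mem t.1 n _ (hx t)
  d_d _ _ := Subtype.ext (funext fun t => P.d_d t.1 _)
  d_act := pushPre_d_act hφ P

/-- The exceptional push-forward of a morphism. -/
noncomputable def pushHom [CharZero k] {P Q : DGOp k F₁ ε} (h : P ⟶ Q) :
    pushDG hφ P ⟶ pushDG hφ Q where
  app v := φ.pushMap h.app (fun l p => (DGOp.Hom.app_evIso h l p).symm) v
  app_mem _ n _ hx t := h.app_mem t.1 n _ (hx t)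
  app_d _ _ := Subtype.ext (funext fun t => h.app_d t.1 _)
  app_act f hf p := by
    rename_i I _ _ x v
    have := ofFinite I
    refine push_ext Q.laws fun t => ?_
    refine (congrArg (h.app t.1) (component_act P.laws hφ f hf t p)).trans ?_
    refine Eq.trans ?_ (component_act Q.laws hφ f hf t _).symm
    rw [map_sum]
    refine sum_congr rfl fun s _ => ?_
    rw [map_smul]
    congr 1
    by_cases hg : ∃ g, φ.IsLift f s t g
    · obtain ⟨g, hg⟩ := hg
      rw [hg.liftAct_eq hφ, hg.liftAct_eq hφ]
      exact h.app_act g _ _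
    · rw [liftAct_eq_zero hg, liftAct_eq_zero hg]
      exact map_zero _

/-- The exceptional push-forward functor. -/
noncomputable def pushFunctor [CharZero k] : DGOp k F₁ ε ⥤ DGOp k F₂ ε where
  obj := pushDG hφ
  map := pushHom hφ

theorem isLift_of_eq {X : F₁.C.Word} {v : F₂.C.V} {f : φ.functor.obj X ⟶ single v} {w : F₁.C.V}
    {g : X ⟶ single w} {σ : single (φ.onV w) ≅ single v} :
    f = φ.mapSingle g ≫ σ.hom ↔ φ.IsLift (I := Fin X.n) (x := fun i => φ.onV (X.x i)) (toOp f)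
        (fun i => φ.baseLift (X.x i)) ⟨w, σ⟩ (toOp g) := by
  have h1 : pre (x' := fun i => φ.onV (X.x i)) (fun i => uop (Iso.refl (single (φ.onV (X.x i)))).hom) (toOp f) = toOp f :=
    (congrArg (fun a => pre a (toOp f)) (funext fun i => uop_id (φ.onV (X.x i)))).trans (pre_one _)
  have h2 : toOp (φ.mapSingle g ≫ σ.hom) = post (φ.onHom (toOp g)) (uop σ.hom) :=
    (toOp_comp_uop _ _).trans (congrArg (fun a => post a (uop σ.hom)) (φ.onHom_toOp g).symm)
  constructor
  · rintro rfl
    exact h2.symm.trans h1.symm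
  · intro h
    exact wordHom_single_ext (h1.symm.trans (Eq.trans (Eq.symm h) h2.symm))

end CubicalMorphism

/-! ### The exceptional push-forward functor -/

namespace CubicalMorphism

variable {F₁ F₂ : CubicalFeynmanCategory.{u}} {φ : CubicalMorphism F₁ F₂}

open Classical in
theorem mk_of_evIso (P : DGOp k F₁ ε) {v : F₂.C.V} {s t : φ.Lift v} (l : single s.1 ≅ single t.1)
    (hl : φ.mapV l ≪≫ t.2 = s.2) (p : P.obj s.1) :
    (φ.balancing P v).mkQ (DirectSum.of (fun t : φ.Lift v => P.obj t.1) t (P.evIso l p)) =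
      (φ.balancing P v).mkQ (DirectSum.of (fun t : φ.Lift v => P.obj t.1) s p) := by
  obtain ⟨w, σ⟩ := s
  obtain ⟨w', τ⟩ := t
  obtain rfl := F₁.isFeynman.skeletal w w' ⟨l⟩
  change single w ≅ single w at l
  change φ.mapV l ≪≫ τ = σ at hl
  subst hl
  rw [Submodule.mkQ_apply, Submodule.mkQ_apply, Submodule.Quotient.eq]
  exact Submodule.subset_span ⟨w, τ, l, p, rfl⟩

theorem pushMap_classAt (hφ : φ.Admissible) {P Q : PreGradedOp k F₁} (hP : P.Laws ε) (hQ : Q.Laws ε)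
    (h : ∀ w, P.obj w →ₗ[k] Q.obj w)
    (hh : ∀ {w w' : F₁.C.V} (l : single w ≅ single w') (p : P.obj w),
      Q.evIso l (h w p) = h w' (P.evIso l p)) {v : F₂.C.V} (s : φ.Lift v) (p : P.obj s.1) :
    φ.pushMap h hh v (classAt hP hφ s p) = classAt hQ hφ s (h s.1 p) := by
  refine push_ext hQ fun t => ?_
  refine Eq.trans (b := h t.1 (component hP t (classAt hP hφ s p))) rfl ?_
  by_cases hc : φ.Conn s t
  · obtain ⟨l, hl⟩ := hc
    rw [component_classAt hP hφ l hl, component_classAt hQ hφ l hl, hh]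
  · rw [component_classAt_zero hP hφ hc, component_classAt_zero hQ hφ hc, map_zero]

variable [CharZero k] (hφ : φ.Admissible)

theorem evIso_classAt_base (P : DGOp k F₁ ε) {v : F₂.C.V} (s : φ.Lift v) (p : P.obj s.1) :
    (pushPre P.laws hφ).evIso s.2 (classAt P.laws hφ (φ.baseLift s.1) p) =
      classAt P.laws hφ s p := by
  refine (evIso_classAt P.laws hφ s.2 (φ.baseLift s.1) p).trans ?_
  have h : (⟨s.1, Iso.refl _ ≪≫ s.2⟩ : φ.Lift v) = s := by
    rw [Iso.refl_trans]; rfl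
  have h2 : ∀ (r : φ.Lift v), r = s → ∀ hr : r.1 = s.1,
      classAt P.laws hφ r (hr ▸ p) = classAt P.laws hφ s p := by
    rintro r rfl hr
    rfl
  exact h2 _ h rfl

open Classical in
theorem summands_of (P : DGOp k F₁ ε) {v : F₂.C.V} (s : φ.Lift v) (p : P.obj s.1) :
    φ.summands P (pushDG hφ P) (fun w => classAt P.laws hφ (φ.baseLift w)) v
      (DirectSum.of (fun t : φ.Lift v => P.obj t.1) s p) = classAt P.laws hφ s p := by
  refine (DirectSum.toModule_lof k (M := fun t : φ.Lift v => P.obj t.1) s p).trans ?_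
  exact evIso_classAt_base hφ P s p

open Classical in
/-- The class in the quotient by the balancing relations of a compatible family. -/
noncomputable def averageClass (P : DGOp k F₁ ε) (v : F₂.C.V) : φ.pushObj P.laws v →ₗ[k]
    (DirectSum (φ.Lift v) fun t => P.obj t.1) ⧸ φ.balancing P v :=
  ∑ s : φ.Lift v, liftWeight k φ s • (φ.balancing P v).mkQ ∘ₗ
    DirectSum.lof k (φ.Lift v) (fun t => P.obj t.1) s ∘ₗ component P.laws s

open Classical in
theorem averageClass_classAt (P : DGOp k F₁ ε) {v : F₂.C.V} (s : φ.Lift v) (p : P.obj s.1) :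
    averageClass P v (classAt P.laws hφ s p) =
      (φ.balancing P v).mkQ (DirectSum.of (fun t : φ.Lift v => P.obj t.1) s p) := by
  unfold averageClass
  rw [LinearMap.sum_apply]
  have h : ∀ t : φ.Lift v, (liftWeight k φ t • (φ.balancing P v).mkQ ∘ₗ
      DirectSum.lof k (φ.Lift v) (fun t => P.obj t.1) t ∘ₗ component P.laws t)
        (classAt P.laws hφ s p) = (if φ.Conn s t then liftWeight k φ t else 0) •
      (φ.balancing P v).mkQ (DirectSum.of (fun t : φ.Lift v => P.obj t.1) s p) := by
    intro t
    simp only [LinearMap.smul_apply, LinearMap.comp_apply]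
    split_ifs with hc
    · obtain ⟨l, hl⟩ := hc
      rw [component_classAt P.laws hφ l hl]
      exact congrArg (liftWeight k φ t • ·) (mk_of_evIso P l hl p)
    · rw [component_classAt_zero P.laws hφ hc, map_zero, map_zero, smul_zero, zero_smul]
  rw [sum_congr rfl fun t _ => h t, ← sum_smul]
  refine Eq.trans (congrArg (· • _) (Eq.trans ?_ (sum_conn (k := k) hφ s))) (one_smul _ _)
  exact sum_congr rfl fun s _ => by congr

open Classical in
theorem ker_summands (P : DGOp k F₁ ε) (v : F₂.C.V) :
    LinearMap.ker (φ.summands P (pushDG hφ P) (fun w => classAt P.laws hφ (φ.baseLift w)) v) =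
      φ.balancing P v := by
  refine le_antisymm (fun x hx => ?_) ?_
  · have h : averageClass P v ∘ₗ (φ.summands P (pushDG hφ P)
        (fun w => classAt P.laws hφ (φ.baseLift w)) v) = (φ.balancing P v).mkQ := by
      refine DirectSum.linearMap_ext k fun s => LinearMap.ext fun p => ?_
      exact (congrArg (averageClass P v) (summands_of hφ P s p)).trans
        (averageClass_classAt hφ P s p)
    rw [← Submodule.Quotient.mk_eq_zero]
    have h0 : (φ.summands P (pushDG hφ P)
        (fun w => classAt P.laws hφ (φ.baseLift w)) v x : φ.pushObj P.laws v) = 0 :=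
      LinearMap.mem_ker.1 hx
    exact (LinearMap.congr_fun h x).symm.trans
      ((congrArg (averageClass P v) h0).trans (map_zero (averageClass P v)))
  · refine Submodule.span_le.2 ?_
    rintro _ ⟨w, σ, l, p, rfl⟩
    refine LinearMap.mem_ker.2 ((map_sub _ _ _).trans ?_)
    refine sub_eq_zero.2 ((summands_of hφ P ⟨w, σ⟩ _).trans (Eq.trans ?_
      (summands_of hφ P ⟨w, φ.mapAut l ≪≫ σ⟩ p).symm))
    exact classAt_evIso (t := (⟨w, σ⟩ : φ.Lift v)) (s := ⟨w, φ.mapAut l ≪≫ σ⟩) P.laws hφ l rfl p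

variable (k ε) in
/-- The exceptional push-forward. -/
noncomputable def exceptionalPush : ExceptionalPush k ε φ where
  functor := pushFunctor hφ
  inc P w := classAt P.laws hφ (φ.baseLift w)
  inc_mem P w n p hp := classAt_mem P.laws hφ (φ.baseLift w) hp
  inc_d P w p := (pushMap_classAt hφ P.laws P.laws P.d (fun l p => (P.d_evIso l p).symm)
    (φ.baseLift w) p).symm
  map_inc {P P'} h w p := pushMap_classAt hφ P.laws P'.laws h.app
    (fun l p => (DGOp.Hom.app_evIso h l p).symm) (φ.baseLift w) p
  surjective P v x := by
    classical
    refine ⟨∑ t : φ.Lift v, liftWeight k φ t • DirectSum.of (fun t : φ.Lift v => P.obj t.1) t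
      (component P.laws t x), ?_⟩
    refine (map_sum _ _ _).trans (Eq.trans (sum_congr rfl fun t _ => ?_)
      (sum_classAt P.laws hφ x))
    exact (map_smul _ _ _).trans (congrArg _ (summands_of hφ P t _))
  ker_eq := ker_summands hφ
  ev_lift P X v f hf w g hg σ h p := by
    refine ((pushPre_laws P.laws hφ).ev_eq (X := φ.functor.obj X) f hf _).trans ?_
    have h1 := (isLift_of_eq.1 h).act_classAt (I := Fin X.n) P.laws hφ (toOp f)
      ((F₂.δ.deg_toOp f).trans_le hf) (fun i => φ.baseLift (X.x i)) p
    refine h1.trans (Eq.trans ?_ (evIso_classAt_base hφ P (⟨w, σ⟩ : φ.Lift v) (P.ev g hg p)).symm)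
    exact congrArg (classAt P.laws hφ (⟨w, σ⟩ : φ.Lift v)) (P.laws.ev_eq g hg p).symm
  ev_eq_zero P X v f hf h p := by
    refine ((pushPre_laws P.laws hφ).ev_eq (X := φ.functor.obj X) f hf _).trans ?_
    refine act_classAt_eq_zero (I := Fin X.n) P.laws hφ (toOp f) ((F₂.δ.deg_toOp f).trans_le hf)
      (fun i => φ.baseLift (X.x i)) p ?_
    rintro ⟨⟨w, σ⟩, g, hg⟩
    refine h ⟨w, ofOp g, σ, isLift_of_eq.2 ?_⟩
    have h1 : toOp (ofOp (X := X) g) = g := toOp_ofOp (X := X) g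
    exact h1.symm ▸ hg

end CubicalMorphism

/-! ### Uniqueness of the exceptional push-forward -/

theorem DGOp.isIso_of_bijective {P Q : DGOp k F ε} (h : P ⟶ Q)
    (hb : ∀ v, Bijective (h.app v)) : IsIso h := by
  let e : ∀ v, P.obj v ≃ₗ[k] Q.obj v := fun v => LinearEquiv.ofBijective (h.app v) (hb v)
  have he : ∀ v x, h.app v ((e v).symm x) = x := fun v => (e v).apply_symm_apply
  have he' : ∀ v x, (e v).symm (h.app v x) = x := fun v => (e v).symm_apply_apply
  refine ⟨⟨⟨fun v => (e v).symm, fun v n x hx => ?_, fun f hf p => ?_, fun v x => ?_⟩,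
    DGOp.Hom.ext (funext fun v => LinearMap.ext (he' v)),
    DGOp.Hom.ext (funext fun v => LinearMap.ext (he v))⟩⟩
  · refine GrVect.mem_of_proj_eq ((hb v).1 ?_)
    rw [GrVect.map_proj₀ _ (h.app_mem v)]
    exact ((congrArg _ (he v x)).trans (GrVect.proj_of_mem hx)).trans (he v x).symm
  · refine (hb _).1 ((he _ _).trans (Eq.trans ?_ (h.app_act f hf _).symm))
    exact congrArg _ (funext fun i => (he _ _).symm)
  · exact (hb _).1 ((he _ _).trans (((congrArg _ (he v x)).symm.trans (h.app_d v _).symm)))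

namespace ExceptionalPush

variable {F₁ F₂ : CubicalFeynmanCategory.{u}} {φ : CubicalMorphism F₁ F₂}
  (L : ExceptionalPush k ε φ) (P : DGOp k F₁ ε)

/-- The class of an element over a lift of a vertex. -/
noncomputable def cls {v : F₂.C.V} (t : φ.Lift v) : P.obj t.1 →ₗ[k] (L.functor.obj P).obj v :=
  (L.functor.obj P).evIso t.2 ∘ₗ L.inc P t.1

open Classical in
theorem summands_of {v : F₂.C.V} (t : φ.Lift v) (p : P.obj t.1) :
    φ.summands P (L.functor.obj P) (L.inc P) v
      (DirectSum.of (fun t : φ.Lift v => P.obj t.1) t p) = L.cls P t p :=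
  DirectSum.toModule_lof k (M := fun t : φ.Lift v => P.obj t.1) t p

theorem cls_evIso {v : F₂.C.V} {s t : φ.Lift v} (l : single s.1 ≅ single t.1)
    (hl : φ.mapV l ≪≫ t.2 = s.2) (p : P.obj s.1) : L.cls P t (P.evIso l p) = L.cls P s p := by
  classical
  have h := CubicalMorphism.mk_of_evIso P l hl p
  rw [Submodule.mkQ_apply, Submodule.mkQ_apply, Submodule.Quotient.eq, ← L.ker_eq,
    LinearMap.mem_ker, map_sub, sub_eq_zero] at h
  exact (L.summands_of P t _).symm.trans (h.trans (L.summands_of P s p))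

variable {I : Type} [Finite I] [LinearOrder I] {x : I → F₂.C.V} {v : F₂.C.V}

theorem exists_sum_cls {v : F₂.C.V} (x : (L.functor.obj P).obj v) :
    ∃ p : ∀ t : φ.Lift v, P.obj t.1, x = ∑ t, L.cls P t (p t) := by
  classical
  obtain ⟨y, rfl⟩ := L.surjective P v x
  refine ⟨fun t => y t, ?_⟩
  have h : y = ∑ t, DirectSum.of (fun t : φ.Lift v => P.obj t.1) t (y t) := by
    refine DFinsupp.ext fun t => ?_
    have h1 := DFinsupp.finsetSum_apply (β := fun t : φ.Lift v => (P.obj t.1 : Type u))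
        Finset.univ (fun t => DirectSum.of (fun t : φ.Lift v => P.obj t.1) t (y t)) t
    refine Eq.trans ?_ h1.symm
    rw [sum_eq_single t]
    · exact (DirectSum.of_eq_same (β := fun t : φ.Lift v => (P.obj t.1 : Type u)) t _).symm
    · exact fun s _ hs =>
        DirectSum.of_eq_of_ne (β := fun t : φ.Lift v => (P.obj t.1 : Type u)) s t _ hs.symm
    · exact fun h => absurd (mem_univ t) h
  conv_lhs => rw [h]
  exact (map_sum _ _ _).trans (sum_congr rfl fun t _ => L.summands_of P t _)

theorem act_cls (f : F₂.C.Hom x v) (hf : F₂.δ.deg f ≤ 1) (s : ∀ i, φ.Lift (x i)) (p : ∀ i, P.obj (s i).1) :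
    (∀ (t : φ.Lift v) (g : F₁.C.Hom (fun i => (s i).1) t.1) (h : φ.IsLift f s t g),
      (L.functor.obj P).act f hf (fun i => L.cls P (s i) (p i)) =
        L.cls P t (P.act g (h.deg_eq.trans_le hf) p)) ∧
    ((¬∃ (t : φ.Lift v) (g : F₁.C.Hom (fun i => (s i).1) t.1), φ.IsLift f s t g) →
      (L.functor.obj P).act f hf (fun i => L.cls P (s i) (p i)) = 0) := by
  have := ofFinite I
  let e : Fin (Fintype.card I) ≃o I := Fintype.orderIsoFinOfCardEq I rfl
  let X : F₁.C.Word := ⟨Fintype.card I, fun i => (s (e i)).1⟩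
  let f' : F₂.C.Hom (fun i => φ.onV (s i).1) v := pre (fun i => uop (s i).2.hom) f
  let f₀ : φ.functor.obj X ⟶ single v := ofOp (X := φ.functor.obj X) (F₂.C.map e.toEquiv f')
  have hf' : F₂.δ.deg f' ≤ 1 := (F₂.δ.deg_pre_iso (fun i => (s i).2) f).trans_le hf
  have hop : toOp f₀ = F₂.C.map e.toEquiv f' := toOp_ofOp (X := φ.functor.obj X) _
  have hf₀ : F₂.δ.degree f₀ ≤ 1 := by
    rw [← F₂.δ.deg_toOp, hop]
    exact (F₂.δ.deg_map e.toEquiv f').trans_le hf'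
  have key : (L.functor.obj P).act f hf (fun i => L.cls P (s i) (p i)) =
      (L.functor.obj P).ev f₀ hf₀ (fun i => L.inc P (X.x i) (p (e i))) := by
    refine Eq.trans ?_ ((L.functor.obj P).laws.ev_eq f₀ hf₀ _).symm
    refine ((L.functor.obj P).laws.act_pre (fun i => (s i).2) f hf hf'
      (fun i => L.inc P (s i).1 (p i))).symm.trans ?_
    refine ((L.functor.obj P).act_map e f' hf' ((F₂.δ.deg_map e.toEquiv f').trans_le hf') _).symm.trans ?_
    exact PreGradedOp.act_congr (I := Fin (Fintype.card I)) hop.symm _ _ _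
  constructor
  · intro t g hg
    have h1 : f₀ = φ.mapSingle (ofOp (X := X) (F₁.C.map e.toEquiv g)) ≫ t.2.hom := by
      refine wordHom_single_ext (hop.trans ?_)
      refine Eq.trans ?_ (toOp_comp_uop (X := φ.functor.obj X) _ _).symm
      have h2 : φ.onHom (F₁.C.map e.toEquiv g) =
          toOp (φ.mapSingle (ofOp (X := X) (F₁.C.map e.toEquiv g))) :=
        (congrArg φ.onHom (toOp_ofOp (X := X) _)).symm.trans (φ.onHom_toOp _)
      rw [← h2, φ.onHom_map]
      exact (congrArg (F₂.C.map e.toEquiv) (Eq.symm hg)).trans (map_post e.toEquiv (φ.onHom g) _)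
    have hd : F₁.δ.degree (ofOp (X := X) (F₁.C.map e.toEquiv g)) ≤ 1 := by
      rw [← F₁.δ.deg_toOp, toOp_ofOp]
      exact ((F₁.δ.deg_map e.toEquiv g).trans hg.deg_eq).trans_le hf
    refine key.trans ((L.ev_lift P f₀ hf₀ _ hd t.2 h1 (fun i => p (e i))).trans ?_)
    refine congrArg (L.cls P t) ((P.laws.ev_eq _ _ _).trans ?_)
    refine (PreGradedOp.act_congr (toOp_ofOp (X := X) _) _
      ((F₁.δ.deg_map e.toEquiv g).trans_le (hg.deg_eq.trans_le hf)) _).trans ?_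
    exact P.act_map e g _ _ p
  · intro h
    refine key.trans (L.ev_eq_zero P f₀ hf₀ ?_ (fun i => p (e i)))
    rintro ⟨w, g, σ, hg⟩
    obtain ⟨g₀, hg₀⟩ := (map_bijective (x := fun i => (s i).1) (v := w) e.toEquiv).2 (toOp g)
    refine h ⟨⟨w, σ⟩, g₀, (CubicalMorphism.isLift_map_iff (t := (⟨w, σ⟩ : φ.Lift v)) e.toEquiv).1 ?_⟩
    have h1 : post (φ.onHom (toOp g)) (uop σ.hom) = toOp f₀ := by
      rw [hg]
      exact (congrArg (fun a => post a (uop σ.hom)) (φ.onHom_toOp g)).trans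
        (toOp_comp_uop (X := φ.functor.obj X) _ _).symm
    refine (congrArg (fun a => post (φ.onHom a) (uop σ.hom)) hg₀).trans (h1.trans (hop.trans ?_))
    exact map_pre (x' := fun i => φ.onV (s i).1) e.toEquiv (fun i => uop (s i).2.hom) f

/-- The comparison map to an exceptional push-forward from the one given by compatible families. -/
noncomputable def comparison (v : F₂.C.V) : φ.pushObj P.laws v →ₗ[k] (L.functor.obj P).obj v :=
  ∑ t : φ.Lift v, CubicalMorphism.liftWeight k φ t • L.cls P t ∘ₗ CubicalMorphism.component P.laws t

theorem comparison_apply {v : F₂.C.V} (x : φ.pushObj P.laws v) : L.comparison P v x =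
    ∑ t : φ.Lift v, CubicalMorphism.liftWeight k φ t •
      L.cls P t (CubicalMorphism.component P.laws t x) :=
  LinearMap.sum_apply _ _ _

variable [CharZero k] (hφ : φ.Admissible)

theorem comparison_classAt {v : F₂.C.V} (s : φ.Lift v) (p : P.obj s.1) :
    L.comparison P v (CubicalMorphism.classAt P.laws hφ s p) = L.cls P s p := by
  classical
  rw [comparison_apply]
  have h : ∀ t : φ.Lift v, CubicalMorphism.liftWeight k φ t • L.cls P t
      (CubicalMorphism.component P.laws t (CubicalMorphism.classAt P.laws hφ s p)) =
      (if φ.Conn s t then CubicalMorphism.liftWeight k φ t else 0) • L.cls P s p := by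
    intro t
    split_ifs with hc
    · obtain ⟨l, hl⟩ := hc
      rw [CubicalMorphism.component_classAt P.laws hφ l hl, L.cls_evIso P l hl]
    · rw [CubicalMorphism.component_classAt_zero P.laws hφ hc, map_zero, smul_zero, zero_smul]
  rw [sum_congr rfl fun t _ => h t, ← sum_smul]
  refine Eq.trans (congrArg (· • _) (Eq.trans ?_ (CubicalMorphism.sum_conn (k := k) hφ s)))
    (one_smul _ _)
  exact sum_congr rfl fun s _ => by congr

include hφ in
theorem comparison_bijective (v : F₂.C.V) : Bijective (L.comparison P v) := by
  classical
  constructor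
  · refine (injective_iff_map_eq_zero _).2 fun x hx => ?_
    have h : (∑ t : φ.Lift v, CubicalMorphism.liftWeight k φ t •
        DirectSum.of (fun t : φ.Lift v => P.obj t.1) t (CubicalMorphism.component P.laws t x)) ∈
        LinearMap.ker (φ.summands P (L.functor.obj P) (L.inc P) v) := by
      refine LinearMap.mem_ker.2 ((map_sum _ _ _).trans (Eq.trans
        (sum_congr rfl fun t _ => ?_) ((L.comparison_apply P x).symm.trans hx)))
      exact (map_smul _ _ _).trans (congrArg _ (L.summands_of P t _))
    rw [L.ker_eq, ← CubicalMorphism.ker_summands hφ] at h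
    have h' := LinearMap.mem_ker.1 h
    rw [map_sum] at h'
    refine (CubicalMorphism.sum_classAt P.laws hφ x).symm.trans (Eq.trans ?_ h')
    refine sum_congr rfl fun t _ => ?_
    exact ((map_smul _ _ _).trans (congrArg _ (CubicalMorphism.summands_of hφ P t _))).symm
  · intro y
    obtain ⟨p, rfl⟩ := L.exists_sum_cls P y
    refine ⟨∑ t, CubicalMorphism.classAt P.laws hφ t (p t), (map_sum _ _ _).trans ?_⟩
    exact sum_congr rfl fun t _ => L.comparison_classAt P hφ t (p t)

theorem comparison_act (f : F₂.C.Hom x v) (hf : F₂.δ.deg f ≤ 1) (p : ∀ i, φ.pushObj P.laws (x i)) :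
    L.comparison P v (CubicalMorphism.pushAct P.laws hφ f hf p) =
      (L.functor.obj P).act f hf fun i => L.comparison P (x i) (p i) := by
  have := ofFinite I
  suffices h : (L.comparison P v).compMultilinearMap
      (CubicalMorphism.pushAct P.laws hφ f hf) =
      ((L.functor.obj P).act f hf).compLinearMap fun i => L.comparison P (x i) from
    congrArg (fun M : MultilinearMap k (fun i => φ.pushObj P.laws (x i)) _ => M p) h
  refine MultilinearMap.ext fun p => ?_
  have hp : p = fun i => ∑ t : φ.Lift (x i), CubicalMorphism.liftWeight k φ t •
      CubicalMorphism.classAt P.laws hφ t (CubicalMorphism.component P.laws t (p i)) :=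
    funext fun i => (CubicalMorphism.sum_classAt P.laws hφ (p i)).symm
  rw [hp, MultilinearMap.map_sum, MultilinearMap.map_sum]
  refine sum_congr rfl fun s _ => ?_
  rw [MultilinearMap.map_smul_univ, MultilinearMap.map_smul_univ]
  congr 1
  set q := fun i => CubicalMorphism.component P.laws (s i) (p i)
  obtain ⟨h1, h2⟩ := L.act_cls P f hf s q
  have h3 : ((L.functor.obj P).act f hf).compLinearMap (fun i => L.comparison P (x i))
      (fun i => CubicalMorphism.classAt P.laws hφ (s i) (q i)) =
      (L.functor.obj P).act f hf (fun i => L.cls P (s i) (q i)) :=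
    congrArg ((L.functor.obj P).act f hf) (funext fun i => L.comparison_classAt P hφ (s i) (q i))
  refine Eq.trans ?_ h3.symm
  by_cases h : ∃ (t : φ.Lift v) (g : F₁.C.Hom (fun i => (s i).1) t.1), φ.IsLift f s t g
  · obtain ⟨t, g, hg⟩ := h
    rw [h1 t g hg]
    exact (congrArg (L.comparison P v) (hg.act_classAt P.laws hφ f hf s q)).trans
      (L.comparison_classAt P hφ t _)
  · rw [h2 h]
    exact (congrArg (L.comparison P v)
      (CubicalMorphism.act_classAt_eq_zero P.laws hφ f hf s q h)).trans (map_zero (L.comparison P v))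

/-- The comparison morphism to an exceptional push-forward from the one given by compatible
families. -/
noncomputable def comparisonHom : CubicalMorphism.pushDG hφ P ⟶ L.functor.obj P :=
  DGOp.Hom.mk (L.comparison P)
    (fun v n x hx => (congrArg (· ∈ ((L.functor.obj P).obj v).gr n) (L.comparison_apply P x)).mpr
      (Submodule.sum_mem _ fun t _ => Submodule.smul_mem _ _
        ((L.functor.obj P).laws.evIso_mem t.2 (L.inc_mem P _ _ _ (hx t)))))
    (fun f hf p => L.comparison_act P hφ f hf p)
    (fun v x => by
      refine (L.comparison_apply P _).trans (Eq.trans ?_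
        (congrArg ((L.functor.obj P).d v) (L.comparison_apply P x).symm))
      rw [map_sum]
      refine sum_congr rfl fun t _ => ?_
      rw [map_smul]
      congr 1
      refine Eq.trans ?_ ((L.functor.obj P).d_evIso t.2 _).symm
      exact congrArg ((L.functor.obj P).evIso t.2) (L.inc_d P t.1 _))

/-- Any exceptional push-forward is isomorphic to the one given by compatible families. -/
noncomputable def isoPush : CubicalMorphism.pushFunctor hφ ≅ L.functor :=
  NatIso.ofComponents (fun P =>
    @asIso _ _ _ _ (L.comparisonHom P hφ)
      (DGOp.isIso_of_bijective (L.comparisonHom P hφ) (L.comparison_bijective P hφ)))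
    fun {P Q} h => by
      refine DGOp.Hom.ext (funext fun v => LinearMap.ext fun x => ?_)
      refine (L.comparison_apply Q _).trans (Eq.trans ?_
        (congrArg ((L.functor.map h).app v) (L.comparison_apply P x).symm))
      rw [map_sum]
      refine sum_congr rfl fun t _ => ?_
      rw [map_smul]
      congr 1
      refine Eq.trans ?_ (DGOp.Hom.app_evIso (L.functor.map h) t.2 _).symm
      exact congrArg ((L.functor.obj Q).evIso t.2) (L.map_inc h t.1 _).symm

end ExceptionalPush

/-! ### Universal models -/

namespace PreGradedOp

variable {P Q : PreGradedOp k F}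

/-- The image of a tensor under maps of the values. -/
def Tensor.mapVal (h : ∀ v, P.obj v → Q.obj v) {X : F.C.Word} (t : P.Tensor X) : Q.Tensor X :=
  ⟨t.sign, t.deg, fun i => h _ (t.val i)⟩

theorem pushChain_mapVal (h : ∀ v, P.obj v → Q.obj v)
    (hact : ∀ {I : Type} [Finite I] [LinearOrder I] {x : I → F.C.V} {v : F.C.V} (f : F.C.Hom x v)
      (hf : F.δ.deg f ≤ 1) (p : ∀ i, P.obj (x i)), h v (P.act f hf p) = Q.act f hf fun i => h _ (p i))
    {X Y : F.C.Word} {n : ℕ} (c : F.δ.Chain X Y n) (t : P.Tensor X) :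
    (pushChain ε c t).mapVal h = pushChain ε c (t.mapVal h) := by
  have hpush : ∀ {X Y : F.C.Word} (m : X ⟶ Y) (hm : F.δ.degree m ≤ 1) (t : P.Tensor X),
      (push ε m hm t).mapVal h = push ε m hm (t.mapVal h) := fun m hm t =>
    Tensor.mk_congr rfl rfl (funext fun j => hact _ _ _)
  induction c with
  | nil e => exact hpush _ _ _
  | cons m hm c ih => exact (ih _).trans (congrArg _ (hpush _ _ _))

theorem value_mapVal (h : ∀ v, P.obj v →ₗ[k] Q.obj v) {v : F.C.V} (t : P.Tensor (single v)) :
    (t.mapVal fun v => h v).value = h v t.value :=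
  (map_zsmul (h v) (t.sign : ℤ) _).symm

end PreGradedOp

theorem MultilinearMap.mem_iSup_of_forall {I : Type*} [Finite I] {A : I → Type*} {N : Type*}
    [∀ i, AddCommGroup (A i)] [∀ i, Module k (A i)] [AddCommGroup N] [Module k N]
    (M : MultilinearMap k A N) (gr : ∀ i, ℤ → Submodule k (A i)) (S : Submodule k N)
    (h : ∀ (n : I → ℤ) (p : ∀ i, A i), (∀ i, p i ∈ gr i (n i)) → M p ∈ S) (p : ∀ i, A i)
    (hp : ∀ i, p i ∈ ⨆ n, gr i n) : M p ∈ S := by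
  classical
  have := ofFinite I
  choose y hy using fun i => (Submodule.mem_iSup_iff_exists_finsupp _ _).1 (hp i)
  have hp' : p = fun i => ∑ n ∈ (y i).support, y i n := funext fun i => (hy i).2.symm
  rw [hp', MultilinearMap.map_sum_finset]
  exact Submodule.sum_mem _ fun n _ => h n _ fun i => (hy i).1 (n i)

/-- A class of objects with marked homogeneous elements. -/
structure Presentation (k : Type u) [Field k] (F : CubicalFeynmanCategory.{u}) (ε : Parity) where
  G : F.C.V → ℤ → Type u
  IsModel : ∀ Q : DGOp k F ε, (∀ v n, G v n → Q.obj v) → Prop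
  homogeneous : ∀ Q γ, IsModel Q γ → ∀ v n g, γ v n g ∈ (Q.obj v).gr n

namespace Presentation

variable (S : Presentation k F ε)

/-- A member of the class. -/
structure Model where
  Q : DGOp k F ε
  gen : ∀ v n, S.G v n → Q.obj v
  isModel : S.IsModel Q gen

/-- Formal expressions in the generators. -/
inductive Term : F.C.V → Type u
  | gen {v : F.C.V} (n : ℤ) (g : S.G v n) : Term v
  | act {X : F.C.Word} {v : F.C.V} (f : F.C.Hom X.x v) (hf : F.δ.deg f ≤ 1)
      (t : ∀ i, Term (X.x i)) : Term v
  | zero {v : F.C.V} : Term v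
  | add {v : F.C.V} (s t : Term v) : Term v
  | smul {v : F.C.V} (r : k) (t : Term v) : Term v
  | d {v : F.C.V} (t : Term v) : Term v

variable {S}

/-- The value of an expression in a model. -/
def Term.eval (M : S.Model) : ∀ {v : F.C.V}, S.Term v → M.Q.obj v
  | v, .gen n g => M.gen v n g
  | _, .act f hf t => M.Q.act f hf fun i => (t i).eval M
  | _, .zero => 0
  | _, .add s t => s.eval M + t.eval M
  | _, .smul r t => r • t.eval M
  | v, .d t => M.Q.d v (t.eval M)

variable (S) in
/-- Equality in all models. -/
def termSetoid (v : F.C.V) : Setoid (S.Term v) where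
  r s t := ∀ M : S.Model, s.eval M = t.eval M
  iseqv := ⟨fun _ _ => rfl, fun h M => (h M).symm, fun h h' M => (h M).trans (h' M)⟩

variable (S) in
/-- Expressions modulo equality in all models. -/
def Univ (v : F.C.V) : Type u := Quotient (S.termSetoid v)

namespace Univ

/-- The value in a model. -/
def eval (M : S.Model) {v : F.C.V} (x : S.Univ v) : M.Q.obj v :=
  Quotient.lift (fun t : S.Term v => t.eval M) 
    (fun s t (h : ∀ N : S.Model, s.eval N = t.eval N) => h M) x

/-- The class of an expression. -/
def mk {v : F.C.V} (t : S.Term v) : S.Univ v := Quotient.mk _ t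

theorem eval_mk (M : S.Model) {v : F.C.V} (t : S.Term v) : (mk t).eval M = t.eval M := rfl

theorem ext {v : F.C.V} {x y : S.Univ v} (h : ∀ M : S.Model, x.eval M = y.eval M) : x = y := by
  induction x using Quotient.inductionOn
  induction y using Quotient.inductionOn
  exact Quotient.sound h

/-- An expression for an element. -/
noncomputable def out {v : F.C.V} (x : S.Univ v) : S.Term v := Quotient.out x

theorem mk_out {v : F.C.V} (x : S.Univ v) : mk x.out = x := Quotient.out_eq x

theorem eval_out (M : S.Model) {v : F.C.V} (x : S.Univ v) : x.out.eval M = x.eval M := by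
  conv_rhs => rw [← mk_out x]
  rfl

noncomputable instance (v : F.C.V) : Zero (S.Univ v) := ⟨mk .zero⟩
noncomputable instance (v : F.C.V) : Add (S.Univ v) := ⟨fun x y => mk (.add x.out y.out)⟩
noncomputable instance (v : F.C.V) : SMul k (S.Univ v) := ⟨fun r x => mk (.smul r x.out)⟩
noncomputable instance (v : F.C.V) : Neg (S.Univ v) := ⟨fun x => (-1 : k) • x⟩

theorem eval_zero (M : S.Model) {v : F.C.V} : (0 : S.Univ v).eval M = 0 := rfl

theorem eval_add (M : S.Model) {v : F.C.V} (x y : S.Univ v) :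
    (x + y).eval M = x.eval M + y.eval M :=
  congrArg₂ (· + ·) (eval_out M x) (eval_out M y)

theorem eval_smul (M : S.Model) {v : F.C.V} (r : k) (x : S.Univ v) :
    (r • x).eval M = r • x.eval M :=
  congrArg (r • ·) (eval_out M x)

theorem eval_neg (M : S.Model) {v : F.C.V} (x : S.Univ v) : (-x).eval M = -x.eval M :=
  (eval_smul M (-1) x).trans (neg_one_smul k _)

noncomputable instance (v : F.C.V) : AddCommGroup (S.Univ v) := { AddGroup.ofLeftAxioms
      (fun x y z => ext fun M => by simp only [eval_add, add_assoc])
      (fun x => ext fun M => by rw [eval_add, eval_zero, zero_add])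
      (fun x => ext fun M => by rw [eval_add, eval_neg, eval_zero, neg_add_cancel]) with
    add_comm := fun x y => ext fun M => by rw [eval_add, eval_add, add_comm] }

noncomputable instance (v : F.C.V) : Module k (S.Univ v) where
  one_smul x := ext fun M => by rw [eval_smul, one_smul]
  mul_smul r s x := ext fun M => by rw [eval_smul, eval_smul, eval_smul, mul_smul]
  smul_zero r := ext fun M => by rw [eval_smul, eval_zero, smul_zero]
  smul_add r x y := ext fun M => by simp only [eval_smul, eval_add, smul_add]
  add_smul r s x := ext fun M => by simp only [eval_smul, eval_add, add_smul]
  zero_smul x := ext fun M => by rw [eval_smul, eval_zero, zero_smul]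

/-- Evaluation in a model as a linear map. -/
noncomputable def evalHom (M : S.Model) (v : F.C.V) : S.Univ v →ₗ[k] M.Q.obj v where
  toFun := eval M
  map_add' := eval_add M
  map_smul' := eval_smul M

variable (S) in
/-- The homogeneous elements. -/
noncomputable def gr (v : F.C.V) (n : ℤ) : Submodule k (S.Univ v) :=
  ⨅ M : S.Model, ((M.Q.obj v).gr n).comap (evalHom M v)

theorem mem_gr {v : F.C.V} {n : ℤ} {x : S.Univ v} :
    x ∈ gr S v n ↔ ∀ M : S.Model, x.eval M ∈ (M.Q.obj v).gr n := by
  simp only [gr, Submodule.mem_iInf, Submodule.mem_comap]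
  rfl

variable {I : Type} [Finite I] [LinearOrder I] {x : I → F.C.V} {v : F.C.V}

/-- The action of operations. -/
noncomputable def act (f : F.C.Hom x v) (hf : F.δ.deg f ≤ 1) (p : ∀ i, S.Univ (x i)) : S.Univ v :=
  letI := ofFinite I
  let e : Fin (Fintype.card I) ≃o I := Fintype.orderIsoFinOfCardEq I rfl
  mk (.act (X := ⟨Fintype.card I, fun i => x (e i)⟩) (F.C.map e.toEquiv f)
    ((F.δ.deg_map e.toEquiv f).trans_le hf) fun i => (p (e i)).out)

theorem eval_act (M : S.Model) (f : F.C.Hom x v) (hf : F.δ.deg f ≤ 1) (p : ∀ i, S.Univ (x i)) :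
    (act f hf p).eval M = M.Q.act f hf fun i => (p i).eval M := by
  let := ofFinite I
  let e : Fin (Fintype.card I) ≃o I := Fintype.orderIsoFinOfCardEq I rfl
  refine Eq.trans ?_ (M.Q.act_map e f hf ((F.δ.deg_map e.toEquiv f).trans_le hf)
    fun i => (p i).eval M)
  exact congrArg (M.Q.act (F.C.map e.toEquiv f) ((F.δ.deg_map e.toEquiv f).trans_le hf))
    (funext fun i => eval_out M (p (e i)))

theorem update_eval {I : Type} [DecidableEq I] {x : I → F.C.V} (M : S.Model)
    (p : ∀ i, S.Univ (x i)) (i : I) (a : S.Univ (x i)) :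
    (fun j => (update p i a j).eval M) = update (fun j => (p j).eval M) i (a.eval M) := by
  funext j
  by_cases h : j = i
  · subst h; simp
  · simp [update_of_ne h]

/-- The action of operations as a multilinear map. -/
noncomputable def actMap (f : F.C.Hom x v) (hf : F.δ.deg f ≤ 1) : MultilinearMap k (fun i => S.Univ (x i)) (S.Univ v) where
  toFun := act f hf
  map_update_add' p i a b := ext fun M => by
    simp only [eval_add, eval_act, update_eval, MultilinearMap.map_update_add]
  map_update_smul' p i r a := ext fun M => by
    simp only [eval_smul, eval_act, update_eval, MultilinearMap.map_update_smul]

/-- The differential. -/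
noncomputable def d (v : F.C.V) : S.Univ v →ₗ[k] S.Univ v where
  toFun x := mk (.d x.out)
  map_add' x y := ext fun M => by
    simp only [eval_mk, eval_add, Term.eval, eval_out, map_add]
  map_smul' r x := ext fun M => by
    simp only [eval_mk, eval_smul, Term.eval, eval_out, map_smul, RingHom.id_apply]

theorem eval_d (M : S.Model) {v : F.C.V} (x : S.Univ v) : (d v x).eval M = M.Q.d v (x.eval M) :=
  congrArg (M.Q.d v) (eval_out M x)

theorem act_mem_gr {I : Type} [Fintype I] [LinearOrder I] {x : I → F.C.V} {v : F.C.V}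
    (f : F.C.Hom x v) (hf : F.δ.deg f ≤ 1) (n : I → ℤ) (p : ∀ i, S.Univ (x i))
    (hp : ∀ i, p i ∈ gr S (x i) (n i)) : act f hf p ∈ gr S v (∑ i, n i + ε.val * F.δ.deg f) :=
  mem_gr.2 fun M => by
    rw [eval_act]
    exact M.Q.act_mem f hf n _ fun i => mem_gr.1 (hp i) M

theorem mem_iSup_gr {v : F.C.V} (x : S.Univ v) : x ∈ ⨆ n, gr S v n := by
  rw [← mk_out x]
  generalize x.out = t
  clear x
  induction t with
  | gen n g =>
    exact Submodule.mem_iSup_of_mem n (mem_gr.2 fun M => S.homogeneous M.Q M.gen M.isModel _ n g)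
  | act f hf t ih =>
    have h : mk (.act f hf t) = act f hf fun i => mk (t i) := ext fun M => by rw [eval_act]; rfl
    rw [h]
    exact MultilinearMap.mem_iSup_of_forall (actMap f hf) (fun i => gr S _) _
      (fun n p hp => Submodule.mem_iSup_of_mem _ (act_mem_gr f hf n p hp)) _ ih
  | zero => exact Submodule.zero_mem _
  | add s t hs ht =>
    have h : mk (.add s t) = mk s + mk t := ext fun M => by rw [eval_add]; rfl
    rw [h]
    exact Submodule.add_mem _ hs ht
  | smul r t ht =>
    have h : mk (.smul r t) = r • mk t := ext fun M => by rw [eval_smul]; rfl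
    rw [h]
    exact Submodule.smul_mem _ _ ht
  | @d v t ht =>
    have h : mk (.d t) = d v (mk t) := ext fun M => by rw [eval_d]; rfl
    rw [h]
    refine Submodule.iSup_induction _ (motive := fun x => d v x ∈ ⨆ n, gr S v n) ht ?_ ?_ ?_
    · intro n x hx
      refine Submodule.mem_iSup_of_mem (n + 1) (mem_gr.2 fun M => ?_)
      rw [eval_d]
      exact M.Q.d_mem v n _ (mem_gr.1 hx M)
    · rw [map_zero]; exact Submodule.zero_mem _
    · intro x y hx hy
      rw [map_add]; exact Submodule.add_mem _ hx hy

theorem eval_units_smul (M : S.Model) {v : F.C.V} (s : ℤˣ) (x : S.Univ v) :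
    (s • x).eval M = s • x.eval M :=
  map_zsmul (evalHom M v) (s : ℤ) x

theorem act_one (v : F.C.V) (h : F.δ.deg (F.C.one v) ≤ 1) (p : S.Univ v) :
    act (F.C.one v) h (fun _ => p) = p :=
  ext fun M => (eval_act M _ _ _).trans (M.Q.act_one v h _)

theorem act_map {I J : Type} [Finite I] [LinearOrder I] [Finite J] [LinearOrder J] (e : I ≃o J)
    {x : J → F.C.V} {v : F.C.V} (f : F.C.Hom x v) (hf : F.δ.deg f ≤ 1)
    (hf' : F.δ.deg (F.C.map e.toEquiv f) ≤ 1) (p : ∀ j, S.Univ (x j)) :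
    act (F.C.map e.toEquiv f) hf' (fun i => p (e i)) = act f hf p :=
  ext fun M => (eval_act M _ _ _).trans
    ((M.Q.act_map e f hf hf' fun j => (p j).eval M).trans (eval_act M f hf _).symm)

theorem act_subst {I J : Type} [Fintype I] [LinearOrder I] [Fintype J] [LinearOrder J]
    {x : I → F.C.V} {y : J → F.C.V} {v : F.C.V} (f : F.C.Hom y v) (π : I → J)
    (g : ∀ j, F.C.Hom (fun i : {i // π i = j} => x i) (y j)) (hf : F.δ.deg f ≤ 1)
    (hg : ∀ j, F.δ.deg (g j) ≤ 1) (h : F.δ.deg (subst f π g) ≤ 1) (n : I → ℤ)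
    (p : ∀ i, S.Univ (x i)) (hp : ∀ i, p i ∈ gr S (x i) (n i)) :
    act (subst f π g) h p = koszulSign ε π (fun j => F.δ.deg (g j)) n •
      act f hf (fun j => act (g j) (hg j) (fun i => p i)) := ext fun M => by
  rw [eval_units_smul, eval_act, eval_act]
  refine (M.Q.act_subst f π g hf hg h n (fun i => (p i).eval M)
    fun i => mem_gr.1 (hp i) M).trans ?_
  congr 2
  exact funext fun j => (eval_act M (g j) (hg j) _).symm

theorem d_mem {v : F.C.V} {n : ℤ} {p : S.Univ v} (hp : p ∈ gr S v n) : d v p ∈ gr S v (n + 1) :=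
  mem_gr.2 fun M => by
    rw [eval_d]
    exact M.Q.d_mem v n _ (mem_gr.1 hp M)

theorem d_d {v : F.C.V} (p : S.Univ v) : d v (d v p) = 0 := ext fun M => by
  rw [eval_d, eval_d]
  exact M.Q.d_d v _

theorem d_act {I : Type} [Fintype I] [LinearOrder I] {x : I → F.C.V} {v : F.C.V}
    (f : F.C.Hom x v) (hf : F.δ.deg f ≤ 1) (n : I → ℤ) (p : ∀ i, S.Univ (x i))
    (hp : ∀ i, p i ∈ gr S (x i) (n i)) :
    d v (act f hf p) = (-1 : ℤˣ) ^ (ε.val * F.δ.deg f) • ∑ i,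
      (∏ i', if i' < i then (-1 : ℤˣ) ^ n i' else 1) •
        act f hf (update p i (d (x i) (p i))) := ext fun M => by
  rw [eval_d, eval_act, eval_units_smul]
  refine (M.Q.d_act f hf n _ fun i => mem_gr.1 (hp i) M).trans ?_
  congr 1
  refine Eq.trans ?_ (map_sum (evalHom M _) _ _).symm
  refine sum_congr rfl fun i _ => ?_
  refine Eq.trans ?_ (eval_units_smul M _ _).symm
  rw [eval_act, update_eval, eval_d]

end Univ

open Univ

variable (S)

/-- The graded vector spaces underlying the universal model. -/
noncomputable def univObj (v : F.C.V) : GrVect k where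
  carrier := S.Univ v
  gr := gr S v
  isInternal := GrVect.isInternal_of_separating (fun M : S.Model => evalHom M v)
    (fun _ h => Univ.ext h) (fun M _ _ hx => mem_gr.1 hx M) mem_iSup_gr

/-- The universal model without its differential. -/
noncomputable def univPre : PreGradedOp k F where
  obj := S.univObj
  act f hf := actMap f hf

/-- The evaluation of the universal model in a model. -/
noncomputable def univEval (M : S.Model) (v : F.C.V) : S.univPre.obj v →ₗ[k] M.Q.obj v := evalHom M v

theorem univEval_act (M : S.Model) {I : Type} [Finite I] [LinearOrder I] {x : I → F.C.V} {v : F.C.V}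
    (f : F.C.Hom x v) (hf : F.δ.deg f ≤ 1) (p : ∀ i, S.univPre.obj (x i)) :
    S.univEval M v (S.univPre.act f hf p) = M.Q.act f hf fun i => S.univEval M _ (p i) :=
  eval_act M f hf p

theorem univPre_swap {X Y : F.C.Word} {v : F.C.V} {n : ℕ} (d d' : F.δ.Chain X Y 2)
    (c : F.δ.Chain Y (single v) n) (h : F.perm (Equiv.swap 0 1) ⟦d⟧ = ⟦d'⟧)
    (t : S.univPre.Tensor X) (ht : t.Homogeneous) :
    (pushChain ε c (pushChain ε d' t)).value =
      (-1 : ℤˣ) ^ ε.val • (pushChain ε c (pushChain ε d t)).value :=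
  Univ.ext fun M => by
    have h1 := M.Q.act_swap d d' c h (t.mapVal fun v => S.univEval M v)
      fun i => mem_gr.1 (ht i) M
    have h2 : ∀ e : F.δ.Chain X Y 2, (pushChain ε c (pushChain ε e
        (t.mapVal fun v => S.univEval M v))).value =
        S.univEval M _ (pushChain ε c (pushChain ε e t)).value := by
      intro e
      refine Eq.trans ?_ (PreGradedOp.value_mapVal (fun v => S.univEval M v) _)
      rw [PreGradedOp.pushChain_mapVal (fun v => S.univEval M v) (S.univEval_act M),
        PreGradedOp.pushChain_mapVal (fun v => S.univEval M v) (S.univEval_act M)]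
    rw [h2, h2] at h1
    exact h1.trans (eval_units_smul M _ _).symm

/-- The universal model. -/
noncomputable def univ : DGOp k F ε where
  toPreGradedOp := S.univPre
  act_mem f hf n p hp := act_mem_gr f hf n p hp
  act_one := Univ.act_one
  act_map e x v f hf hf' p := Univ.act_map e f hf hf' p
  act_subst f π g hf hg h n p hp := Univ.act_subst f π g hf hg h n p hp
  act_swap := S.univPre_swap
  d v := Univ.d v
  d_mem v n p hp := Univ.d_mem hp
  d_d v p := Univ.d_d p
  d_act f hf n p hp := Univ.d_act f hf n p hp

/-- The marked elements of the universal model. -/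
noncomputable def univGen (v : F.C.V) (n : ℤ) (g : S.G v n) : S.univ.obj v := Univ.mk (.gen n g)

/-- The morphism from the universal model to a model. -/
noncomputable def univHom (M : S.Model) : S.univ ⟶ M.Q :=
  DGOp.Hom.mk (evalHom M) (fun _ _ _ hp => mem_gr.1 hp M) (fun f hf p => eval_act M f hf p)
    (fun _ x => eval_d M x)

theorem univ_ext {v : F.C.V} {x y : S.univ.obj v}
    (h : ∀ M, (S.univHom M).app v x = (S.univHom M).app v y) : x = y := Univ.ext h

theorem univGen_mem (v : F.C.V) (n : ℤ) (g : S.G v n) : S.univGen v n g ∈ (S.univ.obj v).gr n :=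
  mem_gr.2 fun M => S.homogeneous M.Q M.gen M.isModel _ n g

theorem mem_univ_gr {v : F.C.V} {n : ℤ} {x : S.univ.obj v} :
    x ∈ (S.univ.obj v).gr n ↔ ∀ M, (S.univHom M).app v x ∈ (M.Q.obj v).gr n := mem_gr

/-- The universal model is generated by the marked elements. -/
theorem univ_induction {p : ∀ v, S.univ.obj v → Prop} (hgen : ∀ v n g, p v (S.univGen v n g))
    (hact : ∀ (X : F.C.Word) (v : F.C.V) (f : F.C.Hom X.x v) (hf : F.δ.deg f ≤ 1)
      (t : ∀ i, S.univ.obj (X.x i)), (∀ i, p _ (t i)) → p v (S.univ.act f hf t))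
    (hzero : ∀ v, p v 0) (hadd : ∀ v x y, p v x → p v y → p v (x + y))
    (hsmul : ∀ v (r : k) x, p v x → p v (r • x)) (hd : ∀ v x, p v x → p v (S.univ.d v x))
    {v : F.C.V} (x : S.univ.obj v) : p v x := by
  have h : ∀ {v : F.C.V} (t : S.Term v), p v (Univ.mk t) := by
    intro v t
    induction t with
    | gen n g => exact hgen _ n g
    | @act X v f hf t ih =>
      have h : Univ.mk (.act f hf t) = Univ.act f hf fun i => Univ.mk (t i) :=
        Univ.ext fun M => by rw [eval_act]; rfl
      rw [h]
      exact hact X v f hf _ ih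
    | zero => exact hzero _
    | add s t hs ht =>
      have h : Univ.mk (.add s t) = Univ.mk s + Univ.mk t := Univ.ext fun M => by rw [eval_add]; rfl
      rw [h]
      exact hadd _ _ _ hs ht
    | smul r t ht =>
      have h : Univ.mk (.smul r t) = r • Univ.mk t := Univ.ext fun M => by rw [eval_smul]; rfl
      rw [h]
      exact hsmul _ _ _ ht
    | @d v t ht =>
      have h : Univ.mk (.d t) = Univ.d v (Univ.mk t) := Univ.ext fun M => by rw [eval_d]; rfl
      rw [h]
      exact hd _ _ ht
  exact (congrArg (p v) (mk_out (S := S) x)).mp (h _)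

theorem univ_hom_ext {Q : DGOp k F ε} {a b : S.univ ⟶ Q}
    (h : ∀ v n g, a.app v (S.univGen v n g) = b.app v (S.univGen v n g)) : a = b := by
  refine DGOp.Hom.ext (funext fun v => LinearMap.ext fun x => ?_)
  refine S.univ_induction (p := fun v x => a.app v x = b.app v x) h ?_ ?_ ?_ ?_ ?_ x
  · intro X v f hf t ht
    rw [a.app_act, b.app_act]
    exact congrArg _ (funext ht)
  · intro v; rw [map_zero, map_zero]
  · intro v x y hx hy; rw [map_add, map_add, hx, hy]
  · intro v r x hx; rw [map_smul, map_smul, hx]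
  · intro v x hx; rw [a.app_d, b.app_d, hx]

end Presentation

/-! ### The left adjoint of the exceptional push-forward -/

theorem isRightAdjoint_of_universalArrow {C D : Type*} [Category* C] [Category* D] (G : D ⥤ C)
    (h : ∀ A : C, ∃ (U : D) (u : A ⟶ G.obj U), ∀ Q : D,
      Bijective fun g : U ⟶ Q => u ≫ G.map g) : G.IsRightAdjoint := by
  choose U u hu using h
  exact (Adjunction.adjunctionOfEquivLeft (G := G)
    (fun A Q => Equiv.ofBijective (fun g : U A ⟶ Q => u A ≫ G.map g) (hu A Q))
    (fun A Q Q' g h => by simp)).isRightAdjoint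

namespace CubicalMorphism

variable {F₁ F₂ : CubicalFeynmanCategory.{u}} {φ : CubicalMorphism F₁ F₂} [CharZero k]
  (hφ : φ.Admissible)

theorem push_hom_ext {P : PreGradedOp k F₁} (hP : P.Laws ε) {v : F₂.C.V} {N : Type*}
    [AddCommGroup N] [Module k N] {f g : φ.pushObj hP v →ₗ[k] N}
    (h : ∀ (s : φ.Lift v) (p : P.obj s.1), f (classAt hP hφ s p) = g (classAt hP hφ s p)) :
    f = g := by
  refine LinearMap.ext fun x => ?_
  rw [← sum_classAt hP hφ x, map_sum, map_sum]
  refine sum_congr rfl fun s _ => ?_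
  rw [map_smul, map_smul, h]

theorem component_evIso {P : PreGradedOp k F₁} (hP : P.Laws ε) {v v' : F₂.C.V}
    (σ : single v ≅ single v') (t : φ.Lift v') (x : φ.pushObj hP v) :
    component hP t ((pushPre hP hφ).evIso σ x) =
      component hP (⟨t.1, t.2 ≪≫ σ.symm⟩ : φ.Lift v) x := by
  suffices h : component hP t ∘ₗ (pushPre hP hφ).evIso σ =
      component hP (⟨t.1, t.2 ≪≫ σ.symm⟩ : φ.Lift v) from LinearMap.congr_fun h x
  refine push_hom_ext hφ hP fun s p => ?_
  refine (congrArg (component hP t) (evIso_classAt hP hφ σ s p)).trans ?_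
  by_cases hc : ∃ l : single s.1 ≅ single t.1, φ.mapV l ≪≫ t.2 = s.2 ≪≫ σ
  · obtain ⟨l, hl⟩ := hc
    have hl' : φ.mapV l ≪≫ t.2 ≪≫ σ.symm = s.2 := by
      rw [← Iso.trans_assoc, hl, Iso.trans_assoc, Iso.self_symm_id, Iso.trans_refl]
    exact (component_classAt hP hφ (s := (⟨s.1, s.2 ≪≫ σ⟩ : φ.Lift v')) l hl p).trans
      (component_classAt hP hφ (t := (⟨t.1, t.2 ≪≫ σ.symm⟩ : φ.Lift v)) l hl' p).symm
  · refine (component_classAt_zero hP hφ (s := (⟨s.1, s.2 ≪≫ σ⟩ : φ.Lift v')) hc p).trans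
      (component_classAt_zero hP hφ (t := (⟨t.1, t.2 ≪≫ σ.symm⟩ : φ.Lift v)) ?_ p).symm
    rintro ⟨l, hl⟩
    refine hc ⟨l, ?_⟩
    change φ.mapV l ≪≫ t.2 ≪≫ σ.symm = s.2 at hl
    rw [← hl, Iso.trans_assoc, Iso.trans_assoc, Iso.symm_self_id, Iso.trans_refl]

theorem component_eq {P : PreGradedOp k F₁} (hP : P.Laws ε) {v : F₂.C.V} (t : φ.Lift v)
    (x : φ.pushObj hP v) : component hP t x =
      component hP (φ.baseLift t.1) ((pushPre hP hφ).evIso t.2.symm x) := by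
  refine Eq.trans ?_ (component_evIso hφ hP t.2.symm (φ.baseLift t.1) x).symm
  have h : (⟨t.1, Iso.refl _ ≪≫ t.2⟩ : φ.Lift v) = t := by
    rw [Iso.refl_trans]; rfl
  have h2 : ∀ (r : φ.Lift v), r = t → ∀ hr : r.1 = t.1,
      component hP t x = hr ▸ component hP r x := by
    rintro r rfl hr
    rfl
  exact h2 _ h rfl

/-- The component at a vertex of the value of a morphism to a push-forward. -/
noncomputable def toBase {A : DGOp k F₂ ε} {Q : DGOp k F₁ ε} (h : A ⟶ pushDG hφ Q) (w : F₁.C.V) :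
    A.obj (φ.onV w) →ₗ[k] Q.obj w :=
  component Q.laws (φ.baseLift w) ∘ₗ h.app (φ.onV w)

theorem component_app {A : DGOp k F₂ ε} {Q : DGOp k F₁ ε} (h : A ⟶ pushDG hφ Q) {v : F₂.C.V}
    (t : φ.Lift v) (x : A.obj v) :
    component Q.laws t (h.app v x) = toBase hφ h t.1 (A.evIso t.2.symm x) := by
  refine (component_eq hφ Q.laws t _).trans ?_
  exact congrArg (component Q.laws (φ.baseLift t.1)) (DGOp.Hom.app_evIso h t.2.symm x).symm

theorem hom_ext_toBase {A : DGOp k F₂ ε} {Q : DGOp k F₁ ε} {h h' : A ⟶ pushDG hφ Q}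
    (H : ∀ w n, ∀ x ∈ (A.obj (φ.onV w)).gr n, toBase hφ h w x = toBase hφ h' w x) : h = h' := by
  refine DGOp.Hom.ext (funext fun v => LinearMap.ext fun x => push_ext Q.laws fun t => ?_)
  have h1 : toBase hφ h t.1 = toBase hφ h' t.1 := GrVect.hom_ext (H t.1)
  exact (component_app hφ h t x).trans ((LinearMap.congr_fun h1 _).trans
    (component_app hφ h' t x).symm)

/-- Morphisms from an object to push-forwards, presented by their components. -/
noncomputable def toPushPresentation (A : DGOp k F₂ ε) : Presentation k F₁ ε where
  G w n := (A.obj (φ.onV w)).gr n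
  IsModel Q γ := ∃ h : A ⟶ pushDG hφ Q, ∀ w n x, γ w n x = toBase hφ h w x
  homogeneous := by
    rintro Q γ ⟨h, hh⟩ w n x
    rw [hh]
    exact h.app_mem _ n _ x.2 (φ.baseLift w)

section Universal

variable (A : DGOp k F₂ ε)

/-- The morphism to the push-forward of a model. -/
noncomputable def modelHom (M : (toPushPresentation hφ A).Model) : A ⟶ pushDG hφ M.Q :=
  M.isModel.choose

theorem toBase_modelHom (M : (toPushPresentation hφ A).Model) (w : F₁.C.V) (n : ℤ)
    (x : (A.obj (φ.onV w)).gr n) : toBase hφ (modelHom hφ A M) w x = M.gen w n x :=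
  (M.isModel.choose_spec w n x).symm

theorem univPush_ext {v : F₂.C.V} {x y : (pushDG hφ (toPushPresentation hφ A).univ).obj v}
    (h : ∀ M, (pushHom hφ ((toPushPresentation hφ A).univHom M)).app v x =
      (pushHom hφ ((toPushPresentation hφ A).univHom M)).app v y) : x = y :=
  push_ext (toPushPresentation hφ A).univ.laws fun t => Presentation.univ_ext _ fun M =>
    congrArg (component M.Q.laws t) (h M)

theorem exists_universal {v : F₂.C.V} (x : A.obj v) :
    ∃ y : (pushDG hφ (toPushPresentation hφ A).univ).obj v, ∀ M,
      (pushHom hφ ((toPushPresentation hφ A).univHom M)).app v y = (modelHom hφ A M).app v x := by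
  suffices h : ∀ n, ∀ x ∈ (A.obj v).gr n,
      ∃ y : (pushDG hφ (toPushPresentation hφ A).univ).obj v, ∀ M,
      (pushHom hφ ((toPushPresentation hφ A).univHom M)).app v y = (modelHom hφ A M).app v x by
    obtain ⟨s, hs⟩ := GrVect.exists_sum_proj x
    choose y hy using fun n => h n _ (GrVect.proj_mem n x)
    refine ⟨∑ n ∈ s, y n, fun M => ?_⟩
    rw [map_sum, sum_congr rfl fun n _ => hy n M, ← map_sum, hs s subset_rfl]
  intro n x hx
  let S := toPushPresentation hφ A
  let g : ∀ t : φ.Lift v, S.univ.obj t.1 := fun t =>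
    S.univGen t.1 n ⟨A.evIso t.2.symm x, A.laws.evIso_mem t.2.symm hx⟩
  have hg : ∀ (M : S.Model) (t : φ.Lift v), (S.univHom M).app t.1 (g t) =
      component M.Q.laws t ((modelHom hφ A M).app v x) := fun M t =>
    (toBase_modelHom hφ A M t.1 n ⟨A.evIso t.2.symm x, A.laws.evIso_mem t.2.symm hx⟩).symm.trans
      (component_app hφ (modelHom hφ A M) t x).symm
  refine ⟨⟨g, fun t t' l hl => S.univ_ext fun M => ?_⟩, fun M => push_ext M.Q.laws (hg M)⟩
  rw [DGOp.Hom.app_evIso, hg, hg]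
  exact evIso_component M.Q.laws l hl _

/-- The universal morphism to a push-forward. -/
noncomputable def toPushUniversal : A ⟶ pushDG hφ (toPushPresentation hφ A).univ := by
  let f := fun v (x : A.obj v) => (exists_universal hφ A x).choose
  have hf : ∀ v (x : A.obj v) M, (pushHom hφ ((toPushPresentation hφ A).univHom M)).app v (f v x) =
      (modelHom hφ A M).app v x := fun v x => (exists_universal hφ A x).choose_spec
  exact DGOp.Hom.mk
    (fun v => 
      { toFun := f v
        map_add' := fun x y => univPush_ext hφ A fun M => by
          rw [map_add, hf, hf, hf, map_add]
        map_smul' := fun r x => univPush_ext hφ A fun M => by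
          rw [RingHom.id_apply, map_smul, hf, hf, map_smul] })
    (fun v n x hx t => (Presentation.mem_univ_gr _).2 fun M => by
      have h : (pushHom hφ ((toPushPresentation hφ A).univHom M)).app v (f v x) ∈
          ((pushDG hφ M.Q).obj v).gr n := by
        rw [hf]
        exact (modelHom hφ A M).app_mem v n x hx
      exact h t)
    (fun g hg p => univPush_ext hφ A fun M => by
      refine (hf _ _ M).trans (((modelHom hφ A M).app_act g hg p).trans ?_)
      refine Eq.trans ?_ ((pushHom hφ ((toPushPresentation hφ A).univHom M)).app_act g hg _).symm
      exact congrArg _ (funext fun i => (hf _ _ M).symm))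
    (fun v x => univPush_ext hφ A fun M => by
      refine (hf _ _ M).trans (((modelHom hφ A M).app_d v x).trans ?_)
      refine Eq.trans ?_ ((pushHom hφ ((toPushPresentation hφ A).univHom M)).app_d v _).symm
      exact congrArg _ (hf _ _ M).symm)

theorem toPushUniversal_comp (M : (toPushPresentation hφ A).Model) :
    toPushUniversal hφ A ≫ pushHom hφ ((toPushPresentation hφ A).univHom M) = modelHom hφ A M :=
  DGOp.Hom.ext (funext fun _ => LinearMap.ext fun x => (exists_universal hφ A x).choose_spec M)

theorem toBase_toPushUniversal (w : F₁.C.V) (n : ℤ) (x : (A.obj (φ.onV w)).gr n) :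
    toBase hφ (toPushUniversal hφ A) w x = (toPushPresentation hφ A).univGen w n x := by
  refine Presentation.univ_ext _ fun M => ?_
  refine Eq.trans ?_ (toBase_modelHom hφ A M w n x)
  rw [← toPushUniversal_comp]
  rfl

theorem toPushUniversal_bijective (Q : DGOp k F₁ ε) :
    Bijective fun g : (toPushPresentation hφ A).univ ⟶ Q =>
      toPushUniversal hφ A ≫ (pushFunctor hφ).map g := by
  constructor
  · intro a b hab
    refine Presentation.univ_hom_ext _ fun w n (x : (A.obj (φ.onV w)).gr n) => ?_
    have h : ∀ g : (toPushPresentation hφ A).univ ⟶ Q, g.app w ((toPushPresentation hφ A).univGen w n x) =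
        toBase hφ (toPushUniversal hφ A ≫ (pushFunctor hφ).map g) w x := fun g =>
      congrArg (g.app w) (toBase_toPushUniversal hφ A w n x).symm
    rw [h, h]
    exact congrArg (fun c => toBase hφ c w x) hab
  · intro f
    let M : (toPushPresentation hφ A).Model :=
      ⟨Q, fun w n (x : (A.obj (φ.onV w)).gr n) => toBase hφ f w x, f, fun _ _ _ => rfl⟩
    refine ⟨(toPushPresentation hφ A).univHom M, (toPushUniversal_comp hφ A M).trans ?_⟩
    exact hom_ext_toBase hφ fun w n x hx => toBase_modelHom hφ A M w n ⟨x, hx⟩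

end Universal

theorem pushFunctor_isRightAdjoint : (pushFunctor (k := k) (ε := ε) hφ).IsRightAdjoint :=
  isRightAdjoint_of_universalArrow _ fun A =>
    ⟨_, toPushUniversal hφ A, toPushUniversal_bijective hφ A⟩

end CubicalMorphism

theorem ExceptionalPush.isRightAdjoint [CharZero k] {F₁ F₂ : CubicalFeynmanCategory.{u}}
    {φ : CubicalMorphism F₁ F₂} (hφ : φ.Admissible) (L : ExceptionalPush k ε φ) :
    L.functor.IsRightAdjoint :=
  haveI := CubicalMorphism.pushFunctor_isRightAdjoint (k := k) (ε := ε) hφ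
  Functor.isRightAdjoint_of_iso (L.isoPush hφ)

/-! ### Decompositions of multilinear functionals -/

/-- Finitely many functionals can be expanded with a finite dual family. -/
theorem exists_dual_family {V D : Type*} [AddCommGroup V] [Module k V] [AddCommGroup D] [Module k D]
    (B : D →ₗ[k] Dual k V) (hB : Function.Injective B) {A : Type*} [Finite A] (ζ : A → D) :
    ∃ (n : ℕ) (e : Fin n → D) (p : Fin n → V), ∀ a, ζ a = ∑ b, B (ζ a) (p b) • e b := by
  let E := Submodule.span k (Set.range ζ)
  have : FiniteDimensional k E := FiniteDimensional.span_of_finite k (Set.finite_range ζ)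
  let b := Module.finBasis k E
  let ev : V →ₗ[k] Dual k E := (B ∘ₗ E.subtype).flip
  have hev : Function.Surjective ev := by
    rw [← LinearMap.range_eq_top]
    have h : (LinearMap.range ev).dualCoannihilator = ⊥ := by
      refine (Submodule.eq_bot_iff _).2 fun x hx => ?_
      rw [Submodule.mem_dualCoannihilator] at hx
      have h1 : B x = 0 := LinearMap.ext fun p => hx (ev p) ⟨p, rfl⟩
      exact Subtype.ext (hB (h1.trans (map_zero B).symm))
    have h2 := Subspace.dualCoannihilator_dualAnnihilator_eq (W := LinearMap.range ev)
    rw [← h2, h, Submodule.dualAnnihilator_bot]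
  choose p hp using fun i => hev (b.coord i)
  refine ⟨_, fun i => b i, p, fun a => ?_⟩
  have h := b.sum_repr ⟨ζ a, Submodule.subset_span ⟨a, rfl⟩⟩
  have h1 := congrArg E.subtype h
  rw [map_sum] at h1
  refine h1.symm.trans (sum_congr rfl fun i _ => ?_)
  rw [map_smul]
  congr 1
  exact (LinearMap.congr_fun (hp i) ⟨ζ a, Submodule.subset_span ⟨a, rfl⟩⟩).symm

/-- A linear relation between products of functionals holds for all multilinear maps. -/
theorem multilinear_sum_eq_zero {I : Type*} [Fintype I] {V D : I → Type*} [∀ i, AddCommGroup (V i)]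
    [∀ i, Module k (V i)] [∀ i, AddCommGroup (D i)] [∀ i, Module k (D i)]
    (B : ∀ i, D i →ₗ[k] Dual k (V i)) (hB : ∀ i, Function.Injective (B i))
    {A : Type*} [Fintype A] (r : A → k) (ζ : A → ∀ i, D i)
    (h : ∀ p : ∀ i, V i, ∑ a, r a * ∏ i, B i (ζ a i) (p i) = 0) {N : Type*} [AddCommGroup N]
    [Module k N] (M : MultilinearMap k D N) : ∑ a, r a • M (ζ a) = 0 := by
  classical
  choose n e p hp using fun i => exists_dual_family (B i) (hB i) fun a => ζ a i
  have h1 : ∀ a, M (ζ a) = ∑ b : ∀ i, Fin (n i), (∏ i, B i (ζ a i) (p i (b i))) •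
      M fun i => e i (b i) := by
    intro a
    have : ζ a = fun i => ∑ b, B i (ζ a i) (p i b) • e i b := funext fun i => hp i a
    conv_lhs => rw [this]
    rw [MultilinearMap.map_sum]
    exact sum_congr rfl fun b _ => MultilinearMap.map_smul_univ _ _ _
  simp only [h1, smul_sum, smul_smul]
  rw [sum_comm]
  refine sum_eq_zero fun b _ => ?_
  rw [← sum_smul, h fun i => p i (b i), zero_smul]

theorem GrVect.dual_apply_proj {M : GrVect k} {n m : ℤ} {ξ : Dual k M} (hξ : ξ ∈ M.dual n)
    (x : M) : ξ (M.proj (-m) x) = if n = m then ξ x else 0 := by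
  split_ifs with h
  · subst h
    obtain ⟨s, hs⟩ := GrVect.exists_sum_proj x
    rw [← hs (insert (-n) s) (Finset.subset_insert _ _), map_sum, map_sum, sum_eq_single (-n)]
    · rw [GrVect.proj_of_mem (GrVect.proj_mem _ _), map_sum, sum_eq_single (-n)]
      · exact fun b _ hb => hξ b hb _ (GrVect.proj_mem _ _)
      · exact fun h => absurd (Finset.mem_insert_self _ _) h
    · intro b _ hb
      rw [GrVect.proj_of_mem_ne hb (GrVect.proj_mem _ _), map_zero]
    · exact fun h => absurd (Finset.mem_insert_self _ _) h
  · exact hξ _ (fun h' => h (neg_injective h').symm) _ (GrVect.proj_mem _ _)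

/-- A way of writing a function of vectors as a sum of products of homogeneous functionals. -/
structure Decomp {I : Type} [Fintype I] (V : I → GrVect k) (Ξ : (∀ i, V i) → k) where
  A : Type
  [fintype : Fintype A]
  r : A → k
  c : A → I → ℤ
  ζ : ∀ a i, (V i).dual (c a i)
  sum_eq : ∀ p, Ξ p = ∑ a, r a * ∏ i, (ζ a i : Dual k (V i)) (p i)

namespace Decomp

variable {I : Type} [Fintype I] {V : I → GrVect k} {Ξ Ξ' : (∀ i, V i) → k} {W : I → Type*}
  [∀ i, AddCommGroup (W i)] [∀ i, Module k (W i)] {N : Type*} [AddCommGroup N] [Module k N]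

instance (T : Decomp V Ξ) : Fintype T.A := T.fintype

open Classical in
/-- The part of the decomposition of the given degrees, evaluated at a multilinear map. -/
noncomputable def part (T : Decomp V Ξ) (γ : ∀ i n, (V i).dual n →ₗ[k] W i) (c : I → ℤ)
    (M : MultilinearMap k W N) : N :=
  ∑ a, if T.c a = c then T.r a • M fun i => γ i _ (T.ζ a i) else 0

/-- The decomposition evaluated at a multilinear map, with signs that depend on the degrees. -/
noncomputable def eval (T : Decomp V Ξ) (γ : ∀ i n, (V i).dual n →ₗ[k] W i) (s : (I → ℤ) → ℤˣ)
    (M : MultilinearMap k W N) : N :=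
  ∑ a, T.r a • s (T.c a) • M fun i => γ i _ (T.ζ a i)

theorem eval_eq_sum_part (T : Decomp V Ξ) (γ : ∀ i n, (V i).dual n →ₗ[k] W i)
    (s : (I → ℤ) → ℤˣ) (M : MultilinearMap k W N) (S : Finset (I → ℤ)) (hS : ∀ a, T.c a ∈ S) :
    T.eval γ s M = ∑ c ∈ S, s c • T.part γ c M := by
  classical
  unfold eval part
  simp only [smul_sum]
  rw [sum_comm]
  refine sum_congr rfl fun a _ => ?_
  rw [sum_eq_single (T.c a)]
  · rw [if_pos rfl]
    exact smul_comm (T.r a) ((s (T.c a) : ℤˣ) : ℤ) _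
  · intro c _ hc
    rw [if_neg hc.symm, smul_zero]
  · exact fun h => absurd (hS a) h

theorem eval_congr {J : Type} [Fintype J] {V' : J → GrVect k} {Ξ' : (∀ j, V' j) → k} {W' : J → Type*}
    [∀ j, AddCommGroup (W' j)] [∀ j, Module k (W' j)] {T : Decomp V Ξ} {T' : Decomp V' Ξ'}
    {γ : ∀ i n, (V i).dual n →ₗ[k] W i} {γ' : ∀ i n, (V' i).dual n →ₗ[k] W' i}
    {s : (I → ℤ) → ℤˣ} {s' : (J → ℤ) → ℤˣ} {M : MultilinearMap k W N} {M' : MultilinearMap k W' N}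
    (e : (I → ℤ) ≃ (J → ℤ))
    (h : ∀ c, s' (e c) • T'.part γ' (e c) M' = s c • T.part γ c M) :
    T'.eval γ' s' M' = T.eval γ s M := by
  classical
  let S : Finset (I → ℤ) := (Finset.univ.image T.c) ∪ (Finset.univ.image fun a => e.symm (T'.c a))
  rw [T.eval_eq_sum_part γ s M S fun a => Finset.mem_union_left _
      (Finset.mem_image_of_mem _ (mem_univ a)),
    T'.eval_eq_sum_part γ' s' M' (S.map e.toEmbedding) fun a => by
      refine Finset.mem_map.2 ⟨e.symm (T'.c a), Finset.mem_union_right _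
        (Finset.mem_image_of_mem (fun a => e.symm (T'.c a)) (mem_univ a)), by simp⟩,
    Finset.sum_map]
  exact sum_congr rfl fun c _ => h c

open Classical in
theorem sum_part_functional (T : Decomp V Ξ) (c : I → ℤ) (p : ∀ i, V i) :
    (∑ a, if T.c a = c then T.r a * ∏ i, (T.ζ a i : Dual k (V i)) (p i) else 0) =
      Ξ fun i => (V i).proj (-c i) (p i) := by
  rw [T.sum_eq]
  refine sum_congr rfl fun a _ => ?_
  simp only [GrVect.dual_apply_proj (T.ζ a _).2]
  split_ifs with h
  · congr 1
    exact prod_congr rfl fun i _ => (if_pos (congrFun h i)).symm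
  · obtain ⟨i, hi⟩ : ∃ i, T.c a i ≠ c i := by
      by_contra! h'
      exact h (funext h')
    rw [Finset.prod_eq_zero (mem_univ i) (if_neg hi), mul_zero]

theorem gamma_congr {M : GrVect k} {W : Type*} [AddCommGroup W] [Module k W]
    (γ : ∀ n, M.dual n →ₗ[k] W) {n m : ℤ} (h : n = m) (ξ : M.dual n) (η : M.dual m)
    (hξ : (ξ : Dual k M) = η) : γ n ξ = γ m η := by
  subst h
  rw [Subtype.ext hξ]

/-- The value of the part of given degrees depends only on the functional on vectors of the
opposite degrees. -/
theorem part_congr (T : Decomp V Ξ) (T' : Decomp V Ξ') (γ : ∀ i n, (V i).dual n →ₗ[k] W i)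
    (c : I → ℤ) (M : MultilinearMap k W N) (u : k)
    (h : ∀ p : ∀ i, V i, (∀ i, p i ∈ (V i).gr (-c i)) → Ξ' p = u * Ξ p) :
    T'.part γ c M = u • T.part γ c M := by
  classical
  have key := multilinear_sum_eq_zero (fun i => ((V i).dual (c i)).subtype)
    (fun i => Subtype.val_injective) (A := T'.A ⊕ T.A)
    (Sum.elim (fun a => if T'.c a = c then T'.r a else 0)
      (fun a => -u * if T.c a = c then T.r a else 0))
    (Sum.elim (fun a i => if hc : T'.c a i = c i then hc ▸ T'.ζ a i else 0)
      (fun a i => if hc : T.c a i = c i then hc ▸ T.ζ a i else 0)) ?_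
    (M.compLinearMap fun i => γ i (c i))
  · rw [Fintype.sum_sum_type] at key
    simp only [Sum.elim_inl, Sum.elim_inr, MultilinearMap.compLinearMap_apply, mul_smul,
      neg_smul, sum_neg_distrib] at key
    have h1 : ∀ {Ξ : (∀ i, V i) → k} (T : Decomp V Ξ), T.part γ c M =
        ∑ a, (if T.c a = c then T.r a else 0) •
          M fun i => γ i (c i) (if hc : T.c a i = c i then hc ▸ T.ζ a i else 0) := by
      intro Ξ T
      refine sum_congr rfl fun a _ => ?_
      split_ifs with hc
      · congr 2
        funext i
        refine gamma_congr (γ i) (congrFun hc i) _ _ ?_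
        rw [dif_pos (congrFun hc i)]
        have : ∀ (m : ℤ) (hm : T.c a i = m), ((T.ζ a i : Dual k (V i))) =
            ((hm ▸ T.ζ a i : (V i).dual m) : Dual k (V i)) := by
          rintro _ rfl; rfl
        exact this _ _
      · rw [zero_smul]
    rw [h1 T, h1 T']
    rwa [← smul_sum, add_neg_eq_zero] at key
  · intro p
    rw [Fintype.sum_sum_type]
    have h1 : ∀ {Ξ : (∀ i, V i) → k} (T : Decomp V Ξ), (∑ a, (if T.c a = c then T.r a else 0) *
        ∏ i, ((V i).dual (c i)).subtype (if hc : T.c a i = c i then hc ▸ T.ζ a i else 0) (p i)) =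
        Ξ fun i => (V i).proj (-c i) (p i) := by
      intro Ξ T
      rw [← T.sum_part_functional c p]
      refine sum_congr rfl fun a _ => ?_
      split_ifs with hc
      · congr 1
        refine prod_congr rfl fun i _ => ?_
        rw [dif_pos (congrFun hc i)]
        have : ∀ (m : ℤ) (hm : T.c a i = m), ((T.ζ a i : Dual k (V i))) =
            ((hm ▸ T.ζ a i : (V i).dual m) : Dual k (V i)) := by
          rintro _ rfl; rfl
        exact (LinearMap.congr_fun (this _ _) _).symm
      · rw [zero_mul]
    simp only [Sum.elim_inl, Sum.elim_inr, mul_assoc, ← mul_sum]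
    rw [h1 T, h1 T', h _ fun i => GrVect.proj_mem _ _]
    ring

theorem part_congr_map (T : Decomp V Ξ) (γ : ∀ i n, (V i).dual n →ₗ[k] W i)
    (c : I → ℤ) (M M' : MultilinearMap k W N) (u : ℤˣ)
    (h : ∀ ζ : ∀ i, (V i).dual (c i), M' (fun i => γ i _ (ζ i)) = u • M fun i => γ i _ (ζ i)) :
    T.part γ c M' = u • T.part γ c M := by
  unfold part
  rw [smul_sum]
  refine sum_congr rfl fun a _ => ?_
  split_ifs with hc
  · subst hc
    rw [h]
    exact smul_comm _ (u : ℤ) _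
  · rw [smul_zero]

/-- A sum of decompositions. -/
def sum {J : Type} [Fintype J] {Ξ : J → (∀ i, V i) → k} (T : ∀ j, Decomp V (Ξ j)) :
    Decomp V fun p => ∑ j, Ξ j p where
  A := Σ j, (T j).A
  r a := (T a.1).r a.2
  c a := (T a.1).c a.2
  ζ a := (T a.1).ζ a.2
  sum_eq p := by
    rw [Fintype.sum_sigma]
    exact sum_congr rfl fun j _ => (T j).sum_eq p

theorem sum_eval {J : Type} [Fintype J] {Ξ : J → (∀ i, V i) → k} (T : ∀ j, Decomp V (Ξ j))
    (γ : ∀ i n, (V i).dual n →ₗ[k] W i) (s : (I → ℤ) → ℤˣ) (M : MultilinearMap k W N) :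
    (sum T).eval γ s M = ∑ j, (T j).eval γ s M :=
  Fintype.sum_sigma _

/-- A multiple of a decomposition. -/
def smul (T : Decomp V Ξ) (l : k) : Decomp V fun p => l * Ξ p where
  A := T.A
  r a := l * T.r a
  c := T.c
  ζ := T.ζ
  sum_eq p := by
    rw [T.sum_eq, mul_sum]
    exact sum_congr rfl fun a _ => (mul_assoc _ _ _).symm

theorem smul_eval (T : Decomp V Ξ) (l : k) (γ : ∀ i n, (V i).dual n →ₗ[k] W i)
    (s : (I → ℤ) → ℤˣ) (M : MultilinearMap k W N) : (T.smul l).eval γ s M = l • T.eval γ s M := by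
  unfold eval
  rw [smul_sum]
  exact sum_congr rfl fun a _ => mul_smul _ _ _

theorem eval_eq (T : Decomp V Ξ) (T' : Decomp V Ξ') (h : ∀ p, Ξ' p = Ξ p)
    (γ : ∀ i n, (V i).dual n →ₗ[k] W i) (s : (I → ℤ) → ℤˣ) (M : MultilinearMap k W N) :
    T'.eval γ s M = T.eval γ s M :=
  eval_congr (Equiv.refl _) fun c => congrArg (s c • ·)
    ((T.part_congr T' γ c M 1 fun p _ => by rw [h, one_mul]).trans (one_smul _ _))

end Decomp

/-! ### The cofree differential graded object on a graded object -/

/-- The sign for moving an element of odd degree to position `i`. -/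
def signBefore (n : I → ℤ) (i : I) : ℤˣ :=
  ∏ i', if i' < i then (-1 : ℤˣ) ^ n i' else 1

theorem signBefore_eq (n : I → ℤ) (i : I) :
    signBefore n i = sgn (∑ i', if i' < i then (n i' : ZMod 2) else 0) := by
  rw [sgn_sum]
  refine prod_congr rfl fun i' _ => ?_
  split_ifs
  · exact (sgn_intCast _).symm
  · rfl

theorem koszulExp_shift (π : I → J) (d : J → ZMod 2) (n : I → ℤ) (i : I) :
    koszulExp π d (fun i' => (update n i (n i + 1) i' : ℤ)) =
      koszulExp π d (fun i' => n i') + ((∑ i', if i < i' ∧ π i' < π i then (n i' : ZMod 2) else 0) +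
        (∑ i', if i' < i ∧ π i < π i' then (n i' : ZMod 2) else 0) +
        ∑ j, if π i < j then d j else 0) := by
  have h : ∀ i', ((update n i (n i + 1) i' : ℤ) : ZMod 2) =
      n i' + if i' = i then 1 else 0 := by
    intro i'
    by_cases hi : i' = i
    · subst hi; simp
    · simp [hi]
  have h1 : ∀ a b, (if a < b ∧ π b < π a then
      ((n a : ZMod 2) + if a = i then 1 else 0) * (n b + if b = i then 1 else 0) else 0) =
      (if a < b ∧ π b < π a then (n a * n b : ZMod 2) else 0) +
      ((if a = i then (if i < b ∧ π b < π i then (n b : ZMod 2) else 0) else 0) +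
      if b = i then (if a < i ∧ π i < π a then (n a : ZMod 2) else 0) else 0) := by
    intro a b
    by_cases ha : a = i <;> by_cases hb : b = i
    · subst ha; subst hb; simp
    · subst ha; simp only [hb, if_true, if_false]; split_ifs <;> ring
    · subst hb; simp only [ha, if_true, if_false]; split_ifs <;> ring
    · simp [ha, hb]
  have h2 : ∀ a j, (if π a < j then d j * ((n a : ZMod 2) + if a = i then 1 else 0) else 0) =
      (if π a < j then d j * (n a : ZMod 2) else 0) +
      if a = i then (if π i < j then d j else 0) else 0 := by
    intro a j
    by_cases ha : a = i
    · subst ha; simp only [if_true]; split_ifs <;> ring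
    · simp [ha]
  simp only [koszulExp, h, h1, h2, sum_add_distrib, Finset.sum_ite_eq', mem_univ, if_true]
  have h3 : ∀ f : I → I → ZMod 2, (∑ a, ∑ b, if a = i then f a b else 0) = ∑ b, f i b := by
    intro f
    rw [sum_eq_single i (fun a _ ha => by simp [ha]) (by simp)]
    simp
  have h4 : (∑ a : I, ∑ j, if a = i then (if π i < j then d j else 0) else 0) =
      ∑ j, if π i < j then d j else 0 := by
    rw [sum_eq_single i (fun a _ ha => by simp [ha]) (by simp)]
    simp
  rw [h3 fun _ b => if i < b ∧ π b < π i then (n b : ZMod 2) else 0, h4]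
  ring

theorem koszulSign_shift (ε : Parity) (π : I → J) (δ : J → ℕ) (n : I → ℤ) (i : I) :
    koszulSign ε π δ n * (signBefore (fun j => (∑ s : {s // π s = j}, n s) + ε.val * δ j) (π i) *
      ((-1) ^ (ε.val * δ (π i)) * signBefore (fun s : {s // π s = π i} => n s) ⟨i, rfl⟩)) =
    (-1) ^ (ε.val * ∑ j, δ j) * (signBefore n i * koszulSign ε π δ (update n i (n i + 1))) := by
  rw [koszulSign_eq, koszulSign_eq, signBefore_eq, signBefore_eq, signBefore_eq, ← sgn_natCast,
    ← sgn_natCast, koszulExp_shift]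
  simp only [← sgn_add]
  congr 1
  push_cast
  have e1 : (∑ j, if j < π i then ((∑ s : {s // π s = j}, (n s : ZMod 2)) + ε.val * δ j) else 0) =
      (∑ s, if π s < π i then (n s : ZMod 2) else 0) +
        ∑ j, if j < π i then (ε.val * δ j : ZMod 2) else 0 := by
    have e0 : ∀ s, (if π s < π i then (n s : ZMod 2) else 0) =
        ∑ j, if π s = j then (if j < π i then (n s : ZMod 2) else 0) else 0 := by simp
    rw [sum_congr rfl fun s _ => e0 s, sum_comm, ← sum_add_distrib]
    refine sum_congr rfl fun j _ => ?_
    rw [sum_subtype_ite (fun s => π s = j) fun s => (n s : ZMod 2)]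
    split_ifs <;> simp
  have e2 : (∑ s : {s // π s = π i}, if s < ⟨i, rfl⟩ then (n s : ZMod 2) else 0) =
      ∑ s, if π s = π i then (if s < i then (n s : ZMod 2) else 0) else 0 :=
    sum_subtype_ite (fun s => π s = π i) fun s => if s < i then (n s : ZMod 2) else 0
  have e3 : (ε.val * δ (π i) : ZMod 2) = ∑ j, if j = π i then (ε.val * δ j : ZMod 2) else 0 := by
    simp
  rw [e1, e2, e3, mul_sum]
  have two : (2 : ZMod 2) = 0 := rfl
  have h1 : (∑ s, if π s < π i then (n s : ZMod 2) else 0) +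
      (∑ s, if π s = π i then (if s < i then (n s : ZMod 2) else 0) else 0) +
      (∑ s, if s < i then (n s : ZMod 2) else 0) +
      (∑ s, if i < s ∧ π s < π i then (n s : ZMod 2) else 0) +
      (∑ s, if s < i ∧ π i < π s then (n s : ZMod 2) else 0) = 0 := by
    simp only [← sum_add_distrib]
    refine sum_eq_zero fun s _ => ?_
    rcases tri_cases s i with hs | hs | hs <;> rcases tri_cases (π s) (π i) with hp | hp | hp <;>
      simp [hs, hp, zmod_two_add_self]
  have h2 : (∑ j, if j < π i then (ε.val * δ j : ZMod 2) else 0) +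
      (∑ j, if j = π i then (ε.val * δ j : ZMod 2) else 0) + (∑ j, (ε.val * δ j : ZMod 2)) +
      (∑ j, if π i < j then (ε.val * δ j : ZMod 2) else 0) = 0 := by
    simp only [← sum_add_distrib]
    refine sum_eq_zero fun j _ => ?_
    rcases tri_cases j (π i) with hp | hp | hp <;> simp [hp, zmod_two_add_self]
  linear_combination h1 + h2 - ((∑ s, if s < i then (n s : ZMod 2) else 0) +
      (∑ s, if i < s ∧ π s < π i then (n s : ZMod 2) else 0) +
      (∑ s, if s < i ∧ π i < π s then (n s : ZMod 2) else 0) + (∑ j, (ε.val * δ j : ZMod 2)) +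
      (∑ j, if π i < j then (ε.val * δ j : ZMod 2) else 0)) * two

theorem LinearMap.map_intUnit_smul {M N : Type*} [AddCommGroup M] [AddCommGroup N] [Module k M]
    [Module k N] (f : M →ₗ[k] N) (s : ℤˣ) (x : M) : f (s • x) = s • f x :=
  map_zsmul f (s : ℤ) x

open LinearMap (map_intUnit_smul)

/-- Applying operations to a sum of tensors in which one component is shifted. -/
theorem sum_shift {A : I → Type*} {B : J → Type*} {N : Type*} [∀ i, AddCommGroup (A i)] [∀ i, Module k (A i)]
    [∀ j, AddCommGroup (B j)] [∀ j, Module k (B j)] [AddCommGroup N] [Module k N] (ε : Parity)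
    (π : I → J) (δ : J → ℕ) (g : ∀ j, MultilinearMap k (fun i : {i // π i = j} => A i) (B j))
    (M : J → MultilinearMap k B N) (n : I → ℤ) (p q : ∀ i, A i) :
    koszulSign ε π δ n • ∑ j, signBefore (fun j => (∑ s : {s // π s = j}, n s) + ε.val * δ j) j •
      M j (update (fun j => g j fun i => p i) j ((-1 : ℤˣ) ^ (ε.val * δ j) •
        ∑ i : {i // π i = j}, signBefore (fun s : {s // π s = j} => n s) i •
          g j (update (fun s : {s // π s = j} => p s) i (q i)))) =
    (-1 : ℤˣ) ^ (ε.val * ∑ j, δ j) • ∑ i, signBefore n i • koszulSign ε π δ (update n i (n i + 1)) •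
        M (π i) (fun j => g j fun s => update p i (q i) s) := by
  have h : ∀ j (c : ∀ j, B j) (x : B j), M j (update c j x) = (M j).toLinearMap c j x :=
    fun _ _ _ => rfl
  simp only [h, map_intUnit_smul, map_sum, smul_sum, smul_smul]
  rw [← Fintype.sum_sigma']
  refine (Fintype.sum_equiv (sigmaFiberEquiv π).symm _ _ fun i => ?_).symm
  change _ = (_ : ℤˣ) • M (π i) (update (fun j => g j fun i => p i) (π i)
    (g (π i) (update (fun s : {s // π s = π i} => p s) ⟨i, rfl⟩ (q i))))
  rw [← fiber_update π (fun j => g j) p i (q i)]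
  congr 1
  exact (koszulSign_shift ε π δ n i).symm

namespace GrVect

/-- The sign of the degree. -/
noncomputable def parityMap (M : GrVect k) : M →ₗ[k] M :=
  DirectSum.toModule k ℤ M (fun n => ((-1 : ℤˣ) ^ n) • (M.gr n).subtype) ∘ₗ M.decomp.toLinearMap

theorem parityMap_of_mem {M : GrVect k} {n : ℤ} {x : M} (hx : x ∈ M.gr n) :
    M.parityMap x = (-1 : ℤˣ) ^ n • x := by
  simp only [parityMap, LinearMap.comp_apply, LinearEquiv.coe_coe, decomp_of_mem hx,
    DirectSum.toModule_lof]
  rfl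

/-- The sum of `M` and its shift. -/
noncomputable def cone (M : GrVect k) : GrVect k where
  carrier := M × M
  gr n := (M.gr n).prod (M.gr (n + 1))
  isInternal := isInternal_of_proj (fun n => (M.proj n).prodMap (M.proj (n + 1)))
    (fun n x => ⟨proj_mem _ _, proj_mem _ _⟩)
    (fun n x hx => Prod.ext (proj_of_mem hx.1) (proj_of_mem hx.2))
    (fun m n h x hx => Prod.ext (proj_of_mem_ne h hx.1) (proj_of_mem_ne (by omega) hx.2))
    (fun x => by
      obtain ⟨s, hs⟩ := exists_sum_proj x.1
      obtain ⟨t, ht⟩ := exists_sum_proj x.2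
      refine ⟨s ∪ t.map (Equiv.subRight 1).toEmbedding, Prod.ext ?_ ?_⟩
      · rw [Prod.fst_sum]
        exact hs _ Finset.subset_union_left
      · rw [Prod.snd_sum]
        refine Eq.trans ?_ (ht ((s ∪ t.map (Equiv.subRight 1).toEmbedding).map
          (Equiv.addRight (1 : ℤ)).toEmbedding) fun n hn => ?_)
        · rw [Finset.sum_map]; rfl
        · exact Finset.mem_map.2 ⟨n - 1, Finset.mem_union_right _
            (Finset.mem_map.2 ⟨n, hn, rfl⟩), by simp⟩)

end GrVect

namespace PreGradedOp

variable (P : PreGradedOp k F) (ε) {I : Type} [Finite I] [LinearOrder I] {x : I → F.C.V} {v : F.C.V}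

/-- The operations on `P ⊗ k[e]`, for `e` of degree `-1` and square zero; an element of degree `n`
is written as a pair of elements of degrees `n` and `n + 1`. -/
noncomputable def coneAct (f : F.C.Hom x v) (hf : F.δ.deg f ≤ 1) :
    MultilinearMap k (fun i => P.obj (x i) × P.obj (x i)) (P.obj v × P.obj v) :=
  letI := ofFinite I
  ((P.act f hf).compLinearMap fun _ => LinearMap.fst k _ _).prod
    ((-1 : ℤˣ) ^ (ε.val * F.δ.deg f) • ∑ i, (P.act f hf).compLinearMap fun j =>
      if j < i then (P.obj (x j)).parityMap ∘ₗ LinearMap.fst k _ _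
      else if j = i then LinearMap.snd k _ _ else LinearMap.fst k _ _)

theorem coneAct_snd' {I : Type} [Fintype I] [LinearOrder I] {x : I → F.C.V} {v : F.C.V}
    (f : F.C.Hom x v) (hf : F.δ.deg f ≤ 1) (p : ∀ i, P.obj (x i) × P.obj (x i)) :
    (P.coneAct ε f hf p).2 = (-1 : ℤˣ) ^ (ε.val * F.δ.deg f) • ∑ i, P.act f hf fun j =>
      if j < i then (P.obj (x j)).parityMap (p j).1 else if j = i then (p j).2 else (p j).1 := by
  unfold coneAct
  rw [Subsingleton.elim (ofFinite I) ‹Fintype I›]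
  simp only [MultilinearMap.prod_apply, _root_.smul_apply, _root_.sum_apply,
    MultilinearMap.compLinearMap_apply]
  congr 1
  refine sum_congr rfl fun i _ => congrArg _ (funext fun j => ?_)
  split_ifs <;> rfl

theorem coneAct_snd {I : Type} [Fintype I] [LinearOrder I] {x : I → F.C.V} {v : F.C.V}
    (f : F.C.Hom x v) (hf : F.δ.deg f ≤ 1) (n : I → ℤ) (p : ∀ i, P.obj (x i) × P.obj (x i))
    (hp : ∀ i, (p i).1 ∈ (P.obj (x i)).gr (n i)) :
    (P.coneAct ε f hf p).2 = (-1 : ℤˣ) ^ (ε.val * F.δ.deg f) • ∑ i, signBefore n i •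
      P.act f hf (update (fun j => (p j).1) i (p i).2) := by
  rw [coneAct_snd']
  congr 1
  refine sum_congr rfl fun i _ => ?_
  rw [signBefore, ← MultilinearMap.map_units_smul]
  refine congrArg _ (funext fun j => ?_)
  by_cases h : j = i
  · subst h; simp
  · rw [update_of_ne h]
    split_ifs with h1
    · exact GrVect.parityMap_of_mem (hp j)
    · exact (one_smul _ _).symm

/-- The underlying data of `P ⊗ k[e]`. -/
noncomputable def cone : PreGradedOp k F where
  obj v := (P.obj v).cone
  act f hf := P.coneAct ε f hf

end PreGradedOp

theorem sum_update_add_one {I : Type} [Fintype I] [DecidableEq I] (n : I → ℤ) (i : I) :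
    ∑ j, update n i (n i + 1) j = ∑ j, n j + 1 := by
  rw [← add_sum_erase _ _ (mem_univ i), ← add_sum_erase _ n (mem_univ i),
    update_self, sum_congr rfl fun j hj => update_of_ne
      (Finset.ne_of_mem_erase hj) _ _]
  ring

theorem signBefore_shift (n : I → ℤ) (i j : I) :
    signBefore (update n i (n i + 1)) j = signBefore n j * if i < j then -1 else 1 := by
  unfold signBefore
  rw [← Finset.mul_prod_erase _ _ (mem_univ i), ← Finset.mul_prod_erase _
    (fun i' => if i' < j then (-1 : ℤˣ) ^ n i' else 1) (mem_univ i), update_self,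
    prod_congr rfl fun i' hi => by rw [update_of_ne (Finset.ne_of_mem_erase hi)]]
  split_ifs
  · rw [zpow_add, zpow_one, mul_assoc, mul_comm (-1 : ℤˣ), ← mul_assoc]
  · rw [mul_one]

theorem GrVect.mem_update {I : Type*} [DecidableEq I] {V : I → GrVect k} {n : I → ℤ} {p : ∀ i, V i}
    (hp : ∀ i, p i ∈ (V i).gr (n i)) (i : I) {m : ℤ} {q : V i} (hq : q ∈ (V i).gr m) (j : I) :
    update p i q j ∈ (V j).gr (update n i m j) := by
  by_cases h : j = i
  · subst h; simpa using hq
  · simpa [h] using hp j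

namespace PreGradedOp

variable {P : PreGradedOp k F}

theorem cone_laws (hP : P.Laws ε) : (P.cone ε).Laws ε where
  act_mem f hf n p hp := by
    refine ⟨hP.act_mem f hf n _ fun i => (hp i).1, ?_⟩
    change (P.coneAct ε f hf p).2 ∈ _
    rw [P.coneAct_snd ε f hf n p fun i => (hp i).1]
    refine Submodule.smul_of_tower_mem _ _ (Submodule.sum_mem _ fun i _ =>
      Submodule.smul_of_tower_mem _ _ ?_)
    have := hP.act_mem f hf _ _ (GrVect.mem_update (fun j => (hp j).1) i (hp i).2)
    rwa [sum_update_add_one, add_right_comm] at this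
  act_one v h p := by
    refine Prod.ext (hP.act_one v h p.1) ((P.coneAct_snd' ε _ h _).trans ?_)
    simp [F.δ.deg_one, hP.act_one v h]
  act_map {I J} _ _ _ _ e x v f hf hf' p := by
    have := ofFinite I
    have := ofFinite J
    refine Prod.ext (hP.act_map e f hf hf' fun j => (p j).1) ?_
    refine (P.coneAct_snd' ε _ hf' _).trans (Eq.trans ?_ (P.coneAct_snd' ε f hf p).symm)
    rw [F.δ.deg_map]
    congr 1
    refine Fintype.sum_equiv e.toEquiv _ _ fun i => ?_
    rw [← hP.act_map e f hf hf']
    refine congrArg _ (funext fun j => ?_)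
    simp
  act_subst {I J} _ _ _ _ x y v f π g hf hg h n p hp := by
    refine Prod.ext (hP.act_subst f π g hf hg h n _ fun i => (hp i).1) ?_
    refine (P.coneAct_snd ε _ h n _ fun i => (hp i).1).trans ?_
    have hg' := fun j => hP.act_mem (g j) (hg j) (fun i => n i) (fun i => (p i).1)
      fun i => (hp i).1
    refine Eq.trans ?_ (congrArg (koszulSign ε π (fun j => F.δ.deg (g j)) n • ·)
      (P.coneAct_snd ε f hf _ (fun j => P.coneAct ε (g j) (hg j) fun i => p i) hg').symm)
    have e1 : ∀ j, (P.coneAct ε (g j) (hg j) fun i => p i).2 = _ := fun j =>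
      P.coneAct_snd ε (g j) (hg j) (fun i => n i) (fun i => p i) fun i => (hp i).1
    have key := sum_shift ε π (fun j => F.δ.deg (g j)) (fun j => P.act (g j) (hg j))
      (fun _ => P.act f hf) n (fun i => (p i).1) (fun i => (p i).2)
    simp only [e1]
    rw [smul_comm]
    refine Eq.trans ?_ (congrArg (((-1 : ℤˣ) ^ (ε.val * F.δ.deg f)) • ·) key.symm)
    rw [F.δ.deg_subst, mul_add, pow_add, mul_smul]
    congr 2
    refine sum_congr rfl fun i _ => congrArg (signBefore n i • ·) ?_
    exact hP.act_subst f π g hf hg h _ _ (GrVect.mem_update (fun j => (hp j).1) i (hp i).2)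

/-- The tensor with one component shifted. -/
def Tensor.shift {X : F.C.Word} (t : (P.cone ε).Tensor X) (i : Fin X.n) : P.Tensor X :=
  ⟨t.sign, update t.deg i (t.deg i + 1), update (fun j => (t.val j).1) i (t.val i).2⟩

theorem Tensor.Homogeneous.shift {X : F.C.Word} {t : (P.cone ε).Tensor X} (ht : t.Homogeneous)
    (i : Fin X.n) : (t.shift i).Homogeneous :=
  GrVect.mem_update (fun j => (ht j).1) i (ht i).2

theorem push_shift (hP : P.Laws ε) {X Y : F.C.Word} (m : X ⟶ Y) (hm : F.δ.degree m ≤ 1)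
    {t : (P.cone ε).Tensor X} (ht : t.Homogeneous) {N : Type*} [AddCommGroup N] [Module k N]
    (M : Fin Y.n → MultilinearMap k (fun j => P.obj (Y.x j)) N) :
    ∑ j, signBefore (push ε m hm t).deg j • ((push ε m hm t).shift j).sign •
        M j ((push ε m hm t).shift j).val =
      (-1 : ℤˣ) ^ (ε.val * F.δ.degree m) • ∑ i, signBefore t.deg i •
        (push ε m hm (t.shift i)).sign • M (WordHom.π m i) (push ε m hm (t.shift i)).val := by
  have key := sum_shift ε (WordHom.π m) (fun j => F.δ.deg (WordHom.g m j))
    (fun j => P.act (WordHom.g m j) (F.δ.deg_le_one hm j)) M t.deg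
    (fun i => (t.val i).1) (fun i => (t.val i).2)
  have e1 : ∀ j, ((push ε m hm t).val j).2 = _ := fun j =>
    P.coneAct_snd ε (WordHom.g m j) (F.δ.deg_le_one hm j) (fun i => t.deg i) (fun i => t.val i)
      fun i => (ht i).1
  simp only [Tensor.shift, e1]
  have key' := congrArg (t.sign • ·) key
  simp only [push, mul_smul] at key' ⊢
  refine Eq.trans ?_ (key'.trans ?_)
  · simp only [smul_sum]
    refine sum_congr rfl fun j _ => ?_
    rw [smul_comm (signBefore _ j), smul_comm (signBefore _ j)]
    rfl
  · rw [smul_comm t.sign]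
    refine congrArg (_ • ·) ?_
    simp only [smul_sum]
    refine sum_congr rfl fun j _ => ?_
    rw [smul_comm t.sign]

theorem pushChain_shift (hP : P.Laws ε) {X Y : F.C.Word} {n : ℕ} (c : F.δ.Chain X Y n)
    {t : (P.cone ε).Tensor X} (ht : t.Homogeneous) {N : Type*} [AddCommGroup N] [Module k N]
    (M : MultilinearMap k (fun j => P.obj (Y.x j)) N) :
    ∑ j, signBefore (pushChain ε c t).deg j • ((pushChain ε c t).shift j).sign •
        M ((pushChain ε c t).shift j).val =
      (-1 : ℤˣ) ^ (ε.val * n) • ∑ i, signBefore t.deg i •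
        (pushChain ε c (t.shift i)).sign • M (pushChain ε c (t.shift i)).val := by
  induction c with
  | nil e =>
    refine (push_shift hP e.hom _ ht fun _ => M).trans ?_
    rw [F.δ.degree_iso]
    rfl
  | cons m hm c ih =>
    refine (ih ((cone_laws hP).homogeneous_push m hm.le ht) M).trans ?_
    have h := push_shift hP m hm.le ht fun j =>
      P.chainMap ε c (update (push ε m hm.le t).deg j ((push ε m hm.le t).deg j + 1)) M
    rw [mul_add, pow_add, mul_smul]
    refine congrArg (((-1 : ℤˣ) ^ (ε.val * _)) • ·) ?_
    refine Eq.trans (sum_congr rfl fun j _ => congrArg (_ • ·)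
      (pushChain_eq_chainMap c _ M)) (h.trans ?_)
    rw [show (-1 : ℤˣ) ^ (ε.val * F.δ.degree m) = (-1) ^ (ε.val * 1) by rw [hm]]
    refine congrArg (_ • ·) (sum_congr rfl fun i _ => congrArg (_ • ·) ?_)
    refine Eq.trans ?_ (pushChain_eq_chainMap c (push ε m hm.le (t.shift i)) M).symm
    refine congrArg (fun d => (push ε m hm.le (t.shift i)).sign • P.chainMap ε c d M _) ?_
    have h1 := fiber_update (WordHom.π m) (fun _ n => ∑ s, n s) t.deg i (t.deg i + 1)
    have h2 := sum_update_add_one (fun s : {s // WordHom.π m s = WordHom.π m i} => t.deg s) ⟨i, rfl⟩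
    funext j
    have h3 := congrFun h1 j
    simp only [push, Tensor.shift]
    by_cases hj : j = WordHom.π m i
    · subst hj
      simp only [update_self] at h3 ⊢
      exact (add_right_comm _ _ _).trans (congrArg (· + _) (h3.trans h2).symm)
    · simp only [update_of_ne hj] at h3 ⊢
      exact congrArg (· + _) h3.symm

theorem value_snd (hP : P.Laws ε) {X : F.C.Word} {v : F.C.V} {n : ℕ} (c : F.δ.Chain X (single v) n)
    {t : (P.cone ε).Tensor X} (ht : t.Homogeneous) :
    (pushChain ε c t).value.2 = (-1 : ℤˣ) ^ (ε.val * n) • ∑ i, signBefore t.deg i •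
      (pushChain ε c (t.shift i)).value := by
  refine Eq.trans ?_ (pushChain_shift hP c ht
    (MultilinearMap.ofSubsingleton k (P.obj v) (P.obj v) (0 : Fin 1) LinearMap.id))
  refine Eq.trans ?_ (Fin.sum_univ_one _).symm
  have h : signBefore (I := Fin 1) (pushChain ε c t).deg 0 = 1 :=
    Finset.prod_eq_one fun i _ => if_neg (not_lt.2 (Fin.zero_le i))
  exact ((congrArg (· • _) h).trans (one_smul _ _)).symm

theorem value_fst {X : F.C.Word} {v : F.C.V} {n : ℕ} (c : F.δ.Chain X (single v) n)
    (t : (P.cone ε).Tensor X) :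
    (pushChain ε c t).value.1 = (pushChain ε c (t.mapVal (Q := P) fun v (x : P.obj v × P.obj v) => x.1)).value :=
  (value_mapVal (P := P.cone ε) (Q := P) (fun v => LinearMap.fst k (P.obj v) (P.obj v)) _).symm.trans
    (congrArg Tensor.value (pushChain_mapVal (P := P.cone ε) (Q := P)
      (fun v (x : P.obj v × P.obj v) => x.1)
      (fun _ _ _ => rfl) c t))

end PreGradedOp

theorem PreGradedOp.coneAct_d (P : PreGradedOp k F) (ε : Parity) {x : I → F.C.V} {v : F.C.V} (f : F.C.Hom x v) (hf : F.δ.deg f ≤ 1) (n : I → ℤ)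
    (p : ∀ i, P.obj (x i) × P.obj (x i)) (hp : ∀ i, p i ∈ ((P.cone ε).obj (x i)).gr (n i)) :
    ((P.coneAct ε f hf p).2, (0 : P.obj v)) = (-1 : ℤˣ) ^ (ε.val * F.δ.deg f) • ∑ i,
      signBefore n i • P.coneAct ε f hf (update p i ((p i).2, 0)) := by
  have e : ∀ i, (fun s => (update p i ((p i).2, 0) s).1) =
      update (fun s => (p s).1) i (p i).2 := by
    intro i
    funext j
    by_cases h : j = i
    · subst h; simp
    · simp [h]
  refine Prod.ext ?_ ?_
  · refine (P.coneAct_snd ε f hf n p fun i => (hp i).1).trans ?_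
    rw [Prod.smul_fst, Prod.fst_sum]
    exact congrArg (((-1 : ℤˣ) ^ (ε.val * F.δ.deg f)) • ·) (sum_congr rfl fun i _ =>
      congrArg (signBefore n i • ·) (congrArg (P.act f hf) (e i).symm))
  · let T : I × I → P.obj v := fun a => (signBefore n a.1 * signBefore n a.2) •
      if a.1 = a.2 then 0 else if a.1 < a.2 then -P.act f hf (update (update
        (fun s => (p s).1) a.1 (p a.1).2) a.2 (p a.2).2) else P.act f hf (update
        (update (fun s => (p s).1) a.1 (p a.1).2) a.2 (p a.2).2)
    have hT : ∑ a, T a = 0 := by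
      refine Finset.sum_involution (fun a _ => (a.2, a.1)) (fun a _ => ?_) (fun a _ h h' => h ?_)
        (fun _ _ => mem_univ _) (fun _ _ => rfl)
      · simp only [T]
        rw [mul_comm (signBefore n a.2), ← smul_add]
        refine (congrArg _ ?_).trans (smul_zero _)
        rcases tri_cases a.1 a.2 with h | h | h
        · simp [h]
        · simp only [h, if_false, if_true]
          rw [Function.update_comm h.2.2.1]
          simp
        · simp only [h, if_false, if_true]
          rw [Function.update_comm h.2.2.1]
          simp
      · have : a.1 = a.2 := (congrArg Prod.snd h')
        simp [T, this]
    rw [Prod.smul_snd, Prod.snd_sum]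
    refine Eq.symm ((congrArg (((-1 : ℤˣ) ^ (ε.val * F.δ.deg f)) • ·) ?_).trans (smul_zero _))
    rw [Fintype.sum_prod_type] at hT
    rw [← smul_zero ((-1 : ℤˣ) ^ (ε.val * F.δ.deg f)), ← hT, smul_sum]
    refine sum_congr rfl fun i _ => ?_
    have h1 := P.coneAct_snd ε f hf (update n i (n i + 1)) _ fun j =>
      (GrVect.mem_update (V := fun j => (P.obj (x j)).cone) hp i (q := ((p i).2, 0))
        ⟨(hp i).2, Submodule.zero_mem _⟩ j).1
    refine (congrArg (signBefore n i • ·) h1).trans ?_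
    rw [smul_comm]
    refine congrArg (((-1 : ℤˣ) ^ (ε.val * F.δ.deg f)) • ·) ?_
    rw [smul_sum]
    refine sum_congr rfl fun j _ => ?_
    have e' : ∀ h : j ≠ i, update (fun s => (update p i ((p i).2, 0) s).1) j
        (update p i ((p i).2, 0) j).2 =
        update (update (fun s => (p s).1) i (p i).2) j (p j).2 := fun h => by
      rw [e i, update_of_ne h]
    simp only [T, signBefore_shift, smul_smul]
    rcases tri_cases i j with rfl | h | h
    · simp only [if_true, smul_zero]
      refine (congrArg _ ((P.act f hf).map_coord_zero (m := update (fun s =>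
        (update p i ((p i).2, 0) s).1) i (update p i ((p i).2, 0) i).2) i ?_)).trans (smul_zero _)
      rw [update_self, update_self]
    · simp only [h, if_false, if_true]
      rw [← mul_assoc, mul_smul, Units.neg_smul, one_smul]
      exact congrArg _ (congrArg Neg.neg (congrArg (P.act f hf) (e' h.2.2.2)))
    · simp only [h, if_false, mul_one]
      exact congrArg _ (congrArg (P.act f hf) (e' h.2.2.2))

namespace GradedOp

open PreGradedOp

theorem cone_swap (P : GradedOp k F ε) {X Y : F.C.Word} {v : F.C.V} {n : ℕ} (d d' : F.δ.Chain X Y 2)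
    (c : F.δ.Chain Y (single v) n) (h : F.perm (Equiv.swap 0 1) ⟦d⟧ = ⟦d'⟧)
    (t : (P.cone ε).Tensor X) (ht : t.Homogeneous) :
    (pushChain ε c (pushChain ε d' t)).value =
      (-1 : ℤˣ) ^ ε.val • (pushChain ε c (pushChain ε d t)).value := by
  have h1 : ∀ d : F.δ.Chain X Y 2, (pushChain ε c (pushChain ε d t)).value =
      (pushChain ε (d.append c) t).value := fun d =>
    ((cone_laws P.laws).pushChain_append d c ht).value_eq.symm
  have h2 : ∀ {s : P.Tensor X}, s.Homogeneous → (pushChain ε (d'.append c) s).value =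
      (-1 : ℤˣ) ^ ε.val • (pushChain ε (d.append c) s).value := fun {s} hs => by
    rw [(P.laws.pushChain_append d c hs).value_eq, (P.laws.pushChain_append d' c hs).value_eq]
    exact P.act_swap d d' c h s hs
  rw [h1, h1]
  refine Prod.ext ?_ ?_
  · exact (value_fst _ t).trans ((h2 fun i => (ht i).1).trans
      (congrArg (((-1 : ℤˣ) ^ ε.val) • ·) (value_fst _ t).symm))
  · refine (value_snd P.laws _ ht).trans (Eq.trans ?_
      (congrArg (((-1 : ℤˣ) ^ ε.val) • ·) (value_snd P.laws _ ht).symm))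
    rw [smul_comm]
    refine congrArg (_ • ·) ?_
    rw [smul_sum]
    exact sum_congr rfl fun i _ => by rw [h2 (ht.shift i), smul_comm]

/-- The cofree differential graded object. -/
noncomputable def cofree (P : GradedOp k F ε) : DGOp k F ε where
  toPreGradedOp := P.cone ε
  act_mem := (cone_laws P.laws).act_mem
  act_one := (cone_laws P.laws).act_one
  act_map := (cone_laws P.laws).act_map
  act_subst := (cone_laws P.laws).act_subst
  act_swap := P.cone_swap
  d v := (LinearMap.inl k (P.obj v) (P.obj v)) ∘ₗ LinearMap.snd k (P.obj v) (P.obj v)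
  d_mem v n p hp := ⟨hp.2, Submodule.zero_mem _⟩
  d_d v p := rfl
  d_act f hf n p hp := P.coneAct_d ε f hf n p hp

end GradedOp

namespace GradedOp

/-- Composition of morphisms of graded objects. -/
def Hom.comp {P Q R : GradedOp k F ε} (h : Hom P Q) (h' : Hom Q R) : Hom P R :=
  ⟨fun v => h'.app v ∘ₗ h.app v, fun v n p hp => h'.app_mem v n _ (h.app_mem v n p hp),
    fun f hf p => by simp [h.app_act, h'.app_act]⟩

/-- The morphism to the cofree object given by a morphism of graded objects. -/
noncomputable def Hom.lift {P : DGOp k F ε} {Q : GradedOp k F ε} (h : Hom P.toGradedOp Q) :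
    P ⟶ Q.cofree :=
  DGOp.Hom.mk (fun v => (h.app v).prod (h.app v ∘ₗ P.d v))
    (fun v n p hp => ⟨h.app_mem v n p hp, h.app_mem v _ _ (P.d_mem v n p hp)⟩)
    (fun {I} _ _ x v f hf p => by
      have := ofFinite I
      refine MultilinearMap.congr_fun (GrVect.multilinear_ext
        (f := ((h.app v).prod (h.app v ∘ₗ P.d v)).compMultilinearMap (P.act f hf))
        (g := (Q.coneAct ε f hf).compLinearMap fun i => (h.app (x i)).prod (h.app (x i) ∘ₗ P.d (x i)))
        fun n p hp => ?_) p
      refine Prod.ext (h.app_act f hf p) ?_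
      refine Eq.trans ?_ (Q.coneAct_snd ε f hf n _ fun i => h.app_mem _ _ _ (hp i)).symm
      change h.app v (P.d v (P.act f hf p)) = _
      rw [P.d_act f hf n p hp, map_intUnit_smul, map_sum]
      refine congrArg (_ • ·) (sum_congr rfl fun i _ => ?_)
      refine (map_intUnit_smul _ _ _).trans (congrArg (signBefore n i • ·) ?_)
      refine (h.app_act f hf _).trans (congrArg _ (funext fun j => ?_))
      by_cases hj : j = i
      · subst hj; simp
      · simp [hj])
    (fun v p => Prod.ext rfl ((congrArg (h.app v) (P.d_d v p)).trans (map_zero _)))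

/-- The projection of the cofree object. -/
def cofreeFst (P : GradedOp k F ε) : Hom P.cofree.toGradedOp P :=
  ⟨fun v => LinearMap.fst k (P.obj v) (P.obj v), fun _ _ _ hp => hp.1, fun _ _ _ => rfl⟩

end GradedOp

/-! ### Twisting families -/

namespace DGOp

variable (O : DGOp k F ε)

/-- The transposed differential. -/
def dualD (v : F.C.V) (n : ℤ) : (O.obj v).dual n →ₗ[k] (O.obj v).dual (n + 1) :=
  LinearMap.restrict ((O.d v).dualMap) fun ξ hξ m hm x hx =>
    hξ (m + 1) (by omega) _ (O.d_mem v m x hx)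

/-- Transposition of an isomorphism of vertices. -/
noncomputable def dualIso {v w : F.C.V} (σ : single v ≅ single w) (n : ℤ) :
    (O.obj w).dual n →ₗ[k] (O.obj v).dual n :=
  LinearMap.restrict ((O.evIso σ).dualMap) fun ξ hξ m hm x hx =>
    hξ m hm _ (O.laws.evIso_mem σ hx)

theorem IsDualMap.evIso {O : DGOp k F ε} {ε' : Parity} {Q : GradedOp k F ε'} {γ : O.DualMap Q}
    (hγ : O.IsDualMap Q γ) {v w : F.C.V} (σ : single v ≅ single w) (n : ℤ) (ξ : (O.obj w).dual n) :
    Q.evIso σ (γ v n (O.dualIso σ n ξ)) = γ w n ξ := by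
  obtain rfl : v = w := F.isFeynman.skeletal v w ⟨σ⟩
  exact hγ.equivariant v n σ ξ _ fun p => rfl

theorem IsDualMap.comp {O : DGOp k F ε} {ε' : Parity} {Q Q' : GradedOp k F ε'} {γ : O.DualMap Q}
    (hγ : O.IsDualMap Q γ) (h : GradedOp.Hom Q Q') :
    O.IsDualMap Q' fun v n => h.app v ∘ₗ γ v n :=
  ⟨fun v n ξ => h.app_mem v n _ (hγ.mem v n ξ), fun v n σ ξ η hη =>
    (h.app_evIso σ _).symm.trans (congrArg _ (hγ.equivariant v n σ ξ η hη))⟩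

/-- Choices of decompositions of the transposes of all degree one operations. -/
abbrev Codecompositions {v : F.C.V} (ξ : Dual k (O.obj v)) : Type u :=
  ∀ f : F.DegOne v, O.Codecomposition f.2.1 f.2.2 ξ

theorem Dualizable.nonempty {O : DGOp k F ε} (hO : O.Dualizable) {v : F.C.V} {n : ℤ}
    (ξ : (O.obj v).dual n) : Nonempty (O.Codecompositions (ξ : Dual k (O.obj v))) :=
  ⟨fun f => (hO f.2.1 f.2.2 n ξ ξ.2).some⟩

variable {O} {D D' : GradedOp k F ε.flip} (γ : O.DualMap D)

/-- The part of the differential of a Feynman transform given by the operations. -/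
noncomputable def cobarSum {v : F.C.V} {ξ : Dual k (O.obj v)} (T : O.Codecompositions ξ) :
    D.obj v :=
  ∑ᶠ f : F.DegOne v, (F.autWeight f.1 : k)⁻¹ • O.cobarTerm D γ f.2.1 f.2.2 (T f)

theorem map_cobarSum (h : GradedOp.Hom D D') {v : F.C.V} {ξ : Dual k (O.obj v)}
    (T : O.Codecompositions ξ) :
    h.app v (cobarSum γ T) = cobarSum (fun v n => h.app v ∘ₗ γ v n) T := by
  have := F.finite_degree_one v
  unfold cobarSum
  refine ((h.app v).toAddMonoidHom.map_finsum (Set.toFinite _)).trans (finsum_congr fun f => ?_)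
  refine (map_smul (h.app v) _ _).trans (congrArg _ ?_)
  refine (map_sum (h.app v) _ _).trans (sum_congr rfl fun a _ => ?_)
  refine (map_smul (h.app v) _ _).trans (congrArg _ ?_)
  exact (map_intUnit_smul _ _ _).trans (congrArg _ (h.app_act _ _ _))

variable (O) in
/-- The families that extend to morphisms from the Feynman transform. -/
structure IsTwisting (Q : DGOp k F ε.flip) (γ : O.DualMap Q.toGradedOp) : Prop where
  isDualMap : O.IsDualMap Q.toGradedOp γ
  d_eq : ∀ (v : F.C.V) (n : ℤ) (ξ : (O.obj v).dual n)
    (T : O.Codecompositions (ξ : Dual k (O.obj v))),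
    Q.d v (γ v n ξ) = -((-1 : ℤˣ) ^ n • (γ v (n + 1) (O.dualD v n ξ) + cobarSum γ T))

theorem IsTwisting.comp {Q Q' : DGOp k F ε.flip} {γ : O.DualMap Q.toGradedOp}
    (hγ : O.IsTwisting Q γ) (h : Q ⟶ Q') : O.IsTwisting Q' fun v n => h.app v ∘ₗ γ v n :=
  ⟨hγ.1.comp h.toGraded, fun v n ξ T => by
    refine (h.app_d v _).symm.trans ((congrArg (h.app v) (hγ.d_eq v n ξ T)).trans ?_)
    rw [map_neg, map_intUnit_smul, map_add]
    exact congrArg (fun z => -((-1 : ℤˣ) ^ n • (_ + z))) (map_cobarSum γ h.toGraded T)⟩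

end DGOp

namespace IsFeynmanTransform

variable {O : DGOp k F ε} {D : DGOp k F ε.flip} {gen : O.DualMap D.toGradedOp}
  (hD : IsFeynmanTransform O D gen)
include hD

theorem isTwisting : O.IsTwisting D gen :=
  ⟨hD.isDualMap, fun v n ξ T => hD.d_gen v n ξ _ (fun _ => rfl) T⟩

theorem graded_hom_ext {Q : GradedOp k F ε.flip} {a b : GradedOp.Hom D.toGradedOp Q}
    (h : ∀ v n ξ, a.app v (gen v n ξ) = b.app v (gen v n ξ)) : a = b :=
  (hD.free Q _ (hD.isDualMap.comp b)).unique h fun _ _ _ => rfl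

theorem hom_ext {Q : DGOp k F ε.flip} {a b : D ⟶ Q}
    (h : ∀ v n ξ, a.app v (gen v n ξ) = b.app v (gen v n ξ)) : a = b :=
  DGOp.Hom.ext (congrArg GradedOp.Hom.app (hD.graded_hom_ext (a := a.toGraded) (b := b.toGraded) h))

theorem exists_hom (hO : O.Dualizable) {Q : DGOp k F ε.flip} {γ : O.DualMap Q.toGradedOp}
    (hγ : O.IsTwisting Q γ) : ∃ h : D ⟶ Q, ∀ v n ξ, h.app v (gen v n ξ) = γ v n ξ := by
  obtain ⟨h, hh, -⟩ := hD.free Q.toGradedOp γ hγ.isDualMap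
  have hγ' : (fun v n => h.app v ∘ₗ gen v n) = γ :=
    funext fun v => funext fun n => LinearMap.ext fun ξ => hh v n ξ
  have key : h.comp (DGOp.Hom.toGraded (GradedOp.Hom.lift (DGOp.Hom.toGraded (𝟙 Q)))) =
      DGOp.Hom.toGraded (GradedOp.Hom.lift h) := by
    refine hD.graded_hom_ext fun v n ξ => Prod.ext rfl ?_
    obtain ⟨T⟩ := hO.nonempty ξ
    change Q.d v (h.app v (gen v n ξ)) = h.app v (D.d v (gen v n ξ))
    rw [hh, hγ.d_eq v n ξ T, hD.isTwisting.d_eq v n ξ T, map_neg, map_intUnit_smul, map_add,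
      DGOp.map_cobarSum, hh, hγ']
  exact ⟨DGOp.Hom.mk h.app h.app_mem h.app_act fun v p =>
    (congrArg Prod.snd (LinearMap.congr_fun (congrFun (congrArg GradedOp.Hom.app key) v) p)).symm, hh⟩

end IsFeynmanTransform

namespace CubicalFeynmanCategory

/-- The isomorphisms of vertices from a vertex. -/
abbrev Star (F : CubicalFeynmanCategory.{u}) (v : F.C.V) : Type u :=
  Σ w : F.C.V, (single v ≅ single w)

theorem star_bijective (v : F.C.V) : Bijective fun σ : Aut (single v) => (⟨v, σ⟩ : F.Star v) :=
  ⟨fun σ τ h => eq_of_heq (Sigma.mk.inj h).2, fun ⟨w, σ⟩ => by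
    obtain rfl := F.isFeynman.skeletal v w ⟨σ⟩
    exact ⟨σ, rfl⟩⟩

instance (v : F.C.V) : Finite (F.Star v) :=
  haveI := F.isFeynman.finite_aut v
  Finite.of_surjective _ (star_bijective v).2

noncomputable instance (v : F.C.V) : Fintype (F.Star v) := ofFinite _

theorem sum_star [CharZero k] (v : F.C.V) :
    ∑ z : F.Star v, (Nat.card (Aut (single z.1)) : k)⁻¹ = 1 := by
  have h : ∀ z : F.Star v, (Nat.card (Aut (single z.1)) : k)⁻¹ = (Nat.card (Aut (single v)) : k)⁻¹ := by
    rintro ⟨w, σ⟩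
    obtain rfl := F.isFeynman.skeletal v w ⟨σ⟩
    rfl
  rw [sum_congr rfl fun z _ => h z, Finset.sum_const, Finset.card_univ, ← Nat.card_eq_fintype_card,
    ← Nat.card_congr (Equiv.ofBijective _ (star_bijective v)), nsmul_eq_mul]
  exact mul_inv_cancel₀ (Nat.cast_ne_zero.2 (card_aut_pos v).ne')

theorem sum_pi_star [CharZero k] {I : Type} [Fintype I] [DecidableEq I] (x : I → F.C.V) :
    ∑ z : ∀ i, F.Star (x i), ∏ i, (Nat.card (Aut (single (z i).1)) : k)⁻¹ = 1 := by
  have := (Finset.prod_univ_sum (fun i => (Finset.univ : Finset (F.Star (x i))))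
    fun i z => (Nat.card (Aut (single z.1)) : k)⁻¹).symm
  rw [Fintype.piFinset_univ] at this
  refine this.trans (Finset.prod_eq_one fun i _ => sum_star _)

theorem inv_autWeight (X : F.C.Word) :
    (F.autWeight X : k)⁻¹ = (X.n.factorial : k)⁻¹ * ∏ i, (Nat.card (Aut (single (X.x i))) : k)⁻¹ := by
  rw [autWeight, Nat.cast_mul, Nat.cast_prod, mul_inv, Finset.prod_inv_distrib]

end CubicalFeynmanCategory

namespace DGOp

variable {O : DGOp k F ε}

/-- The sign of the decompositions in the differential of a Feynman transform. -/
def cobarSign (ε : Parity) (c : I → ℤ) : ℤˣ :=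
  (∏ i, ∏ j, if i < j then (-1 : ℤˣ) ^ (c i * c j) else 1) * (-1 : ℤˣ) ^ (ε.val * ∑ i, c i)

/-- The decomposition underlying a codecomposition. -/
def Codecomposition.toDecomp {X : F.C.Word} {v : F.C.V} {f : X ⟶ single v}
    {hf : F.δ.degree f = 1} {ξ : Dual k (O.obj v)} (T : O.Codecomposition f hf ξ) :
    Decomp (fun i => O.obj (X.x i)) fun p => ξ (O.ev f hf.le p) :=
  { A := Fin T.N, r := T.r, c := T.c, ζ := T.ζ, sum_eq := T.sum_eq }

theorem cobarTerm_eq {D : GradedOp k F ε.flip} (γ : O.DualMap D) {X : F.C.Word} {v : F.C.V}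
    {f : X ⟶ single v} {hf : F.δ.degree f = 1} {ξ : Dual k (O.obj v)}
    (T : O.Codecomposition f hf ξ) : O.cobarTerm D γ f hf T =
      T.toDecomp.eval (fun i n => γ (X.x i) n) (cobarSign ε.flip)
        (D.act (toOp f) ((F.δ.deg_toOp f).trans_le hf.le)) :=
  sum_congr rfl fun _ _ => congrArg (_ • _ • ·) (D.laws.ev_eq f hf.le _)

end DGOp

namespace CubicalMorphism

open CubicalFeynmanCategory DGOp

variable {F₁ F₂ : CubicalFeynmanCategory.{u}} {φ : CubicalMorphism F₁ F₂} [CharZero k]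
  (hφ : φ.Admissible) {O : DGOp k F₂ ε} {Q : DGOp k F₁ ε.flip}
  {γ : (hφ.pullback.obj O).DualMap Q.toGradedOp} {γL : O.DualMap (pushDG hφ Q).toGradedOp}

/-- The term of the differential given by an operation and lifts of its inputs and output. -/
noncomputable def liftTerm (γ : (hφ.pullback.obj O).DualMap Q.toGradedOp) {Y : F₂.C.Word} {v : F₂.C.V} {f : Y ⟶ single v} {hf : F₂.δ.degree f = 1}
    {ξ : Dual k (O.obj v)} (T : O.Codecomposition f hf ξ) (t : φ.Lift v)
    (s : ∀ i, φ.Lift (Y.x i)) : Q.obj t.1 :=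
  ∑ a, T.r a • cobarSign ε.flip (T.c a) • φ.liftAct Q.toPreGradedOp (toOp f)
    ((F₂.δ.deg_toOp f).trans_le hf.le) s t fun i => γ (s i).1 _ (O.dualIso (s i).2 _ (T.ζ a i))

theorem component_cobarTerm
    (hγ : ∀ v n ξ (t : φ.Lift v), component Q.laws t (γL v n ξ) = γ t.1 n (O.dualIso t.2 n ξ))
    {Y : F₂.C.Word} {v : F₂.C.V} {f : Y ⟶ single v} {hf : F₂.δ.degree f = 1}
    {ξ : Dual k (O.obj v)} (T : O.Codecomposition f hf ξ) (t : φ.Lift v) :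
    component Q.laws t (O.cobarTerm (pushDG hφ Q).toGradedOp γL f hf T) =
      ∑ s : ∀ i, φ.Lift (Y.x i), (∏ i, liftWeight k φ (s i)) • liftTerm hφ γ T t s := by
  unfold liftTerm
  simp only [smul_sum]
  rw [sum_comm]
  refine (map_sum (component Q.laws t) _ _).trans (sum_congr rfl fun a _ => ?_)
  refine (map_smul (component Q.laws t) _ _).trans ?_
  refine (congrArg (T.r a • ·) ((map_intUnit_smul (component Q.laws t) _ _).trans
    (congrArg (cobarSign ε.flip (T.c a) • ·) ((congrArg (component Q.laws t)
      ((pushPre_laws Q.laws hφ).ev_eq f hf.le _)).trans (component_act Q.laws hφ _ _ t _))))).trans ?_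
  rw [smul_sum, smul_sum]
  refine sum_congr rfl fun s _ => ?_
  rw [smul_comm (∏ i, liftWeight k φ (s i)), smul_comm (∏ i, liftWeight k φ (s i))]
  simp only [hγ]

theorem liftTerm_eq {Y : F₂.C.Word} {v : F₂.C.V} {f : Y ⟶ single v} {hf : F₂.δ.degree f = 1} {n : ℤ}
    {ξ : (O.obj v).dual n} (T : O.Codecomposition f hf (ξ : Dual k (O.obj v)))
    {t : φ.Lift v} {s : ∀ i, φ.Lift (Y.x i)}
    {g : (⟨Y.n, fun i => (s i).1⟩ : F₁.C.Word) ⟶ single t.1} (hg : F₁.δ.degree g = 1)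
    (h : φ.IsLift (toOp f) s t (toOp g))
    (T' : (hφ.pullback.obj O).Codecomposition g hg (O.dualIso t.2 n ξ).1) :
    liftTerm hφ γ T t s = (hφ.pullback.obj O).cobarTerm Q.toGradedOp γ g hg T' := by
  refine Eq.trans ?_ (cobarTerm_eq γ T').symm
  let T'' : Decomp (fun i => (hφ.pullback.obj O).obj (s i).1)
      (fun p => (O.dualIso t.2 n ξ).1 ((hφ.pullback.obj O).ev g hg.le p)) :=
    { A := Fin T.N
      r := T.r
      c := T.c
      ζ a i := O.dualIso (s i).2 _ (T.ζ a i)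
      sum_eq p := by
        refine Eq.trans ?_ (T.sum_eq fun i => O.evIso (s i).2 (p i))
        have h1 : O.evIso t.2 ((hφ.pullback.obj O).ev g hg.le p) =
            O.ev f hf.le fun i => O.evIso (s i).2 (p i) := by
          refine (congrArg (O.evIso t.2) ((hφ.pullback.obj O).laws.ev_eq g hg.le p)).trans ?_
          have h2 : F₂.δ.deg (post (φ.onHom (toOp g)) (uop t.2.hom)) ≤ 1 := by
            rw [F₂.δ.deg_post_iso, φ.deg_onHom, F₁.δ.deg_toOp, hg]
          refine (O.laws.act_post (φ.onHom (toOp g)) _ t.2 h2 p).symm.trans ?_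
          refine (PreGradedOp.act_congr h _ (h ▸ h2) p).trans ?_
          exact (O.laws.act_pre (fun i => (s i).2) (toOp f) ((F₂.δ.deg_toOp f).trans_le hf.le) _ p).trans
            (O.laws.ev_eq f hf.le _).symm
        exact congrArg ξ.1 h1 }
  refine Eq.trans ?_ (Decomp.eval_eq T'' T'.toDecomp (fun _ => rfl) (fun i n => γ (s i).1 n) _ _).symm
  refine sum_congr rfl fun a _ => ?_
  rw [IsLift.liftAct_eq hφ h]

variable (φ) in
/-- Morphisms of degree one to a vertex with isomorphisms to the images of their letters. -/
abbrev BelowPair {v : F₂.C.V} (t : φ.Lift v) :=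
  Σ b : F₁.DegOne t.1, ∀ i, F₂.Star (φ.onV (b.1.x i))

variable (φ) in
/-- Morphisms of degree one to a vertex with lifts of their letters. -/
abbrev AbovePair (v : F₂.C.V) :=
  Σ f : F₂.DegOne v, ∀ i, φ.Lift (f.1.x i)

/-- A degree one operation to a lift of `v` with isomorphisms from the images of its inputs, as a
degree one operation to `v` with lifts of its inputs. -/
noncomputable def liftedPair {v : F₂.C.V} (t : φ.Lift v) (c : φ.BelowPair t) :
    φ.AbovePair v :=
  ⟨⟨⟨c.1.1.n, fun i => (c.2 i).1⟩, ofOp (X := ⟨c.1.1.n, fun i => (c.2 i).1⟩)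
      (pre (fun i => uop (c.2 i).2.symm.hom) (post (φ.onHom (toOp c.1.2.1)) (uop t.2.hom))), by
    rw [← F₂.δ.deg_toOp, toOp_ofOp, F₂.δ.deg_pre_iso, F₂.δ.deg_post_iso, φ.deg_onHom,
      F₁.δ.deg_toOp, c.1.2.2]⟩, fun i => ⟨c.1.1.x i, (c.2 i).2⟩⟩

theorem isLift_liftedPair {v : F₂.C.V} (t : φ.Lift v) (c : φ.BelowPair t) :
    φ.IsLift (toOp (liftedPair t c).1.2.1) (liftedPair t c).2 t (toOp c.1.2.1) :=
  ((congrArg (pre (x' := fun i => φ.onV (c.1.1.x i)) fun i => uop (c.2 i).2.hom)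
    (toOp_ofOp (X := ⟨c.1.1.n, fun i => (c.2 i).1⟩) _)).trans (pre_iso_symm
      (fun i => (c.2 i).2.symm) (post (φ.onHom (toOp c.1.2.1)) (uop t.2.hom)))).symm

open Classical in
/-- A partial inverse of `liftedPair`. -/
noncomputable def unliftedPair {v : F₂.C.V} (t : φ.Lift v) (a : φ.AbovePair v) :
    Option (φ.BelowPair t) :=
  if h : ∃ g, φ.IsLift (toOp a.1.2.1) a.2 t g then
    some ⟨⟨⟨a.1.1.n, fun i => (a.2 i).1⟩, ofOp (X := ⟨a.1.1.n, fun i => (a.2 i).1⟩) h.choose, by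
      rw [← F₁.δ.deg_toOp, toOp_ofOp, h.choose_spec.deg_eq, F₂.δ.deg_toOp, a.1.2.2]⟩,
      fun i => ⟨a.1.1.x i, (a.2 i).2⟩⟩
  else none

theorem unliftedPair_liftedPair (hφ : φ.Admissible) {v : F₂.C.V} (t : φ.Lift v)
    (c : φ.BelowPair t) : unliftedPair t (liftedPair t c) = some c := by
  have h : ∃ g, φ.IsLift (toOp (liftedPair t c).1.2.1) (liftedPair t c).2 t g :=
    ⟨_, isLift_liftedPair t c⟩
  rw [unliftedPair, dif_pos h]
  obtain ⟨⟨X, g, hg⟩, z⟩ := c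
  have h1 : ofOp (X := X) h.choose = g := by
    rw [IsLift.unique hφ h.choose_spec (isLift_liftedPair t _)]
    exact ofOp_toOp g
  refine congrArg some ?_
  have h2 : ∀ (g' : X ⟶ single t.1) (hg' : F₁.δ.degree g' = 1), g' = g →
      (⟨⟨X, g', hg'⟩, z⟩ : φ.BelowPair t) = ⟨⟨X, g, hg⟩, z⟩ := by
    rintro _ _ rfl
    rfl
  exact h2 _ _ h1

theorem exists_liftedPair {v : F₂.C.V} (t : φ.Lift v) (a : φ.AbovePair v) (h : ∃ g, φ.IsLift (toOp a.1.2.1) a.2 t g) :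
    ∃ c, liftedPair t c = a := by
  obtain ⟨⟨Y, f, hf⟩, s⟩ := a
  obtain ⟨g, hg⟩ := h
  have h1 : F₁.δ.degree (ofOp (X := ⟨Y.n, fun i => (s i).1⟩) g) = 1 := by
    rw [← F₁.δ.deg_toOp, toOp_ofOp, hg.deg_eq, F₂.δ.deg_toOp, hf]
  refine ⟨⟨⟨⟨Y.n, fun i => (s i).1⟩, ofOp (X := ⟨Y.n, fun i => (s i).1⟩) g, h1⟩,
    fun i => ⟨Y.x i, (s i).2⟩⟩, ?_⟩
  have h2 : ∀ (f' : Y ⟶ single v) (hf' : F₂.δ.degree f' = 1), f' = f →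
      (⟨⟨Y, f', hf'⟩, s⟩ : φ.AbovePair v) = ⟨⟨Y, f, hf⟩, s⟩ := by
    rintro _ _ rfl
    rfl
  refine h2 _ _ (wordHom_single_ext ?_)
  have hg' : φ.IsLift (toOp f) s t (toOp (ofOp (X := ⟨Y.n, fun i => (s i).1⟩) g)) :=
    (congrArg (φ.IsLift (toOp f) s t) (toOp_ofOp _)).mpr hg
  exact (toOp_ofOp (X := Y) _).trans <| (congrArg (pre (x' := Y.x) (x := fun i => φ.onV (s i).1) fun i => uop (s i).2.symm.hom)
    hg').trans (pre_iso_symm (fun i => (s i).2) (toOp f))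

theorem component_cobarSum
    (hγ : ∀ v n ξ (t : φ.Lift v), component Q.laws t (γL v n ξ) = γ t.1 n (O.dualIso t.2 n ξ))
    {v : F₂.C.V} (t : φ.Lift v) {n : ℤ} {ξ : (O.obj v).dual n}
    (T : O.Codecompositions (ξ : Dual k (O.obj v)))
    (T' : (hφ.pullback.obj O).Codecompositions (O.dualIso t.2 n ξ).1) :
    component Q.laws t (cobarSum γL T) = cobarSum γ T' := by
  classical
  have := F₁.finite_degree_one t.1
  have := F₂.finite_degree_one v
  have := ofFinite (F₂.DegOne v)
  have := ofFinite (F₁.DegOne t.1)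
  unfold cobarSum
  rw [finsum_eq_sum_of_fintype, finsum_eq_sum_of_fintype]
  refine (map_sum (component Q.laws t) _ _).trans ?_
  have e1 : ∀ f : F₂.DegOne v, component Q.laws t ((F₂.autWeight f.1 : k)⁻¹ •
        O.cobarTerm (pushDG hφ Q).toGradedOp γL f.2.1 f.2.2 (T f)) =
      ∑ s : ∀ i, φ.Lift (f.1.x i), ((F₂.autWeight f.1 : k)⁻¹ * ∏ i, liftWeight k φ (s i)) •
        liftTerm hφ γ (T f) t s := fun f =>
    (map_smul (component Q.laws t) _ _).trans ((congrArg _ (component_cobarTerm hφ hγ (T f) t)).trans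
      (by simp only [smul_sum, smul_smul]))
  have e2 : ∀ b : F₁.DegOne t.1,
      (F₁.autWeight b.1 : k)⁻¹ • (hφ.pullback.obj O).cobarTerm Q.toGradedOp γ b.2.1 b.2.2 (T' b) =
      ∑ z : ∀ i, F₂.Star (φ.onV (b.1.x i)), ((F₁.autWeight b.1 : k)⁻¹ *
        ∏ i, (Nat.card (Aut (single (z i).1)) : k)⁻¹) •
        (hφ.pullback.obj O).cobarTerm Q.toGradedOp γ b.2.1 b.2.2 (T' b) := fun b =>
    ((sum_smul).symm.trans (congrArg (· • _) ((mul_sum _ _ _).symm.trans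
      ((congrArg (_ * ·) (sum_pi_star fun i => φ.onV (b.1.x i))).trans (mul_one _))))).symm
  refine (sum_congr rfl fun f _ => e1 f).trans
    (Eq.trans ?_ (sum_congr rfl fun b _ => (e2 b).symm))
  rw [← Fintype.sum_sigma', ← Fintype.sum_sigma']
  refine (Fintype.sum_of_injective (liftedPair t) (fun c c' h => Option.some_injective _ ?_) _ _
    (fun a ha => ?_) fun c => ?_).symm
  · rw [← unliftedPair_liftedPair hφ t c, h, unliftedPair_liftedPair hφ t c']
  · have h : ¬∃ g, φ.IsLift (toOp a.1.2.1) a.2 t g := fun h => ha (exists_liftedPair t a h)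
    refine (congrArg _ (sum_eq_zero fun j _ => ?_)).trans (smul_zero _)
    rw [liftAct, dif_neg h]
    exact (congrArg _ (smul_zero _)).trans (smul_zero _)
  · refine congrArg₂ _ ?_ (liftTerm_eq hφ (T (liftedPair t c).1) c.1.2.2 (isLift_liftedPair t c) (T' c.1)).symm
    rw [inv_autWeight, inv_autWeight, mul_right_comm]
    rfl

end CubicalMorphism

/-! ### The push-forward and Feynman transforms -/

theorem CategoryTheory.Adjunction.nonempty_iso_of_universal {A C D : Type*} [Category* A]
    [Category* C] [Category* D] {R : C ⥤ D} {G : D ⥤ C} (adj : R ⊣ G) {S : A ⥤ C} {T : A ⥤ D}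
    (u : S ⟶ T ⋙ G) (hu : ∀ a Q, Bijective fun g : T.obj a ⟶ Q => u.app a ≫ G.map g) :
    Nonempty (S ⋙ R ≅ T) := by
  let θ : S ⋙ R ⟶ T := {
      app := fun a => (adj.homEquiv _ _).symm (u.app a)
      naturality := fun a b f => by
        apply (adj.homEquiv _ _).injective
        have := u.naturality f
        rw [Functor.comp_map, Adjunction.homEquiv_naturality_left, Adjunction.homEquiv_naturality_right,
          Equiv.apply_symm_apply, Equiv.apply_symm_apply]
        exact this }
  have : ∀ a, IsIso (θ.app a) := fun a => by
    refine isIso_of_coyoneda_map_bijective _ fun Q => ?_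
    have h : (fun g : T.obj a ⟶ Q => θ.app a ≫ g) =
        (adj.homEquiv _ _).symm ∘ fun g => u.app a ≫ G.map g := by
      funext g
      exact (adj.homEquiv_naturality_right_symm _ _).symm
    rw [h]
    exact (adj.homEquiv _ _).symm.bijective.comp (hu a Q)
  exact ⟨NatIso.ofComponents (fun a => asIso (θ.app a)) fun f => θ.naturality f⟩

theorem DGOp.dualIso_refl (O : DGOp k F ε) {v : F.C.V} {n : ℤ} (ξ : (O.obj v).dual n) :
    O.dualIso (Iso.refl (single v)) n ξ = ξ :=
  Subtype.ext (LinearMap.ext fun p => congrArg (ξ : Dual k (O.obj v)) (O.laws.evIso_refl p))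

namespace CubicalMorphism

open DGOp

variable {F₁ F₂ : CubicalFeynmanCategory.{u}} {φ : CubicalMorphism F₁ F₂} [CharZero k]
  (hφ : φ.Admissible) {O : DGOp k F₂ ε} {Q : DGOp k F₁ ε.flip}
  {γ : (hφ.pullback.obj O).DualMap Q.toGradedOp} {γL : O.DualMap (pushDG hφ Q).toGradedOp}

/-- The family of maps to a push-forward given by a family on the restriction. -/
noncomputable def pushDualMap (hγ : (hφ.pullback.obj O).IsDualMap Q.toGradedOp γ) :
    O.DualMap (pushDG hφ Q).toGradedOp := fun _ n =>
  { toFun := fun ξ => ⟨fun t => γ t.1 n (O.dualIso t.2 n ξ), fun t t' l hl => by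
      have h : O.dualIso t.2 n ξ = (hφ.pullback.obj O).dualIso l n (O.dualIso t'.2 n ξ) :=
        Subtype.ext (LinearMap.ext fun p => congrArg (ξ : Dual k (O.obj _))
          ((congrArg (fun σ => O.evIso σ p) hl.symm).trans (O.laws.evIso_trans _ _ p)))
      exact (congrArg (fun η => Q.evIso l (γ t.1 n η)) h).trans (hγ.evIso l n _)⟩
    map_add' := fun ξ η => Subtype.ext (funext fun t =>
      (congrArg (γ t.1 n) (map_add (O.dualIso t.2 n) ξ η)).trans (map_add _ _ _))
    map_smul' := fun r ξ => Subtype.ext (funext fun t =>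
      (congrArg (γ t.1 n) (map_smul (O.dualIso t.2 n) r ξ)).trans (map_smul _ _ _)) }

theorem isTwisting_push (hO : (hφ.pullback.obj O).Dualizable)
    (hγ : (hφ.pullback.obj O).IsTwisting Q γ) :
    O.IsTwisting (pushDG hφ Q) (pushDualMap hφ hγ.1) := by
  refine ⟨⟨fun v n ξ t => hγ.1.mem _ _ _, fun v n σ ξ η hη => push_ext Q.laws fun t => ?_⟩,
    fun v n ξ T => push_ext Q.laws fun t => ?_⟩
  · refine (component_evIso hφ Q.laws σ t _).trans (congrArg (γ t.1 n) (Subtype.ext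
      (LinearMap.ext fun p => ?_)))
    refine (hη _).trans (congrArg (ξ : Dual k (O.obj v)) ?_)
    refine (congrArg (O.evIso σ) (O.laws.evIso_trans t.2 σ.symm p)).trans ?_
    exact O.laws.evIso_evIso_symm σ _
  · obtain ⟨T'⟩ := hO.nonempty (O.dualIso t.2 n ξ)
    refine (hγ.d_eq t.1 n (O.dualIso t.2 n ξ) T').trans (Eq.symm ((map_neg _ _).trans
      (congrArg Neg.neg ((map_intUnit_smul _ _ _).trans (congrArg ((-1 : ℤˣ) ^ n • ·)
      ((map_add _ _ _).trans (congrArg₂ (· + ·) (congrArg (γ t.1 (n + 1)) ?_) ?_)))))))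
    · exact Subtype.ext (LinearMap.ext fun p => congrArg (ξ : Dual k (O.obj v))
        (O.d_evIso t.2 p))
    · exact component_cobarSum hφ (fun _ _ _ _ => rfl) t T T'

theorem isTwisting_base (hO : O.Dualizable) (hγ : O.IsTwisting (pushDG hφ Q) γL) :
    ∃ γ : (hφ.pullback.obj O).DualMap Q.toGradedOp, (hφ.pullback.obj O).IsTwisting Q γ ∧
      ∀ v n ξ (t : φ.Lift v), component Q.laws t (γL v n ξ) = γ t.1 n (O.dualIso t.2 n ξ) := by
  let γ : (hφ.pullback.obj O).DualMap Q.toGradedOp := fun w n =>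
    component Q.laws (φ.baseLift w) ∘ₗ γL (φ.onV w) n
  have hc : ∀ v n ξ (t : φ.Lift v), component Q.laws t (γL v n ξ) = γ t.1 n (O.dualIso t.2 n ξ) := by
    intro v n ξ t
    refine (component_eq hφ Q.laws t _).trans (congrArg (component Q.laws (φ.baseLift t.1)) ?_)
    have h := hγ.1.evIso t.2.symm n (O.dualIso t.2 n ξ)
    have h1 : O.dualIso t.2.symm n (O.dualIso t.2 n ξ) = ξ :=
      Subtype.ext (LinearMap.ext fun p => congrArg (ξ : Dual k (O.obj v))
        (O.laws.evIso_evIso_symm t.2 p))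
    rwa [h1] at h
  have hb : ∀ w n (ξ : (O.obj (φ.onV w)).dual n), O.dualIso (φ.baseLift w).2 n ξ = ξ :=
    fun w n ξ => O.dualIso_refl ξ
  refine ⟨γ, ⟨⟨fun w n ξ => hγ.1.mem _ n ξ (φ.baseLift w), fun w n σ ξ η hη => ?_⟩,
    fun w n ξ T' => ?_⟩, hc⟩
  · have h : η = O.dualIso (φ.mapV σ) n ξ := Subtype.ext (LinearMap.ext hη)
    refine (congrArg (fun η => Q.evIso σ (γ w n η)) h).trans ?_
    refine (congrArg (Q.evIso σ) (hc _ n ξ (⟨w, φ.mapV σ⟩ : φ.Lift (φ.onV w))).symm).trans ?_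
    exact evIso_component Q.laws (t := (⟨w, φ.mapV σ⟩ : φ.Lift (φ.onV w)))
      (t' := φ.baseLift w) σ (Iso.trans_refl _) _
  · obtain ⟨T⟩ := hO.nonempty (v := φ.onV w) ξ
    refine (congrArg (component Q.laws (φ.baseLift w)) (hγ.d_eq _ n ξ T)).trans ((map_neg _ _).trans
      (congrArg Neg.neg ((map_intUnit_smul _ _ _).trans (congrArg ((-1 : ℤˣ) ^ n • ·)
      ((map_add _ _ _).trans (congrArg₂ (· + ·) rfl ?_))))))
    let T'' : (hφ.pullback.obj O).Codecompositions (O.dualIso (φ.baseLift w).2 n ξ).1 := fun f =>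
      { T' f with
        sum_eq p := (congrArg (fun η : (O.obj (φ.onV w)).dual n => η.1 _) (hb w n ξ)).trans
          ((T' f).sum_eq p) }
    exact component_cobarSum hφ hc (φ.baseLift w) T T''

theorem exists_push_universal {D₂ : DGOp k F₂ ε.flip} {gen₂ : O.DualMap D₂.toGradedOp}
    (h₂ : IsFeynmanTransform O D₂ gen₂) {D₁ : DGOp k F₁ ε.flip}
    {gen₁ : (hφ.pullback.obj O).DualMap D₁.toGradedOp}
    (h₁ : IsFeynmanTransform (hφ.pullback.obj O) D₁ gen₁) (hO : O.Dualizable)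
    (hO' : (hφ.pullback.obj O).Dualizable) :
    ∃ u : D₂ ⟶ pushDG hφ D₁, (∀ v n ξ (t : φ.Lift v),
      component D₁.laws t (u.app v (gen₂ v n ξ)) = gen₁ t.1 n (O.dualIso t.2 n ξ)) ∧
      ∀ Q : DGOp k F₁ ε.flip, Bijective fun g : D₁ ⟶ Q => u ≫ pushHom hφ g := by
  obtain ⟨u, hu⟩ := h₂.exists_hom hO (isTwisting_push hφ hO' h₁.isTwisting)
  have hu' : ∀ v n ξ (t : φ.Lift v),
      component D₁.laws t (u.app v (gen₂ v n ξ)) = gen₁ t.1 n (O.dualIso t.2 n ξ) :=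
    fun v n ξ t => congrArg (component D₁.laws t) (hu v n ξ)
  refine ⟨u, hu', fun Q => ⟨fun a b hab => h₁.hom_ext fun w n ξ => ?_, fun h => ?_⟩⟩
  · have hb : O.dualIso (φ.baseLift w).2 n ξ = ξ := O.dualIso_refl ξ
    have key : ∀ g : D₁ ⟶ Q, g.app w (gen₁ w n ξ) =
        component Q.laws (φ.baseLift w) ((u ≫ pushHom hφ g).app _ (gen₂ (φ.onV w) n ξ)) := fun g =>
      congrArg (g.app w) ((congrArg (gen₁ w n) hb.symm).trans (hu' _ n ξ (φ.baseLift w)).symm)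
    rw [key, key]
    exact congrArg (fun c : D₂ ⟶ pushDG hφ Q =>
      component Q.laws (φ.baseLift w) (c.app _ (gen₂ (φ.onV w) n ξ))) hab
  · obtain ⟨γ, hγ, hγc⟩ := isTwisting_base hφ hO (h₂.isTwisting.comp h)
    obtain ⟨g, hg⟩ := h₁.exists_hom hO' hγ
    refine ⟨g, h₂.hom_ext fun v n ξ => push_ext Q.laws fun t => ?_⟩
    exact (congrArg (g.app t.1) (hu' v n ξ t)).trans ((hg _ _ _).trans (hγc v n ξ t).symm)

theorem nonempty_transform_iso (D₁ : FeynmanTransform k F₁ ε) (D₂ : FeynmanTransform k F₂ ε)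
    (L : ExceptionalPush k ε.flip φ) {R : DGOp k F₂ ε.flip ⥤ DGOp k F₁ ε.flip}
    (adj : R ⊣ L.functor) :
    Nonempty (D₂.functor ⋙ R ≅ hφ.pullbackDualizable.op ⋙ D₁.functor) := by
  choose u hu hb using fun O : DualizableOp k F₂ ε =>
    exists_push_universal hφ (D₂.isFeynmanTransform O)
      (D₁.isFeynmanTransform (hφ.pullbackDualizable.obj O)) O.property
      (hφ.pullbackDualizable.obj O).property
  refine (adj.ofNatIsoRight (L.isoPush hφ).symm).nonempty_iso_of_universal
    (S := D₂.functor) (T := hφ.pullbackDualizable.op ⋙ D₁.functor)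
    { app := fun O => u O.unop
      naturality := fun O' O f => ?_ } fun O Q => hb O.unop Q
  refine (D₂.isFeynmanTransform O'.unop).hom_ext fun v n ξ => 
    push_ext (D₁.functor.obj (Opposite.op (hφ.pullbackDualizable.obj O.unop))).laws fun t => ?_
  let f' : O.unop ⟶ O'.unop := f.unop
  let η : (O.unop.obj.obj v).dual n := ⟨ξ.1 ∘ₗ f'.hom.app v, fun m hm x hx =>
    ξ.2 m hm _ (f'.hom.app_mem v m x hx)⟩
  have h1 : (D₂.functor.map f).app v (D₂.gen O'.unop v n ξ) = D₂.gen O.unop v n η :=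
    D₂.map_gen f' v n ξ η fun _ => rfl
  refine (congrArg (fun x => component _ t ((u O.unop).app v x)) h1).trans
    ((hu O.unop v n η t).trans ?_)
  refine Eq.trans ?_ (congrArg ((D₁.functor.map (hφ.pullbackDualizable.map f').op).app t.1)
    (hu O'.unop v n ξ t)).symm
  refine (D₁.map_gen (hφ.pullbackDualizable.map f') t.1 n _ _ fun p => ?_).symm
  exact congrArg (ξ : Dual k (O'.unop.obj.obj v)) (DGOp.Hom.app_evIso f'.hom t.2 p)

end CubicalMorphism

/-! ### The differential of the Feynman transform on generators -/

theorem Decomp.sum_ite_eq {I : Type} [Fintype I] {V : I → GrVect k} {Ξ : (∀ i, V i) → k}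
    (T : Decomp V Ξ) (N : ℤ)
    (h : ∀ (c : I → ℤ) (p : ∀ i, V i), (∀ i, p i ∈ (V i).gr (-c i)) → ∑ i, c i ≠ N → Ξ p = 0)
    (p : ∀ i, V i) : (∑ a, if ∑ i, T.c a i = N then
      T.r a * ∏ i, (T.ζ a i : Dual k (V i)) (p i) else 0) = Ξ p := by
  classical
  rw [T.sum_eq, ← sub_eq_zero, ← Finset.sum_sub_distrib,
    ← Finset.sum_fiberwise_of_maps_to (t := Finset.univ.image T.c)
      fun a _ => Finset.mem_image_of_mem _ (mem_univ a)]
  refine sum_eq_zero fun c _ => ?_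
  by_cases hc : ∑ i, c i = N
  · refine sum_eq_zero fun a ha => ?_
    rw [if_pos ((congrArg (fun c => ∑ i, c i) (Finset.mem_filter.1 ha).2).trans hc), sub_self]
  · have h1 := T.sum_part_functional c p
    rw [h c _ (fun i => GrVect.proj_mem _ _) hc] at h1
    rw [← sum_filter] at h1
    refine (sum_congr rfl fun a ha => ?_).trans
      ((sum_neg_distrib _).trans (neg_eq_zero.2 h1))
    rw [if_neg ((congrArg (fun c => ∑ i, c i) (Finset.mem_filter.1 ha).2).trans_ne hc), zero_sub]

namespace DGOp

variable {O : DGOp k F ε}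

theorem ev_mem {ε' : Parity} (P : GradedOp k F ε') {X : F.C.Word} {v : F.C.V} (f : X ⟶ single v)
    (hf : F.δ.degree f = 1) {c : Fin X.n → ℤ} {p : ∀ i, P.obj (X.x i)}
    (hp : ∀ i, p i ∈ (P.obj (X.x i)).gr (c i)) :
    P.ev f hf.le p ∈ (P.obj v).gr (∑ i, c i + ε'.val) := by
  rw [P.laws.ev_eq f hf.le]
  have := P.act_mem (toOp f) ((F.δ.deg_toOp f).trans_le hf.le) c p hp
  have h : ((F.δ.deg (toOp f) : ℕ) : ℤ) = 1 := by rw [F.δ.deg_toOp, hf, Nat.cast_one]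
  rwa [h, mul_one] at this

/-- Codecompositions into functionals of the total degree that is not zero for degree reasons. -/
theorem Dualizable.exists_homogeneous (hO : O.Dualizable) {v : F.C.V} {n : ℤ}
    (ξ : (O.obj v).dual n) : ∃ T : O.Codecompositions (ξ : Dual k (O.obj v)),
      ∀ f a, ∑ i, (T f).c a i = n + ε.val := by
  classical
  obtain ⟨T⟩ := hO.nonempty ξ
  let e := fun f => (Fintype.equivFin {a // ∑ i, (T f).c a i = n + ε.val}).symm
  refine ⟨fun f => ⟨_, fun b => (T f).r (e f b).1, fun b => (T f).c (e f b).1,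
    fun b => (T f).ζ (e f b).1, fun p => ?_⟩, fun f b => (e f b).2⟩
  have h := (T f).toDecomp.sum_ite_eq (n + ε.val) (fun c p hp hc => ?_) p
  · refine h.symm.trans ((sum_subtype_ite _ _).symm.trans ?_)
    exact (Equiv.sum_comp (e f) _).symm
  · refine ξ.2 _ ?_ _ (ev_mem O.toGradedOp f.2.1 f.2.2 hp)
    rw [sum_neg_distrib]
    omega

variable {D : GradedOp k F ε.flip} {γ : O.DualMap D}

theorem cobarTerm_combination {X : F.C.Word} {v : F.C.V} {f : X ⟶ single v}
    {hf : F.δ.degree f = 1} {ξ ξ' ξ'' : Dual k (O.obj v)} {r : k} (h : ξ'' = r • ξ + ξ')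
    (T : O.Codecomposition f hf ξ) (T' : O.Codecomposition f hf ξ')
    (T'' : O.Codecomposition f hf ξ'') :
    O.cobarTerm D γ f hf T'' = r • O.cobarTerm D γ f hf T + O.cobarTerm D γ f hf T' := by
  subst h
  rw [cobarTerm_eq, cobarTerm_eq, cobarTerm_eq, ← Decomp.smul_eval]
  refine (Decomp.eval_eq (Decomp.sum (J := Bool) (Ξ := fun b p => bif b then r * ξ (O.ev f hf.le p)
    else ξ' (O.ev f hf.le p)) fun | true => T.toDecomp.smul r | false => T'.toDecomp) _
    (fun p => ?_) _ _ _).trans ?_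
  · rw [Fintype.sum_bool]
    rfl
  · rw [Decomp.sum_eval, Fintype.sum_bool]

theorem cobarSum_combination {v : F.C.V} {ξ ξ' ξ'' : Dual k (O.obj v)} {r : k}
    (h : ξ'' = r • ξ + ξ') (T : O.Codecompositions ξ) (T' : O.Codecompositions ξ')
    (T'' : O.Codecompositions ξ'') : cobarSum γ T'' = r • cobarSum γ T + cobarSum γ T' := by
  have := F.finite_degree_one v
  have := ofFinite (F.DegOne v)
  simp only [cobarSum, finsum_eq_sum_of_fintype, smul_sum, ← sum_add_distrib]
  refine sum_congr rfl fun f _ => ?_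
  rw [cobarTerm_combination h (T f) (T' f) (T'' f), smul_add, smul_comm]

theorem cobarSum_zero {v : F.C.V} (T : O.Codecompositions (0 : Dual k (O.obj v))) :
    cobarSum γ T = 0 := by
  simpa using cobarSum_combination (γ := γ) (r := 1) (by simp) T T T

theorem cobarSum_congr {v : F.C.V} {ξ ξ' : Dual k (O.obj v)} (h : ξ = ξ')
    (T : O.Codecompositions ξ) (T' : O.Codecompositions ξ') : cobarSum γ T = cobarSum γ T' := by
  subst h
  have := cobarSum_combination (γ := γ) (r := 0) (by simp) T T T'
  simpa using this.symm

theorem evIso_cobarSum {v w : F.C.V} (σ : single v ≅ single w)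
    {ξ : Dual k (O.obj v)} {ξ' : Dual k (O.obj w)} (h : ∀ p, ξ p = ξ' (O.evIso σ p))
    (T : O.Codecompositions ξ) (T' : O.Codecompositions ξ') :
    D.evIso σ (cobarSum γ T) = cobarSum γ T' := by
  have := F.finite_degree_one v
  have hσ : ∀ {X : F.C.Word} (f : X ⟶ single v), F.δ.degree (f ≫ σ.hom) = F.δ.degree f := fun f => by
    rw [F.δ.degree_comp, F.δ.degree_iso, add_zero]
  have hσ' : ∀ {X : F.C.Word} (f : X ⟶ single w), F.δ.degree (f ≫ σ.inv) = F.δ.degree f := fun f => by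
    rw [F.δ.degree_comp, show F.δ.degree σ.inv = 0 from F.δ.degree_iso σ.symm, add_zero]
  let e : F.DegOne v ≃ (F.DegOne w) := Equiv.sigmaCongrRight fun X =>
    { toFun := fun f => ⟨f.1 ≫ σ.hom, (hσ f.1).trans f.2⟩
      invFun := fun f => ⟨f.1 ≫ σ.inv, (hσ' f.1).trans f.2⟩
      left_inv := fun f => Subtype.ext (by simp)
      right_inv := fun f => Subtype.ext (by simp) }
  unfold cobarSum
  refine ((D.evIso σ).toAddMonoidHom.map_finsum (Set.toFinite _)).trans
    (Eq.trans (finsum_congr fun f => ?_) (finsum_comp_equiv e))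
  refine (map_smul (D.evIso σ) _ _).trans (congrArg _ ?_)
  have hf : F.δ.degree (f.2.1 ≫ σ.hom) = 1 := (hσ f.2.1).trans f.2.2
  have hact : ∀ {ε' : Parity} (P : GradedOp k F ε') p, P.act (toOp (f.2.1 ≫ σ.hom))
      ((F.δ.deg_toOp _).trans_le hf.le) p =
        P.evIso σ (P.act (toOp f.2.1) ((F.δ.deg_toOp _).trans_le f.2.2.le) p) := fun P p => by
    have h1 := toOp_comp_uop f.2.1 σ.hom
    refine (PreGradedOp.act_congr h1 _ (h1 ▸ (F.δ.deg_toOp _).trans_le hf.le) p).trans ?_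
    exact P.laws.act_post _ _ σ _ p
  change _ = O.cobarTerm D γ (f.2.1 ≫ σ.hom) hf (T' (e f))
  rw [cobarTerm_eq]
  refine Eq.trans ?_ ((cobarTerm_eq γ (T' (e f))).trans
    (Decomp.eval_eq (T f).toDecomp (T' (e f)).toDecomp (fun p => ?_) _ _ _)).symm
  · refine (map_sum (D.evIso σ) _ _).trans (sum_congr rfl fun a _ => ?_)
    refine (map_smul (D.evIso σ) _ _).trans (congrArg _ ?_)
    exact (map_intUnit_smul _ _ _).trans (congrArg _ (hact D _).symm)
  · refine Eq.trans ?_ (h _).symm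
    exact congrArg ξ' ((O.laws.ev_eq _ hf.le p).trans ((hact O.toGradedOp p).trans
      (congrArg (O.evIso σ) (O.laws.ev_eq _ f.2.2.le p).symm)))

theorem cobarSum_mem (hO : O.Dualizable) (hγ : O.IsDualMap D γ) {v : F.C.V} {n : ℤ}
    (ξ : (O.obj v).dual n) (T : O.Codecompositions (ξ : Dual k (O.obj v))) :
    cobarSum γ T ∈ (D.obj v).gr (n + 1) := by
  have := F.finite_degree_one v
  have := ofFinite (F.DegOne v)
  obtain ⟨T', hT'⟩ := hO.exists_homogeneous ξ
  rw [cobarSum_congr rfl T T', cobarSum, finsum_eq_sum_of_fintype]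
  refine Submodule.sum_mem _ fun f _ => Submodule.smul_mem _ _ (Submodule.sum_mem _ fun a _ =>
    Submodule.smul_mem _ _ (Submodule.smul_of_tower_mem _ _ ?_))
  have h := ev_mem D f.2.1 f.2.2 fun i => hγ.mem _ _ ((T' f).ζ a i)
  rw [hT'] at h
  have he : n + ε.val + ε.flip.val = n + 1 := by cases ε <;> simp [Parity.val, Parity.flip]
  rwa [he] at h

/-- The value that the differential of a Feynman transform must take on generators. -/
noncomputable def transformD (hO : O.Dualizable) (γ : O.DualMap D) (v : F.C.V) (n : ℤ) :
    (O.obj v).dual n →ₗ[k] D.obj v :=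
  -((-1 : ℤˣ) ^ n • (γ v (n + 1) ∘ₗ O.dualD v n +
    { toFun := fun ξ => cobarSum γ (hO.nonempty ξ).some
      map_add' := fun ξ η => (cobarSum_combination (r := 1) (by simp) _ _ _).trans
        (congrArg (· + _) (one_smul _ _))
      map_smul' := fun r ξ => (cobarSum_combination (r := r) (ξ := ξ.1) (ξ' := 0)
        (add_zero (r • ξ.1)).symm (hO.nonempty ξ).some (hO.nonempty (0 : (O.obj v).dual n)).some _).trans
        ((congrArg (_ + ·) (cobarSum_zero _)).trans (add_zero _)) }))

theorem transformD_apply (hO : O.Dualizable) (γ : O.DualMap D) {v : F.C.V} {n : ℤ}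
    (ξ : (O.obj v).dual n) (T : O.Codecompositions (ξ : Dual k (O.obj v))) :
    transformD hO γ v n ξ = -((-1 : ℤˣ) ^ n • (γ v (n + 1) (O.dualD v n ξ) + cobarSum γ T)) := by
  rw [cobarSum_congr rfl T (hO.nonempty ξ).some]
  rfl

theorem isDualMap_lift (hO : O.Dualizable) (hγ : O.IsDualMap D γ) :
    O.IsDualMap D.cofree.toGradedOp fun v n => (γ v n).prod (transformD hO γ v n) := by
  refine ⟨fun v n ξ => ⟨hγ.mem v n ξ, ?_⟩, fun v n σ ξ η hη => ?_⟩
  · obtain ⟨T⟩ := hO.nonempty ξ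
    change transformD hO γ v n ξ ∈ (D.obj v).gr (n + 1)
    rw [transformD_apply hO γ ξ T]
    exact Submodule.neg_mem _ (Submodule.smul_of_tower_mem _ _ (Submodule.add_mem _
      (hγ.mem v _ _) (cobarSum_mem hO hγ ξ T)))
  · obtain ⟨T⟩ := hO.nonempty ξ
    obtain ⟨T'⟩ := hO.nonempty η
    have h1 : D.evIso σ (transformD hO γ v n η) = transformD hO γ v n ξ := by
      rw [transformD_apply hO γ ξ T, transformD_apply hO γ η T', map_neg,
        map_intUnit_smul, map_add, evIso_cobarSum σ hη T' T,
        hγ.equivariant v (n + 1) σ (O.dualD v n ξ) (O.dualD v n η) fun p => ?_]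
      exact (hη _).trans (congrArg (ξ : Dual k (O.obj v)) (O.d_evIso σ p).symm)
    have h2 : ∀ q : D.obj v × D.obj v, D.cofree.evIso σ q = (D.evIso σ q.1, D.evIso σ q.2) := by
      have h3 : ∀ q : D.obj v × D.obj v, (D.cofree.evIso σ q).1 = D.evIso σ q.1 :=
        GradedOp.Hom.app_evIso D.cofreeFst σ
      exact fun q => Prod.ext (h3 q) ((congrArg Prod.fst (D.cofree.d_evIso σ q)).trans (h3 _))
    exact (h2 _).trans (Prod.ext (hγ.equivariant v n σ ξ η hη) h1)

end DGOp

/-- The sum of the products of pairs of entries. -/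
def pairSum (c : I → ℤ) : ℤ :=
  ∑ i, ∑ j, if i < j then c i * c j else 0

theorem two_mul_pairSum (c : I → ℤ) :
    2 * pairSum c = (∑ i, c i) ^ 2 - ∑ i, c i ^ 2 := by
  have h1 : pairSum c = ∑ i, ∑ j, if j < i then c i * c j else 0 := by
    rw [pairSum, sum_comm]
    exact sum_congr rfl fun i _ => sum_congr rfl fun j _ => by rw [mul_comm]
  have h2 : ∑ i, c i ^ 2 = ∑ i, ∑ j, if i = j then c i * c j else 0 :=
    sum_congr rfl fun i _ => by simp [sq]
  rw [two_mul]
  nth_rw 2 [h1]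
  rw [h2, sq, Finset.sum_mul_sum, pairSum, eq_sub_iff_add_eq]
  simp only [← sum_add_distrib]
  refine sum_congr rfl fun i _ => sum_congr rfl fun j _ => ?_
  rcases tri_cases i j with rfl | h | h <;> simp [*]

theorem pairSum_update_add_one (c : I → ℤ) (i : I) :
    pairSum (update c i (c i + 1)) = pairSum c + ∑ j, c j - c i := by
  have h1 := two_mul_pairSum c
  have h2 := two_mul_pairSum (update c i (c i + 1))
  have h3 : ∑ j, update c i (c i + 1) j ^ 2 = ∑ j, c j ^ 2 + (2 * c i + 1) := by
    rw [← add_sum_erase _ _ (mem_univ i),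
      ← add_sum_erase _ (fun j => c j ^ 2) (mem_univ i), update_self,
      sum_congr rfl fun j hj => by rw [update_of_ne (Finset.ne_of_mem_erase hj)]]
    ring
  rw [sum_update_add_one, h3] at h2
  linarith

theorem MultilinearMap.eq_sum_prod {I : Type} [Fintype I] {V : I → GrVect k}
    (Φ : MultilinearMap k (fun i => V i) k) {A : Type*} [Fintype A] (r : A → k)
    (ζ : A → ∀ i, Dual k (V i))
    (h : ∀ (n : I → ℤ) (p : ∀ i, V i), (∀ i, p i ∈ (V i).gr (n i)) →
      Φ p = ∑ a, r a * ∏ i, ζ a i (p i)) (p : ∀ i, V i) : Φ p = ∑ a, r a * ∏ i, ζ a i (p i) := by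
  classical
  let Ψ : MultilinearMap k (fun i => V i) k :=
    ∑ a, r a • (MultilinearMap.mkPiAlgebra k I k).compLinearMap (ζ a)
  have hΨ : ∀ p, Ψ p = ∑ a, r a * ∏ i, ζ a i (p i) := fun p => by
    simp only [Ψ, _root_.sum_apply, _root_.smul_apply, MultilinearMap.compLinearMap_apply,
      MultilinearMap.mkPiAlgebra_apply, smul_eq_mul]
  rw [← hΨ, GrVect.multilinear_ext (f := Φ) (g := Ψ) fun n p hp => (h n p hp).trans (hΨ p).symm]

/-- Replacing one of a family of homogeneous functionals by one of the next degree. -/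
def GrVect.updateDual {I : Type} [DecidableEq I] {V : I → GrVect k} {c : I → ℤ}
    (ζ : ∀ i, (V i).dual (c i)) (i : I) (η : (V i).dual (c i + 1)) (j : I) :
    (V j).dual (update c i (c i + 1) j) :=
  ⟨update (fun j => (ζ j : Dual k (V j))) i η j, by
    by_cases h : j = i
    · subst h; simp
    · simp [h]⟩

theorem GrVect.updateDual_self {I : Type} [DecidableEq I] {V : I → GrVect k} {c : I → ℤ}
    (ζ : ∀ i, (V i).dual (c i)) (i : I) (η : (V i).dual (c i + 1)) :
    (updateDual ζ i η i : Dual k (V i)) = η := by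
  simp [updateDual]

theorem GrVect.updateDual_of_ne {I : Type} [DecidableEq I] {V : I → GrVect k} {c : I → ℤ}
    (ζ : ∀ i, (V i).dual (c i)) {i j : I} (h : j ≠ i) (η : (V i).dual (c i + 1)) :
    (updateDual ζ i η j : Dual k (V j)) = ζ j := by
  simp [updateDual, h]

theorem GrVect.gamma_updateDual {I : Type} [DecidableEq I] {V : I → GrVect k} {W : I → Type*}
    [∀ i, AddCommGroup (W i)] [∀ i, Module k (W i)] (γ : ∀ i n, (V i).dual n →ₗ[k] W i)
    {c : I → ℤ} (ζ : ∀ i, (V i).dual (c i)) (i : I) (η : (V i).dual (c i + 1)) :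
    (fun j => γ j _ (GrVect.updateDual ζ i η j)) = update (fun j => γ j _ (ζ j)) i (γ i _ η) := by
  funext j
  by_cases h : j = i
  · subst h
    exact (Decomp.gamma_congr (γ j) (update_self ..) _ _ (updateDual_self ζ j η)).trans
      (update_self (β := W) j (γ j _ η) fun j => γ j _ (ζ j)).symm
  · exact (Decomp.gamma_congr (γ j) (update_of_ne h ..) _ _ (updateDual_of_ne ζ h η)).trans
      (update_of_ne (β := W) h (γ i _ η) fun j => γ j _ (ζ j)).symm

theorem neg_one_zpow_congr {a b : ℤ} (h : Even (a - b)) : (-1 : ℤˣ) ^ a = (-1) ^ b := by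
  rw [← sub_add_cancel a b, zpow_add, h.neg_one_zpow, one_mul]

namespace DGOp

theorem cobarSign_eq (ε : Parity) (c : I → ℤ) :
    cobarSign ε c = (-1) ^ (pairSum c) * (-1) ^ (ε.val * ∑ i, c i) := by
  unfold cobarSign pairSum
  congr 1
  simp only [← sgn_intCast]
  push_cast
  rw [sgn_sum]
  refine prod_congr rfl fun i _ => ?_
  rw [sgn_sum]
  refine prod_congr rfl fun j _ => ?_
  split_ifs <;> simp [sgn_zero]

variable {O : DGOp k F ε}

theorem prod_update_d {x : I → F.C.V} {c m : I → ℤ}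
    (ζ : ∀ i, (O.obj (x i)).dual (c i)) {p : ∀ i, O.obj (x i)}
    (hp : ∀ i, p i ∈ (O.obj (x i)).gr (m i)) (i : I) :
    signBefore m i • ∏ j, (ζ j : Dual k (O.obj (x j))) (update p i (O.d _ (p i)) j) =
      signBefore c i • ∏ j, (GrVect.updateDual ζ i (O.dualD _ _ (ζ i)) j :
        Dual k (O.obj (x j))) (p j) := by
  have h1 : ∀ j, (ζ j : Dual k (O.obj (x j))) (update p i (O.d _ (p i)) j) =
      (GrVect.updateDual ζ i (O.dualD _ _ (ζ i)) j : Dual k (O.obj (x j))) (p j) := fun j => by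
    by_cases h : j = i
    · subst h
      rw [GrVect.updateDual_self, update_self]
      rfl
    · rw [GrVect.updateDual_of_ne _ h, update_of_ne h]
  rw [prod_congr rfl fun j _ => h1 j]
  by_cases h : ∀ j, j ≠ i → m j = -c j
  · congr 1
    refine prod_congr rfl fun j _ => ?_
    split_ifs with hj
    · rw [h j hj.ne, zpow_neg, Int.units_inv_eq_self]
    · rfl
  · push Not at h
    obtain ⟨j, hj, hm⟩ := h
    rw [Finset.prod_eq_zero (mem_univ j), smul_zero, smul_zero]
    rw [GrVect.updateDual_of_ne _ hj]
    exact (ζ j).2 _ hm _ (hp j)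

/-- The decomposition of the transpose of an operation on a transposed differential. -/
noncomputable def Codecomposition.dual {X : F.C.Word} {v : F.C.V} {f : X ⟶ single v}
    {hf : F.δ.degree f = 1} {ξ : Dual k (O.obj v)} (T : O.Codecomposition f hf ξ) :
    Decomp (fun i => O.obj (X.x i)) fun p => ξ (O.d v (O.ev f hf.le p)) where
  A := Fin T.N × Fin X.n
  r a := ((-1 : ℤˣ) ^ ε.val * signBefore (T.c a.1) a.2) • T.r a.1
  c a := update (T.c a.1) a.2 (T.c a.1 a.2 + 1)
  ζ a := GrVect.updateDual (T.ζ a.1) a.2 (O.dualD _ _ (T.ζ a.1 a.2))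
  sum_eq p := by
    have hd : F.δ.deg (toOp f) = 1 := (F.δ.deg_toOp f).trans hf
    have hev := fun p => O.laws.ev_eq f hf.le p
    refine (congrArg (fun y => ξ (O.d v y)) (hev p)).trans
      (MultilinearMap.eq_sum_prod ((ξ ∘ₗ O.d v).compMultilinearMap (O.act (toOp f) hd.le))
        _ _ (fun m p hp => ?_) p)
    have h1 : (ξ ∘ₗ O.d v).compMultilinearMap (O.act (toOp f) hd.le) p = (-1 : ℤˣ) ^ ε.val • ∑ i,
        signBefore m i • ξ (O.act (toOp f) hd.le (update p i (O.d _ (p i)))) := by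
      have h2 := O.d_act (toOp f) hd.le m p hp
      have h3 : ε.val * F.δ.deg (toOp f) = ε.val := by rw [hd, mul_one]
      rw [h3] at h2
      refine (congrArg ξ h2).trans ((map_intUnit_smul ξ _ _).trans (congrArg _ ?_))
      exact (map_sum ξ _ _).trans (sum_congr rfl fun i _ => map_intUnit_smul ξ _ _)
    rw [h1, Fintype.sum_prod_type_right, smul_sum]
    refine sum_congr rfl fun i _ => ?_
    rw [← hev, T.sum_eq, smul_sum, smul_sum]
    refine sum_congr rfl fun a _ => ?_
    rw [smul_mul_assoc, mul_smul, ← mul_smul_comm (signBefore m i)]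
    refine congrArg ((-1 : ℤˣ) ^ ε.val • ·) ?_
    rw [← mul_smul_comm]
    exact congrArg (T.r a * ·) (prod_update_d (T.ζ a) hp i)

variable {D : GradedOp k F ε.flip} {γ : O.DualMap D}

/-- The terms of the differential of the Feynman transform on a transposed differential. -/
theorem cobarTerm_dualD {X : F.C.Word} {v : F.C.V} {f : X ⟶ single v} {hf : F.δ.degree f = 1}
    {n : ℤ} {ξ : (O.obj v).dual n} (T : O.Codecomposition f hf (ξ : Dual k (O.obj v)))
    (hT : ∀ a, ∑ i, T.c a i = n + ε.val)
    (T' : O.Codecomposition f hf (O.dualD v n ξ : Dual k (O.obj v))) :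
    (-1 : ℤˣ) ^ n • O.cobarTerm D γ f hf T' = (-1 : ℤˣ) ^ ε.flip.val • ∑ a, T.r a •
      cobarSign ε.flip (T.c a) • ∑ i, signBefore (T.c a) i • (-1 : ℤˣ) ^ T.c a i •
        D.ev f hf.le (update (fun j => γ (X.x j) _ (T.ζ a j)) i
          (γ (X.x i) _ (O.dualD _ _ (T.ζ a i)))) := by
  rw [cobarTerm_eq, Decomp.eval_eq T.dual T'.toDecomp fun p => rfl]
  refine (congrArg _ (Fintype.sum_prod_type _)).trans ?_
  rw [smul_sum, smul_sum]
  refine sum_congr rfl fun a _ => ?_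
  simp only [smul_sum]
  refine sum_congr rfl fun i _ => ?_
  have h1 := GrVect.gamma_updateDual (fun j n => γ (X.x j) n) (T.ζ a) i (O.dualD _ _ (T.ζ a i))
  refine (congrArg ((-1 : ℤˣ) ^ n • ·) ((smul_assoc _ _ _).trans (congrArg (fun y : D.obj v =>
    ((-1 : ℤˣ) ^ ε.val * signBefore (T.c a) i) • T.r a • cobarSign ε.flip
      (update (T.c a) i (T.c a i + 1)) • y)
    ((congrArg (D.act (toOp f) _) h1).trans (D.laws.ev_eq f hf.le _).symm)))).trans ?_
  simp only [smul_comm (T.r a), smul_smul]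
  congr 1
  rw [cobarSign_eq, cobarSign_eq, pairSum_update_add_one, sum_update_add_one, hT]
  simp only [← zpow_natCast]
  have h2 : ∀ (a b c d a' c' d' e' : ℤ) (s : ℤˣ), Even (a + b + c + d - (a' + c' + d' + e')) →
      (-1) ^ a * ((-1) ^ b * s * ((-1) ^ c * (-1) ^ d)) =
        (-1) ^ a' * ((-1) ^ c' * (-1) ^ d' * (s * (-1) ^ e')) :=
    fun a b c d a' c' d' e' s h => by
      calc _ = s * (-1) ^ (a + b + c + d) := by simp only [zpow_add]; ac_rfl
        _ = s * (-1) ^ (a' + c' + d' + e') := by rw [neg_one_zpow_congr h]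
        _ = _ := by simp only [zpow_add]; ac_rfl
  refine h2 _ _ _ _ _ _ _ _ _ ⟨n + ε.val - T.c a i, ?_⟩
  ring

end DGOp

namespace DGOp

variable {O : DGOp k F ε} {D : GradedOp k F ε.flip} {γ : O.DualMap D}

/-- The part of the square of the differential of the Feynman transform that contains two
operations. -/
noncomputable def cobarSq (hO : O.Dualizable) (γ : O.DualMap D) {v : F.C.V}
    {ξ : Dual k (O.obj v)} (T : O.Codecompositions ξ) : D.obj v :=
  ∑ᶠ f : F.DegOne v, (F.autWeight f.1 : k)⁻¹ • ∑ a, (T f).r a • cobarSign ε.flip ((T f).c a) • ∑ i,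
      signBefore ((T f).c a) i • (-1 : ℤˣ) ^ (T f).c a i • D.ev f.2.1 f.2.2.le
        (update (fun j => γ (f.1.x j) _ ((T f).ζ a j)) i
          (cobarSum γ (hO.nonempty ((T f).ζ a i)).some))

theorem cobarTerm_lift_snd (hγ : O.IsDualMap D γ) (τ : O.DualMap D) {X : F.C.Word} {v : F.C.V}
    {f : X ⟶ single v} {hf : F.δ.degree f = 1} {ξ : Dual k (O.obj v)}
    (T : O.Codecomposition f hf ξ) :
    (O.cobarTerm D.cofree.toGradedOp (fun v n => (γ v n).prod (τ v n)) f hf T).2 =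
      (-1 : ℤˣ) ^ ε.flip.val • ∑ a, T.r a • cobarSign ε.flip (T.c a) • ∑ i, signBefore (T.c a) i •
        D.ev f hf.le (update (fun j => γ (X.x j) _ (T.ζ a j)) i
          (τ (X.x i) _ (T.ζ a i))) := by
  have hd : F.δ.deg (toOp f) = 1 := (F.δ.deg_toOp f).trans hf
  have h1 : ∀ a, (D.cofree.ev f hf.le fun i => (γ (X.x i) _ (T.ζ a i), τ (X.x i) _ (T.ζ a i))).2 =
      (-1 : ℤˣ) ^ ε.flip.val • ∑ i, signBefore (T.c a) i • D.ev f hf.le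
        (update (fun j => γ (X.x j) _ (T.ζ a j)) i (τ (X.x i) _ (T.ζ a i))) := fun a => by
    refine (congrArg Prod.snd (D.cofree.laws.ev_eq f hf.le _)).trans
      ((D.coneAct_snd ε.flip (toOp f) hd.le (T.c a) _ fun i => hγ.mem _ _ _).trans ?_)
    have h3 : ε.flip.val * F.δ.deg (toOp f) = ε.flip.val := by rw [hd, mul_one]
    rw [h3]
    exact congrArg _ (sum_congr rfl fun i _ => congrArg _ (D.laws.ev_eq f hf.le _).symm)
  refine (map_sum (LinearMap.snd k (D.obj v) (D.obj v)) _ _).trans ?_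
  rw [smul_sum]
  refine sum_congr rfl fun a _ => ?_
  refine (congrArg (fun y : D.obj v => T.r a • cobarSign ε.flip (T.c a) • y) (h1 a)).trans ?_
  rw [smul_comm (cobarSign ε.flip (T.c a)), smul_comm (T.r a)]

theorem cobarTerm_transformD_snd (hO : O.Dualizable) (hγ : O.IsDualMap D γ) {X : F.C.Word}
    {v : F.C.V} {f : X ⟶ single v} {hf : F.δ.degree f = 1} {n : ℤ} {ξ : (O.obj v).dual n}
    (T : O.Codecomposition f hf (ξ : Dual k (O.obj v))) (hT : ∀ a, ∑ i, T.c a i = n + ε.val)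
    (T' : O.Codecomposition f hf (O.dualD v n ξ : Dual k (O.obj v))) :
    (O.cobarTerm D.cofree.toGradedOp (fun v n => (γ v n).prod (transformD hO γ v n)) f hf T).2 =
      -((-1 : ℤˣ) ^ n • O.cobarTerm D γ f hf T' + (-1 : ℤˣ) ^ ε.flip.val • ∑ a, T.r a •
        cobarSign ε.flip (T.c a) • ∑ i, signBefore (T.c a) i • (-1 : ℤˣ) ^ T.c a i •
          D.ev f hf.le (update (fun j => γ (X.x j) _ (T.ζ a j)) i
            (cobarSum γ (hO.nonempty (T.ζ a i)).some))) := by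
  refine (cobarTerm_lift_snd hγ _ T).trans (Eq.trans ?_
    (congrArg (fun y : D.obj v => -(y + _)) (cobarTerm_dualD T hT T')).symm)
  simp only [← smul_add, ← smul_neg, ← sum_add_distrib, ← sum_neg_distrib]
  refine congrArg _ (sum_congr rfl fun a _ => congrArg _ (congrArg _
    (sum_congr rfl fun i _ => congrArg _ ?_)))
  rw [smul_neg]
  have hev := fun p => D.laws.ev_eq f hf.le p
  refine (hev _).trans (Eq.trans ?_ (congrArg₂ (fun y z => -((-1 : ℤˣ) ^ T.c a i • (y + z)))
    (hev _) (hev _)).symm)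
  refine (congrArg (fun y => D.act (toOp f) _ (update _ i y))
    (transformD_apply hO γ (T.ζ a i) (hO.nonempty (T.ζ a i)).some)).trans ?_
  refine (MultilinearMap.map_update_neg (D.act (toOp f) _) _ i _).trans (congrArg Neg.neg ?_)
  refine (map_intUnit_smul ((D.act (toOp f) _).toLinearMap _ i) _ _).trans
    (congrArg _ ?_)
  exact MultilinearMap.map_update_add (D.act (toOp f) _) _ i _ _

theorem isTwisting_lift (hO : O.Dualizable) (hγ : O.IsDualMap D γ)
    (hsq : ∀ (v : F.C.V) (n : ℤ) (ξ : (O.obj v).dual n)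
      (T : O.Codecompositions (ξ : Dual k (O.obj v))),
        (∀ f a, ∑ i, (T f).c a i = n + ε.val) → cobarSq hO γ T = 0) :
    O.IsTwisting D.cofree fun v n => (γ v n).prod (transformD hO γ v n) := by
  refine ⟨isDualMap_lift hO hγ, fun v n ξ T => ?_⟩
  have h1 : (cobarSum (D := D.cofree.toGradedOp) (fun v n => (γ v n).prod (transformD hO γ v n)) T).1 =
      cobarSum γ T := map_cobarSum (D := D.cofree.toGradedOp) _ D.cofreeFst T
  refine Prod.ext ((transformD_apply hO γ ξ T).trans ?_) ?_
  · exact congrArg (fun y => -((-1 : ℤˣ) ^ n • (γ v (n + 1) (O.dualD v n ξ) + y))) h1.symm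
  obtain ⟨T₀, hT₀⟩ := hO.exists_homogeneous ξ
  have := F.finite_degree_one v
  have := ofFinite (F.DegOne v)
  let T' := (hO.nonempty (O.dualD v n ξ)).some
  have hdd : O.dualD v (n + 1) (O.dualD v n ξ) = 0 := Subtype.ext (LinearMap.ext fun p =>
    (congrArg ξ.1 (O.d_d v p)).trans (map_zero ξ.1))
  have e1 : transformD hO γ v (n + 1) (O.dualD v n ξ) = (-1 : ℤˣ) ^ n • cobarSum γ T' := by
    refine (transformD_apply hO γ _ T').trans ?_
    rw [hdd, map_zero, zero_add, zpow_add, zpow_one, mul_neg_one, Units.neg_smul, neg_neg]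
  have e2 : (cobarSum (D := D.cofree.toGradedOp) (fun v n => (γ v n).prod (transformD hO γ v n)) T₀).2 =
      -((-1 : ℤˣ) ^ n • cobarSum γ T' + (-1 : ℤˣ) ^ ε.flip.val • cobarSq hO γ T₀) := by
    unfold cobarSum cobarSq
    rw [finsum_eq_sum_of_fintype, finsum_eq_sum_of_fintype, finsum_eq_sum_of_fintype]
    refine (map_sum (LinearMap.snd k (D.obj v) (D.obj v)) _ _).trans ?_
    rw [smul_sum, smul_sum, ← sum_add_distrib, ← sum_neg_distrib]
    refine sum_congr rfl fun f _ => ?_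
    refine (congrArg ((F.autWeight f.1 : k)⁻¹ • ·) (cobarTerm_transformD_snd hO hγ (T₀ f) (hT₀ f)
      (T' f))).trans ?_
    rw [smul_neg, smul_add, smul_comm _ ((-1 : ℤˣ) ^ n), smul_comm _ ((-1 : ℤˣ) ^ ε.flip.val)]
  have e3 : transformD hO γ v (n + 1) (O.dualD v n ξ) + (cobarSum (D := D.cofree.toGradedOp)
      (fun v n => (γ v n).prod (transformD hO γ v n)) T).2 = 0 := by
    refine (congrArg₂ (· + ·) e1 ((congrArg Prod.snd (cobarSum_congr rfl T T₀)).trans e2)).trans ?_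
    rw [hsq v n ξ T₀ hT₀, smul_zero, add_zero]
    exact add_neg_cancel _
  refine Eq.symm ((congrArg (fun y : D.obj v => -((-1 : ℤˣ) ^ n • y)) e3).trans ?_)
  rw [smul_zero, neg_zero]
  rfl

end DGOp

/-! ### Sums over operations -/

namespace CubicalFeynmanCategory

/-- The operations of degree `d` to `v` with inputs named by `I`. -/
abbrev Ops (F : CubicalFeynmanCategory.{u}) (I : Type) [Finite I] (v : F.C.V) (d : Fin 2) : Type u :=
  {u : Σ x : I → F.C.V, F.C.Hom x v // F.δ.deg u.2 = d}

namespace Ops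

variable {I J : Type} [Finite I] [Finite J] {v : F.C.V} {d : Fin 2}

theorem deg_le (u : F.Ops I v d) : F.δ.deg u.1.2 ≤ 1 := u.2.trans_le d.is_le

/-- Renaming the inputs. -/
def map (e : I ≃ J) (u : F.Ops J v d) : F.Ops I v d :=
  ⟨⟨fun i => u.1.1 (e i), F.C.map e u.1.2⟩, (F.δ.deg_map e u.1.2).trans u.2⟩

theorem map_bijective (e : I ≃ J) : Bijective (map (v := v) (d := d) e) := by
  refine ⟨?_, fun u => ?_⟩
  · rintro ⟨⟨x, g⟩, h⟩ ⟨⟨x', g'⟩, h'⟩ hu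
    have h1 : x = x' := funext fun j => by
      have := congrFun (congrArg (fun u : F.Ops I v d => u.1.1) hu) (e.symm j)
      simpa [map] using this
    subst h1
    have h2 : F.C.map e g = F.C.map e g' := eq_of_heq (Sigma.mk.inj (congrArg Subtype.val hu)).2
    obtain rfl := map_injective e h2
    rfl
  · obtain ⟨⟨x, g⟩, h⟩ := u
    obtain ⟨y, rfl⟩ : ∃ y : J → F.C.V, x = fun i => y (e i) :=
      ⟨fun j => x (e.symm j), funext fun i => by simp⟩
    obtain ⟨g', rfl⟩ := (ColoredOperad.map_bijective e (x := y)).2 g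
    exact ⟨⟨⟨y, g'⟩, (F.δ.deg_map e g').symm.trans h⟩, rfl⟩

theorem card_eq_one (u : F.Ops I v 0) : Nat.card I = 1 := by
  let w : F.Ops (Fin (Nat.card I)) v 0 := u.map (Finite.equivFin I).symm
  let m : (⟨_, w.1.1⟩ : F.C.Word) ⟶ single v := ofOp (X := ⟨_, w.1.1⟩) w.1.2
  have : IsIso m := (F.degree_eq_zero_iff m).1 (by
    rw [← F.δ.deg_toOp, toOp_ofOp]
    exact w.2)
  have h := Nat.card_eq_of_bijective _ (iso_bijective (asIso m))
  simpa [single] using h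

/-- The degree zero operation with one input given by an isomorphism. -/
def ofStar [Unique I] (z : F.Star v) : F.Ops I v 0 :=
  ⟨⟨fun _ => z.1, F.C.map (Equiv.ofUnique I Unit) (uop z.2.symm.hom)⟩,
    (F.δ.deg_map _ _).trans (F.δ.deg_uop z.2.symm)⟩

theorem ofStar_bijective [Unique I] : Bijective (ofStar (F := F) (I := I) (v := v)) := by
  refine ⟨?_, fun u => ?_⟩
  · rintro ⟨w, σ⟩ ⟨w', σ'⟩ h
    have h1 : w = w' := congrFun (congrArg (fun u : F.Ops I v 0 => u.1.1) h) default
    subst h1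
    have h2 := uop_injective (map_injective (Equiv.ofUnique I Unit)
      (eq_of_heq (Sigma.mk.inj (congrArg Subtype.val h)).2))
    exact congrArg _ (Iso.symm_bijective.1 (Iso.ext h2))
  · obtain ⟨⟨⟨x, g⟩, h⟩, rfl⟩ := (map_bijective (Equiv.ofUnique I Unit)).2 u
    obtain ⟨w, rfl⟩ : ∃ w, x = fun _ => w := ⟨x (), rfl⟩
    obtain ⟨σ, rfl⟩ := exists_iso_of_deg g h
    exact ⟨⟨w, σ.symm⟩, rfl⟩

instance : Finite (F.Ops I v d) := by
  have := F.finite_degree_one v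
  fin_cases d
  · by_cases h : Nat.card I = 1
    · obtain ⟨h1, ⟨i⟩⟩ := Nat.card_eq_one_iff_unique.1 h
      let := uniqueOfSubsingleton i
      exact Finite.of_surjective _ (ofStar_bijective (I := I) (v := v)).2
    · exact @Finite.of_subsingleton _ ⟨fun u => absurd u.card_eq_one h⟩
  · let e := (Finite.equivFin I).symm
    refine Finite.of_injective (β := F.DegOne v)
      (fun u => ⟨⟨_, (u.map e).1.1⟩, ofOp (X := ⟨_, (u.map e).1.1⟩) (u.map e).1.2,
        by rw [← F.δ.deg_toOp, toOp_ofOp]; exact (u.map e).2⟩) fun u u' h => ?_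
    refine (map_bijective e).1 ?_
    have key : ∀ w w' : F.Ops (Fin (Nat.card I)) v 1, (⟨⟨_, w.1.1⟩, ofOp (X := ⟨_, w.1.1⟩) w.1.2⟩ :
        Σ X : F.C.Word, X ⟶ single v) = ⟨⟨_, w'.1.1⟩, ofOp (X := ⟨_, w'.1.1⟩) w'.1.2⟩ → w = w' := by
      rintro ⟨⟨x, g⟩, hg⟩ ⟨⟨x', g'⟩, hg'⟩ h
      obtain ⟨h1, h2⟩ := Sigma.mk.inj h
      obtain rfl : x = x' := eq_of_heq (Word.mk.inj h1).2
      have h3 := congrArg (toOp (X := ⟨_, x⟩)) (eq_of_heq h2)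
      refine Subtype.ext (congrArg (Sigma.mk x) ?_)
      exact (toOp_ofOp (X := ⟨_, x⟩) g).symm.trans (h3.trans (toOp_ofOp (X := ⟨_, x⟩) g'))
    exact key _ _ (congrArg (fun s : F.DegOne v =>
      (⟨s.1, s.2.1⟩ : Σ X : F.C.Word, X ⟶ single v)) h)

noncomputable instance : Fintype (F.Ops I v d) := ofFinite _

end Ops

/-- The inverse of the number of automorphisms. -/
noncomputable def invAut (k : Type u) [Field k] (v : F.C.V) : k := (Nat.card (Aut (single v)) : k)⁻¹

theorem Ops.sum_zero [CharZero k] (I : Type) [Fintype I] (v : F.C.V) :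
    ∑ u : F.Ops I v 0, ∏ i, invAut k (u.1.1 i) = if Fintype.card I = 1 then 1 else 0 := by
  split_ifs with h
  · obtain ⟨h1, ⟨i⟩⟩ := (Nat.card_eq_one_iff_unique (α := I)).1 (Nat.card_eq_fintype_card.trans h)
    let := uniqueOfSubsingleton i
    refine Eq.trans ?_ (sum_star (k := k) v)
    refine ((Ops.ofStar_bijective (I := I)).sum_comp _).symm.trans
      (sum_congr rfl fun z _ => ?_)
    exact Fintype.prod_unique _
  · have : IsEmpty (F.Ops I v 0) := ⟨fun u => h (Nat.card_eq_fintype_card.symm.trans u.card_eq_one)⟩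
    exact Finset.sum_of_isEmpty _

/-- Words of length `n` with a morphism to `Y` with components of degrees `d`. -/
abbrev Over (F : CubicalFeynmanCategory.{u}) (n : ℕ) (Y : F.C.Word) (d : Fin Y.n → Fin 2) : Type u :=
  {w : Σ x : Fin n → F.C.V, ((⟨n, x⟩ : F.C.Word) ⟶ Y) // ∀ j, F.δ.deg (WordHom.g w.2 j) = d j}

namespace Over

variable {n : ℕ} {Y : F.C.Word} {d : Fin Y.n → Fin 2}

/-- The map of letters. -/
def π (w : F.Over n Y d) : Fin n → Fin Y.n := WordHom.π w.1.2

/-- The components. -/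
def component (w : F.Over n Y d) (j : Fin Y.n) : F.Ops {i // w.π i = j} (Y.x j) (d j) :=
  ⟨⟨fun i => w.1.1 i, WordHom.g w.1.2 j⟩, w.2 j⟩

theorem bijective : Bijective fun w : F.Over n Y d =>
    (⟨w.π, w.component⟩ : Σ π : Fin n → Fin Y.n, ∀ j, F.Ops {i // π i = j} (Y.x j) (d j)) := by
  refine ⟨?_, ?_⟩
  · rintro ⟨⟨x, ⟨π, g⟩⟩, h⟩ ⟨⟨x', ⟨π', g'⟩⟩, h'⟩ hw
    obtain ⟨h1, h2⟩ := Sigma.mk.inj hw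
    obtain rfl : π = π' := h1
    have h3 := eq_of_heq h2
    have h4 : x = x' := funext fun i =>
      congrFun (congrArg (fun u : F.Ops {i' // π i' = π i} (Y.x (π i)) (d (π i)) => u.1.1)
        (congrFun h3 (π i))) ⟨i, rfl⟩
    subst h4
    have h5 : g = g' := funext fun j =>
      eq_of_heq (Sigma.mk.inj (congrArg Subtype.val (congrFun h3 j))).2
    subst h5
    rfl
  · rintro ⟨π, u⟩
    have hx : ∀ j, (fun i : {i // π i = j} => (u (π i)).1.1 ⟨i, rfl⟩) = (u j).1.1 := fun j =>
      funext fun ⟨i, h⟩ => by subst h; rfl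
    have hu : ∀ j, ∃ g : F.C.Hom (fun i : {i // π i = j} => (u (π i)).1.1 ⟨i, rfl⟩) (Y.x j),
        (⟨_, g⟩ : Σ x : {i // π i = j} → F.C.V, F.C.Hom x (Y.x j)) = (u j).1 := fun j => by
      rw [hx]
      exact ⟨_, rfl⟩
    choose g hg using hu
    refine ⟨⟨⟨fun i => (u (π i)).1.1 ⟨i, rfl⟩, ⟨π, g⟩⟩, fun j => ?_⟩, ?_⟩
    · have := (u j).2
      rw [← hg j] at this
      exact this
    · exact congrArg (Sigma.mk π) (funext fun j => Subtype.ext (hg j))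

noncomputable instance : Fintype (F.Over n Y d) := Fintype.ofInjective _ bijective.1

theorem sum_eq {W : Fin Y.n → Type*} [∀ j, AddCommGroup (W j)] [∀ j, Module k (W j)] {N : Type*}
    [AddCommGroup N] [Module k N] (α : F.C.V → k) (Φ : MultilinearMap k W N)
    (t : ∀ (π : Fin n → Fin Y.n) j, F.Ops {i // π i = j} (Y.x j) (d j) → W j) :
    ∑ w : F.Over n Y d, (∏ i, α (w.1.1 i)) • Φ (fun j => t w.π j (w.component j)) =
      ∑ π : Fin n → Fin Y.n, Φ fun j => ∑ u : F.Ops {i // π i = j} (Y.x j) (d j),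
        (∏ i, α (u.1.1 i)) • t π j u := by
  simp only [MultilinearMap.map_sum, MultilinearMap.map_smul_univ]
  rw [← Fintype.sum_sigma' (f := fun π (u : ∀ j, F.Ops {i // π i = j} (Y.x j) (d j)) =>
    (∏ j, ∏ i, α ((u j).1.1 i)) • Φ fun j => t π j (u j)), ← bijective.sum_comp]
  refine sum_congr rfl fun w _ => congrArg (· • _) ?_
  exact (Fintype.prod_fiberwise w.π fun i => α (w.1.1 i)).symm

end Over

end CubicalFeynmanCategory

theorem card_one_fiber {L J : Type} [Fintype L] [Fintype J] [DecidableEq L] [DecidableEq J] (i : J) :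
    Fintype.card {π : L → J // ∀ j, j ≠ i → Fintype.card {l // π l = j} = 1} =
      (Fintype.card L).descFactorial (Fintype.card J - 1) := by
  have hJ : Fintype.card {j : J // j ≠ i} = Fintype.card J - 1 := by
    rw [Fintype.card_subtype_compl, Fintype.card_subtype_eq]
  rw [← hJ, ← Fintype.card_embedding_eq]
  have h1 : ∀ (π : {π : L → J // ∀ j, j ≠ i → Fintype.card {l // π l = j} = 1}) (j : {j // j ≠ i}),
      ∃ l, ∀ l', π.1 l' = j.1 ↔ l' = l := fun π j => by
    obtain ⟨⟨l, hl⟩, h⟩ := Fintype.card_eq_one_iff.1 (π.2 j.1 j.2)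
    exact ⟨l, fun l' => ⟨fun h' => congrArg Subtype.val (h ⟨l', h'⟩), fun h' => h' ▸ hl⟩⟩
  choose e he using h1
  refine Fintype.card_of_bijective (f := fun π => (⟨e π, fun j j' h => Subtype.ext ?_⟩ :
    {j // j ≠ i} ↪ L)) ⟨fun π π' h => Subtype.ext (funext fun l => ?_), fun f => ?_⟩
  · rw [← (he π j (e π j)).2 rfl, h, (he π j' (e π j')).2 rfl]
  · have h2 : e π = e π' := congrArg DFunLike.coe h
    by_cases hl : π.1 l = i
    · by_cases hl' : π'.1 l = i
      · rw [hl, hl']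
      · have h3 := (he π' ⟨_, hl'⟩ l).1 rfl
        rw [← h2] at h3
        exact (he π ⟨_, hl'⟩ l).2 h3
    · have h3 := (he π ⟨_, hl⟩ l).1 rfl
      rw [h2] at h3
      exact ((he π' ⟨_, hl⟩ l).2 h3).symm
  · classical
    let g : L → J := fun l => if h : ∃ j, f j = l then h.choose.1 else i
    have hg : ∀ (j : {j // j ≠ i}) l, g l = j.1 ↔ l = f j := fun j l => by
      by_cases h : ∃ j, f j = l
      · have h3 : g l = h.choose.1 := dif_pos h
        rw [h3]
        refine ⟨fun h4 => h.choose_spec.symm.trans (congrArg f (Subtype.ext h4)), fun h4 => ?_⟩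
        exact congrArg Subtype.val (f.injective (h.choose_spec.trans h4))
      · have h3 : g l = i := dif_neg h
        rw [h3]
        exact ⟨fun h4 => absurd h4.symm j.2, fun h4 => absurd ⟨j, h4.symm⟩ h⟩
    refine ⟨⟨g, fun j hj => Fintype.card_eq_one_iff.2 ⟨⟨f ⟨j, hj⟩, (hg ⟨j, hj⟩ _).2 rfl⟩,
      fun l => Subtype.ext ((hg ⟨j, hj⟩ _).1 l.2)⟩⟩, ?_⟩
    refine DFunLike.ext _ _ fun j => ?_
    exact ((he _ j _).1 ((hg j _).2 rfl)).symm

theorem card_fiber_eq {L J : Type} [Fintype L] [Fintype J] [DecidableEq J] {i : J} {π : L → J}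
    (h : ∀ j, j ≠ i → Fintype.card {l // π l = j} = 1) :
    Fintype.card {l // π l = i} = Fintype.card L - (Fintype.card J - 1) := by
  have h1 : Fintype.card L = ∑ j, Fintype.card {l // π l = j} := by
    rw [← Fintype.card_sigma, Fintype.card_congr (sigmaFiberEquiv π)]
  rw [← add_sum_erase _ _ (mem_univ i), sum_congr rfl fun j hj =>
    h j (Finset.ne_of_mem_erase hj)] at h1
  simp only [Finset.sum_const, Finset.card_erase_of_mem (mem_univ i), Finset.card_univ,
    smul_eq_mul, mul_one] at h1
  omega

theorem sum_fibers [CharZero k] {J : Type} [Fintype J] [DecidableEq J] {W : J → Type*}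
    [∀ j, AddCommGroup (W j)] [∀ j, Module k (W j)] {N : Type*} [AddCommGroup N] [Module k N]
    (Φ : MultilinearMap k W N) (w : ∀ j, W j) (i : J) (S : ℕ → W i) (B : ℕ) :
    ∑ n ∈ Finset.range (Fintype.card J - 1 + B), (n.factorial : k)⁻¹ • ∑ π : Fin n → J,
      Φ (update (fun j => if Fintype.card {l // π l = j} = 1 then w j else 0) i
        (S (Fintype.card {l // π l = i}))) =
      Φ (update w i (∑ n ∈ Finset.range B, (n.factorial : k)⁻¹ • S n)) := by
  classical
  set K := Fintype.card J - 1 with hK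
  have h1 : ∀ n, ∑ π : Fin n → J,
      Φ (update (fun j => if Fintype.card {l // π l = j} = 1 then w j else 0) i
        (S (Fintype.card {l // π l = i}))) =
      (n.descFactorial K : k) • Φ (update w i (S (n - K))) := fun n => by
    have h2 := card_one_fiber (L := Fin n) i
    rw [Fintype.card_fin] at h2
    rw [hK, ← h2, Fintype.card_subtype, Nat.cast_smul_eq_nsmul, ← Finset.sum_const, sum_filter]
    refine sum_congr rfl fun π _ => ?_
    split_ifs with h
    · rw [card_fiber_eq h, Fintype.card_fin]
      congr 1
      funext j
      by_cases hj : j = i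
      · subst hj; simp
      · rw [update_of_ne hj, update_of_ne hj, if_pos (h j hj)]
    · push Not at h
      obtain ⟨j, hj, h⟩ := h
      refine Φ.map_coord_zero j ?_
      rw [update_of_ne hj, if_neg h]
  rw [sum_congr rfl fun n _ => congrArg _ (h1 n), Finset.sum_range_add,
    sum_eq_zero fun n hn => ?_, zero_add, Φ.map_update_sum]
  · refine sum_congr rfl fun n _ => ?_
    rw [Φ.map_update_smul, smul_smul, Nat.add_sub_cancel_left]
    congr 1
    have h3 := Nat.factorial_mul_descFactorial (Nat.le_add_right K n)
    rw [Nat.add_sub_cancel_left] at h3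
    have h4 : ((K + n).factorial : k) ≠ 0 := Nat.cast_ne_zero.2 (Nat.factorial_ne_zero _)
    have h5 : (n.factorial : k) ≠ 0 := Nat.cast_ne_zero.2 (Nat.factorial_ne_zero _)
    rw [inv_mul_eq_div, div_eq_iff h4, ← h3]
    push_cast
    field_simp
  · rw [Nat.descFactorial_of_lt (Finset.mem_range.1 hn), Nat.cast_zero, zero_smul, smul_zero]

namespace CubicalFeynmanCategory

theorem Over.sum_iso [CharZero k] (Y : F.C.Word) :
    ∑ w : F.Over Y.n Y (fun _ => 0), ∏ i, invAut k (w.1.1 i) = (Y.n.factorial : k) := by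
  have h := Over.sum_eq (F := F) (n := Y.n) (Y := Y) (d := fun _ => 0) (W := fun _ => k) (invAut k)
    (MultilinearMap.mkPiAlgebra k (Fin Y.n) k) fun _ _ _ => 1
  simp only [MultilinearMap.mkPiAlgebra_apply, Finset.prod_const_one, smul_eq_mul, mul_one,
    Ops.sum_zero] at h
  have h1 : ∀ π : Fin Y.n → Fin Y.n, (∏ j, if Fintype.card {i // π i = j} = 1 then (1 : k) else 0) =
      if Bijective π then 1 else 0 := fun π => by
    rw [Finset.prod_ite_zero, Finset.prod_const_one]
    have h2 : (∀ j ∈ Finset.univ, Fintype.card {i // π i = j} = 1) ↔ Bijective π := by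
      rw [Function.bijective_iff_existsUnique]
      refine forall_congr' fun j => ?_
      simp only [mem_univ, true_imp_iff, Fintype.card_eq_one_iff]
      exact ⟨fun ⟨x, hx⟩ => ⟨x.1, x.2, fun y hy => congrArg Subtype.val (hx ⟨y, hy⟩)⟩,
        fun ⟨x, hx, h⟩ => ⟨⟨x, hx⟩, fun y => Subtype.ext (h y.1 y.2)⟩⟩
    split_ifs <;> tauto
  rw [h, sum_congr rfl fun π _ => h1 π, Finset.sum_boole, ← Fintype.card_subtype,
    Fintype.card_congr (Equiv.bijectiveEquiv), Fintype.card_perm, Fintype.card_fin]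

/-- The words isomorphic to `Y`, with an isomorphism. -/
theorem sum_isos [CharZero k] (Y : F.C.Word) : ∃ _ : Finite (Σ Y' : F.C.Word, (Y' ≅ Y)),
    ∑ᶠ s : Σ Y' : F.C.Word, (Y' ≅ Y), (F.autWeight s.1 : k)⁻¹ = 1 := by
  let e : F.Over Y.n Y (fun _ => 0) → Σ Y' : F.C.Word, (Y' ≅ Y) := fun w =>
    ⟨⟨Y.n, w.1.1⟩, @asIso _ _ _ _ w.1.2 ((F.degree_eq_zero_iff _).1
      (sum_eq_zero fun j _ => w.2 j))⟩
  have he : Bijective e := by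
    refine ⟨?_, ?_⟩
    · rintro ⟨⟨x, m⟩, h⟩ ⟨⟨x', m'⟩, h'⟩ hw
      obtain ⟨h1, h2⟩ := Sigma.mk.inj hw
      obtain rfl : x = x' := eq_of_heq (Word.mk.inj h1).2
      have h3 : m = m' := congrArg Iso.hom (eq_of_heq h2)
      subst h3
      rfl
    · rintro ⟨⟨n, x⟩, σ⟩
      obtain rfl : n = Y.n := by simpa using Nat.card_eq_of_bijective _ (iso_bijective σ)
      exact ⟨⟨⟨x, σ.hom⟩, fun j => sum_eq_zero_iff.1 (F.δ.degree_iso σ) j (mem_univ j)⟩,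
        congrArg (Sigma.mk _) (Iso.ext rfl)⟩
  refine ⟨Finite.of_surjective e he.2, ?_⟩
  rw [← finsum_comp_equiv (Equiv.ofBijective e he), finsum_eq_sum_of_fintype]
  refine (sum_congr rfl fun w _ => inv_autWeight _).trans ?_
  refine (mul_sum Finset.univ (fun w : F.Over Y.n Y fun _ => 0 =>
    ∏ i, invAut k (w.1.1 i)) (Y.n.factorial : k)⁻¹).symm.trans ?_
  exact (congrArg _ (Over.sum_iso Y)).trans
    (inv_mul_cancel₀ (Nat.cast_ne_zero.2 (Nat.factorial_ne_zero _)))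

end CubicalFeynmanCategory

namespace CubicalFeynmanCategory

/-- Pairs of composable degree one morphisms from `X` to `v`. -/
abbrev Pairs (F : CubicalFeynmanCategory.{u}) (X : F.C.Word) (v : F.C.V) : Type u :=
  Σ f : F.DegOne v, {m : X ⟶ f.1 // F.δ.degree m = 1}

namespace Pairs

variable {X : F.C.Word} {v : F.C.V}

/-- The chain of length two. -/
def chain (z : F.Pairs X v) : F.δ.Chain X (single v) 2 :=
  .cons z.2.1 z.2.2 (.cons z.1.2.1 z.1.2.2 (.nil (Iso.refl _)))

theorem chain_rel_iff (z z' : F.Pairs X v) : z.chain.Rel z'.chain ↔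
    ∃ θ : z.1.1 ≅ z'.1.1, z.2.1 ≫ θ.hom = z'.2.1 ∧ z.1.2.1 = θ.hom ≫ z'.1.2.1 := by
  constructor
  · rintro ⟨θ, h1, θ', h2, h3⟩
    refine ⟨θ, h1, ?_⟩
    have h4 : Iso.refl (single v) = θ' ≪≫ Iso.refl _ := h3
    rw [Iso.trans_refl] at h4
    rw [← h2, ← h4]
    exact (Category.comp_id _).symm
  · rintro ⟨θ, h1, h2⟩
    refine ⟨θ, h1, Iso.refl _, ?_, ?_⟩
    · exact (Category.comp_id _).trans h2
    · exact (Iso.trans_refl _).symm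

theorem exists_chain (q : F.δ.ChainClass X (single v) 2) : ∃ z : F.Pairs X v, ⟦z.chain⟧ = q := by
  obtain ⟨c, rfl⟩ := Quotient.exists_rep q
  obtain _ | ⟨m, hm, c⟩ := c
  obtain _ | ⟨f, hf, c⟩ := c
  obtain e | _ := c
  refine ⟨⟨⟨_, f ≫ e.hom, by rw [F.δ.degree_comp, hf, F.δ.degree_iso]⟩, m, hm⟩, Quotient.sound ?_⟩
  refine Setoid.symm ⟨Iso.refl _, Category.comp_id _, e, (Category.id_comp _).symm, ?_⟩
  exact (Iso.trans_refl _).symm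

/-- The pairs that differ by a transposition. -/
def IsSwap (z z' : F.Pairs X v) : Prop := F.perm (Equiv.swap 0 1) ⟦z.chain⟧ = ⟦z'.chain⟧

theorem IsSwap.symm {z z' : F.Pairs X v} (h : z.IsSwap z') : z'.IsSwap z := by
  unfold IsSwap at *
  rw [← h, ← Equiv.Perm.mul_apply, ← map_mul, Equiv.swap_mul_self, map_one, Equiv.Perm.one_apply]

instance : Finite (F.Pairs X v) := by
  have := F.finite_degree_one v
  have : ∀ f : F.DegOne v,
      Finite {m : X ⟶ f.1 // F.δ.degree m = 1} := fun f => by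
    refine Finite.of_injective (β := Σ d : Fin f.1.n → Fin 2, F.Over X.n f.1 d)
      (fun m => ⟨fun j => ⟨F.δ.deg (WordHom.g m.1 j), Nat.lt_succ_of_le (F.δ.deg_le_one m.2.le j)⟩,
        ⟨⟨X.x, m.1⟩, fun j => rfl⟩⟩) fun m m' h => ?_
    have h1 := congrArg (fun s : Σ d : Fin f.1.n → Fin 2, F.Over X.n f.1 d => s.2.1) h
    exact Subtype.ext (eq_of_heq (Sigma.mk.inj h1).2)
  infer_instance

noncomputable instance : Fintype (F.Pairs X v) := ofFinite _

open Classical in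
theorem sum_isSwap [CharZero k] (hF : F.Rigid) (z : F.Pairs X v) :
    ∑ z' : F.Pairs X v, (if z.IsSwap z' then (F.autWeight z'.1.1 : k)⁻¹ else 0) = 1 := by
  obtain ⟨z₀, h₀⟩ := exists_chain (F.perm (Equiv.swap 0 1) ⟦z.chain⟧)
  obtain ⟨hfin, hsum⟩ := F.sum_isos (k := k) z₀.1.1
  have := ofFinite (Σ Y' : F.C.Word, (Y' ≅ z₀.1.1))
  let e : (Σ Y' : F.C.Word, (Y' ≅ z₀.1.1)) → F.Pairs X v := fun s =>
    ⟨⟨s.1, s.2.hom ≫ z₀.1.2.1, by rw [F.δ.degree_comp, F.δ.degree_iso, z₀.1.2.2]⟩,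
      z₀.2.1 ≫ s.2.inv, by rw [F.δ.degree_comp, z₀.2.2, show F.δ.degree s.2.inv = 0 from
        F.δ.degree_iso s.2.symm]⟩
  have he : ∀ z', z.IsSwap z' ↔ ∃ s, e s = z' := fun z' => by
    unfold IsSwap
    rw [← h₀, Quotient.eq]
    refine (chain_rel_iff z₀ z').trans ⟨?_, ?_⟩
    · have key : ∀ (Y' : F.C.Word) (f' : Y' ⟶ single v) (hf' : F.δ.degree f' = 1) (m' : X ⟶ Y')
          (hm' : F.δ.degree m' = 1) (θ : z₀.1.1 ≅ Y'), z₀.2.1 ≫ θ.hom = m' →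
          f' = θ.inv ≫ z₀.1.2.1 → ∃ s, e s = ⟨⟨Y', f', hf'⟩, m', hm'⟩ := by
        rintro Y' _ _ _ _ θ rfl rfl
        exact ⟨⟨Y', θ.symm⟩, rfl⟩
      rintro ⟨θ, h1, h2⟩
      exact key _ _ z'.1.2.2 _ z'.2.2 θ h1 (θ.inv_comp_eq.2 h2).symm
    · rintro ⟨s, rfl⟩
      exact ⟨s.2.symm, rfl, (s.2.inv_hom_id_assoc _).symm⟩
  have hinj : Function.Injective e := by
    rintro ⟨Y, σ⟩ ⟨Y', σ'⟩ h
    obtain ⟨h1, h2⟩ := Sigma.mk.inj h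
    obtain ⟨h3, h4⟩ := Sigma.mk.inj h1
    obtain rfl : Y = Y' := h3
    have h5 : σ.hom ≫ z₀.1.2.1 = σ'.hom ≫ z₀.1.2.1 := congrArg Subtype.val (eq_of_heq h4)
    have h6 : z₀.2.1 ≫ σ.inv = z₀.2.1 ≫ σ'.inv := by
      have key : ∀ (f f' : {f : Y ⟶ single v // F.δ.degree f = 1})
          (m : {m : X ⟶ Y // F.δ.degree m = 1}) (m' : {m : X ⟶ Y // F.δ.degree m = 1}),
          (⟨⟨Y, f⟩, m⟩ : F.Pairs X v) = ⟨⟨Y, f'⟩, m'⟩ → m.1 = m'.1 := by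
        intro f f' m m' h
        obtain ⟨h1, h2⟩ := Sigma.mk.inj h
        obtain rfl := eq_of_heq (Sigma.mk.inj h1).2
        exact congrArg Subtype.val (eq_of_heq h2)
      exact key _ _ _ _ h
    have h7 := hF z₀.2.1 z₀.1.2.1 z₀.2.2 z₀.1.2.2 (σ.symm ≪≫ σ')
      (by simpa using congrArg (· ≫ σ'.hom) h6) (by simp [← h5])
    have h8 : σ' = σ := by
      have := congrArg (fun τ : Aut z₀.1.1 => σ.hom ≫ τ.hom) h7
      refine Iso.ext ?_
      exact (σ.hom_inv_id_assoc _).symm.trans (this.trans (Category.comp_id _))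
    rw [h8]
  rw [← hsum, finsum_eq_sum_of_fintype]
  refine (Fintype.sum_of_injective e hinj (fun s => (F.autWeight s.1 : k)⁻¹)
    (fun z' => if z.IsSwap z' then (F.autWeight z'.1.1 : k)⁻¹ else 0) (fun z' hz' => if_neg fun h => hz' ((he z').1 h))
    fun s => (if_pos ((he _).2 ⟨s, rfl⟩)).symm).symm

theorem sum_eq_zero [CharZero k] (hF : F.Rigid) {N : Type*} [AddCommGroup N] [Module k N]
    (E : F.Pairs X v → N) (hE : ∀ z z', z.IsSwap z' → E z' = -E z) :
    ∑ z : F.Pairs X v, (F.autWeight z.1.1 : k)⁻¹ • E z = 0 := by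
  classical
  have h1 : ∀ z, (F.autWeight z.1.1 : k)⁻¹ • E z = ∑ z', if z.IsSwap z' then
      ((F.autWeight z.1.1 : k)⁻¹ * (F.autWeight z'.1.1 : k)⁻¹) • E z else 0 := fun z => by
    conv_lhs => rw [← mul_one (F.autWeight z.1.1 : k)⁻¹, ← sum_isSwap hF z, mul_sum, sum_smul]
    exact sum_congr rfl fun z' _ => by split_ifs <;> simp
  have h2 : ∑ z : F.Pairs X v, (F.autWeight z.1.1 : k)⁻¹ • E z =
      -∑ z : F.Pairs X v, (F.autWeight z.1.1 : k)⁻¹ • E z := by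
    conv_lhs => rw [sum_congr rfl fun z _ => h1 z, sum_comm]
    rw [sum_congr rfl fun z _ => h1 z, ← sum_neg_distrib]
    refine sum_congr rfl fun z _ => ?_
    rw [← sum_neg_distrib]
    refine sum_congr rfl fun z' _ => ?_
    by_cases h : z.IsSwap z'
    · rw [if_pos h, if_pos h.symm, hE z z' h, smul_neg, mul_comm]
    · rw [if_neg h, if_neg fun h' => h h'.symm, neg_zero]
  have h3 : (2 : k) • ∑ z : F.Pairs X v, (F.autWeight z.1.1 : k)⁻¹ • E z = 0 := by
    rw [two_smul]
    nth_rw 1 [h2]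
    exact neg_add_cancel _
  exact (smul_eq_zero.1 h3).resolve_left two_ne_zero

end Pairs

end CubicalFeynmanCategory

namespace Decomp

variable {I J : Type} {V : J → GrVect k}

/-- The functionals of a decomposition, indexed along a bijection. -/
def reindexζ (e : I ≃ J) {c : I → ℤ} (ζ : ∀ i, (V (e i)).dual (c i)) : ∀ j, Σ n : ℤ, (V j).dual n :=
  e.piCongrLeft (fun j => Σ n : ℤ, (V j).dual n) fun i => ⟨c i, ζ i⟩

theorem reindexζ_apply (e : I ≃ J) {c : I → ℤ} (ζ : ∀ i, (V (e i)).dual (c i)) (i : I) :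
    reindexζ e ζ (e i) = ⟨c i, ζ i⟩ :=
  Equiv.piCongrLeft_apply_apply (fun j => Σ n : ℤ, (V j).dual n) e _ i

/-- Renaming the inputs of a decomposition. -/
def reindex [Fintype I] [Fintype J] (e : I ≃ J) {Ξ : (∀ i, V (e i)) → k} {Ξ' : (∀ j, V j) → k}
    (T : Decomp (fun i => V (e i)) Ξ) (h : ∀ p, Ξ' p = Ξ fun i => p (e i)) : Decomp V Ξ' where
  A := T.A
  r := T.r
  c a j := (reindexζ e (T.ζ a) j).1
  ζ a j := (reindexζ e (T.ζ a) j).2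
  sum_eq p := by
    rw [h, T.sum_eq]
    refine sum_congr rfl fun a _ => congrArg _ ?_
    rw [← e.prod_comp]
    exact prod_congr rfl fun i _ => congrArg (fun q : Σ n : ℤ, (V (e i)).dual n =>
      (q.2 : Dual k (V (e i))) (p (e i))) (reindexζ_apply e (T.ζ a) i).symm

end Decomp

theorem pairSum_equiv {I J : Type} [Fintype I] [LinearOrder I] [Fintype J] [LinearOrder J]
    (e : I ≃ J) (c : J → ℤ) : pairSum (fun i => c (e i)) = pairSum c := by
  have h1 := two_mul_pairSum fun i => c (e i)
  rw [e.sum_comp c, e.sum_comp fun j => c j ^ 2, ← two_mul_pairSum] at h1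
  linarith

namespace DGOp

open CubicalFeynmanCategory

/-- The sign of the decompositions of the transpose of an operation of degree `d`. -/
def opSign (ε : Parity) (d : Fin 2) {I : Type} [Fintype I] [LinearOrder I] (c : I → ℤ) : ℤˣ :=
  (-1) ^ pairSum c * (-1) ^ ((ε.val * (d : ℕ) : ℤ) * ∑ i, c i)

theorem opSign_one (ε : Parity) {I : Type} [Fintype I] [LinearOrder I] :
    opSign ε 1 (I := I) = cobarSign ε := by
  funext c
  simp [opSign, cobarSign_eq]

theorem opSign_equiv (ε : Parity) (d : Fin 2) {I J : Type} [Fintype I] [LinearOrder I] [Fintype J]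
    [LinearOrder J] (e : I ≃ J) (c : J → ℤ) : opSign ε d (fun i => c (e i)) = opSign ε d c := by
  unfold opSign
  rw [pairSum_equiv e, e.sum_comp]

variable {O : DGOp k F ε} {I : Type} [Fintype I] [LinearOrder I] {v : F.C.V} {d : Fin 2}

/-- The decomposition of the transpose of an isomorphism. -/
noncomputable def starDecomp [Unique I] (z : F.Star v) {n : ℤ} (ξ : (O.obj v).dual n) :
    Decomp (fun i => O.obj ((Ops.ofStar (I := I) z).1.1 i)) fun p =>
      (ξ : Dual k (O.obj v)) (O.act (Ops.ofStar z).1.2 (Ops.ofStar z).deg_le p) where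
  A := Unit
  r _ := 1
  c _ _ := n
  ζ _ _ := O.dualIso z.2.symm n ξ
  sum_eq p := by
    rw [Fintype.sum_unique, one_mul, Fintype.prod_unique]
    refine congrArg (ξ : Dual k (O.obj v)) (Eq.trans ?_ (O.laws.evIso_eq z.2.symm _).symm)
    obtain ⟨q, rfl⟩ : ∃ q : O.obj z.1, p = fun _ => q :=
      ⟨p default, funext fun i => by rw [Subsingleton.elim i default]⟩
    exact O.laws.act_map' (Equiv.ofUnique I Unit) (by simp [Subsingleton.elim _ (default : I)]) _ _ _
      fun _ => q

theorem Dualizable.exists_decomp (hO : O.Dualizable) (u : F.Ops I v d) {n : ℤ}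
    (ξ : (O.obj v).dual n) : ∃ T : Decomp (fun i => O.obj (u.1.1 i)) (fun p =>
      (ξ : Dual k (O.obj v)) (O.act u.1.2 u.deg_le p)),
        ∀ a, ∑ i, T.c a i = n + ε.val * (d : ℕ) := by
  obtain rfl | rfl : d = 0 ∨ d = 1 := by fin_cases d <;> simp
  · obtain ⟨h1, ⟨i⟩⟩ := Nat.card_eq_one_iff_unique.1 u.card_eq_one
    let := uniqueOfSubsingleton i
    obtain ⟨z, rfl⟩ := Ops.ofStar_bijective.2 u
    refine ⟨starDecomp z ξ, fun a => ?_⟩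
    rw [Fintype.sum_unique]
    simp [starDecomp]
  · let e : Fin (Fintype.card I) ≃o I := Fintype.orderIsoFinOfCardEq I rfl
    let w := u.map e.toEquiv
    obtain ⟨T, hT⟩ := hO.exists_homogeneous ξ
    let f : (⟨_, w.1.1⟩ : F.C.Word) ⟶ single v := ofOp (X := ⟨_, w.1.1⟩) w.1.2
    have hto : toOp f = w.1.2 := toOp_ofOp (X := ⟨_, w.1.1⟩) w.1.2
    have hf : F.δ.degree f = 1 := by
      rw [← F.δ.deg_toOp, hto]
      exact w.2
    let T' := T ⟨_, f, hf⟩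
    refine ⟨Decomp.reindex e.toEquiv (V := fun i => O.obj (u.1.1 i)) T'.toDecomp fun p => ?_,
      fun a => ?_⟩
    · refine congrArg (ξ : Dual k (O.obj v)) (Eq.symm ?_)
      refine (O.laws.ev_eq f hf.le _).trans ((PreGradedOp.act_congr hto _ w.deg_le _).trans ?_)
      exact O.act_map e u.1.2 u.deg_le w.deg_le p
    · refine Eq.trans ?_ ((hT ⟨_, f, hf⟩ a).trans (by simp))
      refine (e.toEquiv.sum_comp fun j => (Decomp.reindexζ e.toEquiv (V := fun i => O.obj (u.1.1 i))
        (T'.ζ a) j).1).symm.trans (sum_congr rfl fun i _ => ?_)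
      exact congrArg Sigma.fst (Decomp.reindexζ_apply e.toEquiv (V := fun i => O.obj (u.1.1 i)) (T'.ζ a) i)

variable {D : GradedOp k F ε.flip}

/-- The operation applied to the transpose of the operation. -/
noncomputable def opTerm (hO : O.Dualizable) (γ : O.DualMap D) (u : F.Ops I v d) {n : ℤ}
    (ξ : (O.obj v).dual n) : D.obj v :=
  (hO.exists_decomp u ξ).choose.eval (fun i n => γ (u.1.1 i) n) (opSign ε.flip d)
    (D.act u.1.2 u.deg_le)

variable (hO : O.Dualizable) (γ : O.DualMap D)

theorem opTerm_eq (u : F.Ops I v d) {n : ℤ} (ξ : (O.obj v).dual n)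
    (T : Decomp (fun i => O.obj (u.1.1 i)) fun p =>
      (ξ : Dual k (O.obj v)) (O.act u.1.2 u.deg_le p)) :
    opTerm hO γ u ξ = T.eval (fun i n => γ (u.1.1 i) n) (opSign ε.flip d) (D.act u.1.2 u.deg_le) :=
  Decomp.eval_eq _ _ (fun _ => rfl) _ _ _

theorem opTerm_zero {γ : O.DualMap D} (hγ : O.IsDualMap D γ) (u : F.Ops I v 0) {n : ℤ}
    (ξ : (O.obj v).dual n) : opTerm hO γ u ξ = γ v n ξ := by
  obtain ⟨h1, ⟨i⟩⟩ := Nat.card_eq_one_iff_unique.1 u.card_eq_one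
  let := uniqueOfSubsingleton i
  obtain ⟨z, rfl⟩ := Ops.ofStar_bijective.2 u
  refine (opTerm_eq hO γ _ ξ (starDecomp z ξ)).trans ((Fintype.sum_unique (ι := Unit) _).trans ?_)
  have hs : ∀ c : I → ℤ, opSign ε.flip 0 c = 1 := fun c => by
    have := two_mul_pairSum c
    rw [Fintype.sum_unique, Fintype.sum_unique, sub_self] at this
    simp [opSign, show pairSum c = 0 by linarith]
  rw [hs, one_smul]
  refine (one_smul _ _).trans (Eq.trans ?_ (hγ.evIso z.2.symm n ξ))
  refine Eq.trans ?_ (D.laws.evIso_eq z.2.symm _).symm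
  exact D.laws.act_map' (Equiv.ofUnique I Unit) (by simp [Subsingleton.elim _ (default : I)]) _ _ _
    fun _ => γ z.1 n (O.dualIso z.2.symm n ξ)

theorem opTerm_map {J : Type} [Fintype J] [LinearOrder J] (e : I ≃o J) (u : F.Ops J v d) {n : ℤ}
    (ξ : (O.obj v).dual n) : opTerm hO γ (u.map e.toEquiv) ξ = opTerm hO γ u ξ := by
  obtain ⟨T, -⟩ := hO.exists_decomp (u.map e.toEquiv) ξ
  have hq := fun a i => Decomp.reindexζ_apply e.toEquiv (V := fun j => O.obj (u.1.1 j)) (T.ζ a) i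
  refine (opTerm_eq hO γ _ ξ T).trans ((opTerm_eq hO γ u ξ (Decomp.reindex e.toEquiv
    (V := fun j => O.obj (u.1.1 j)) T fun p => congrArg (ξ : Dual k (O.obj v))
      (O.act_map e u.1.2 u.deg_le (u.map e.toEquiv).deg_le p).symm)).trans
        (sum_congr rfl fun a _ => congrArg _ ?_)).symm
  refine congrArg₂ (fun (s : ℤˣ) (y : D.obj v) => s • y) ?_ ?_
  · have h2 : T.c a = fun i => (Decomp.reindexζ e.toEquiv (V := fun j => O.obj (u.1.1 j)) (T.ζ a)
        (e.toEquiv i)).1 := funext fun i => congrArg Sigma.fst (hq a i).symm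
    exact (opSign_equiv ε.flip d e.toEquiv _).symm.trans (congrArg _ h2.symm)
  · refine (D.act_map e u.1.2 u.deg_le (u.map e.toEquiv).deg_le _).symm.trans
      (congrArg (D.act _ _) (funext fun i => ?_))
    exact congrArg (fun q : Σ n : ℤ, (O.obj (u.1.1 (e i))).dual n => γ (u.1.1 (e i)) q.1 q.2) (hq a i)

/-- The weighted sum of the terms of all operations of degree `d` with inputs named by `I`. -/
noncomputable def opSum (I : Type) [Fintype I] [LinearOrder I] (d : Fin 2) {n : ℤ}
    (ξ : (O.obj v).dual n) : D.obj v :=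
  ∑ u : F.Ops I v d, (∏ i, invAut k (u.1.1 i)) • opTerm hO γ u ξ

theorem opSum_zero [CharZero k] {γ : O.DualMap D} (hγ : O.IsDualMap D γ) {n : ℤ}
    (ξ : (O.obj v).dual n) :
    opSum hO γ I 0 ξ = if Fintype.card I = 1 then γ v n ξ else 0 := by
  unfold opSum
  rw [sum_congr rfl fun u _ => congrArg _ (opTerm_zero hO hγ u ξ), ← sum_smul, Ops.sum_zero]
  split_ifs <;> simp

theorem opSum_eq {n : ℤ} (ξ : (O.obj v).dual n) :
    opSum hO γ I d ξ = opSum hO γ (Fin (Fintype.card I)) d ξ := by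
  let e : Fin (Fintype.card I) ≃o I := Fintype.orderIsoFinOfCardEq I rfl
  refine Eq.trans ?_ ((Ops.map_bijective e.toEquiv).sum_comp fun u =>
    (∏ i, invAut k (u.1.1 i)) • opTerm hO γ u ξ)
  refine sum_congr rfl fun u _ => congrArg₂ (· • ·) ?_ (opTerm_map hO γ e u ξ).symm
  exact (e.toEquiv.prod_comp fun i => invAut k (u.1.1 i)).symm

theorem cobarSum_eq {n : ℤ} (ξ : (O.obj v).dual n)
    (T : O.Codecompositions (ξ : Dual k (O.obj v))) {B : ℕ}
    (hB : ∀ f : F.DegOne v, f.1.n < B) :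
    cobarSum γ T = ∑ N ∈ Finset.range B, (N.factorial : k)⁻¹ • opSum hO γ (Fin N) 1 ξ := by
  have := F.finite_degree_one v
  have := ofFinite (F.DegOne v)
  unfold opSum
  rw [cobarSum, finsum_eq_sum_of_fintype, Finset.sum_range]
  simp only [smul_sum]
  rw [← Fintype.sum_sigma' (f := fun (N : Fin B) (u : F.Ops (Fin N) v 1) =>
    ((N : ℕ).factorial : k)⁻¹ • (∏ i, invAut k (u.1.1 i)) • opTerm hO γ u ξ)]
  let e : F.DegOne v → Σ N : Fin B, F.Ops (Fin N) v 1 := fun f =>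
    ⟨⟨f.1.n, hB f⟩, ⟨⟨f.1.x, toOp f.2.1⟩, (F.δ.deg_toOp f.2.1).trans f.2.2⟩⟩
  have he : Bijective e := by
    refine ⟨?_, ?_⟩
    · rintro ⟨⟨N, x⟩, f, hf⟩ ⟨⟨N', x'⟩, f', hf'⟩ h
      obtain ⟨h1, h2⟩ := Sigma.mk.inj h
      obtain rfl : N = N' := congrArg Fin.val h1
      obtain ⟨h3, h4⟩ := Sigma.mk.inj (congrArg Subtype.val (eq_of_heq h2))
      obtain rfl : x = x' := h3
      obtain rfl : f = f' := wordHom_single_ext (eq_of_heq h4)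
      rfl
    · rintro ⟨N, ⟨⟨x, g⟩, hg⟩⟩
      have hto : toOp (X := ⟨N, x⟩) (ofOp g) = g := toOp_ofOp (X := ⟨N, x⟩) g
      refine ⟨⟨⟨N, x⟩, ofOp (X := ⟨N, x⟩) g, ?_⟩, ?_⟩
      · rw [← F.δ.deg_toOp, hto]
        exact hg
      · exact congrArg (Sigma.mk N) (Subtype.ext (congrArg (Sigma.mk x) hto))
  rw [← he.sum_comp]
  refine sum_congr rfl fun f _ => ?_
  rw [inv_autWeight, mul_smul]
  refine congrArg _ (congrArg _ ((cobarTerm_eq γ (T f)).trans ?_))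
  rw [← opSign_one]
  exact (opTerm_eq hO γ (e f).2 ξ (Decomp.mk (T f).toDecomp.A (T f).toDecomp.r (T f).toDecomp.c
    (T f).toDecomp.ζ fun p => (congrArg (ξ : Dual k (O.obj v))
      (O.laws.ev_eq f.2.1 f.2.2.le p).symm).trans ((T f).toDecomp.sum_eq p))).symm

end DGOp

namespace Decomp

variable {L J : Type} [Fintype L] [Fintype J] [DecidableEq J] {V : L → GrVect k} {U : J → GrVect k}
  {Ξ : (∀ j, U j) → k}

/-- Decompositions of the functionals of a decomposition, along the fibres of a map. -/
noncomputable def subst (T : Decomp U Ξ) (π : L → J) (g : ∀ j, (∀ l : {l // π l = j}, V l) → U j)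
    (S : ∀ a j, Decomp (fun l : {l // π l = j} => V l) fun p =>
      (T.ζ a j : Dual k (U j)) (g j p)) :
    Decomp V fun p => Ξ fun j => g j fun l => p l where
  A := Σ a, ∀ j, (S a j).A
  r a := T.r a.1 * ∏ j, (S a.1 j).r (a.2 j)
  c a l := (S a.1 (π l)).c (a.2 (π l)) ⟨l, rfl⟩
  ζ a l := (S a.1 (π l)).ζ (a.2 (π l)) ⟨l, rfl⟩
  sum_eq p := by
    rw [T.sum_eq, Fintype.sum_sigma]
    refine sum_congr rfl fun a _ => ?_
    rw [prod_congr rfl fun j _ => (S a j).sum_eq _, Fintype.prod_sum, mul_sum]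
    refine sum_congr rfl fun b _ => ?_
    rw [Finset.prod_mul_distrib, mul_assoc]
    refine congrArg _ (congrArg _ ?_)
    rw [← Fintype.prod_fiberwise π]
    refine prod_congr rfl fun j _ => prod_congr rfl fun l _ => ?_
    obtain ⟨l, rfl⟩ := l
    rfl

theorem subst_c {T : Decomp U Ξ} {π : L → J} {g : ∀ j, (∀ l : {l // π l = j}, V l) → U j}
    {S : ∀ a j, Decomp (fun l : {l // π l = j} => V l) fun p =>
      (T.ζ a j : Dual k (U j)) (g j p)} (a : (T.subst π g S).A) (j : J) :
    (fun l : {l // π l = j} => (T.subst π g S).c a l) = (S a.1 j).c (a.2 j) := by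
  funext ⟨l, h⟩
  subst h
  rfl

theorem subst_eval {W : L → Type*} [∀ l, AddCommGroup (W l)] [∀ l, Module k (W l)] {Z : J → Type*}
    [∀ j, AddCommGroup (Z j)] [∀ j, Module k (Z j)] {N : Type*} [AddCommGroup N] [Module k N]
    [DecidableEq L] (T : Decomp U Ξ) (π : L → J) (g : ∀ j, (∀ l : {l // π l = j}, V l) → U j)
    (S : ∀ a j, Decomp (fun l : {l // π l = j} => V l) fun p =>
      (T.ζ a j : Dual k (U j)) (g j p)) (γ : ∀ l n, (V l).dual n →ₗ[k] W l)
    (s : (L → ℤ) → ℤˣ) (s₀ : T.A → ℤˣ) (σ : ∀ j, ({l // π l = j} → ℤ) → ℤˣ)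
    (hs : ∀ a, s ((T.subst π g S).c a) = s₀ a.1 * ∏ j, σ j fun l => (T.subst π g S).c a l)
    (M : MultilinearMap k Z N) (K : ∀ j, MultilinearMap k (fun l : {l // π l = j} => W l) (Z j)) :
    (T.subst π g S).eval γ s (M.compFibers π K) =
      ∑ a, T.r a • s₀ a • M fun j => (S a j).eval (fun l n => γ l n) (σ j) (K j) := by
  unfold eval
  refine (Fintype.sum_sigma _).trans (sum_congr rfl fun a _ => ?_)
  rw [MultilinearMap.map_sum, smul_sum, smul_sum]
  refine sum_congr rfl fun b _ => ?_
  rw [MultilinearMap.map_smul_univ, MultilinearMap.map_units_smul]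
  refine (congrArg (fun t : ℤˣ => (T.r a * ∏ j, (S a j).r (b j)) • t •
    M.compFibers π K fun l => γ l _ ((T.subst π g S).ζ ⟨a, b⟩ l)) (hs ⟨a, b⟩)).trans ?_
  rw [mul_smul, mul_smul, smul_comm (s₀ a) (∏ j, (S a j).r (b j))]
  refine congrArg _ (congrArg _ (congrArg _ (congrArg₂ (fun (t : ℤˣ) (y : N) => t • y)
    (prod_congr rfl fun j _ => congrArg (σ j) (subst_c ⟨a, b⟩ j))
    (congrArg M (funext fun j => congrArg (K j) (funext fun l => ?_))))))
  obtain ⟨l, rfl⟩ := l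
  rfl

end Decomp

theorem pairSum_fibers {L J : Type} [Fintype L] [LinearOrder L] [Fintype J] [LinearOrder J]
    (π : L → J) (c : L → ℤ) : pairSum c = ∑ j, pairSum (fun l : {l // π l = j} => c l) +
      pairSum fun j => ∑ l : {l // π l = j}, c l := by
  have h1 := two_mul_pairSum c
  have h2 := two_mul_pairSum fun j => ∑ l : {l // π l = j}, c l
  have h3 : 2 * ∑ j, pairSum (fun l : {l // π l = j} => c l) =
      ∑ j, (∑ l : {l // π l = j}, c l) ^ 2 - ∑ l, c l ^ 2 := by
    rw [mul_sum, sum_congr rfl fun j _ => two_mul_pairSum _, Finset.sum_sub_distrib,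
      Fintype.sum_fiberwise π fun l => c l ^ 2]
  rw [Fintype.sum_fiberwise π c] at h2
  linarith

theorem koszulSign_neg (ε : Parity) (π : I → J) (δ : J → ℕ) (n : I → ℤ) :
    koszulSign ε π δ (fun i => -n i) = koszulSign ε π δ n := by
  have h : ∀ z : ℤ, (-1 : ℤˣ) ^ (-z) = (-1) ^ z := fun z => by
    rw [zpow_neg, Int.units_inv_eq_self]
  unfold koszulSign
  simp only [mul_neg, neg_mul, h]

theorem koszulSign_mul_flip (ε : Parity) (π : I → J) {δ : J → ℕ} {i : J} (hδ : ∀ j, δ j = if j = i then 1 else 0)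
    (n : I → ℤ) : koszulSign ε π δ n * koszulSign ε.flip π δ n =
      signBefore (fun j => ∑ l : {l // π l = j}, n l) i := by
  unfold koszulSign signBefore
  rw [mul_mul_mul_comm, Int.units_mul_self, one_mul, ← Finset.prod_mul_distrib,
    ← Fintype.prod_fiberwise π]
  refine prod_congr rfl fun j _ => ?_
  have h : ∀ (ε : Parity) (l : {l // π l = j}), (∏ j', if π l < j' then
      (-1 : ℤˣ) ^ ((ε.val * δ j' : ℤ) * n l) else 1) =
        if j < i then (-1) ^ ((ε.val : ℤ) * n l) else 1 := fun ε l => by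
    rw [l.2, Finset.prod_eq_single i]
    · simp [hδ]
    · intro j' _ hj'
      simp [hδ, hj']
    · exact fun h => absurd (mem_univ i) h
  rw [prod_congr rfl fun l _ => congrArg₂ (· * ·) (h ε l) (h ε.flip l)]
  split_ifs
  · rw [← sgn_intCast, Int.cast_sum, sgn_sum]
    refine prod_congr rfl fun l _ => ?_
    rw [sgn_intCast]
    cases ε <;> simp [Parity.val, Parity.flip]
  · simp

namespace DGOp

open CubicalFeynmanCategory

/-- The sign of the decompositions of the transpose of a composition of operations, of degrees `δ`
for the first ones. -/
def chainSign (ε : Parity) (π : I → J) (δ : J → ℕ) (c : I → ℤ) : ℤˣ :=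
  (-1) ^ pairSum c * (koszulSign ε π δ c * koszulSign ε.flip π δ c)

theorem chainSign_eq (ε : Parity) (π : I → J) (d : J → Fin 2) {i : J} (hd : d = Pi.single i 1) (C : I → ℤ)
    (c : J → ℤ) (h : ∀ j, ∑ l : {l // π l = j}, C l = c j + ε.val * (d j : ℕ)) :
    chainSign ε π (fun j => d j) C =
      (-1) ^ (∑ j, c j) * cobarSign ε.flip c * signBefore c i * (-1) ^ c i *
        ∏ j, opSign ε.flip (d j) fun l : {l // π l = j} => C l := by
  have hδ : ∀ j, ((d j : Fin 2) : ℕ) = if j = i then 1 else 0 := fun j => by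
    subst hd
    by_cases hj : j = i
    · subst hj; simp
    · simp [hj]
  have h1 : (fun j => ∑ l : {l // π l = j}, C l) = update c i (c i + ε.val) :=
    funext fun j => by
      rw [h, hδ]
      by_cases hj : j = i
      · subst hj; simp
      · simp [hj]
  have h2 : signBefore (update c i (c i + ε.val)) i = signBefore c i := by
    unfold signBefore
    refine prod_congr rfl fun j _ => ?_
    split_ifs with hj
    · rw [update_of_ne hj.ne]
    · rfl
  have h3 : ∏ j, opSign ε.flip (d j) (fun l : {l // π l = j} => C l) =
      (-1) ^ (∑ j, pairSum fun l : {l // π l = j} => C l) * (-1) ^ (ε.flip.val * c i) := by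
    unfold opSign
    rw [Finset.prod_mul_distrib, ← sgn_intCast, Int.cast_sum, sgn_sum]
    simp only [sgn_intCast]
    rw [Finset.prod_eq_single i (f := fun j => (-1 : ℤˣ) ^ ((ε.flip.val * ((d j : Fin 2) : ℕ) : ℤ) *
      ∑ l : {l // π l = j}, C l))]
    · rw [h, hδ, if_pos rfl]
      cases ε <;> simp [Parity.val, Parity.flip]
    · intro j _ hj
      simp [hδ, hj]
    · exact fun h => absurd (mem_univ i) h
  unfold chainSign
  rw [koszulSign_mul_flip ε π hδ, h1, h2, h3, cobarSign_eq, pairSum_fibers π, h1]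
  generalize (∑ j, pairSum fun l : {l // π l = j} => C l) = P
  generalize signBefore c i = s
  rw [mul_comm _ s]
  have key : ∀ (a b x y z w : ℤ), Even (a - (b + x + y + z + P + w)) →
      s * (-1) ^ a = (-1) ^ b * ((-1) ^ x * (-1) ^ y) * s * (-1) ^ z * ((-1) ^ P * (-1) ^ w) :=
    fun a b x y z w h => by
      rw [neg_one_zpow_congr h]
      simp only [zpow_add]
      ac_rfl
  refine key _ _ _ _ _ _ ?_
  cases ε
  · simp only [Parity.val, Parity.flip, Nat.cast_zero, add_zero, Function.update_eq_self]
    exact ⟨-(∑ j, c j) - c i, by push_cast; ring⟩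
  · simp only [Parity.val, Parity.flip, Nat.cast_one, pairSum_update_add_one]
    exact ⟨-c i, by push_cast; ring⟩

end DGOp

namespace CubicalFeynmanCategory.Pairs

variable {X : F.C.Word} {v : F.C.V}

/-- The composition of the operations of a pair. -/
noncomputable def map (P : PreGradedOp k F) (z : F.Pairs X v) :
    MultilinearMap k (fun i => P.obj (X.x i)) (P.obj v) :=
  P.wordMap z.2.1 z.2.2.le (P.act (toOp z.1.2.1) ((F.δ.deg_toOp _).trans_le z.1.2.2.le))

/-- The Koszul sign of the first step of a pair. -/
def sign (ε : Parity) (z : F.Pairs X v) (n : Fin X.n → ℤ) : ℤˣ :=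
  koszulSign ε (WordHom.π z.2.1) (fun j => F.δ.deg (WordHom.g z.2.1 j)) n

theorem value_chain (P : GradedOp k F ε) (z : F.Pairs X v) (n : Fin X.n → ℤ)
    (p : ∀ i, P.obj (X.x i)) : (pushChain ε (.nil (Iso.refl (single v)))
      (pushChain ε z.chain ⟨1, n, p⟩ : P.Tensor (single v))).value =
        z.sign ε n • z.map P.toPreGradedOp p := by
  have h := (P.laws.push_id (F.δ.degree_id (single v) |>.trans_le zero_le_one)
    (pushChain ε z.chain ⟨1, n, p⟩)).trans (P.laws.push_id (F.δ.degree_id (single v)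
      |>.trans_le zero_le_one) (push ε z.1.2.1 z.1.2.2.le
        (push ε z.2.1 z.2.2.le ⟨1, n, p⟩)))
  refine h.value_eq.trans ?_
  have : Subsingleton (Fin (single v).n) := inferInstanceAs (Subsingleton (Fin 1))
  refine congrArg₂ (fun (s : ℤˣ) (y : P.obj v) => s • y) ?_ (P.laws.ev_eq z.1.2.1 z.1.2.2.le _)
  refine (congrArg (1 * z.sign ε n * ·) (koszulSign_subsingleton ε _ _ _)).trans ?_
  rw [one_mul, mul_one]

theorem IsSwap.map_eq (P : GradedOp k F ε) {z z' : F.Pairs X v} (h : z.IsSwap z')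
    (n : Fin X.n → ℤ) (p : ∀ i, P.obj (X.x i)) (hp : ∀ i, p i ∈ (P.obj (X.x i)).gr (n i)) :
    z'.map P.toPreGradedOp p = ((-1) ^ ε.val * (z.sign ε n * z'.sign ε n)) •
      z.map P.toPreGradedOp p := by
  have h1 := P.act_swap z.chain z'.chain (.nil (Iso.refl (single v))) h ⟨1, n, p⟩ hp
  rw [value_chain, value_chain] at h1
  rw [← mul_assoc, mul_comm, mul_smul, mul_smul, ← h1, smul_smul, Int.units_mul_self, one_smul]

end CubicalFeynmanCategory.Pairs

namespace DGOp

open CubicalFeynmanCategory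

variable {O : DGOp k F ε} {D : GradedOp k F ε.flip} {X : F.C.Word} {v : F.C.V}

/-- The components of the first step of a pair. -/
def _root_.CubicalFeynmanCategory.Pairs.component (z : F.Pairs X v) (j : Fin z.1.1.n) :
    F.Ops {i // WordHom.π z.2.1 i = j} (z.1.1.x j)
      ⟨F.δ.deg (WordHom.g z.2.1 j), Nat.lt_succ_of_le (F.δ.deg_le_one z.2.2.le j)⟩ :=
  ⟨⟨fun i => X.x i, WordHom.g z.2.1 j⟩, rfl⟩

theorem Dualizable.nonempty_pairs (hO : O.Dualizable) (z : F.Pairs X v) {n : ℤ}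
    (ξ : (O.obj v).dual n) : Nonempty (Decomp (fun i => O.obj (X.x i)) fun p =>
      (ξ : Dual k (O.obj v)) (z.map O.toPreGradedOp p)) := by
  obtain ⟨T, -⟩ := hO.exists_decomp (d := 1)
    ⟨⟨z.1.1.x, toOp z.1.2.1⟩, (F.δ.deg_toOp _).trans z.1.2.2⟩ ξ
  choose S hS using fun a j => hO.exists_decomp (z.component j) (T.ζ a j)
  exact ⟨T.subst (V := fun i => O.obj (X.x i)) (WordHom.π z.2.1)
    (fun j p => O.act (WordHom.g z.2.1 j) (F.δ.deg_le_one z.2.2.le j) p) S⟩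

/-- The composition of the operations of a pair applied to its transpose. -/
noncomputable def chainTerm (hO : O.Dualizable) (γ : O.DualMap D) (z : F.Pairs X v) {n : ℤ}
    (ξ : (O.obj v).dual n) : D.obj v :=
  (hO.nonempty_pairs z ξ).some.eval (fun i n => γ (X.x i) n)
    (chainSign ε (WordHom.π z.2.1) fun j => F.δ.deg (WordHom.g z.2.1 j)) (z.map D.toPreGradedOp)

variable (hO : O.Dualizable) {γ : O.DualMap D}

theorem chainTerm_swap (hγ : O.IsDualMap D γ) {z z' : F.Pairs X v} (h : z.IsSwap z') {n : ℤ}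
    (ξ : (O.obj v).dual n) : chainTerm hO γ z' ξ = -chainTerm hO γ z ξ := by
  unfold chainTerm
  set T := (hO.nonempty_pairs z ξ).some
  set T' := (hO.nonempty_pairs z' ξ).some
  have h1 : ∀ c, T'.part (fun i n => γ (X.x i) n) c (z'.map D.toPreGradedOp) =
      (-((z.sign ε c * z.sign ε.flip c) * (z'.sign ε c * z'.sign ε.flip c))) •
        T.part (fun i n => γ (X.x i) n) c (z.map D.toPreGradedOp) := fun c => by
    have h2 := T'.part_congr_map (fun i n => γ (X.x i) n) c (z.map D.toPreGradedOp)
      (z'.map D.toPreGradedOp) ((-1) ^ ε.flip.val * (z.sign ε.flip c * z'.sign ε.flip c)) fun ζ =>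
        h.map_eq D c _ fun i => hγ.mem _ _ _
    have h3 := T.part_congr T' (fun i n => γ (X.x i) n) c (z.map D.toPreGradedOp)
      ((((-1) ^ ε.val * (z.sign ε c * z'.sign ε c) : ℤˣ) : ℤ) : k) fun p hp => by
        have h4 := h.map_eq O.toGradedOp (fun i => -c i) p hp
        have h5 : ∀ z : F.Pairs X v, z.sign ε (fun i => -c i) = z.sign ε c := fun z =>
          koszulSign_neg ε _ _ c
        rw [h5, h5] at h4
        refine (congrArg (ξ : Dual k (O.obj v)) h4).trans
          ((map_intUnit_smul _ _ _).trans ?_)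
        exact (Int.cast_smul_eq_zsmul k _ _).symm
    rw [h2, h3, Int.cast_smul_eq_zsmul]
    refine (smul_smul ((-1) ^ ε.flip.val * (z.sign ε.flip c * z'.sign ε.flip c))
      ((-1) ^ ε.val * (z.sign ε c * z'.sign ε c)) _).trans (congrArg (fun t : ℤˣ => t • _) ?_)
    generalize z.sign ε c = a
    generalize z'.sign ε c = b
    cases ε <;> simp [Parity.val, Parity.flip] <;> ac_rfl
  have h2 : T'.eval (fun i n => γ (X.x i) n)
      (chainSign ε (WordHom.π z'.2.1) fun j => F.δ.deg (WordHom.g z'.2.1 j)) (z'.map D.toPreGradedOp) =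
      T.eval (fun i n => γ (X.x i) n) (fun c => -chainSign ε (WordHom.π z.2.1)
        (fun j => F.δ.deg (WordHom.g z.2.1 j)) c) (z.map D.toPreGradedOp) :=
    Decomp.eval_congr (Equiv.refl _) fun c => by
      refine (congrArg (_ • ·) (h1 c)).trans ?_
      rw [smul_smul]
      refine congrArg (fun t : ℤˣ => t • _) ?_
      change (-1) ^ pairSum c * (z'.sign ε c * z'.sign ε.flip c) *
        -((z.sign ε c * z.sign ε.flip c) * (z'.sign ε c * z'.sign ε.flip c)) =
          -((-1) ^ pairSum c * (z.sign ε c * z.sign ε.flip c))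
      generalize z'.sign ε c * z'.sign ε.flip c = a
      generalize z.sign ε c * z.sign ε.flip c = b
      rw [mul_neg, mul_comm b a, mul_assoc, ← mul_assoc a a b, Int.units_mul_self, one_mul]
  refine h2.trans ?_
  unfold Decomp.eval
  rw [← sum_neg_distrib]
  refine sum_congr rfl fun a _ => ?_
  rw [Units.neg_smul, smul_neg]

/-- The pair of a morphism of degree one and a word over its source. -/
def _root_.CubicalFeynmanCategory.Over.pair {N : ℕ} {Y : F.C.Word} {i : Fin Y.n}
    (w : F.Over N Y (Pi.single i 1)) (f : {f : Y ⟶ single v // F.δ.degree f = 1}) :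
    F.Pairs ⟨N, w.1.1⟩ v :=
  ⟨⟨Y, f⟩, w.1.2, (sum_congr rfl fun j _ => w.2 j).trans
    ((sum_eq_single i (fun j _ hj => by simp [hj])
      fun h => absurd (mem_univ i) h).trans (by simp))⟩

theorem chainTerm_eq {N : ℕ} {Y : F.C.Word} {i : Fin Y.n} (w : F.Over N Y (Pi.single i 1))
    (f : {f : Y ⟶ single v // F.δ.degree f = 1}) {n : ℤ} (ξ : (O.obj v).dual n)
    (T : O.Codecomposition f.1 f.2 (ξ : Dual k (O.obj v)))
    (hT : ∀ a, ∑ i, T.c a i = n + ε.val) :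
    chainTerm hO γ (w.pair f) ξ = (-1 : ℤˣ) ^ (n + ε.val) • ∑ a, T.r a •
      cobarSign ε.flip (T.c a) • signBefore (T.c a) i • (-1 : ℤˣ) ^ T.c a i •
        D.ev f.1 f.2.le fun j => opTerm hO γ (w.component j) (T.ζ a j) := by
  choose S hS using fun a j => hO.exists_decomp (w.component j) (T.ζ a j)
  let T₀ : Decomp (fun j => O.obj (Y.x j)) fun p =>
      (ξ : Dual k (O.obj v)) (O.act (toOp f.1) ((F.δ.deg_toOp _).trans_le f.2.le) p) :=
    Decomp.mk T.toDecomp.A T.toDecomp.r T.toDecomp.c T.toDecomp.ζ fun p =>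
      (congrArg (ξ : Dual k (O.obj v)) (O.laws.ev_eq f.1 f.2.le p).symm).trans
        (T.toDecomp.sum_eq p)
  let T' := T₀.subst (V := fun l => O.obj (w.1.1 l)) w.π
    (fun j p => O.act (w.component j).1.2 (w.component j).deg_le p) S
  have hs : ∀ a, chainSign ε w.π (fun j => F.δ.deg (WordHom.g w.1.2 j)) (T'.c a) =
      ((-1) ^ (n + ε.val : ℤ) * (cobarSign ε.flip (T.c a.1) * (signBefore (T.c a.1) i *
        (-1) ^ T.c a.1 i))) * ∏ j, opSign ε.flip (Pi.single (M := fun _ => Fin 2) i 1 j)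
          fun l : {l // w.π l = j} => T'.c a l := fun a => by
    have h1 := chainSign_eq ε w.π (Pi.single i 1) rfl (T'.c a) (T.c a.1) fun j =>
      (sum_congr rfl fun l _ => congrFun (Decomp.subst_c a j) l).trans (hS a.1 j (a.2 j))
    refine Eq.trans (congrArg (fun δ => chainSign ε w.π δ (T'.c a)) (funext w.2)) (h1.trans ?_)
    refine (congrArg (fun m : ℤ => (-1 : ℤˣ) ^ m * _ * _ * _ * _) (hT a.1)).trans ?_
    simp only [mul_assoc]
  have e1 := Decomp.eval_eq T' (hO.nonempty_pairs (w.pair f) ξ).some (fun p => rfl)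
    (fun l n => γ (w.1.1 l) n) (chainSign ε w.π fun j => F.δ.deg (WordHom.g w.1.2 j))
    ((w.pair f).map D.toPreGradedOp)
  have e2 := Decomp.subst_eval (V := fun l => O.obj (w.1.1 l)) T₀ w.π
    (fun j p => O.act (w.component j).1.2 (w.component j).deg_le p) S (fun l n => γ (w.1.1 l) n)
    (chainSign ε w.π fun j => F.δ.deg (WordHom.g w.1.2 j)) (fun a => (-1) ^ (n + ε.val : ℤ) *
      (cobarSign ε.flip (T.c a) * (signBefore (T.c a) i * (-1) ^ T.c a i)))
    (fun j => opSign ε.flip (Pi.single (M := fun _ => Fin 2) i 1 j)) hs (D.act (toOp f.1) ((F.δ.deg_toOp _).trans_le f.2.le))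
    fun j => D.act (w.component j).1.2 (w.component j).deg_le
  refine e1.trans (e2.trans ?_)
  rw [smul_sum]
  refine sum_congr rfl fun a _ => ?_
  rw [mul_smul, mul_smul, mul_smul]
  refine (smul_comm _ _ _).trans (congrArg ((-1 : ℤˣ) ^ (n + ε.val : ℤ) • ·) ?_)
  refine congrArg (T.r a • ·) (congrArg _ (congrArg _ (congrArg _ ?_)))
  refine Eq.trans ?_ (D.laws.ev_eq f.1 f.2.le _).symm
  exact congrArg (D.act (toOp f.1) _) (funext fun j => (opTerm_eq hO γ (w.component j) _ (S a j)).symm)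

end DGOp

section Rearrange

variable {M : Type*} [AddCommGroup M] [Module k M]

theorem sum_rearrange {A I : Type*} [Fintype A] [Fintype I] {W : I → ℕ → Type*}
    [∀ i N, Fintype (W i N)] (R : Finset ℕ) (r : A → k) (s : A → ℤˣ) (t t' : A → I → ℤˣ) (c : ℕ → k)
    (d : ∀ i N, W i N → k) (E : A → ∀ i N, W i N → M) :
    ∑ a, r a • s a • ∑ i, t a i • t' a i • ∑ N ∈ R, c N • ∑ w, d i N w • E a i N w =
      ∑ N ∈ R, c N • ∑ i, ∑ w, d i N w • ∑ a, r a • s a • t a i • t' a i • E a i N w := by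
  have h : ∀ (s : ℤˣ) (x : M), s • x = (((s : ℤˣ) : ℤ) : k) • x := fun s x =>
    (Int.cast_smul_eq_zsmul k _ _).symm
  simp only [h, smul_sum, smul_smul]
  rw [sum_comm, sum_comm (s := R)]
  refine sum_congr rfl fun i _ => ?_
  rw [sum_comm]
  refine sum_congr rfl fun N _ => ?_
  rw [sum_comm]
  refine sum_congr rfl fun w _ => sum_congr rfl fun a _ => congrArg (· • _) ?_
  ring

theorem sum_sigma_rearrange {A : Type*} [Fintype A] {I : A → Type*} [∀ f, Fintype (I f)]
    {W : ∀ f, I f → ℕ → Type*} [∀ f i N, Fintype (W f i N)] (R : Finset ℕ) (b : A → k) (u : ℤˣ)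
    (c : ℕ → k) (d : ∀ f i N, W f i N → k) (E : ∀ f i N, W f i N → M) :
    ∑ f, b f • u • ∑ N ∈ R, c N • ∑ i, ∑ w, d f i N w • E f i N w =
      u • ∑ N ∈ R, c N • ∑ q : Σ f, Σ i, W f i N,
        (b q.1 * d q.1 q.2.1 N q.2.2) • E q.1 q.2.1 N q.2.2 := by
  have h : ∀ (s : ℤˣ) (x : M), s • x = (((s : ℤˣ) : ℤ) : k) • x := fun s x =>
    (Int.cast_smul_eq_zsmul k _ _).symm
  simp only [h, smul_sum, smul_smul, Fintype.sum_sigma]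
  rw [sum_comm]
  refine sum_congr rfl fun N _ => sum_congr rfl fun f _ => sum_congr rfl
    fun i _ => sum_congr rfl fun w _ => congrArg (· • _) ?_
  ring

end Rearrange

namespace DGOp

open CubicalFeynmanCategory

variable {O : DGOp k F ε} {D : GradedOp k F ε.flip} {v : F.C.V} (hO : O.Dualizable)
  {γ : O.DualMap D} [CharZero k]

theorem ev_update_cobarSum (hγ : O.IsDualMap D γ) {Y : F.C.Word}
    (f : {f : Y ⟶ single v // F.δ.degree f = 1}) {c : Fin Y.n → ℤ}
    (ζ : ∀ j, (O.obj (Y.x j)).dual (c j)) (i : Fin Y.n)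
    (T : O.Codecompositions (ζ i : Dual k (O.obj (Y.x i)))) {L : ℕ}
    (hL : ∀ g : F.DegOne (Y.x i), Y.n + g.1.n < L)
    (hne : Y.n < L) :
    D.ev f.1 f.2.le (update (fun j => γ (Y.x j) _ (ζ j)) i (cobarSum γ T)) =
      ∑ N ∈ Finset.range L, (N.factorial : k)⁻¹ • ∑ w : F.Over N Y (Pi.single i 1),
        (∏ l, invAut k (w.1.1 l)) • D.ev f.1 f.2.le fun j => opTerm hO γ (w.component j) (ζ j) := by
  have h1 := sum_fibers (D.act (toOp f.1) ((F.δ.deg_toOp _).trans_le f.2.le))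
    (fun j => γ (Y.x j) _ (ζ j)) i (fun N => opSum hO γ (Fin N) 1 (ζ i)) (L - (Y.n - 1))
  have h2 := cobarSum_eq hO γ (ζ i) T (B := L - (Y.n - 1)) fun g => by have := hL g; omega
  refine (D.laws.ev_eq f.1 f.2.le _).trans ((congrArg (fun y => D.act (toOp f.1) _
    (update (fun j => γ (Y.x j) _ (ζ j)) i y)) h2).trans (h1.symm.trans ?_))
  have h3 : Fintype.card (Fin Y.n) - 1 + (L - (Y.n - 1)) = L := by
    rw [Fintype.card_fin]
    omega
  rw [h3]
  refine sum_congr rfl fun N _ => congrArg _ ?_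
  have h4 := Over.sum_eq (F := F) (n := N) (d := Pi.single i 1) (invAut k)
    (D.act (toOp f.1) ((F.δ.deg_toOp _).trans_le f.2.le)) fun π j u => opTerm hO γ u (ζ j)
  refine Eq.trans ?_ (h4.symm.trans (sum_congr rfl fun w _ => congrArg _
    (D.laws.ev_eq f.1 f.2.le _).symm))
  refine sum_congr rfl fun π _ => congrArg _ (funext fun j => ?_)
  by_cases hj : j = i
  · subst hj
    rw [update_self]
    have h5 : ∀ d : Fin 2, d = 1 → opSum hO γ (Fin (Fintype.card {l // π l = j})) 1 (ζ j) =
        opSum hO γ {l // π l = j} d (ζ j) := by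
      rintro _ rfl
      exact (opSum_eq hO γ (ζ j)).symm
    exact h5 _ (Pi.single_eq_same (M := fun _ => Fin 2) j 1)
  · rw [update_of_ne hj]
    have h5 : ∀ d : Fin 2, d = 0 → (if Fintype.card {l // π l = j} = 1 then γ (Y.x j) _ (ζ j) else 0) =
        opSum hO γ {l // π l = j} d (ζ j) := by
      rintro _ rfl
      exact (opSum_zero hO hγ (ζ j)).symm
    exact h5 _ (Pi.single_eq_of_ne (M := fun _ => Fin 2) hj 1)

theorem sum_chainTerm (hF : F.Rigid) (hγ : O.IsDualMap D γ) (N : ℕ) {n : ℤ} (ξ : (O.obj v).dual n)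
    [Fintype (F.DegOne v)] :
    ∑ q : (Σ f : F.DegOne v, Σ i : Fin f.1.n,
      F.Over N f.1 (Pi.single i 1)), ((F.autWeight q.1.1 : k)⁻¹ * ∏ l, invAut k (q.2.2.1.1 l)) •
        chainTerm hO γ (q.2.2.pair q.1.2) ξ = 0 := by
  classical
  let e : (Σ f : F.DegOne v, Σ i : Fin f.1.n,
      F.Over N f.1 (Pi.single i 1)) → Σ x : Fin N → F.C.V, F.Pairs ⟨N, x⟩ v := fun q =>
    ⟨q.2.2.1.1, q.2.2.pair q.1.2⟩
  have he : Bijective e := by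
    refine ⟨?_, ?_⟩
    · rintro ⟨f, i, ⟨⟨x, m⟩, h⟩⟩ ⟨f', i', ⟨⟨x', m'⟩, h'⟩⟩ hq
      obtain ⟨h1, h2⟩ := Sigma.mk.inj hq
      obtain rfl : x = x' := h1
      obtain ⟨h3, h4⟩ := Sigma.mk.inj (eq_of_heq h2)
      obtain rfl : f = f' := h3
      obtain rfl : m = m' := congrArg Subtype.val (eq_of_heq h4)
      obtain rfl : i = i' := by
        by_contra hi
        have h5 := (h i).symm.trans (h' i)
        rw [Pi.single_eq_same, Pi.single_eq_of_ne hi] at h5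
        exact absurd h5 (by decide)
      rfl
    · rintro ⟨x, ⟨f, m, hm⟩⟩
      obtain ⟨i, -, hi⟩ := Finset.exists_ne_zero_of_sum_ne_zero (hm.trans_ne one_ne_zero)
      refine ⟨⟨f, i, ⟨x, m⟩, fun j => ?_⟩, rfl⟩
      have h1 := add_sum_erase Finset.univ (fun j => F.δ.deg (WordHom.g m j))
        (mem_univ i)
      have h2 : ∑ j, F.δ.deg (WordHom.g m j) = 1 := hm
      by_cases hj : j = i
      · subst hj
        rw [Pi.single_eq_same]
        exact le_antisymm (F.δ.deg_le_one hm.le j) (Nat.one_le_iff_ne_zero.2 hi)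
      · rw [Pi.single_eq_of_ne hj]
        have h3 : 1 ≤ F.δ.deg (WordHom.g m i) := Nat.one_le_iff_ne_zero.2 hi
        have h4 : ∑ j ∈ Finset.univ.erase i, F.δ.deg (WordHom.g m j) = 0 := by
          rw [h2] at h1
          dsimp only at h1
          omega
        exact sum_eq_zero_iff.1 h4 j (Finset.mem_erase.2 ⟨hj, mem_univ j⟩)
  have := Fintype.ofBijective e he
  refine (Fintype.sum_bijective e he _ (fun s : Σ x : Fin N → F.C.V, F.Pairs ⟨N, x⟩ v =>
    ((F.autWeight s.2.1.1 : k)⁻¹ * ∏ l, invAut k (s.1 l)) • chainTerm hO γ s.2 ξ)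
      fun q => rfl).trans ?_
  have h1 : (Finset.univ : Finset (Σ x : Fin N → F.C.V, F.Pairs ⟨N, x⟩ v)) =
      ((Finset.univ : Finset (Σ x : Fin N → F.C.V, F.Pairs ⟨N, x⟩ v)).image Sigma.fst).sigma
        fun x => Finset.univ := by
    ext s
    simp only [mem_univ, Finset.mem_sigma, Finset.mem_image, true_and, and_true, true_iff]
    exact ⟨s, rfl⟩
  rw [h1, Finset.sum_sigma]
  refine Finset.sum_eq_zero fun x _ => ?_
  simp only [mul_comm _ (∏ l, invAut k (x l)), mul_smul, ← smul_sum]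
  rw [Pairs.sum_eq_zero hF (fun z => chainTerm hO γ z ξ) fun z z' h => chainTerm_swap hO hγ h ξ,
    smul_zero]

theorem sum_ev_update_cobarSum (hγ : O.IsDualMap D γ) {Y : F.C.Word}
    (f : {f : Y ⟶ single v // F.δ.degree f = 1}) {n : ℤ} (ξ : (O.obj v).dual n)
    (T : O.Codecomposition f.1 f.2 (ξ : Dual k (O.obj v)))
    (hT : ∀ a, ∑ i, T.c a i = n + ε.val) {L : ℕ} (hL : ∀ (i : Fin Y.n)
      (g : F.DegOne (Y.x i)), Y.n + g.1.n < L)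
    (hY : Y.n < L) :
    ∑ a, T.r a • cobarSign ε.flip (T.c a) • ∑ i, signBefore (T.c a) i • (-1 : ℤˣ) ^ T.c a i •
      D.ev f.1 f.2.le (update (fun j => γ (Y.x j) _ (T.ζ a j)) i
        (cobarSum γ (hO.nonempty (T.ζ a i)).some)) =
      (-1 : ℤˣ) ^ (n + ε.val) • ∑ N ∈ Finset.range L, (N.factorial : k)⁻¹ • ∑ i : Fin Y.n,
        ∑ w : F.Over N Y (Pi.single i 1), (∏ l, invAut k (w.1.1 l)) •
          chainTerm hO γ (w.pair f) ξ := by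
  have h1 : ∀ N (i : Fin Y.n) (w : F.Over N Y (Pi.single i 1)), ∑ a, T.r a •
      cobarSign ε.flip (T.c a) • signBefore (T.c a) i • (-1 : ℤˣ) ^ T.c a i •
        D.ev f.1 f.2.le (fun j => opTerm hO γ (w.component j) (T.ζ a j)) =
          (-1 : ℤˣ) ^ (n + ε.val) • chainTerm hO γ (w.pair f) ξ := fun N i w => by
    rw [chainTerm_eq hO w f ξ T hT, smul_smul, Int.units_mul_self, one_smul]
  have h2 : ∀ a i, _ := fun a i =>
    ev_update_cobarSum hO hγ f (T.ζ a) i (hO.nonempty (T.ζ a i)).some (hL i) hY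
  simp only [h2]
  refine (sum_rearrange _ T.r _ _ _ _ (fun i N (w : F.Over N Y (Pi.single i 1)) =>
    ∏ l, invAut k (w.1.1 l)) fun a i N w => D.ev f.1 f.2.le fun j =>
      opTerm hO γ (w.component j) (T.ζ a j)).trans ?_
  simp only [h1, smul_sum, smul_comm ((-1 : ℤˣ) ^ (n + ε.val : ℤ))]

theorem cobarSq_eq_zero (hF : F.Rigid) (hγ : O.IsDualMap D γ) {n : ℤ} (ξ : (O.obj v).dual n)
    (T : O.Codecompositions (ξ : Dual k (O.obj v)))
    (hT : ∀ f a, ∑ i, (T f).c a i = n + ε.val) : cobarSq hO γ T = 0 := by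
  have := F.finite_degree_one
  have := ofFinite (F.DegOne v)
  obtain ⟨L, hL, hL'⟩ : ∃ L, (∀ f : F.DegOne v, f.1.n < L) ∧ ∀ (f : F.DegOne v) (i : Fin f.1.n)
      (g : F.DegOne (f.1.x i)), f.1.n + g.1.n < L := by
    obtain ⟨M, hM⟩ := Finite.exists_le fun f : F.DegOne v => f.1.n
    obtain ⟨M', hM'⟩ := Finite.exists_le fun s : (Σ f : F.DegOne v, Σ i : Fin f.1.n, F.DegOne (f.1.x i)) => s.1.1.n + s.2.2.1.n
    exact ⟨M + M' + 1, fun f => by have := hM f; omega, fun f i g => by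
      have : f.1.n + g.1.n ≤ M' := hM' ⟨f, i, g⟩
      omega⟩
  unfold cobarSq
  rw [finsum_eq_sum_of_fintype]
  refine (sum_congr rfl fun f _ => congrArg ((F.autWeight f.1 : k)⁻¹ • ·)
    (sum_ev_update_cobarSum hO hγ f.2 ξ (T f) (hT f) (hL' f) (hL f))).trans ?_
  refine (sum_sigma_rearrange (Finset.range L) (fun f : F.DegOne v => (F.autWeight f.1 : k)⁻¹) ((-1 : ℤˣ) ^ (n + ε.val : ℤ))
    (fun N => (N.factorial : k)⁻¹) (I := fun f => Fin f.1.n)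
    (W := fun f i N => F.Over N f.1 (Pi.single i 1)) (fun f i N w =>
    ∏ l, invAut k (w.1.1 l)) fun f i N w => chainTerm hO γ (w.pair f.2) ξ).trans ?_
  refine (congrArg (fun y : D.obj v => (-1 : ℤˣ) ^ (n + ε.val : ℤ) • y)
    (Finset.sum_eq_zero fun N _ => ?_)).trans (smul_zero _)
  exact (congrArg (fun y : D.obj v => (N.factorial : k)⁻¹ • y)
    (sum_chainTerm hO hF hγ N ξ)).trans (smul_zero _)

end DGOp

/-! ### Existence of the Feynman transform -/

namespace DGOp

variable {O O' : DGOp k F ε}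

/-- Transposition of a morphism. -/
def Hom.transpose (h : O ⟶ O') (v : F.C.V) (n : ℤ) : (O'.obj v).dual n →ₗ[k] (O.obj v).dual n :=
  LinearMap.restrict ((h.app v).dualMap) fun _ hξ m hm x hx => hξ m hm _ (h.app_mem v m x hx)

theorem IsTwisting.transpose {Q : DGOp k F ε.flip} {γ : O.DualMap Q.toGradedOp}
    (hγ : O.IsTwisting Q γ) (h : O ⟶ O') :
    O'.IsTwisting Q fun v n => γ v n ∘ₗ Hom.transpose h v n := by
  refine ⟨⟨fun v n ξ => hγ.1.mem _ _ _, fun v n σ ξ η hη => hγ.1.equivariant v n σ _ _ fun p => ?_⟩,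
    fun v n ξ T => ?_⟩
  · exact (hη _).trans (congrArg (ξ : Dual k (O'.obj v)) (h.app_evIso σ p).symm)
  · refine (hγ.d_eq v n (Hom.transpose h v n ξ) fun f =>
      ⟨(T f).N, (T f).r, (T f).c, fun a i => Hom.transpose h _ _ ((T f).ζ a i), fun p => ?_⟩).trans ?_
    · exact (congrArg (ξ : Dual k (O'.obj v)) (h.app_act _ _ _)).trans ((T f).sum_eq fun i => h.app _ (p i))
    · have h1 : O.dualD v n (Hom.transpose h v n ξ) = Hom.transpose h v (n + 1) (O'.dualD v n ξ) :=
        Subtype.ext (LinearMap.ext fun p => congrArg (ξ : Dual k (O'.obj v)) (h.app_d v p))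
      rw [h1]
      rfl

/-- The targets of twisting families. -/
def transformPresentation (O : DGOp k F ε) : Presentation k F ε.flip where
  G v n := (O.obj v).dual n
  IsModel Q γ := ∃ γ' : O.DualMap Q.toGradedOp, O.IsTwisting Q γ' ∧ ∀ v n ξ, γ v n ξ = γ' v n ξ
  homogeneous := by
    rintro Q γ ⟨γ', h, hγ⟩ v n ξ
    rw [hγ]
    exact h.1.mem v n ξ

/-- The universal target of a twisting family. -/
noncomputable abbrev transform (O : DGOp k F ε) : DGOp k F ε.flip := (transformPresentation O).univ

/-- The universal twisting family. -/
noncomputable def transformGen (O : DGOp k F ε) : O.DualMap (transform O).toGradedOp := fun v n =>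
  { toFun := (transformPresentation O).univGen v n
    map_add' := fun ξ η => Presentation.univ_ext _ fun M => by
      obtain ⟨γ, -, hγ⟩ := M.isModel
      rw [map_add]
      exact (hγ v n _).trans ((map_add (γ v n) ξ η).trans
        (congrArg₂ (· + ·) (hγ v n ξ).symm (hγ v n η).symm))
    map_smul' := fun r ξ => Presentation.univ_ext _ fun M => by
      obtain ⟨γ, -, hγ⟩ := M.isModel
      rw [RingHom.id_apply, map_smul]
      exact (hγ v n _).trans ((map_smul (γ v n) r ξ).trans (congrArg (r • ·) (hγ v n ξ).symm)) }

theorem exists_transformHom {Q : DGOp k F ε.flip} {γ : O.DualMap Q.toGradedOp}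
    (hγ : O.IsTwisting Q γ) :
    ∃ h : transform O ⟶ Q, ∀ v n ξ, h.app v (transformGen O v n ξ) = γ v n ξ :=
  ⟨(transformPresentation O).univHom ⟨Q, fun v n ξ => γ v n ξ, γ, hγ, fun _ _ _ => rfl⟩,
    fun _ _ _ => rfl⟩

theorem isTwisting_transformGen (O : DGOp k F ε) : O.IsTwisting (transform O) (transformGen O) := by
  have h : ∀ M : (transformPresentation O).Model, O.IsTwisting M.Q fun v n =>
      ((transformPresentation O).univHom M).app v ∘ₗ transformGen O v n := fun M => by
    obtain ⟨γ, h, hγ⟩ := M.isModel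
    obtain rfl : (fun v n => ((transformPresentation O).univHom M).app v ∘ₗ transformGen O v n) = γ :=
      funext fun v => funext fun n => LinearMap.ext fun ξ => hγ v n ξ
    exact h
  refine ⟨⟨fun v n ξ => Presentation.univGen_mem (S := transformPresentation O) v n ξ, fun v n σ ξ η hη =>
    Presentation.univ_ext _ fun M => ?_⟩, fun v n ξ T => Presentation.univ_ext _ fun M => ?_⟩
  · exact (Hom.app_evIso _ σ _).trans ((h M).1.equivariant v n σ ξ η hη)
  · refine (Hom.app_d _ v _).trans (((h M).d_eq v n ξ T).trans ?_)
    rw [map_neg, map_intUnit_smul, map_add]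
    exact congrArg (fun z => -((-1 : ℤˣ) ^ n • (_ + z)))
      (map_cobarSum (transformGen O) (Hom.toGraded ((transformPresentation O).univHom M)) T).symm

theorem Dualizable.isFeynmanTransform [CharZero k] (hF : F.Rigid) (hO : O.Dualizable) :
    IsFeynmanTransform O (transform O) (transformGen O) where
  isDualMap := (isTwisting_transformGen O).1
  d_gen v n ξ η hη T := by
    obtain rfl : η = O.dualD v n ξ := Subtype.ext (LinearMap.ext hη)
    exact (isTwisting_transformGen O).d_eq v n ξ T
  free Q γ hγ := by
    obtain ⟨h, hh⟩ := exists_transformHom (isTwisting_lift hO hγ fun v n ξ T hT =>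
      cobarSq_eq_zero hO hF hγ ξ T hT)
    refine ⟨h.toGraded.comp Q.cofreeFst, fun v n ξ => congrArg Prod.fst (hh v n ξ), fun a ha => ?_⟩
    have key : ∀ a b : GradedOp.Hom (transform O).toGradedOp Q, (∀ v n ξ,
        a.app v (transformGen O v n ξ) = b.app v (transformGen O v n ξ)) → a = b := fun a b hab => by
      have h1 : a.lift = b.lift := Presentation.univ_hom_ext _ fun v n ξ => by
        refine Prod.ext (hab v n ξ) ?_
        obtain ⟨T⟩ := hO.nonempty ξ
        have h2 : ∀ a : GradedOp.Hom (transform O).toGradedOp Q,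
            a.app v ((transform O).d v (transformGen O v n ξ)) = -((-1 : ℤˣ) ^ n •
              (a.app v (transformGen O v (n + 1) (O.dualD v n ξ)) +
                cobarSum (fun v n => a.app v ∘ₗ transformGen O v n) T)) := fun a => by
          rw [(isTwisting_transformGen O).d_eq v n ξ T, map_neg, map_intUnit_smul, map_add,
            map_cobarSum]
        have h3 : (fun v n => a.app v ∘ₗ transformGen O v n) =
            fun v n => b.app v ∘ₗ transformGen O v n :=
          funext fun v => funext fun n => LinearMap.ext fun ξ => hab v n ξ
        exact (h2 a).trans ((congrArg₂ (fun x y => -((-1 : ℤˣ) ^ n • (x + y))) (hab _ _ _)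
          (congrArg (fun γ => cobarSum γ T) h3)).trans (h2 b).symm)
      have h2 : a.app = b.app := funext fun v => LinearMap.ext fun x =>
        congrArg (fun c : transform O ⟶ Q.cofree => (c.app v x).1) h1
      cases a
      cases b
      congr
    exact key _ _ fun v n ξ => (ha v n ξ).trans (congrArg Prod.fst (hh v n ξ)).symm

/-- The map of Feynman transforms given by a morphism. -/
noncomputable def transformMap (h : O ⟶ O') : transform O' ⟶ transform O :=
  (transformPresentation O').univHom ⟨_, fun v n ξ => transformGen O v n (Hom.transpose h v n ξ), _,
    (isTwisting_transformGen O).transpose h, fun _ _ _ => rfl⟩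

end DGOp

namespace CubicalFeynmanCategory

theorem nonempty_feynmanTransform [CharZero k] (hF : F.Rigid) (ε : Parity) :
    Nonempty (FeynmanTransform k F ε) :=
  ⟨{ functor := {
        obj := fun O => DGOp.transform O.unop.obj
        map := fun h => DGOp.transformMap h.unop.hom
        map_id := fun _ => Presentation.univ_hom_ext _ fun _ _ _ => rfl
        map_comp := fun _ _ => Presentation.univ_hom_ext _ fun _ _ _ => rfl }
     gen := fun O => DGOp.transformGen O.obj
     isFeynmanTransform := fun O => DGOp.Dualizable.isFeynmanTransform hF O.property
     map_gen := fun {O _} _ v n _ _ hη => congrArg (DGOp.transformGen O.obj v n)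
       (Subtype.ext (LinearMap.ext fun p => (hη p).symm)) }⟩

end CubicalFeynmanCategory

theorem CubicalMorphism.Admissible.rigid {F₁ F₂ : CubicalFeynmanCategory.{u}}
    {φ : CubicalMorphism F₁ F₂} (hφ : φ.Admissible) (hF : F₂.Rigid) : F₁.Rigid := by
  have := hφ.faithful
  intro X Y v m n hm hn θ h1 h2
  have h3 := hF (v := φ.onV v) (φ.functor.map m) (φ.functor.map n) ((φ.degree_map m).trans hm)
    ((φ.degree_map n).trans hn) (φ.functor.mapIso θ)
    ((φ.functor.map_comp _ _).symm.trans (congrArg _ h1))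
    ((φ.functor.map_comp _ _).symm.trans (congrArg _ h2))
  refine Iso.ext (φ.functor.map_injective ?_)
  exact (congrArg Iso.hom h3).trans (φ.functor.map_id Y).symm

theorem theorem5p4 {k : Type u} [Field k] [CharZero k] {F₁ F₂ : CubicalFeynmanCategory.{u}}
    (φ : CubicalMorphism F₁ F₂) (hφ : φ.Admissible) (ε : Parity) :
    Nonempty (ExceptionalPush k ε.flip φ) ∧
    (∀ L : ExceptionalPush k ε.flip φ, L.functor.IsRightAdjoint) ∧
    (F₂.Rigid → Nonempty (FeynmanTransform k F₁ ε) ∧ Nonempty (FeynmanTransform k F₂ ε)) ∧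
    ∀ (D₁ : FeynmanTransform k F₁ ε) (D₂ : FeynmanTransform k F₂ ε)
      (L : ExceptionalPush k ε.flip φ) (R : DGOp k F₂ ε.flip ⥤ DGOp k F₁ ε.flip),
      (R ⊣ L.functor) → Nonempty (D₂.functor ⋙ R ≅ hφ.pullbackDualizable.op ⋙ D₁.functor) :=
  ⟨⟨CubicalMorphism.exceptionalPush k ε.flip hφ⟩, fun L => L.isRightAdjoint hφ,
    fun hF => ⟨CubicalFeynmanCategory.nonempty_feynmanTransform (hφ.rigid hF) ε,
      CubicalFeynmanCategory.nonempty_feynmanTransform hF ε⟩,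
    fun D₁ D₂ L _ adj => CubicalMorphism.nonempty_transform_iso hφ D₁ D₂ L adj⟩
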